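/- Conventions. Algorithms are deterministic one-tape Turing machines with arbitrary finite tape alphabets: a machine has a blank and $n\ge 2$ further symbols, the digits $0,\dots,n-1$, and its integer inputs and outputs are written in base $n$. Several inputs are written one after another, and each input word is terminated by one blank cell, which belongs to the tape used. The space $p_e(x)$ of an algorithm $e$ on input $x$ is the number of tape cells used, reduced by $1$, and $p_e(x)=\infty$ if $e$ does not halt on $x$. A partial function $p$ from $\mathbb N$ (or $\mathbb N^2$) to $\mathbb N$ is treated in inequalities as having the value $\infty$ where it is undefined. It is called *simple* if some algorithm that halts exactly on the domain of $p$ computes $p(x)$ within space $p(x)$ for each $x$ in that domain. An algorithm is called *simple* if it outputs its own space, i.e. on every input on which it halts its output equals the space it has used. The length of the binary word of $k\in\mathbb N$ is denoted $l(k)$ (with $l(0)=1$). For a set $A\subseteq\mathbb N$, $f\prec g$ on $A$ (also written $g\succ f$) means $\exists C\,\forall x\in A\ f(x)\le C\,g(x)$. Let $A\subseteq\mathbb N$ be a recursively enumerable set. A class $M$ of partial functions from $\mathbb N$ to $\mathbb N$ is called *$A$-canonical* if 1. all functions of $M$ are simple, and some function of $M$ has domain $A$; 2. if $f,g,h$ are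 simple, $f,g\in M$, and $h\succ\min(f,g)$ on $A$, then $h\in M$; 3. the class $\overline M$ of simple algorithms that compute functions of $M$ is of type $\Sigma^0_2$, i.e. there is a recursive relation $R$ such that $e\in\overline M\iff\exists a\,\forall b\,R(a,b,e)$ for every algorithm $e$. Lemma 1. For every $A$-canonical class $M$ there is a partial recursive function $g(k,x)$ such that - $g$ is non-increasing in $k$: $g(k',x)\le g(k,x)$ for all $x$ and $k\le k'$ (undefined values being $\infty$); - the partial function $(k,x)\mapsto g(k,x)+l(k)$ of two arguments is simple; - the domain of $g(0,\cdot)$ is $A$; - for every simple $p$: $\ p\in M\iff\exists k\ \ g(k,\cdot)\prec p$ on $A$. -/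

import Mathlib

namespace SpaceComplexity

/-- A tape symbol: `none` is the blank, `some d` is the digit `d`. -/
abbrev Symbol := Option ℕ

/-- Head moves. -/
inductive Move
  | left
  | stay
  | right

/-- Moves are coded by the elements of a three-element type. -/
def Move.equivFin : Move ≃ Fin 3 where
  toFun
    | .left => 0
    | .stay => 1
    | .right => 2
  invFun
    | 0 => .left
    | 1 => .stay
    | 2 => .right
  left_inv := by rintro (_ | _ | _) <;> rfl
  right_inv := by intro i; fin_cases i <;> rfl

instance : Primcodable Move := Primcodable.ofEquiv (Fin 3) Move.equivFin

/-- One instruction: in state `state`, reading `read`, write `write`, move the head according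
to `move` and go to state `next`. -/
structure Instr where
  state : ℕ
  read : Symbol
  write : Symbol
  move : Move
  next : ℕ

/-- An instruction is coded as the tuple of its fields. -/
def Instr.equivProd : Instr ≃ ℕ × Symbol × Symbol × Move × ℕ where
  toFun i := (i.state, i.read, i.write, i.move, i.next)
  invFun t := ⟨t.1, t.2.1, t.2.2.1, t.2.2.2.1, t.2.2.2.2⟩
  left_inv _ := rfl
  right_inv _ := rfl

instance : Primcodable Instr := Primcodable.ofEquiv _ Instr.equivProd

/-- A program of a one-tape Turing machine: the number `base` of its non-blank tape symbols (the
digits `0, …, base - 1`) and a finite list of instructions. The first applicable instruction is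
executed, so machines are deterministic. -/
structure Machine where
  base : ℕ
  program : List Instr

/-- A machine is coded as the pair of its fields. -/
def Machine.equivProd : Machine ≃ ℕ × List Instr where
  toFun m := (m.base, m.program)
  invFun t := ⟨t.1, t.2⟩
  left_inv _ := rfl
  right_inv _ := rfl

instance : Primcodable Machine := Primcodable.ofEquiv _ Machine.equivProd

/-- The machine has at least two digits and writes no other symbols than its digits and the
blank. -/
def Machine.Valid (m : Machine) : Prop :=
  2 ≤ m.base ∧ ∀ i ∈ m.program, ∀ d ∈ i.write, d < m.base

/-- A configuration: the state, the scanned symbol, and the used part of the tape to the left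
(nearest cell first) and to the right of the head. -/
structure Config where
  state : ℕ
  left : List Symbol
  head : Symbol
  right : List Symbol

/-- The number of cells of the used part of the tape. It never decreases during a computation. -/
def Config.size (c : Config) : ℕ := c.left.length + 1 + c.right.length

/-- Execute an instruction. When the head leaves the used part of the tape, this part grows by
one blank cell. -/
def Instr.exec (i : Instr) (c : Config) : Config :=
  match i.move with
  | .stay => ⟨i.next, c.left, i.write, c.right⟩
  | .left =>
    match c.left with
    | [] => ⟨i.next, [], none, i.write :: c.right⟩
    | a :: l => ⟨i.next, l, a, i.write :: c.right⟩
  | .right =>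
    match c.right with
    | [] => ⟨i.next, i.write :: c.left, none, []⟩
    | a :: r => ⟨i.next, i.write :: c.left, a, r⟩

/-- One step of computation; `none` means that no instruction applies, i.e. the machine halts. -/
def Machine.step (m : Machine) (c : Config) : Option Config :=
  (m.program.find? fun i => i.state == c.state && i.read == c.head).map fun i => i.exec c

/-- The word denoting `x` in base `b`, least significant digit first; `0` is the word of length
one consisting of the digit `0`. -/
def word (b x : ℕ) : List ℕ := if x = 0 then [0] else b.digits x

/-- The length of the binary word of `x`. -/
def len (x : ℕ) : ℕ := (word 2 x).length

/-- The initial tape: the words of the arguments, each of them terminated by one blank cell. -/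
def inputTape (b : ℕ) (xs : List ℕ) : List Symbol :=
  xs.flatMap fun x => (word b x).map some ++ [none]

/-- The machine starts in state `0` on the first cell of the initial tape. -/
def Machine.init (m : Machine) (xs : List ℕ) : Config :=
  ⟨0, [], (inputTape m.base xs).headD none, (inputTape m.base xs).tail⟩

/-- The number written in base `b` from the scanned cell rightwards up to the first blank, least
significant digit first. -/
def Config.output (b : ℕ) (c : Config) : ℕ :=
  Nat.ofDigits b ((c.head :: c.right).takeWhile Option.isSome).reduceOption

/-- The final configuration on the arguments `xs`, if the machine halts. -/
def Machine.final (m : Machine) (xs : List ℕ) : Part Config :=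
  StateTransition.eval m.step (m.init xs)

/-- The partial function computed by the machine. -/
def Machine.result (m : Machine) (xs : List ℕ) : Part ℕ :=
  (m.final xs).map (Config.output m.base)

/-- The space of the computation: the size, reduced by one, of the tape used. It is undefined
(i.e. infinite) when the machine does not halt. -/
def Machine.space (m : Machine) (xs : List ℕ) : Part ℕ :=
  (m.final xs).map fun c => c.size - 1

open Classical in
/-- The value of a partial function as an extended natural number: undefined means infinite. -/
noncomputable def ext (a : Part ℕ) : ℕ∞ := if h : a.Dom then ((a.get h : ℕ) : ℕ∞) else ⊤

/-- A partial function is simple if some algorithm computes it, with the same domain, within the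
space given by its own values. -/
def IsSimple (p : ℕ →. ℕ) : Prop :=
  ∃ m : Machine, m.Valid ∧ ∀ x, m.result [x] = p x ∧ ext (m.space [x]) ≤ ext (p x)

/-- Simplicity for partial functions of two arguments. -/
def IsSimple₂ (p : ℕ → ℕ →. ℕ) : Prop :=
  ∃ m : Machine, m.Valid ∧
    ∀ k x, m.result [k, x] = p k x ∧ ext (m.space [k, x]) ≤ ext (p k x)

/-- A simple algorithm outputs its own space. -/
def Machine.IsSimple (m : Machine) : Prop :=
  m.Valid ∧ ∀ x, m.result [x] = m.space [x]

/-- `f ≺ g` on `A`: the inequality `f ≤ g` holds on `A` within a constant factor. -/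
def Below (A : Set ℕ) (f g : ℕ → ℕ∞) : Prop :=
  ∃ C : ℕ, ∀ x ∈ A, f x ≤ (C : ℕ∞) * g x

/-- The simple algorithms that compute functions of `M`. -/
def algorithms (M : Set (ℕ →. ℕ)) : Set Machine :=
  {m | m.IsSimple ∧ (fun x => m.result [x]) ∈ M}

/-- A class of algorithms of type `Σ⁰₂`. -/
def IsSigma02 (S : Set Machine) : Prop :=
  ∃ R : ℕ → ℕ → Machine → Prop,
    ComputablePred (fun t : ℕ × ℕ × Machine => R t.1 t.2.1 t.2.2) ∧
    ∀ m, m ∈ S ↔ ∃ a, ∀ b, R a b m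

/-- `A`-canonical classes of partial functions. -/
structure IsCanonical (A : Set ℕ) (M : Set (ℕ →. ℕ)) : Prop where
  simple : ∀ f ∈ M, IsSimple f
  exists_dom : ∃ f ∈ M, f.Dom = A
  closed : ∀ f g h : ℕ →. ℕ, f ∈ M → g ∈ M → IsSimple h →
    Below A (fun x => min (ext (f x)) (ext (g x))) (fun x => ext (h x)) → h ∈ M
  sigma : IsSigma02 (algorithms M)

end SpaceComplexity

/-! Enumerating. By the $\Sigma^0_2$ condition there are a computable sequence of machines `E i` and
a computable function `ρ` such that every `E i` without a defect, i.e. with `ρ i b = 0` for all `b`,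
is a simple algorithm for a function of $M$, and every such algorithm occurs in this way; moreover
`E 0` has no defect and its domain is $A$ (`IsCanonical.exists_sequence`). This rests on
`exists_isSimple`: a simple function agrees, up to a constant factor, with the result of a simple
algorithm.

The function $g$. Up to a factor, and a lower bound of the order of the length of $x$, $g(k,x)$ is
the least $s$ such that for some $i<n(k)$ the simulation of `E i` on $x$ halts within $2^s$ steps
while $x$ steps of a search reveal no defect of $i$ (`Accepts`, `minSpace`). Here $n(k)$ is the
length of $k$ in the base of the machine that computes $g$; it is monotone and unbounded, so $g$ is
non-increasing in $k$.

Time against space. The logarithm of the simulation time is the space of the simulated machine up to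
a constant factor. In one direction, a program with registers bounded by $V$ has only polynomially
many configurations in $V$ and cannot repeat one before halting (`Run.steps_le`,
`Simulates.exists_accepts`). In the other, $2^s$ steps cannot raise a register beyond its initial
value by more than $2^s$, so the coded tape has $O(s)$ symbols (`Simulates.result_le`).

Membership. If $p\in M$, an algorithm equivalent to $p$ is some `E i` without a defect, and
$g(k,\cdot)\prec p$ as soon as $n(k)>i$. Conversely, every simple function above the minimum over
the first $n$ programs lies in $M$, by induction on $n$ (`IsCanonical.mem_of_minSpace_below`): a
program without a defect adds a member of $M$ to a minimum, and condition 2 applies; a program whose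
defect is found in $w$ steps influences only the finitely many $x<w$, where a constant factor
absorbs it because program $0$ keeps the values on $A$ finite.

Simplicity. The least $s$ is found by dovetailing within space determined by $s$ itself: programs
are run with fuel, each increment costs one unit, and so registers stay below argument plus fuel
(`runs_clip`). Since the factor in "within space $p(x)$" is exactly one, programs are compiled to
machines that keep all registers as parallel binary tracks of the same cells. A register left with
$2^v$ pins the number of cells to $v+1$, so that the space can be written out exactly
(`IsCore.exists_machine₁`); with two arguments the summand $l(k)$ pays for the tape of $k$
(`IsCore.exists_machine₂`). -/

namespace SpaceComplexity

open Relation StateTransition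

/-! ### Register programs and their big-step semantics -/

/-- Programs over registers holding natural numbers, with an input tape of words of digits and an
output tape of digits. -/
inductive Prog
  | skip
  | inc (r : ℕ)
  | seq (p q : Prog)
  | cond (r : ℕ) (p q : Prog)
  | loop (r : ℕ) (p : Prog)
  | take (p q : Prog)
  | last (p q : Prog)
  | emit (d : ℕ)

/-- The data on which programs work. -/
@[ext]
structure St where
  regs : ℕ → ℕ
  inp : List (List ℕ)
  out : List ℕ

instance : CoeFun St (fun _ => ℕ → ℕ) := ⟨St.regs⟩

/-- Assign a value to a register. -/
def St.set (s : St) (r v : ℕ) : St := { s with regs := Function.update s.regs r v }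

theorem St.set_apply (s : St) (r v i : ℕ) : (s.set r v) i = if i = r then v else s i := by
  simp [St.set, Function.update_apply]

@[simp] theorem St.set_same (s : St) (r v : ℕ) : (s.set r v) r = v := by simp [St.set_apply]

@[simp] theorem St.set_inp (s : St) (r v : ℕ) : (s.set r v).inp = s.inp := rfl
@[simp] theorem St.set_out (s : St) (r v : ℕ) : (s.set r v).out = s.out := rfl

@[simp] theorem St.set_self (s : St) (r : ℕ) : s.set r (s r) = s := by
  simp [St.set]

@[simp] theorem St.set_set (s : St) (r v w : ℕ) : (s.set r v).set r w = s.set r w := by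
  simp [St.set]

theorem St.ext_regs {s t : St} (h : ∀ r, s r = t r) (hi : s.inp = t.inp) (ho : s.out = t.out) :
    s = t := by
  ext1
  · exact funext h
  · exact hi
  · exact ho

/-- `Run V p n s t`: the program `p` leads from `s` to `t` in `n` steps, and no register is
increased beyond `V`. -/
inductive Run (V : ℕ) : Prog → ℕ → St → St → Prop
  | skip (s) : Run V .skip 1 s s
  | inc (s) (r) : s r + 1 ≤ V → Run V (.inc r) 1 s (s.set r (s r + 1))
  | seq {p q n m s t u} : Run V p n s t → Run V q m t u → Run V (.seq p q) (n + m + 1) s u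
  | cond_pos {r p q n s t} : s r ≠ 0 → Run V p n (s.set r (s r - 1)) t →
      Run V (.cond r p q) (n + 1) s t
  | cond_zero {r p q n s t} : s r = 0 → Run V q n s t → Run V (.cond r p q) (n + 1) s t
  | loop_zero {r p s} : s r = 0 → Run V (.loop r p) 1 s s
  | loop_pos {r p n m s t u} : s r ≠ 0 → Run V p n (s.set r (s r - 1)) t →
      Run V (.loop r p) m t u → Run V (.loop r p) (n + m + 1) s u
  | take_pos {p q n s t d w ws} : s.inp = ((d + 1) :: w) :: ws →
      Run V p n { s with inp := (d :: w) :: ws } t → Run V (.take p q) (n + 1) s t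
  | take_zero {p q n s t w ws} : s.inp = (0 :: w) :: ws →
      Run V q n s t → Run V (.take p q) (n + 1) s t
  | last_pos {p q n s t d ws} : s.inp = [d] :: ws →
      Run V p n { s with inp := ws } t → Run V (.last p q) (n + 1) s t
  | last_neg {p q n s t d e w ws} : s.inp = (d :: e :: w) :: ws →
      Run V q n { s with inp := (e :: w) :: ws } t → Run V (.last p q) (n + 1) s t
  | emit (s d) : s.inp = [] → Run V (.emit d) 1 s { s with out := s.out ++ [d] }

/-- `Run` with an unspecified number of steps. -/
def Runs (V : ℕ) (p : Prog) (s t : St) : Prop := ∃ n, Run V p n s t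

theorem Run.mono {V W p n s t} (h : Run V p n s t) (hVW : V ≤ W) : Run W p n s t := by
  induction h with
  | skip s => exact .skip s
  | inc s r h => exact .inc s r (h.trans hVW)
  | seq _ _ h1 h2 => exact .seq h1 h2
  | cond_pos h _ h1 => exact .cond_pos h h1
  | cond_zero h _ h1 => exact .cond_zero h h1
  | loop_zero h => exact .loop_zero h
  | loop_pos h _ _ h1 h2 => exact .loop_pos h h1 h2
  | take_pos h _ h1 => exact .take_pos h h1
  | take_zero h _ h1 => exact .take_zero h h1
  | last_pos h _ h1 => exact .last_pos h h1
  | last_neg h _ h1 => exact .last_neg h h1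
  | emit s d h => exact .emit s d h

theorem Run.unique {V W p n m s t u} (h : Run V p n s t) (h' : Run W p m s u) :
    n = m ∧ t = u := by
  induction h generalizing m u with
  | skip s => cases h'; simp
  | inc s r h => cases h'; simp
  | seq _ _ h1 h2 =>
    cases h' with
    | seq a b =>
      obtain ⟨rfl, rfl⟩ := h1 a
      obtain ⟨rfl, rfl⟩ := h2 b
      simp
  | cond_pos h _ h1 =>
    cases h' with
    | cond_pos _ a => obtain ⟨rfl, rfl⟩ := h1 a; simp
    | cond_zero h' a => exact absurd h' h
  | cond_zero h _ h1 =>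
    cases h' with
    | cond_pos h' a => exact absurd h h'
    | cond_zero h' a => obtain ⟨rfl, rfl⟩ := h1 a; simp
  | loop_zero h =>
    cases h' with
    | loop_zero => simp
    | loop_pos h' _ _ => exact absurd h h'
  | loop_pos h _ _ h1 h2 =>
    cases h' with
    | loop_zero h' => exact absurd h' h
    | loop_pos _ a b =>
      obtain ⟨rfl, rfl⟩ := h1 a
      obtain ⟨rfl, rfl⟩ := h2 b
      simp
  | take_pos h _ h1 =>
    cases h' with
    | take_pos h' a =>
      rw [h] at h'
      simp only [List.cons.injEq, Nat.add_right_cancel_iff] at h'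
      obtain ⟨⟨rfl, rfl⟩, rfl⟩ := h'
      obtain ⟨rfl, rfl⟩ := h1 a; simp
    | take_zero h' a => simp [h] at h'
  | take_zero h _ h1 =>
    cases h' with
    | take_pos h' a => simp [h] at h'
    | take_zero h' a => obtain ⟨rfl, rfl⟩ := h1 a; simp
  | last_pos h _ h1 =>
    cases h' with
    | last_pos h' a =>
      rw [h] at h'
      simp only [List.cons.injEq, and_true] at h'
      obtain ⟨rfl, rfl⟩ := h'
      obtain ⟨rfl, rfl⟩ := h1 a; simp
    | last_neg h' a => simp [h] at h'
  | last_neg h _ h1 =>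
    cases h' with
    | last_pos h' a => simp [h] at h'
    | last_neg h' a =>
      rw [h] at h'
      simp only [List.cons.injEq] at h'
      obtain ⟨⟨rfl, rfl, rfl⟩, rfl⟩ := h'
      obtain ⟨rfl, rfl⟩ := h1 a; simp
  | emit s d h => cases h'; simp

theorem Runs.unique {V W p s t u} (h : Runs V p s t) (h' : Runs W p s u) : t = u :=
  let ⟨_, h⟩ := h
  let ⟨_, h'⟩ := h'
  (h.unique h').2

/-- A step raises a register by at most one. This half of the comparison of time and space bounds a
simulated tape by the logarithm of the simulation time. -/
theorem Run.le_add {V p n s t} (h : Run V p n s t) (r : ℕ) : t r ≤ s r + n := by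
  induction h with
  | inc s r h => simp only [St.set_apply]; split_ifs <;> subst_vars <;> omega
  | cond_pos h _ h1 =>
    refine h1.trans ?_
    simp only [St.set_apply]; split_ifs <;> subst_vars <;> omega
  | loop_pos h _ _ h1 h2 =>
    simp only [St.set_apply] at h1; split_ifs at h1 <;> subst_vars <;> omega
  | take_pos _ _ h1 => simp only at h1; omega
  | last_pos _ _ h1 => simp only at h1; omega
  | last_neg _ _ h1 => simp only at h1; omega
  | emit => simp
  | _ => omega

/-- `Run` checks the bound only at increments, the only instructions that raise a register. -/
theorem Run.le {V p n s t} (h : Run V p n s t) (hs : ∀ r, s r ≤ V) (r : ℕ) : t r ≤ V := by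
  induction h generalizing r with
  | skip => exact hs r
  | inc s i h =>
    have := hs r
    simp only [St.set_apply]; split_ifs <;> omega
  | seq _ _ h1 h2 => exact h2 (fun r => h1 hs r) r
  | cond_pos h _ h1 =>
    refine h1 (fun r => ?_) r
    have := hs r
    simp only [St.set_apply]; split_ifs <;> subst_vars <;> omega
  | cond_zero h _ h1 => exact h1 hs r
  | loop_zero => exact hs r
  | loop_pos h _ _ h1 h2 =>
    refine h2 (fun r => h1 (fun r => ?_) r) r
    have := hs r
    simp only [St.set_apply]; split_ifs <;> subst_vars <;> omega
  | take_pos _ _ h1 => exact h1 hs r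
  | take_zero _ _ h1 => exact h1 hs r
  | last_pos _ _ h1 => exact h1 hs r
  | last_neg _ _ h1 => exact h1 hs r
  | emit s d h => exact hs r

theorem Runs.le {V p s t} (h : Runs V p s t) (hs : ∀ r, s r ≤ V) (r : ℕ) : t r ≤ V :=
  let ⟨_, h⟩ := h
  h.le hs r

/-- Programs without input and output. -/
def Prog.Pure : Prog → Prop
  | .skip => True
  | .inc _ => True
  | .seq p q => p.Pure ∧ q.Pure
  | .cond _ p q => p.Pure ∧ q.Pure
  | .loop _ p => p.Pure
  | .take _ _ => False
  | .last _ _ => False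
  | .emit _ => False

/-- All registers of a program are below its bound. -/
def Prog.bound : Prog → ℕ
  | .skip => 0
  | .inc r => r + 1
  | .seq p q => max p.bound q.bound
  | .cond r p q => max (r + 1) (max p.bound q.bound)
  | .loop r p => max (r + 1) p.bound
  | .take p q => max p.bound q.bound
  | .last p q => max p.bound q.bound
  | .emit _ => 0

/-- All digits written by a program are below the base `N`. -/
def Prog.EmitsBelow (N : ℕ) : Prog → Prop
  | .skip => True
  | .inc _ => True
  | .seq p q => p.EmitsBelow N ∧ q.EmitsBelow N
  | .cond _ p q => p.EmitsBelow N ∧ q.EmitsBelow N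
  | .loop _ p => p.EmitsBelow N
  | .take p q => p.EmitsBelow N ∧ q.EmitsBelow N
  | .last p q => p.EmitsBelow N ∧ q.EmitsBelow N
  | .emit d => d < N

theorem Prog.Pure.emitsBelow {p : Prog} (h : p.Pure) (N : ℕ) : p.EmitsBelow N := by
  induction p <;> simp_all [Prog.Pure, Prog.EmitsBelow]

theorem Run.inp_out {V p n s t} (h : Run V p n s t) (hp : p.Pure) :
    t.inp = s.inp ∧ t.out = s.out := by
  induction h with
  | seq _ _ h1 h2 => simp [h1 hp.1, h2 hp.2]
  | cond_pos _ _ h1 => simpa using h1 hp.1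
  | cond_zero _ _ h1 => exact h1 hp.2
  | loop_pos _ _ _ h1 h2 =>
    have := h1 hp
    simp_all
  | _ => simp_all [Prog.Pure]

theorem Runs.inp {V p s t} (h : Runs V p s t) (hp : p.Pure) : t.inp = s.inp :=
  let ⟨_, h⟩ := h
  (h.inp_out hp).1

theorem Runs.out {V p s t} (h : Runs V p s t) (hp : p.Pure) : t.out = s.out :=
  let ⟨_, h⟩ := h
  (h.inp_out hp).2

theorem Run.frame {V p n s t} (h : Run V p n s t) {r : ℕ} (hr : p.bound ≤ r) : t r = s r := by
  induction h with
  | inc s i h =>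
    simp only [Prog.bound] at hr
    simp only [St.set_apply]; split_ifs <;> omega
  | seq _ _ h1 h2 =>
    simp only [Prog.bound] at hr
    rw [h2 (by omega), h1 (by omega)]
  | cond_pos _ _ h1 =>
    simp only [Prog.bound] at hr
    rw [h1 (by omega), St.set_apply, if_neg (by omega)]
  | cond_zero _ _ h1 =>
    simp only [Prog.bound] at hr
    rw [h1 (by omega)]
  | loop_pos _ _ _ h1 h2 =>
    have hr' := hr
    simp only [Prog.bound] at hr
    rw [h2 hr', h1 (by omega), St.set_apply, if_neg (by omega)]
  | take_pos _ _ h1 => simp only [Prog.bound] at hr; simpa using h1 (by omega)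
  | take_zero _ _ h1 => simp only [Prog.bound] at hr; rw [h1 (by omega)]
  | last_pos _ _ h1 => simp only [Prog.bound] at hr; simpa using h1 (by omega)
  | last_neg _ _ h1 => simp only [Prog.bound] at hr; simpa using h1 (by omega)
  | _ => rfl

theorem Runs.frame {V p s t} (h : Runs V p s t) {r : ℕ} (hr : p.bound ≤ r) : t r = s r :=
  let ⟨_, h⟩ := h
  h.frame hr

/-- A run of a pure program depends only on the registers below its bound. -/
theorem Run.congr {V p n s t} (h : Run V p n s t) {D : ℕ} (hp : p.Pure) (hD : p.bound ≤ D)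
    {s' : St} (hs : ∀ r < D, s' r = s r) :
    ∃ t', Run V p n s' t' ∧ ∀ r < D, t' r = t r := by
  induction h generalizing s' with
  | skip s => exact ⟨s', .skip _, hs⟩
  | inc s i h =>
    simp only [Prog.bound] at hD
    refine ⟨_, .inc _ _ (by rwa [hs i (by omega)]), fun r hr => ?_⟩
    simp only [St.set_apply]
    rw [hs i (by omega), hs r hr]
  | seq _ _ h1 h2 =>
    simp only [Prog.bound] at hD
    obtain ⟨t', a, ha⟩ := h1 hp.1 (by omega) hs
    obtain ⟨u', b, hb⟩ := h2 hp.2 (by omega) ha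
    exact ⟨u', .seq a b, hb⟩
  | @cond_pos i p q n s t h _ h1 =>
    simp only [Prog.bound] at hD
    have hi := hs i (by omega)
    obtain ⟨t', a, ha⟩ := h1 hp.1 (by omega) (s' := s'.set i (s' i - 1)) (fun r hr => by
      simp only [St.set_apply, hi, hs r hr])
    exact ⟨t', .cond_pos (by rwa [hi]) a, ha⟩
  | @cond_zero i p q n s t h _ h1 =>
    simp only [Prog.bound] at hD
    obtain ⟨t', a, ha⟩ := h1 hp.2 (by omega) hs
    exact ⟨t', .cond_zero (by rwa [hs i (by omega)]) a, ha⟩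
  | @loop_zero i p s h =>
    simp only [Prog.bound] at hD
    exact ⟨s', .loop_zero (by rwa [hs i (by omega)]), hs⟩
  | @loop_pos i p n m s t u h _ _ h1 h2 =>
    have hD' := hD
    simp only [Prog.bound] at hD
    have hi := hs i (by omega)
    obtain ⟨t', a, ha⟩ := h1 hp (by omega) (s' := s'.set i (s' i - 1)) (fun r hr => by
      simp only [St.set_apply, hi, hs r hr])
    obtain ⟨u', b, hb⟩ := h2 hp hD' ha
    exact ⟨u', .loop_pos (by rwa [hi]) a b, hb⟩
  | _ => simp [Prog.Pure] at hp

theorem Runs.skip (V s) : Runs V .skip s s := ⟨_, .skip s⟩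

theorem Runs.inc {V} {s : St} {r : ℕ} (h : s r + 1 ≤ V) : Runs V (.inc r) s (s.set r (s r + 1)) :=
  ⟨_, .inc s r h⟩

theorem Runs.seq {V p q s t u} : Runs V p s t → Runs V q t u → Runs V (.seq p q) s u
  | ⟨_, h⟩, ⟨_, h'⟩ => ⟨_, .seq h h'⟩

theorem Runs.cond_pos {V r p q} {s t : St} (h : s r ≠ 0) :
    Runs V p (s.set r (s r - 1)) t → Runs V (.cond r p q) s t
  | ⟨_, h'⟩ => ⟨_, .cond_pos h h'⟩

theorem Runs.cond_zero {V r p q} {s t : St} (h : s r = 0) : Runs V q s t → Runs V (.cond r p q) s t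
  | ⟨_, h'⟩ => ⟨_, .cond_zero h h'⟩

theorem Runs.loop_zero {V r p} {s : St} (h : s r = 0) : Runs V (.loop r p) s s :=
  ⟨_, .loop_zero h⟩

theorem Runs.loop_pos {V r p} {s t u : St} (h : s r ≠ 0) :
    Runs V p (s.set r (s r - 1)) t → Runs V (.loop r p) t u → Runs V (.loop r p) s u
  | ⟨_, h1⟩, ⟨_, h2⟩ => ⟨_, .loop_pos h h1 h2⟩

/-- The rule for counting loops. -/
theorem Runs.loop_count {V r p} (I : ℕ → St → Prop)
    (hr : ∀ k s, I k s → s r = k)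
    (hI : ∀ k s, I (k + 1) s → ∃ t, Runs V p (s.set r k) t ∧ I k t) :
    ∀ k s, I k s → ∃ t, Runs V (.loop r p) s t ∧ I 0 t
  | 0, s, h => ⟨s, .loop_zero (hr 0 s h), h⟩
  | k + 1, s, h => by
    obtain ⟨t, h1, h2⟩ := hI k s h
    obtain ⟨u, h3, h4⟩ := Runs.loop_count I hr hI k t h2
    have hk := hr _ _ h
    exact ⟨u, .loop_pos (by omega) (by rwa [hk]) h3, h4⟩

/-! ### Small steps -/

/-- The effect of the first instruction of a program on the data, with the outcome of its test. -/
def act : Prog → St → Option (Bool × St)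
  | .skip, s => some (true, s)
  | .inc r, s => some (true, s.set r (s r + 1))
  | .seq _ _, s => some (true, s)
  | .cond r _ _, s => if s r = 0 then some (false, s) else some (true, s.set r (s r - 1))
  | .loop r _, s => if s r = 0 then some (false, s) else some (true, s.set r (s r - 1))
  | .take _ _, s =>
    match s.inp with
    | (0 :: _) :: _ => some (false, s)
    | ((d + 1) :: w) :: ws => some (true, { s with inp := (d :: w) :: ws })
    | _ => none
  | .last _ _, s =>
    match s.inp with
    | [_] :: ws => some (true, { s with inp := ws })
    | (_ :: e :: w) :: ws => some (false, { s with inp := (e :: w) :: ws })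
    | _ => none
  | .emit d, s => if s.inp = [] then some (true, { s with out := s.out ++ [d] }) else none

/-- What remains to be done after the first instruction. -/
def cont : List Prog → Bool → List Prog
  | [], _ => []
  | .skip :: K, _ => K
  | .inc _ :: K, _ => K
  | .seq p q :: K, _ => p :: q :: K
  | .cond _ p q :: K, b => bif b then p :: K else q :: K
  | .loop r p :: K, b => bif b then p :: .loop r p :: K else K
  | .take p q :: K, b => bif b then p :: K else q :: K
  | .last p q :: K, b => bif b then p :: K else q :: K
  | .emit _ :: K, _ => K

/-- A small step of a list of programs. -/
def step : List Prog × St → Option (List Prog × St)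
  | ([], _) => none
  | (p :: K, s) => (act p s).map fun a => (cont (p :: K) a.1, a.2)

/-- `Path V n c c'`: `n` small steps lead from `c` to `c'`, without increasing registers
beyond `V`. -/
inductive Path (V : ℕ) : ℕ → List Prog × St → List Prog × St → Prop
  | refl (c) : Path V 0 c c
  | head {n c d e} : step c = some d → ((∀ r, c.2 r ≤ V) → ∀ r, d.2 r ≤ V) →
      (∀ r K, c.1 = .inc r :: K → c.2 r + 1 ≤ V) →
      Path V n d e → Path V (n + 1) c e

theorem Path.trans {V n m c d e} (h : Path V n c d) (h' : Path V m d e) :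
    Path V (n + m) c e := by
  induction h with
  | refl => simpa
  | head h1 h2 h3 _ ih =>
    have := Path.head h1 h2 h3 (ih h')
    convert this using 1
    omega

theorem Path.single {V c d} (h : step c = some d) (h' : (∀ r, c.2 r ≤ V) → ∀ r, d.2 r ≤ V)
    (h3 : ∀ r K, c.1 = .inc r :: K → c.2 r + 1 ≤ V) : Path V 1 c d :=
  .head h h' h3 (.refl _)

/-- The continuation `K` is arbitrary so that the induction can descend into a subprogram, with the
rest of the program pushed onto `K`. -/
theorem Run.path {V p n s t} (h : Run V p n s t) (K : List Prog) :
    Path V n (p :: K, s) (K, t) := by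
  have hset : ∀ (s : St) r, (∀ i, s i ≤ V) → ∀ i, (s.set r (s r - 1)) i ≤ V := by
    intro s r h i
    have := h i
    simp only [St.set_apply]; split_ifs <;> subst_vars <;> omega
  induction h generalizing K with
  | skip s => exact .single rfl (fun h => h) (by simp)
  | inc s r h =>
    refine .single rfl (fun h' i => ?_) (fun r K h => ?_)
    · have := h' i
      simp only [St.set_apply]; split_ifs <;> omega
    · simp only [List.cons.injEq, Prog.inc.injEq] at h
      obtain ⟨rfl, -⟩ := h
      assumption
  | seq _ _ h1 h2 =>
    exact .head rfl (by intro h; exact h) (by simp) ((h1 _).trans (h2 K))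
  | cond_pos h _ h1 =>
    exact .head (by simp [step, act, h, cont]) (by exact hset _ _) (by simp) (h1 K)
  | cond_zero h _ h1 =>
    exact .head (by simp [step, act, h, cont]) (by intro h; exact h) (by simp) (h1 K)
  | loop_zero h => exact .single (by simp [step, act, h, cont]) (fun h => h) (by simp)
  | loop_pos h _ _ h1 h2 =>
    exact .head (by simp [step, act, h, cont]) (by exact hset _ _) (by simp) ((h1 _).trans (h2 K))
  | take_pos h _ h1 =>
    exact .head (by simp [step, act, h, cont]) (by intro h; exact h) (by simp) (h1 K)
  | take_zero h _ h1 =>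
    exact .head (by simp [step, act, h, cont]) (by intro h; exact h) (by simp) (h1 K)
  | last_pos h _ h1 =>
    exact .head (by simp [step, act, h, cont]) (by intro h; exact h) (by simp) (h1 K)
  | last_neg h _ h1 =>
    exact .head (by simp [step, act, h, cont]) (by intro h; exact h) (by simp) (h1 K)
  | emit s d h => exact .single (by simp [step, act, h, cont]) (fun h => h) (by simp)

/-- Running the programs of a list one after another. -/
inductive RunList : List Prog → St → Prop
  | nil (s) : RunList [] s
  | cons {V p n s t K} : Run V p n s t → RunList K t → RunList (p :: K) s

/-- A small step of a pure program is defined. -/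
theorem act_isSome {p : Prog} (hp : p.Pure) (s : St) : ∃ b t, act p s = some (b, t) := by
  cases p <;> simp_all [Prog.Pure, act] <;> split_ifs <;> simp

theorem cont_pure {K : List Prog} (h : ∀ p ∈ K, p.Pure) (b : Bool) : ∀ p ∈ cont K b, p.Pure := by
  rcases K with _ | ⟨p, K⟩
  · simp [cont]
  · cases p <;> cases b <;> simp_all [cont, Prog.Pure]

/-- A run of what remains after one small step is completed to a run from before it. Contraposed:
non-termination is inherited along small steps, which carries divergence over to the machine. -/
theorem RunList.of_step {p : Prog} {K : List Prog} {s t : St} {b : Bool} (hp : p.Pure)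
    (h : act p s = some (b, t)) (hr : RunList (cont (p :: K) b) t) : RunList (p :: K) s := by
  cases p with
  | skip =>
    simp only [act, Option.some.injEq, Prod.mk.injEq] at h
    obtain ⟨rfl, rfl⟩ := h
    exact .cons (V := 0) (.skip _) hr
  | inc r =>
    simp only [act, Option.some.injEq, Prod.mk.injEq] at h
    obtain ⟨rfl, rfl⟩ := h
    exact .cons (.inc _ _ le_rfl) hr
  | seq p q =>
    simp only [act, Option.some.injEq, Prod.mk.injEq] at h
    obtain ⟨rfl, rfl⟩ := h
    rcases hr with _ | ⟨h1, _ | ⟨h2, h3⟩⟩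
    exact .cons (.seq (h1.mono (le_max_left _ _)) (h2.mono (le_max_right _ _))) h3
  | cond r p q =>
    simp only [act] at h
    split_ifs at h with h0 <;> simp only [Option.some.injEq, Prod.mk.injEq] at h <;>
      obtain ⟨rfl, rfl⟩ := h <;> rcases hr with _ | ⟨h1, h2⟩
    · exact .cons (.cond_zero h0 h1) h2
    · exact .cons (.cond_pos h0 h1) h2
  | loop r p =>
    simp only [act] at h
    split_ifs at h with h0 <;> simp only [Option.some.injEq, Prod.mk.injEq] at h <;>
      obtain ⟨rfl, rfl⟩ := h
    · exact .cons (V := 0) (.loop_zero h0) hr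
    · rcases hr with _ | ⟨h1, _ | ⟨h2, h3⟩⟩
      exact .cons (.loop_pos h0 (h1.mono (le_max_left _ _)) (h2.mono (le_max_right _ _))) h3
  | _ => simp [Prog.Pure] at hp

/-! ### The number of steps of a run in bounded space -/

/-- The lists of programs that occur while `p :: K` is executed, before `K` remains. -/
def conts : Prog → List Prog → List (List Prog)
  | .skip, K => [.skip :: K]
  | .inc r, K => [.inc r :: K]
  | .seq p q, K => (.seq p q :: K) :: (conts p (q :: K) ++ conts q K)
  | .cond r p q, K => (.cond r p q :: K) :: (conts p K ++ conts q K)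
  | .loop r p, K => (.loop r p :: K) :: conts p (.loop r p :: K)
  | .take p q, K => (.take p q :: K) :: (conts p K ++ conts q K)
  | .last p q, K => (.last p q :: K) :: (conts p K ++ conts q K)
  | .emit d, K => [.emit d :: K]

theorem self_mem_conts (p : Prog) (K : List Prog) : p :: K ∈ conts p K := by
  cases p <;> simp [conts]

/-- Control is finite. This gives the machine finitely many states and makes the configurations in
bounded space countable. -/
theorem cont_mem_conts {p : Prog} {K L : List Prog} (h : L ∈ conts p K) (b : Bool) :
    cont L b ∈ conts p K ∨ cont L b = K := by
  induction p generalizing K with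
  | skip | inc | emit => simp only [conts, List.mem_singleton] at h; subst h; simp [cont]
  | seq p q hp hq =>
    simp only [conts, List.mem_cons, List.mem_append] at h ⊢
    rcases h with rfl | h | h
    · simp [cont, self_mem_conts]
    · rcases hp h with h | h
      · simp [h]
      · simp [h, self_mem_conts]
    · rcases hq h with h | h <;> simp [h]
  | cond r p q hp hq | take p q hp hq | last p q hp hq =>
    simp only [conts, List.mem_cons, List.mem_append] at h ⊢
    rcases h with rfl | h | h
    · cases b <;> simp [cont, self_mem_conts]
    · rcases hp h with h | h <;> simp [h]
    · rcases hq h with h | h <;> simp [h]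
  | loop r p hp =>
    simp only [conts, List.mem_cons] at h ⊢
    rcases h with rfl | h
    · cases b <;> simp [cont, self_mem_conts]
    · rcases hp h with h | h
      · simp [h]
      · simp [h]

theorem conts_pure {p : Prog} {K L : List Prog} (h : L ∈ conts p K) (hp : p.Pure)
    (hK : ∀ q ∈ K, q.Pure) : ∀ q ∈ L, q.Pure := by
  induction p generalizing K with
  | skip | inc | emit => simp only [conts, List.mem_singleton] at h; subst h; simp_all
  | seq p q ihp ihq =>
    simp only [conts, List.mem_cons, List.mem_append] at h
    rcases h with rfl | h | h
    · simp_all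
    · exact ihp h hp.1 (by simpa using ⟨hp.2, hK⟩)
    · exact ihq h hp.2 hK
  | cond r p q ihp ihq =>
    simp only [conts, List.mem_cons, List.mem_append] at h
    rcases h with rfl | h | h
    · simp_all
    · exact ihp h hp.1 hK
    · exact ihq h hp.2 hK
  | loop r p ihp =>
    simp only [conts, List.mem_cons] at h
    rcases h with rfl | h
    · simp_all
    · exact ihp h hp (by simpa using ⟨hp, hK⟩)
  | _ => simp [Prog.Pure] at hp

theorem conts_bound {p : Prog} {K L : List Prog} {D : ℕ} (h : L ∈ conts p K) (hp : p.bound ≤ D)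
    (hK : ∀ q ∈ K, q.bound ≤ D) : ∀ q ∈ L, q.bound ≤ D := by
  induction p generalizing K with
  | skip | inc | emit => simp only [conts, List.mem_singleton] at h; subst h; simp_all
  | seq p q ihp ihq | cond r p q ihp ihq | take p q ihp ihq | last p q ihp ihq =>
    have hp' := hp
    simp only [Prog.bound, max_le_iff] at hp'
    simp only [conts, List.mem_cons, List.mem_append] at h
    rcases h with rfl | h | h
    · simp_all
    · exact ihp h (by simp_all) (by simp_all)
    · exact ihq h (by simp_all) (by simp_all)
  | loop r p ihp =>
    have hp' := hp
    simp only [Prog.bound, max_le_iff] at hp'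
    simp only [conts, List.mem_cons] at h
    rcases h with rfl | h
    · simp_all
    · exact ihp h (by simp_all) (by simp_all)

theorem conts_emitsBelow {p : Prog} {K L : List Prog} {N : ℕ} (h : L ∈ conts p K)
    (hp : p.EmitsBelow N) (hK : ∀ q ∈ K, q.EmitsBelow N) : ∀ q ∈ L, q.EmitsBelow N := by
  induction p generalizing K with
  | skip | inc | emit => simp only [conts, List.mem_singleton] at h; subst h; simp_all
  | seq p q ihp ihq =>
    simp only [conts, List.mem_cons, List.mem_append] at h
    rcases h with rfl | h | h
    · simp_all
    · exact ihp h hp.1 (by simpa using ⟨hp.2, hK⟩)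
    · exact ihq h hp.2 hK
  | cond r p q ihp ihq | take p q ihp ihq | last p q ihp ihq =>
    simp only [conts, List.mem_cons, List.mem_append] at h
    rcases h with rfl | h | h
    · simp_all
    · exact ihp h hp.1 hK
    · exact ihq h hp.2 hK
  | loop r p ihp =>
    simp only [conts, List.mem_cons] at h
    rcases h with rfl | h
    · simp_all
    · exact ihp h hp (by simpa using ⟨hp, hK⟩)

/-- The configuration after `k` small steps. -/
def trace (c : List Prog × St) : ℕ → Option (List Prog × St)
  | 0 => some c
  | k + 1 => (trace c k).bind step

theorem trace_add (c : List Prog × St) (k l : ℕ) :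
    trace c (k + l) = (trace c k).bind fun d => trace d l := by
  induction l with
  | zero => simp [trace]
  | succ l ih =>
    rw [← add_assoc]
    simp only [trace, ih]
    cases trace c k <;> rfl

theorem trace_succ (c : List Prog × St) (k : ℕ) :
    trace c (k + 1) = (step c).bind fun d => trace d k := by
  rw [add_comm, trace_add]; rfl

theorem act_frame {p : Prog} {s t : St} {b : Bool} (hp : p.Pure) (h : act p s = some (b, t)) :
    t.inp = s.inp ∧ t.out = s.out ∧ ∀ r, p.bound ≤ r → t r = s r := by
  cases p with
  | cond r p q | loop r p =>
    simp only [act] at h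
    split_ifs at h <;> simp only [Option.some.injEq, Prod.mk.injEq] at h <;>
      obtain ⟨rfl, rfl⟩ := h
    · simp
    · simp only [Prog.bound, St.set_apply, St.set_inp, St.set_out, true_and]
      intro i hi
      rw [if_neg (by omega)]
  | inc r =>
    simp only [act, Option.some.injEq, Prod.mk.injEq] at h
    obtain ⟨rfl, rfl⟩ := h
    simp only [Prog.bound, St.set_apply, St.set_inp, St.set_out, true_and]
    intro i hi
    rw [if_neg (by omega)]
  | _ => simp_all [act, Prog.Pure]

/-- A pure program that works with registers below `D` of size at most `V` halts within
`O((V + 1) ^ D)` steps, or not at all. -/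
theorem Run.steps_le {V p n s t} (h : Run V p n s t) (hp : p.Pure) {D : ℕ} (hD : p.bound ≤ D)
    (hs : ∀ r < D, s r ≤ V) : n ≤ ((conts p []).length + 1) * (V + 1) ^ D := by
  classical
  -- Registers from `D` on and both tapes are irrelevant for a pure program; once they are erased,
  -- only finitely many data are possible.
  obtain ⟨t', h', -⟩ := h.congr hp hD (s' := ⟨fun r => if r < D then s r else 0, [], []⟩)
    (fun r hr => by simp [hr])
  generalize hs' : (⟨fun r => if r < D then s r else 0, [], []⟩ : St) = s' at h'
  have hsV : ∀ r, s' r ≤ V := by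
    intro r; subst hs'; dsimp only; split_ifs with hr
    · exact hs r hr
    · simp
  have hsD : ∀ r, D ≤ r → s' r = 0 := by
    intro r hr; subst hs'; simp; omega
  have hio : s'.inp = [] ∧ s'.out = [] := by subst hs'; simp
  -- Along the whole path control stays in the finite set, registers stay bounded, and what was
  -- erased stays empty.
  have key : ∀ m c d, Path V m c d → (c.1 ∈ conts p [] ∨ c.1 = []) → (∀ r, c.2 r ≤ V) →
      (∀ r, D ≤ r → c.2 r = 0) → (c.2.inp = [] ∧ c.2.out = []) →
      trace c m = some d ∧ ∀ k ≤ m, ∃ e, trace c k = some e ∧ (e.1 ∈ conts p [] ∨ e.1 = []) ∧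
        (∀ r, e.2 r ≤ V) ∧ (∀ r, D ≤ r → e.2 r = 0) ∧ (e.2.inp = [] ∧ e.2.out = []) := by
    intro m c d hpath
    induction hpath with
    | refl c =>
      intro h1 h2 h3 h4
      refine ⟨rfl, fun k hk => ?_⟩
      obtain rfl : k = 0 := by omega
      exact ⟨c, rfl, h1, h2, h3, h4⟩
    | @head n c d e hst hV hV' _ ih =>
      intro h1 h2 h3 h4
      have h5 : (d.1 ∈ conts p [] ∨ d.1 = []) ∧ (∀ r, D ≤ r → d.2 r = 0) ∧
          (d.2.inp = [] ∧ d.2.out = []) := by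
        rcases c with ⟨_ | ⟨q, K⟩, s⟩
        · simp [step] at hst
        · simp only [step, Option.map_eq_some_iff, Prod.exists] at hst
          obtain ⟨b, u, hact, rfl⟩ := hst
          have hmem : q :: K ∈ conts p [] := by simpa using h1
          have hq := conts_pure hmem hp (by simp) q (by simp)
          have hqb := conts_bound hmem hD (by simp) q (by simp)
          obtain ⟨f1, f2, f3⟩ := act_frame hq hact
          refine ⟨cont_mem_conts hmem b, fun r hr => ?_, ?_⟩
          · rw [f3 r (hqb.trans hr)]; exact h3 r hr
          · rw [f1, f2]; exact h4
      obtain ⟨g1, g2⟩ := ih h5.1 (hV h2) h5.2.1 h5.2.2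
      refine ⟨by rw [trace_succ, hst]; exact g1, fun k hk => ?_⟩
      rcases k with _ | k
      · exact ⟨c, rfl, h1, h2, h3, h4⟩
      · rw [trace_succ, hst]
        exact g2 k (by omega)
  obtain ⟨hn, htr⟩ := key n _ _ (h'.path []) (Or.inl (self_mem_conts p [])) hsV hsD hio
  have hnone : trace (p :: [], s') (n + 1) = none := by simp [trace, hn, step]
  have hnone' : ∀ k, trace (p :: [], s') (n + 1 + k) = none := by
    intro k; rw [trace_add, hnone]; rfl
  -- If the configurations at times `a < b` agreed, then so would those at times `a + (n + 1 - b) ≤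
  -- n` and `n + 1`; but at the latter time the computation is already over.
  have hinj : ∀ a b, a < b → b ≤ n → trace (p :: [], s') a ≠ trace (p :: [], s') b := by
    intro a b hab hb heq
    have h1 : trace (p :: [], s') (a + (n + 1 - b)) = trace (p :: [], s') (b + (n + 1 - b)) := by
      rw [trace_add, trace_add, heq]
    rw [show b + (n + 1 - b) = n + 1 by omega, hnone] at h1
    obtain ⟨e, he, -⟩ := htr (a + (n + 1 - b)) (by omega)
    rw [he] at h1
    simp at h1
  -- Control and the first `D` registers determine the configuration, so the times `0, …, n` inject
  -- into a set of the required size.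
  let f : ℕ → List Prog × (Fin D → ℕ) := fun k =>
    (((trace (p :: [], s') k).getD ([], s')).1,
      fun i => ((trace (p :: [], s') k).getD ([], s')).2 i)
  have hcard : (Finset.range (n + 1)).card ≤
      ((insert [] (conts p []).toFinset) ×ˢ
        Fintype.piFinset (fun _ : Fin D => Finset.range (V + 1))).card := by
    refine Finset.card_le_card_of_injOn f ?_ ?_
    · intro k hk
      have hk : k ≤ n := by simpa [Nat.lt_succ_iff] using hk
      obtain ⟨e, he, h1, h2, -⟩ := htr k hk
      simp only [f, he, Option.getD_some, Finset.coe_product, Set.mem_prod, Finset.mem_coe,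
        Finset.mem_insert, List.mem_toFinset, Fintype.mem_piFinset, Finset.mem_range,
        Nat.lt_succ_iff]
      exact ⟨h1.symm, fun i => h2 i⟩
    · intro a ha b hb hab
      have ha : a ≤ n := by simpa [Nat.lt_succ_iff] using ha
      have hb : b ≤ n := by simpa [Nat.lt_succ_iff] using hb
      have heq : trace (p :: [], s') a = trace (p :: [], s') b := by
        obtain ⟨e, he, h1, h2, h3, h4⟩ := htr a ha
        obtain ⟨e', he', h1', h2', h3', h4'⟩ := htr b hb
        simp only [f, he, he', Option.getD_some, Prod.mk.injEq] at hab
        rw [he, he']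
        congr 1
        refine Prod.ext hab.1 (St.ext_regs (fun r => ?_) ?_ ?_)
        · rcases lt_or_ge r D with hr | hr
          · exact congrFun hab.2 ⟨r, hr⟩
          · rw [h3 r hr, h3' r hr]
        · rw [h4.1, h4'.1]
        · rw [h4.2, h4'.2]
      rcases lt_trichotomy a b with h | h | h
      · exact absurd heq (hinj a b h hb)
      · exact h
      · exact absurd heq.symm (hinj b a h ha)
  rw [Finset.card_range, Finset.card_product, Fintype.card_piFinset] at hcard
  simp only [Finset.card_range, Finset.prod_const, Finset.card_univ, Fintype.card_fin] at hcard
  calc n ≤ n + 1 := by omega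
    _ ≤ _ := hcard
    _ ≤ _ := by
      gcongr
      exact (Finset.card_insert_le _ _).trans (by gcongr; exact List.toFinset_card_le _)

/-! ### Register cells: bit `r` of the `i`-th cell is the `i`-th binary digit of register `r` -/

/-- Flip a bit. -/
def flip (r c : ℕ) : ℕ := c ^^^ 2 ^ r

theorem testBit_flip_same (r c : ℕ) : (flip r c).testBit r = !c.testBit r := by
  simp [flip, Nat.testBit_xor]

theorem testBit_flip_ne {r i : ℕ} (h : i ≠ r) (c : ℕ) : (flip r c).testBit i = c.testBit i := by
  simp [flip, Nat.testBit_xor, Nat.testBit_two_pow_of_ne h.symm]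

theorem flip_flip (r c : ℕ) : flip r (flip r c) = c := by
  simp [flip]

theorem flip_lt {r c d : ℕ} (hr : r < d) (hc : c < 2 ^ d) : flip r c < 2 ^ d :=
  Nat.xor_lt_two_pow hc (Nat.pow_lt_pow_right (by norm_num) hr)

/-- The content of register `r`. -/
def val (r : ℕ) : List ℕ → ℕ
  | [] => 0
  | c :: cs => (c.testBit r).toNat + 2 * val r cs

theorem val_lt (r : ℕ) (cs : List ℕ) : val r cs < 2 ^ cs.length := by
  induction cs with
  | nil => simp [val]
  | cons c cs ih =>
    have := Bool.toNat_lt (c.testBit r)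
    simp only [val, List.length_cons, pow_succ]
    omega

/-- Increment register `r`. -/
def incBits (r : ℕ) : List ℕ → List ℕ
  | [] => [2 ^ r]
  | c :: cs => if c.testBit r then flip r c :: incBits r cs else flip r c :: cs

/-- Decrement register `r` if it is not zero. -/
def decBits (r : ℕ) : List ℕ → Option (List ℕ)
  | [] => none
  | c :: cs => if c.testBit r then some (flip r c :: cs) else (decBits r cs).map (flip r c :: ·)

theorem val_incBits_same (r : ℕ) (cs : List ℕ) : val r (incBits r cs) = val r cs + 1 := by
  induction cs with
  | nil => simp [val, incBits]
  | cons c cs ih =>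
    simp only [incBits]
    split_ifs with h
    · simp only [val, testBit_flip_same, h, ih]; simp; ring
    · simp only [val, testBit_flip_same, h]; simp; ring

theorem val_incBits_ne {r i : ℕ} (hi : i ≠ r) (cs : List ℕ) :
    val i (incBits r cs) = val i cs := by
  induction cs with
  | nil => simp [val, incBits, Nat.testBit_two_pow_of_ne hi.symm]
  | cons c cs ih =>
    simp only [incBits]
    split_ifs with h <;> simp only [val, testBit_flip_ne hi, ih]

theorem length_le_incBits (r : ℕ) (cs : List ℕ) : cs.length ≤ (incBits r cs).length := by
  induction cs with
  | nil => simp [incBits]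
  | cons c cs ih => simp only [incBits]; split_ifs <;> simp [ih]

/-- A cell is appended only when the carry passes every cell, and then the new value really needs
that further bit. So the register area is no longer than the largest content demands. -/
theorem incBits_length_le {r : ℕ} {cs : List ℕ} {m : ℕ} (h : cs.length ≤ m)
    (hv : val r cs + 1 < 2 ^ m) : (incBits r cs).length ≤ m := by
  induction cs generalizing m with
  | nil =>
    rcases m with _ | m
    · simp [val] at hv
    · simp [incBits]
  | cons c cs ih =>
    rcases m with _ | m
    · simp at h
    · simp only [incBits]
      split_ifs with hc
      · simp only [val, hc, Bool.toNat_true, pow_succ] at hv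
        simpa using ih (by simpa using h) (by omega)
      · simpa using h

theorem incBits_lt {r d : ℕ} (hr : r < d) {cs : List ℕ} (h : ∀ c ∈ cs, c < 2 ^ d) :
    ∀ c ∈ incBits r cs, c < 2 ^ d := by
  induction cs with
  | nil =>
    simp only [incBits, List.mem_singleton, forall_eq]
    exact Nat.pow_lt_pow_right (by norm_num) hr
  | cons c cs ih =>
    simp only [List.mem_cons, forall_eq_or_imp] at h
    simp only [incBits]
    split_ifs <;> simp only [List.mem_cons, forall_eq_or_imp]
    · exact ⟨flip_lt hr h.1, ih h.2⟩
    · exact ⟨flip_lt hr h.1, h.2⟩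

theorem decBits_eq_none {r : ℕ} {cs : List ℕ} : decBits r cs = none ↔ val r cs = 0 := by
  induction cs with
  | nil => simp [decBits, val]
  | cons c cs ih =>
    simp only [decBits, val]
    split_ifs with h <;> simp [h, ih]

theorem decBits_eq_some {r : ℕ} {cs cs' : List ℕ} (h : decBits r cs = some cs') :
    cs'.length = cs.length ∧ val r cs' + 1 = val r cs ∧ (∀ i ≠ r, val i cs' = val i cs) ∧
      ∀ d, r < d → (∀ c ∈ cs, c < 2 ^ d) → ∀ c ∈ cs', c < 2 ^ d := by
  induction cs generalizing cs' with
  | nil => simp [decBits] at h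
  | cons c cs ih =>
    simp only [decBits] at h
    split_ifs at h with hc
    · simp only [Option.some.injEq] at h
      subst h
      refine ⟨by simp, ?_, fun i hi => ?_, fun d hr h => ?_⟩
      · simp only [val, testBit_flip_same, hc]; simp; ring
      · simp only [val, testBit_flip_ne hi]
      · simp only [List.mem_cons, forall_eq_or_imp] at h ⊢
        exact ⟨flip_lt hr h.1, h.2⟩
    · simp only [Option.map_eq_some_iff] at h
      obtain ⟨cs', h, rfl⟩ := h
      obtain ⟨h1, h2, h3, h4⟩ := ih h
      refine ⟨by simp [h1], ?_, fun i hi => ?_, fun d hr h => ?_⟩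
      · simp only [val, testBit_flip_same, hc, ← h2]; simp; ring
      · simp only [val, testBit_flip_ne hi, h3 i hi]
      · simp only [List.mem_cons, forall_eq_or_imp] at h ⊢
        exact ⟨flip_lt hr h.1, h4 d hr h.2⟩

/-! ### The machine -/

/-- The phases of the execution of an instruction. -/
inductive Phase
  | init₁ | init₂ | init₃ | init₄ | go | carry | grow | borrow | restore | back | fetch | peek
  | rewind (b : Bool)
  | hop | append | unwind | fin₁ | fin₂

/-- The list of all phases. -/
def Phase.all : List Phase :=
  [.init₁, .init₂, .init₃, .init₄, .go, .carry, .grow, .borrow, .restore, .back, .fetch, .peek,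
    .rewind true, .rewind false, .hop, .append, .unwind, .fin₁, .fin₂]

theorem Phase.mem_all (a : Phase) : a ∈ Phase.all := by
  rcases a with _ | _ | _ | _ | _ | _ | _ | _ | _ | _ | _ | _ | (_ | _) | _ | _ | _ | _ | _ <;>
    simp [Phase.all]

/-- The transition table. At home, the head scans the lowest register cell; its right neighbour is
blank. -/
def trans : List Prog → Phase → Symbol → Option (Symbol × Move × List Prog × Phase)
  | L, .init₁, a => some (a, .left, L, .init₂)
  | L, .init₂, a => some (a, .left, L, .init₃)
  -- The cell next to the input stays blank as a separator; the first register cell lies two cells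
  -- to the left of the input, and one more blank is visited as the left end of the register area.
  | L, .init₃, _ => some (some 0, .left, L, .init₄)
  | L, .init₄, a => some (a, .right, L, .go)
  | [], .go, a => some (a, .right, [], .fin₁)
  | [], .fin₁, a => some (a, .right, [], .fin₂)
  | .inc r :: K, .go, a => some (a, .stay, .inc r :: K, .carry)
  | .cond r p q :: K, .go, a => some (a, .stay, .cond r p q :: K, .borrow)
  | .loop r p :: K, .go, a => some (a, .stay, .loop r p :: K, .borrow)
  | .take p q :: K, .go, a => some (a, .right, .take p q :: K, .fetch)
  | .last p q :: K, .go, a => some (a, .right, .last p q :: K, .fetch)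
  | .emit d :: K, .go, a => some (a, .right, .emit d :: K, .hop)
  | .skip :: K, .go, a => some (a, .stay, K, .go)
  | .seq p q :: K, .go, a => some (a, .stay, p :: q :: K, .go)
  | .inc r :: K, .carry, some c =>
    if c.testBit r then some (some (flip r c), .left, .inc r :: K, .carry)
    else some (some (flip r c), .right, .inc r :: K, .back)
  -- The carry left the top cell: the end marker becomes a new top cell, and the move to the left
  -- provides a new blank end marker.
  | .inc r :: K, .carry, none => some (some (2 ^ r), .left, .inc r :: K, .grow)
  | L, .grow, a => some (a, .right, L, .back)
  | L, .back, some c => some (some c, .right, L, .back)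
  | L, .back, none => some (none, .left, cont L true, .go)
  | .cond r p q :: K, .borrow, some c =>
    if c.testBit r then some (some (flip r c), .right, .cond r p q :: K, .back)
    else some (some (flip r c), .left, .cond r p q :: K, .borrow)
  | .loop r p :: K, .borrow, some c =>
    if c.testBit r then some (some (flip r c), .right, .loop r p :: K, .back)
    else some (some (flip r c), .left, .loop r p :: K, .borrow)
  -- No set bit was met, so the register is zero, and all its bits have been flipped in vain; they
  -- are flipped back on the way home.
  | L, .borrow, none => some (none, .right, L, .restore)
  | .cond r p q :: K, .restore, some c => some (some (flip r c), .right, .cond r p q :: K, .restore)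
  | .loop r p :: K, .restore, some c => some (some (flip r c), .right, .loop r p :: K, .restore)
  | L, .restore, none => some (none, .left, cont L false, .go)
  -- Consumed input has become blank, so the first nonblank cell to the right carries the current
  -- digit.
  | L, .fetch, none => some (none, .right, L, .fetch)
  | .take p q :: K, .fetch, some 0 => some (some 0, .left, .take p q :: K, .rewind false)
  | .take p q :: K, .fetch, some (d + 1) => some (some d, .left, .take p q :: K, .rewind true)
  | .last p q :: K, .fetch, some _ => some (none, .right, .last p q :: K, .peek)
  | L, .peek, none => some (none, .left, L, .rewind true)
  | L, .peek, some c => some (some c, .left, L, .rewind false)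
  | L, .rewind b, none => some (none, .left, L, .rewind b)
  | L, .rewind b, some c => some (some c, .stay, cont L b, .go)
  -- The separator is skipped and the first blank behind the output is filled. Unread input would be
  -- mistaken for output here, which is why `emit` requires the input to be consumed.
  | L, .hop, a => some (a, .right, L, .append)
  | L, .append, some c => some (some c, .right, L, .append)
  | .emit d :: K, .append, none => some (some d, .left, .emit d :: K, .unwind)
  | L, .unwind, some c => some (some c, .left, L, .unwind)
  | L, .unwind, none => some (none, .left, cont L true, .go)
  | _, _, _ => none

theorem trans_back_some (L : List Prog) (c : ℕ) :
    trans L .back (some c) = some (some c, .right, L, .back) := by cases L <;> rfl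

theorem trans_back_none (L : List Prog) :
    trans L .back none = some (none, .left, cont L true, .go) := by cases L <;> rfl

theorem trans_restore_none (L : List Prog) :
    trans L .restore none = some (none, .left, cont L false, .go) := by
  rcases L with _ | ⟨p, K⟩
  · rfl
  · cases p <;> rfl

theorem trans_borrow_none (L : List Prog) :
    trans L .borrow none = some (none, .right, L, .restore) := by
  rcases L with _ | ⟨p, K⟩
  · rfl
  · cases p <;> rfl

theorem trans_fetch_none (L : List Prog) :
    trans L .fetch none = some (none, .right, L, .fetch) := by cases L <;> rfl

theorem trans_peek_some (L : List Prog) (c : ℕ) :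
    trans L .peek (some c) = some (some c, .left, L, .rewind false) := by cases L <;> rfl

theorem trans_peek_none (L : List Prog) :
    trans L .peek none = some (none, .left, L, .rewind true) := by cases L <;> rfl

theorem trans_rewind_some (L : List Prog) (b : Bool) (c : ℕ) :
    trans L (.rewind b) (some c) = some (some c, .stay, cont L b, .go) := by cases L <;> rfl

theorem trans_rewind_none (L : List Prog) (b : Bool) :
    trans L (.rewind b) none = some (none, .left, L, .rewind b) := by cases L <;> rfl

theorem trans_append_some (L : List Prog) (c : ℕ) :
    trans L .append (some c) = some (some c, .right, L, .append) := by cases L <;> rfl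

theorem trans_unwind_some (L : List Prog) (c : ℕ) :
    trans L .unwind (some c) = some (some c, .left, L, .unwind) := by cases L <;> rfl

theorem trans_unwind_none (L : List Prog) :
    trans L .unwind none = some (none, .left, cont L true, .go) := by cases L <;> rfl

/-- The register tested by an instruction. -/
def Tests (r : ℕ) (L : List Prog) : Prop :=
  (∃ p q K, L = .cond r p q :: K) ∨ ∃ p K, L = .loop r p :: K

theorem trans_borrow_some {r : ℕ} {L : List Prog} (ht : Tests r L) (c : ℕ) :
    trans L .borrow (some c) = if c.testBit r then some (some (flip r c), .right, L, .back)
      else some (some (flip r c), .left, L, .borrow) := by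
  obtain ⟨p, q, K, rfl⟩ | ⟨p, K, rfl⟩ := ht <;> rfl

theorem trans_restore_some {r : ℕ} {L : List Prog} (ht : Tests r L) (c : ℕ) :
    trans L .restore (some c) = some (some (flip r c), .right, L, .restore) := by
  obtain ⟨p, q, K, rfl⟩ | ⟨p, K, rfl⟩ := ht <;> rfl

/-- The lists of programs that occur while `P` is executed. -/
def states (P : Prog) : List (List Prog) := conts P [] ++ [[]]

open Classical in
/-- The number of a state of the machine. -/
noncomputable def num (P : Prog) (L : List Prog) (a : Phase) : ℕ :=
  Nat.pair ((states P).idxOf L) (Phase.all.idxOf a)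

theorem num_inj {P : Prog} {L L' : List Prog} {a a' : Phase} (hL : L ∈ states P)
    (h : num P L a = num P L' a') : L = L' ∧ a = a' := by
  classical
  simp only [num, Nat.pair_eq_pair] at h
  exact ⟨(List.idxOf_inj hL).1 (by convert h.1), (List.idxOf_inj (Phase.mem_all a)).1 (by convert h.2)⟩

/-- Machines start in state `0`, so the initial situation has to come first in both enumerations. -/
theorem num_init (P : Prog) : num P [P] .init₁ = 0 := by
  have h : ∃ l, states P = [P] :: l := by cases P <;> simp [states, conts]
  obtain ⟨l, h⟩ := h
  simp only [num, h, Phase.all, List.idxOf_cons_self]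
  rfl

/-- The symbols of a machine with base `N`. -/
def symbols (N : ℕ) : List Symbol := none :: (List.range N).map some

theorem mem_symbols {N : ℕ} {a : Symbol} : a ∈ symbols N ↔ ∀ c ∈ a, c < N := by
  cases a <;> simp [symbols]

/-- The instruction of the machine in a given situation. -/
noncomputable def instr (P : Prog) (L : List Prog) (ph : Phase) (a : Symbol)
    (t : Symbol × Move × List Prog × Phase) : Instr :=
  ⟨num P L ph, a, t.1, t.2.1, num P t.2.2.1 t.2.2.2⟩

/-- The machine that executes the program `P` with registers below `d`, with base `2 ^ d`. -/
noncomputable def machine (P : Prog) (d : ℕ) : Machine where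
  base := 2 ^ d
  program := (states P).flatMap fun L => Phase.all.flatMap fun ph =>
    (symbols (2 ^ d)).filterMap fun a => (trans L ph a).map (instr P L ph a)

theorem mem_program {P : Prog} {d : ℕ} {i : Instr} : i ∈ (machine P d).program ↔
    ∃ L ∈ states P, ∃ ph, ∃ a ∈ symbols (2 ^ d), ∃ t, trans L ph a = some t ∧
      instr P L ph a t = i := by
  simp only [machine, List.mem_flatMap, List.mem_filterMap, Option.map_eq_some_iff]
  constructor
  · rintro ⟨L, hL, ph, -, a, ha, t, h⟩
    exact ⟨L, hL, ph, a, ha, t, h⟩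
  · rintro ⟨L, hL, ph, a, ha, t, h⟩
    exact ⟨L, hL, ph, Phase.mem_all ph, a, ha, t, h⟩

/-- The numbering of states is injective, so all matching instructions come from the same place of
the transition table, and the first one found is as good as any. -/
theorem machine_find {P : Prog} {d : ℕ} {L : List Prog} (hL : L ∈ states P) (ph : Phase)
    {a : Symbol} (ha : a ∈ symbols (2 ^ d)) :
    ((machine P d).program.find? fun i => i.state == num P L ph && i.read == a) =
      (trans L ph a).map (instr P L ph a) := by
  cases hf : (machine P d).program.find? fun i => i.state == num P L ph && i.read == a with
  | none =>
    rw [List.find?_eq_none] at hf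
    cases ht : trans L ph a with
    | none => rfl
    | some t =>
      exact absurd (by simp [instr]) (hf _ (mem_program.2 ⟨L, hL, ph, a, ha, t, ht, rfl⟩))
  | some i =>
    have h1 := List.find?_some hf
    obtain ⟨L', hL', ph', a', ha', t, ht, rfl⟩ := mem_program.1 (List.mem_of_find?_eq_some hf)
    simp only [instr, Bool.and_eq_true, beq_iff_eq] at h1
    obtain ⟨h1, rfl⟩ := h1
    obtain ⟨rfl, rfl⟩ := num_inj hL' h1
    simp [ht]

/-- The configuration after writing and moving. -/
def moved (n : ℕ) (l : List Symbol) (b : Symbol) (r : List Symbol) : Move → Config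
  | .left => ⟨n, l.tail, l.headD none, b :: r⟩
  | .stay => ⟨n, l, b, r⟩
  | .right => ⟨n, b :: l, r.headD none, r.tail⟩

theorem machine_step {P : Prog} {d : ℕ} {L : List Prog} (hL : L ∈ states P) {ph : Phase}
    {a : Symbol} (ha : ∀ c ∈ a, c < 2 ^ d) {b : Symbol} {mv : Move} {L' : List Prog} {ph' : Phase}
    (h : trans L ph a = some (b, mv, L', ph')) (l r : List Symbol) :
    moved (num P L' ph') l b r mv ∈ (machine P d).step ⟨num P L ph, l, a, r⟩ := by
  simp only [Machine.step, machine_find hL ph (mem_symbols.2 ha), h, Option.map_some, instr,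
    Instr.exec, Option.mem_def, Option.some.injEq]
  cases mv
  · cases l <;> rfl
  · rfl
  · cases r <;> rfl

theorem machine_halt {P : Prog} {d : ℕ} (l : List Symbol) {a : Symbol} (ha : ∀ c ∈ a, c < 2 ^ d)
    (r : List Symbol) : (machine P d).step ⟨num P [] .fin₂, l, a, r⟩ = none := by
  have hL : [] ∈ states P := by simp [states]
  simp [Machine.step, machine_find hL _ (mem_symbols.2 ha), trans]

/-- A digit below `2 ^ d` is a column of `d` bits, one for each register; flipping the bit of a
register below `d` stays among these columns. -/
theorem machine_valid {P : Prog} {d : ℕ} (hd : 0 < d) (hb : P.bound ≤ d)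
    (he : P.EmitsBelow (2 ^ d)) : (machine P d).Valid := by
  refine ⟨by simpa [machine] using Nat.pow_le_pow_right (by norm_num : 0 < 2) hd, ?_⟩
  intro i hi
  obtain ⟨L, hL, ph, a, ha, t, ht, rfl⟩ := mem_program.1 hi
  have h1 : ∀ q ∈ L, q.bound ≤ d ∧ q.EmitsBelow (2 ^ d) := by
    intro q hq
    simp only [states, List.mem_append, List.mem_singleton] at hL
    rcases hL with hL | rfl
    · exact ⟨conts_bound hL hb (by simp) q hq, conts_emitsBelow hL he (by simp) q hq⟩
    · simp at hq
  rw [mem_symbols] at ha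
  change ∀ c ∈ t.1, c < 2 ^ d
  revert ht
  fun_cases trans L ph a <;> intro ht <;>
    simp only [Option.some.injEq, reduceCtorEq] at ht <;> subst ht <;>
    simp_all [Prog.bound, Prog.EmitsBelow, flip_lt] <;>
    first
    | exact Nat.pow_lt_pow_right (by norm_num) (by omega)
    | exact flip_lt (by omega) (by omega)
    | omega

/-! ### Walks of the head over register cells, input and output -/

section walks

variable {P : Prog} {d : ℕ}

/-- The configuration in which the head is inside the register area: `done` are the register cells
to its right, nearest first, and `cs` the other ones, lowest first. -/
noncomputable def within (P : Prog) (L : List Prog) (ph : Phase) (done cs : List ℕ)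
    (rest : List Symbol) : Config :=
  ⟨num P L ph, (cs.map some ++ [none]).tail, (cs.map some ++ [none]).headD none,
    done.map some ++ none :: rest⟩

/-- The configuration in which an instruction begins. -/
noncomputable abbrev home (P : Prog) (L : List Prog) (cs : List ℕ) (rest : List Symbol) : Config :=
  within P L .go [] cs rest

theorem back_reaches {L : List Prog} (hL : L ∈ states P) (rest : List Symbol) (done : List ℕ)
    (hd : ∀ c ∈ done, c < 2 ^ d) (cs : List ℕ) :
    Reaches₁ (machine P d).step
      ⟨num P L .back, cs.map some ++ [none], (done.map some ++ none :: rest).headD none,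
        (done.map some ++ none :: rest).tail⟩
      (home P (cont L true) (done.reverseAux cs) rest) := by
  induction done generalizing cs with
  | nil => exact .single (machine_step (d := d) hL (a := none) (by simp) (trans_back_none L) _ _)
  | cons c done ih =>
    refine .head (machine_step hL (by simpa using hd c (by simp)) (trans_back_some L c) _ _) ?_
    exact ih (fun c hc => hd c (by simp [hc])) (c :: cs)

/-- Induction on the cells still ahead; those already passed are collected in `done`, and
`reverseAux` lays them back on the way home. -/
theorem carry_reaches {r : ℕ} {K : List Prog} (hL : .inc r :: K ∈ states P) (hr : r < d)
    (rest : List Symbol) (done : List ℕ) (hd : ∀ c ∈ done, c < 2 ^ d) (cs : List ℕ)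
    (hc : ∀ c ∈ cs, c < 2 ^ d) :
    Reaches₁ (machine P d).step (within P (.inc r :: K) .carry done cs rest)
      (home P K (done.reverseAux (incBits r cs)) rest) := by
  induction cs generalizing done with
  | nil =>
    refine .head (machine_step hL (by simp) rfl _ _) ?_
    refine .head (machine_step hL (by simp) rfl _ _) ?_
    refine back_reaches hL rest (2 ^ r :: done) ?_ []
    simpa using ⟨Nat.pow_lt_pow_right (by norm_num) hr, hd⟩
  | cons c cs ih =>
    simp only [List.mem_cons, forall_eq_or_imp] at hc
    simp only [incBits]
    split_ifs with hb
    · refine .head (machine_step hL (a := some c) (by simpa using hc.1)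
        (by simp only [trans, hb, if_true]; rfl) _ _) ?_
      exact ih (flip r c :: done) (by simpa using ⟨flip_lt hr hc.1, hd⟩) hc.2
    · refine .head (machine_step hL (a := some c) (by simpa using hc.1)
        (by simp only [trans, hb, if_false, Bool.false_eq_true]; rfl) _ _) ?_
      exact back_reaches hL rest done hd (flip r c :: cs)

theorem restore_reaches {r : ℕ} {L : List Prog} (hL : L ∈ states P) (ht : Tests r L)
    (rest : List Symbol) (done : List ℕ) (hd : ∀ c ∈ done, c < 2 ^ d) (cs : List ℕ) :
    Reaches₁ (machine P d).step
      ⟨num P L .restore, cs.map some ++ [none], (done.map some ++ none :: rest).headD none,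
        (done.map some ++ none :: rest).tail⟩
      (home P (cont L false) ((done.map (flip r)).reverseAux cs) rest) := by
  induction done generalizing cs with
  | nil => exact .single (machine_step (d := d) hL (a := none) (by simp) (trans_restore_none L) _ _)
  | cons c done ih =>
    refine .head (machine_step hL (by simpa using hd c (by simp))
      (trans_restore_some ht c) _ _) ?_
    exact ih (fun c hc => hd c (by simp [hc])) (flip r c :: cs)

/-- When the borrow fails, each bit passed has been flipped once going out and once coming back, and
`flip_flip` cancels the two. -/
theorem borrow_reaches {r : ℕ} {L : List Prog} (hL : L ∈ states P) (ht : Tests r L) (hr : r < d)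
    (rest : List Symbol) (done : List ℕ) (hd : ∀ c ∈ done, c < 2 ^ d) (cs : List ℕ)
    (hc : ∀ c ∈ cs, c < 2 ^ d) :
    Reaches₁ (machine P d).step (within P L .borrow done cs rest)
      (match decBits r cs with
      | some cs' => home P (cont L true) (done.reverseAux cs') rest
      | none => home P (cont L false) ((done.map (flip r)).reverseAux cs) rest) := by
  induction cs generalizing done with
  | nil =>
    refine .head (machine_step hL (by simp) (trans_borrow_none L) _ _) ?_
    exact restore_reaches hL ht rest done hd []
  | cons c cs ih =>
    simp only [List.mem_cons, forall_eq_or_imp] at hc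
    simp only [decBits]
    have htr := trans_borrow_some ht c
    by_cases hb : c.testBit r
    · rw [if_pos hb] at htr
      simp only [hb, if_true]
      refine .head (machine_step hL (a := some c) (by simpa using hc.1) htr _ _) ?_
      exact back_reaches hL rest done hd (flip r c :: cs)
    · rw [if_neg hb] at htr
      simp only [hb, Bool.false_eq_true, if_false]
      refine .head (machine_step hL (a := some c) (by simpa using hc.1) htr _ _) ?_
      have := ih (flip r c :: done) (by simpa using ⟨flip_lt hr hc.1, hd⟩) hc.2
      change Reaches₁ _ (within P L .borrow (flip r c :: done) cs rest) _
      cases h : decBits r cs with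
      | none =>
        simp only [h, List.map_cons, flip_flip, List.reverseAux_cons] at this
        simpa using this
      | some cs' =>
        simp only [h, List.reverseAux_cons] at this
        simpa using this

theorem fetch_reaches {L : List Prog} (hL : L ∈ states P) (j : ℕ) (l : List Symbol) (a : Symbol)
    (r : List Symbol) :
    Reaches (machine P d).step ⟨num P L .fetch, l, none, List.replicate j none ++ a :: r⟩
      ⟨num P L .fetch, List.replicate (j + 1) none ++ l, a, r⟩ := by
  induction j generalizing l with
  | zero =>
    exact .head (machine_step (d := d) hL (a := none) (by simp) (trans_fetch_none L) _ _) .refl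
  | succ j ih =>
    refine .head (machine_step hL (by simp) (trans_fetch_none L) _ _) ?_
    have := ih (none :: l)
    rwa [show List.replicate (j + 1) none ++ none :: l = List.replicate (j + 1 + 1) none ++ l by
      rw [List.replicate_succ' (n := j + 1)]; simp] at this

theorem rewind_reaches {L : List Prog} (hL : L ∈ states P) (b : Bool) (j c : ℕ) (hc : c < 2 ^ d)
    (l r : List Symbol) :
    Reaches₁ (machine P d).step
      ⟨num P L (.rewind b), List.replicate j none ++ some c :: l, none, r⟩
      ⟨num P (cont L b) .go, l, some c, List.replicate (j + 1) none ++ r⟩ := by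
  induction j generalizing r with
  | zero =>
    refine .head (machine_step hL (by simp) (trans_rewind_none L b) _ _) ?_
    exact .single (machine_step (d := d) hL (a := some c) (by simpa using hc)
      (trans_rewind_some L b c) _ _)
  | succ j ih =>
    refine .head (machine_step hL (by simp) (trans_rewind_none L b) _ _) ?_
    have := ih (none :: r)
    rwa [show List.replicate (j + 1) none ++ none :: r = List.replicate (j + 1 + 1) none ++ r by
      rw [List.replicate_succ' (n := j + 1)]; simp] at this

theorem append_reaches {L : List Prog} (hL : L ∈ states P) (j : ℕ) (o : List ℕ)
    (ho : ∀ c ∈ o, c < 2 ^ d) (l : List Symbol) :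
    Reaches (machine P d).step
      ⟨num P L .append, l, (o.map some ++ List.replicate j none).headD none,
        (o.map some ++ List.replicate j none).tail⟩
      ⟨num P L .append, (o.map some).reverse ++ l, none, List.replicate (j - 1) none⟩ := by
  induction o generalizing l with
  | nil =>
    cases j <;> simp [List.replicate_succ] <;> exact .refl
  | cons c o ih =>
    refine .head (machine_step hL (a := some c) (by simpa using ho c (by simp))
      (trans_append_some L c) _ _) ?_
    have := ih (fun c hc => ho c (by simp [hc])) (some c :: l)
    simpa [moved, Reaches] using this

theorem unwind_reaches {L : List Prog} (hL : L ∈ states P) (o : List ℕ) (ho : ∀ c ∈ o, c < 2 ^ d)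
    (l r : List Symbol) :
    Reaches (machine P d).step
      ⟨num P L .unwind, (o.map some ++ none :: l).tail, (o.map some ++ none :: l).headD none, r⟩
      ⟨num P L .unwind, l, none, (o.map some).reverse ++ r⟩ := by
  induction o generalizing r with
  | nil => exact .refl
  | cons c o ih =>
    refine .head (machine_step hL (a := some c) (by simpa using ho c (by simp))
      (trans_unwind_some L c) _ _) ?_
    have := ih (fun c hc => ho c (by simp [hc])) (some c :: r)
    simpa [moved, Reaches] using this

end walks

/-! ### Representation of the data on the tape and simulation of small steps -/

/-- The tape that holds the given words. -/
def tapeOf (ws : List (List ℕ)) : List Symbol := ws.flatMap fun w => w.map some ++ [none]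

/-- The register cells `cs` and the right part `rest` of the tape represent the data `s`. -/
structure Rep (d : ℕ) (s : St) (cs : List ℕ) (rest : List Symbol) : Prop where
  ne : cs ≠ []
  cells : ∀ c ∈ cs, c < 2 ^ d
  regs : ∀ r < d, val r cs = s r
  -- The `j` blanks are the consumed cells of the input. They remain part of the tape and are later
  -- overwritten by the output, so input and output share their space.
  rest_inp : s.inp ≠ [] → s.out = [] ∧ ∃ j, rest = List.replicate j none ++ tapeOf s.inp
  rest_out : s.inp = [] → ∃ j, rest = s.out.map some ++ List.replicate j none
  inp : ∀ w ∈ s.inp, w ≠ [] ∧ ∀ x ∈ w, x < 2 ^ d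
  out : ∀ x ∈ s.out, x < 2 ^ d

theorem Rep.out_length_le {d s cs rest} (h : Rep d s cs rest) : s.out.length ≤ rest.length := by
  by_cases hi : s.inp = []
  · obtain ⟨j, rfl⟩ := h.rest_out hi
    simp
  · simp [(h.rest_inp hi).1]

theorem Rep.congr {d s cs cs' rest t} (h : Rep d s cs rest) (hne : cs' ≠ [])
    (hc : ∀ c ∈ cs', c < 2 ^ d) (hr : ∀ r < d, val r cs' = t r) (hi : t.inp = s.inp)
    (ho : t.out = s.out) : Rep d t cs' rest :=
  ⟨hne, hc, hr, by rw [hi, ho]; exact h.rest_inp, by rw [hi, ho]; exact h.rest_out,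
    by rw [hi]; exact h.inp, by rw [ho]; exact h.out⟩

theorem head_valid {d : ℕ} {cs : List ℕ} (h : ∀ c ∈ cs, c < 2 ^ d) :
    ∀ c ∈ (cs.map some ++ [none]).headD none, c < 2 ^ d := by
  cases cs <;> simp_all

theorem trans_fetch_last (p q : Prog) (K : List Prog) (x : ℕ) :
    trans (.last p q :: K) .fetch (some x) = some (none, .right, .last p q :: K, .peek) := by
  cases x <;> rfl

theorem trans_go_tests {r : ℕ} {L : List Prog} (ht : Tests r L) (a : Symbol) :
    trans L .go a = some (a, .stay, L, .borrow) := by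
  obtain ⟨p, q, K, rfl⟩ | ⟨p, K, rfl⟩ := ht <;> rfl

section

variable {P : Prog} {d : ℕ}

/-- `cond` and `loop` test and decrement in the same way; `ha` is the common form of their effect.
-/
theorem test_reaches {r : ℕ} {L : List Prog} (hL : L ∈ states P) (ht : Tests r L) (hr : r < d)
    {s : St} {cs : List ℕ} {rest : List Symbol} (h : Rep d s cs rest) {b : Bool} {t : St}
    (ha : (if s r = 0 then some (false, s) else some (true, s.set r (s r - 1))) = some (b, t)) :
    ∃ cs', Rep d t cs' rest ∧ cs'.length = cs.length ∧
      Reaches₁ (machine P d).step (home P L cs rest) (home P (cont L b) cs' rest) := by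
  have h1 := borrow_reaches hL ht hr rest [] (by simp) cs h.cells
  have h2 : Reaches₁ (machine P d).step (home P L cs rest) (within P L .borrow [] cs rest) :=
    .single (machine_step (d := d) hL (head_valid h.cells) (trans_go_tests ht _) _ _)
  split_ifs at ha with h0
  · simp only [Option.some.injEq, Prod.mk.injEq] at ha
    obtain ⟨rfl, rfl⟩ := ha
    rw [← h.regs r hr, ← decBits_eq_none] at h0
    rw [h0] at h1
    exact ⟨cs, h, rfl, h2.trans h1⟩
  · simp only [Option.some.injEq, Prod.mk.injEq] at ha
    obtain ⟨rfl, rfl⟩ := ha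
    cases hd : decBits r cs with
    | none => rw [decBits_eq_none, h.regs r hr] at hd; exact absurd hd h0
    | some cs' =>
      rw [hd] at h1
      obtain ⟨g1, g2, g3, g4⟩ := decBits_eq_some hd
      refine ⟨cs', h.congr ?_ (g4 d hr h.cells) (fun i hi => ?_) rfl rfl, g1, h2.trans h1⟩
      · have := h.ne
        rintro rfl
        exact this (List.length_eq_zero_iff.1 g1.symm)
      · rw [St.set_apply]
        split_ifs with hir
        · subst hir
          have := h.regs i hi
          omega
        · rw [g3 i hir, h.regs i hi]

/-- The head goes to the current input digit. -/
theorem input_reaches {L : List Prog} (hL : L ∈ states P)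
    (hgo : ∀ a, trans L .go a = some (a, .right, L, .fetch)) {c : ℕ} {cs : List ℕ}
    (hc : c < 2 ^ d) (j : ℕ) (a : Symbol) (r : List Symbol) :
    Reaches₁ (machine P d).step (home P L (c :: cs) (List.replicate j none ++ a :: r))
      ⟨num P L .fetch, List.replicate (j + 1) none ++ some c :: (cs.map some ++ [none]), a, r⟩ :=
  TransGen.head' (machine_step (d := d) hL (a := some c) (by simpa using hc) (hgo _) _ _)
    (fetch_reaches hL j _ a r)

theorem rewind_home {L : List Prog} (hL : L ∈ states P) (b : Bool) (j c : ℕ) (hc : c < 2 ^ d)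
    (cs : List ℕ) (r : List Symbol) :
    Reaches₁ (machine P d).step
      ⟨num P L (.rewind b), List.replicate j none ++ some c :: (cs.map some ++ [none]), none, r⟩
      (home P (cont L b) (c :: cs) (List.replicate j none ++ r)) :=
  rewind_reaches hL b j c hc _ r

/-- The space account of one instruction: only `inc` can lengthen the register area, and only when
the new value needs another bit; the right part grows only when the output outgrows it. -/
theorem act_reaches {p : Prog} {K : List Prog} (hL : p :: K ∈ states P) (hb : p.bound ≤ d)
    (he : p.EmitsBelow (2 ^ d)) {s t : St} {b : Bool} (ha : act p s = some (b, t))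
    {cs : List ℕ} {rest : List Symbol} (h : Rep d s cs rest) :
    ∃ cs' rest', Rep d t cs' rest' ∧
      (∀ W, cs.length ≤ W → (∀ r, p = .inc r → s r + 1 < 2 ^ W) → cs'.length ≤ W) ∧
      rest'.length = max rest.length t.out.length ∧
      Reaches₁ (machine P d).step (home P (p :: K) cs rest)
        (home P (cont (p :: K) b) cs' rest') := by
  have hlen := h.out_length_le
  cases p with
  | skip =>
    simp only [act, Option.some.injEq, Prod.mk.injEq] at ha
    obtain ⟨rfl, rfl⟩ := ha
    have hgo : ∀ a, trans (.skip :: K) .go a = some (a, .stay, K, .go) := fun _ => rfl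
    exact ⟨cs, rest, h, fun W hW _ => hW, by omega,
      .single (machine_step (d := d) hL (head_valid h.cells) (hgo _) _ _)⟩
  | seq p q =>
    simp only [act, Option.some.injEq, Prod.mk.injEq] at ha
    obtain ⟨rfl, rfl⟩ := ha
    have hgo : ∀ a, trans (.seq p q :: K) .go a = some (a, .stay, p :: q :: K, .go) := fun _ => rfl
    exact ⟨cs, rest, h, fun W hW _ => hW, by omega,
      .single (machine_step (d := d) hL (head_valid h.cells) (hgo _) _ _)⟩
  | inc r =>
    simp only [act, Option.some.injEq, Prod.mk.injEq] at ha
    obtain ⟨rfl, rfl⟩ := ha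
    simp only [Prog.bound] at hb
    refine ⟨incBits r cs, rest, h.congr ?_ (incBits_lt (by omega) h.cells) (fun i hi => ?_) rfl rfl,
      fun W hW hV => incBits_length_le hW ?_, by simpa using hlen, ?_⟩
    · intro hnil
      have := length_le_incBits r cs
      rw [hnil] at this
      exact h.ne (List.length_eq_zero_iff.1 (by simpa using this))
    · rw [St.set_apply]
      split_ifs with hir
      · subst hir; rw [val_incBits_same, h.regs i hi]
      · rw [val_incBits_ne hir, h.regs i hi]
    · rw [h.regs r (by omega)]; exact hV r rfl
    · refine .head (machine_step hL (head_valid h.cells) rfl _ _) ?_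
      exact carry_reaches hL (by omega) rest [] (by simp) cs h.cells
  | cond r p q =>
    obtain ⟨cs', h1, h2, h3⟩ := test_reaches hL (.inl ⟨p, q, K, rfl⟩)
      (by simp only [Prog.bound] at hb; omega) h ha
    have := act_frame (p := .cond r .skip .skip) (by simp [Prog.Pure]) (b := b) (t := t) (s := s) ha
    exact ⟨cs', rest, h1, fun W hW _ => by omega, by rw [this.2.1]; omega, h3⟩
  | loop r p =>
    obtain ⟨cs', h1, h2, h3⟩ := test_reaches hL (.inr ⟨p, K, rfl⟩)
      (by simp only [Prog.bound] at hb; omega) h ha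
    have := act_frame (p := .loop r .skip) (by simp [Prog.Pure]) (b := b) (t := t) (s := s) ha
    exact ⟨cs', rest, h1, fun W hW _ => by omega, by rw [this.2.1]; omega, h3⟩
  | take p q =>
    obtain ⟨c, cs, rfl⟩ := List.exists_cons_of_ne_nil h.ne
    have hc : c < 2 ^ d := h.cells c (by simp)
    simp only [act] at ha
    split at ha
    · rename_i w ws hin
      simp only [Option.some.injEq, Prod.mk.injEq] at ha
      obtain ⟨rfl, rfl⟩ := ha
      obtain ⟨-, j, rfl⟩ := h.rest_inp (by simp [hin])
      refine ⟨c :: cs, _, h, fun W hW _ => hW, by omega, ?_⟩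
      simp only [tapeOf, hin, List.flatMap_cons, List.map_cons, List.cons_append]
      refine (input_reaches hL (fun _ => rfl) hc j _ _).trans ?_
      refine .head (machine_step hL (a := some 0) (by simp) rfl _ _) ?_
      exact rewind_home hL false j c hc cs _
    · rename_i x w ws hin
      simp only [Option.some.injEq, Prod.mk.injEq] at ha
      obtain ⟨rfl, rfl⟩ := ha
      obtain ⟨h0, j, rfl⟩ := h.rest_inp (by simp [hin])
      have hx := (h.inp ((x + 1) :: w) (by rw [hin]; simp)).2 (x + 1) (by simp)
      refine ⟨c :: cs, List.replicate j none ++ tapeOf ((x :: w) :: ws),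
        ⟨by simp, h.cells, h.regs, fun _ => ⟨h0, j, rfl⟩, by simp, ?_, h.out⟩,
        fun W hW _ => hW, by simp [h0, tapeOf, hin], ?_⟩
      · have := h.inp
        simp only [hin, List.mem_cons, forall_eq_or_imp] at this ⊢
        exact ⟨⟨by simp, by omega, this.1.2.2⟩, this.2⟩
      · simp only [tapeOf, hin, List.flatMap_cons, List.map_cons, List.cons_append]
        refine (input_reaches hL (fun _ => rfl) hc j _ _).trans ?_
        refine .head (machine_step hL (a := some (x + 1)) (by simpa using hx) rfl _ _) ?_
        exact rewind_home hL true j c hc cs _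
    · simp at ha
  | last p q =>
    obtain ⟨c, cs, rfl⟩ := List.exists_cons_of_ne_nil h.ne
    have hc : c < 2 ^ d := h.cells c (by simp)
    simp only [act] at ha
    split at ha
    · rename_i x ws hin
      simp only [Option.some.injEq, Prod.mk.injEq] at ha
      obtain ⟨rfl, rfl⟩ := ha
      obtain ⟨h0, j, rfl⟩ := h.rest_inp (by simp [hin])
      have hx := (h.inp [x] (by rw [hin]; simp)).2 x (by simp)
      refine ⟨c :: cs, List.replicate (j + 2) none ++ tapeOf ws,
        ⟨by simp, h.cells, h.regs, fun _ => ⟨h0, _, rfl⟩, ?_, ?_, h.out⟩,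
        fun W hW _ => hW, ?_, ?_⟩
      · intro hws
        have hws : ws = [] := hws
        exact ⟨j + 2, by simp [h0, hws, tapeOf]⟩
      · have := h.inp
        simp only [hin, List.mem_cons, forall_eq_or_imp] at this ⊢
        exact this.2
      · simp [h0, tapeOf, hin]; omega
      · simp only [tapeOf, hin, List.flatMap_cons, List.map_cons, List.cons_append, List.map_nil,
          List.nil_append]
        refine (input_reaches hL (fun _ => rfl) hc j _ _).trans ?_
        refine .head (machine_step hL (a := some x) (by simpa using hx) (trans_fetch_last p q K x) _ _) ?_
        refine .head (machine_step hL (a := none) (by simp) (trans_peek_none _) _ _) ?_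
        have := rewind_home hL true (j + 1) c hc cs (none :: ws.flatMap fun w => w.map some ++ [none])
        rwa [show List.replicate (j + 1) none ++ none :: (ws.flatMap fun w => w.map some ++ [none]) =
          List.replicate (j + 2) none ++ ws.flatMap fun w => w.map some ++ [none] by
            rw [List.replicate_succ' (n := j + 1)]; simp] at this
    · rename_i x e w ws hin
      simp only [Option.some.injEq, Prod.mk.injEq] at ha
      obtain ⟨rfl, rfl⟩ := ha
      obtain ⟨h0, j, rfl⟩ := h.rest_inp (by simp [hin])
      have hx := (h.inp (x :: e :: w) (by rw [hin]; simp)).2 x (by simp)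
      have hy := (h.inp (x :: e :: w) (by rw [hin]; simp)).2 e (by simp)
      refine ⟨c :: cs, List.replicate (j + 1) none ++ tapeOf ((e :: w) :: ws),
        ⟨by simp, h.cells, h.regs, fun _ => ⟨h0, _, rfl⟩, by simp, ?_, h.out⟩,
        fun W hW _ => hW, ?_, ?_⟩
      · have := h.inp
        simp only [hin, List.mem_cons, forall_eq_or_imp] at this ⊢
        exact ⟨⟨by simp, this.1.2.2⟩, this.2⟩
      · simp [h0, tapeOf, hin]; omega
      · simp only [tapeOf, hin, List.flatMap_cons, List.map_cons, List.cons_append]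
        refine (input_reaches hL (fun _ => rfl) hc j _ _).trans ?_
        refine .head (machine_step hL (a := some x) (by simpa using hx) (trans_fetch_last p q K x) _ _) ?_
        refine .head (machine_step hL (a := some e) (by simpa using hy) (trans_peek_some _ e) _ _) ?_
        exact rewind_home hL false (j + 1) c hc cs _
    · simp at ha
  | emit e =>
    obtain ⟨c, cs, rfl⟩ := List.exists_cons_of_ne_nil h.ne
    have hc : c < 2 ^ d := h.cells c (by simp)
    simp only [act] at ha
    split_ifs at ha with hin
    simp only [Option.some.injEq, Prod.mk.injEq] at ha
    obtain ⟨rfl, rfl⟩ := ha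
    obtain ⟨j, rfl⟩ := h.rest_out hin
    simp only [Prog.EmitsBelow] at he
    refine ⟨c :: cs, (s.out ++ [e]).map some ++ List.replicate (j - 1) none,
      ⟨by simp, h.cells, h.regs, fun h => absurd hin h, fun _ => ⟨_, rfl⟩, h.inp, ?_⟩,
      fun W hW _ => hW, ?_, ?_⟩
    · intro x hx
      simp only [List.mem_append, List.mem_singleton] at hx
      rcases hx with hx | rfl
      · exact h.out x hx
      · exact he
    · simp; omega
    · refine .head (machine_step hL (a := some c) (by simpa using hc) rfl _ _) ?_
      refine .head (machine_step hL (a := none) (by simp) rfl _ _) ?_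
      refine TransGen.trans_right (append_reaches hL j s.out h.out _) ?_
      refine .head (machine_step hL (a := none) (by simp) rfl _ _) ?_
      have h1 := unwind_reaches (d := d) hL s.out.reverse (by simpa using h.out)
        (some c :: (cs.map some ++ [none])) (some e :: List.replicate (j - 1) none)
      simp only [List.map_reverse, List.reverse_reverse] at h1
      refine TransGen.trans_right h1 ?_
      refine .single ?_
      have h2 := machine_step (d := d) hL (a := none) (by simp) (trans_unwind_none (.emit e :: K))
        (some c :: (cs.map some ++ [none]))
        (s.out.map some ++ some e :: List.replicate (j - 1) none)
      simpa [moved, home, within] using h2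

theorem path_reaches {V n : ℕ} {c c' : List Prog × St} (h : Path V n c c')
    (hb : P.bound ≤ d) (he : P.EmitsBelow (2 ^ d))
    (hc : c.1 ∈ states P) {cs : List ℕ} {rest : List Symbol} (hr : Rep d c.2 cs rest)
    {W : ℕ} (hV : V < 2 ^ W) (hW : cs.length ≤ W) :
    c'.1 ∈ states P ∧ ∃ cs' rest', Rep d c'.2 cs' rest' ∧ cs'.length ≤ W ∧
      rest'.length = max rest.length c'.2.out.length ∧
      Reaches (machine P d).step (home P c.1 cs rest) (home P c'.1 cs' rest') := by
  induction h generalizing cs rest with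
  | refl c =>
    have := hr.out_length_le
    exact ⟨hc, cs, rest, hr, hW, by omega, .refl⟩
  | @head n c c₁ c' hst _ hinc _ ih =>
    rcases c with ⟨_ | ⟨p, K⟩, s⟩
    · simp [step] at hst
    · simp only [step, Option.map_eq_some_iff, Prod.exists] at hst
      obtain ⟨b, u, hact, rfl⟩ := hst
      have hm : p :: K ∈ conts P [] := by simpa [states] using hc
      obtain ⟨cs₁, rest₁, h1, h2, h3, h4⟩ := act_reaches hc
        (conts_bound hm hb (by simp) p (by simp))
        (conts_emitsBelow hm he (by simp) p (by simp)) hact hr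
      have h5 : cont (p :: K) b ∈ states P := by
        rcases cont_mem_conts hm b with h | h <;> simp [states, h]
      obtain ⟨g1, cs', rest', g2, g3, g4, g5⟩ := ih h5 h1 (h2 W hW (fun r hr => by
        have := hinc r K (by simp [hr])
        dsimp only at this
        omega))
      have h6 := g2.out_length_le
      have h7 := h1.out_length_le
      refine ⟨g1, cs', rest', g2, g3, ?_, h4.to_reflTransGen.trans g5⟩
      rw [g4, h3]
      -- The output never shrinks, so the maxima taken along the path collapse to the last one.
      have : u.out.length ≤ c'.2.out.length := by
        have key : ∀ {m c c'}, Path V m c c' → c.2.out.length ≤ c'.2.out.length := by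
          intro m c c' h
          induction h with
          | refl => rfl
          | @head n c d e hst _ _ _ ih =>
            refine le_trans ?_ ih
            rcases c with ⟨_ | ⟨p, K⟩, s⟩
            · simp [step] at hst
            · simp only [step, Option.map_eq_some_iff, Prod.exists] at hst
              obtain ⟨b, u, hact, rfl⟩ := hst
              cases p <;> simp only [act] at hact <;> (try split at hact) <;>
                simp at hact <;> obtain ⟨-, rfl⟩ := hact <;> simp
        rename_i hp _
        exact key hp
      omega

/-! ### Complete computations of the machine -/

/-- The data at the beginning of the computation on given arguments. -/
def start (N : ℕ) (xs : List ℕ) : St := ⟨fun _ => 0, xs.map (word N), []⟩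

theorem word_ne_nil {N : ℕ} (x : ℕ) : word N x ≠ [] := by
  unfold word
  split_ifs with h
  · simp
  · simpa [Nat.digits_eq_nil_iff_eq_zero] using h

theorem word_lt {N : ℕ} (hN : 2 ≤ N) (x : ℕ) : ∀ a ∈ word N x, a < N := by
  unfold word
  split_ifs with h
  · simp; omega
  · exact fun a ha => Nat.digits_lt_base (by omega) ha

theorem ofDigits_word {N : ℕ} (x : ℕ) : Nat.ofDigits N (word N x) = x := by
  unfold word
  split_ifs with h
  · simp [h]
  · exact Nat.ofDigits_digits N x

theorem inputTape_eq (N : ℕ) (xs : List ℕ) : inputTape N xs = tapeOf (xs.map (word N)) := by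
  simp [inputTape, tapeOf, List.flatMap_map]

theorem inputTape_ne_nil {N : ℕ} {xs : List ℕ} (hx : xs ≠ []) : inputTape N xs ≠ [] := by
  obtain ⟨x, xs, rfl⟩ := List.exists_cons_of_ne_nil hx
  simp [inputTape]

theorem rep_start (hd : 0 < d) {xs : List ℕ} (hx : xs ≠ []) :
    Rep d (start (2 ^ d) xs) [0] (inputTape (2 ^ d) xs) where
  ne := by simp
  cells := by simp
  regs := by simp [val, start]
  rest_inp _ := ⟨rfl, 0, by simp [inputTape_eq, start]⟩
  rest_out h := by simp [start, hx] at h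
  inp := by
    have : 2 ≤ 2 ^ d := Nat.pow_le_pow_right (by norm_num : 0 < 2) hd
    simp only [start, List.mem_map]
    rintro _ ⟨x, -, rfl⟩
    exact ⟨word_ne_nil x, word_lt this x⟩
  out := by simp [start]

theorem start_reaches (hd : 0 < d) {xs : List ℕ} (hx : xs ≠ []) :
    Reaches (machine P d).step ((machine P d).init xs)
      (home P [P] [0] (inputTape (2 ^ d) xs)) := by
  have hP : [P] ∈ states P := by simp [states, self_mem_conts]
  have h2 : 2 ≤ 2 ^ d := Nat.pow_le_pow_right (by norm_num : 0 < 2) hd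
  obtain ⟨a, r, har⟩ := List.exists_cons_of_ne_nil (inputTape_ne_nil (N := 2 ^ d) hx)
  have ha : ∀ c ∈ a, c < 2 ^ d := by
    obtain ⟨x, xs, rfl⟩ := List.exists_cons_of_ne_nil hx
    obtain ⟨y, w, hw⟩ := List.exists_cons_of_ne_nil (word_ne_nil (N := 2 ^ d) x)
    simp only [inputTape, List.flatMap_cons, hw, List.map_cons, List.cons_append,
      List.cons.injEq] at har
    rw [← har.1]
    simpa using word_lt h2 x y (by simp [hw])
  simp only [Machine.init]
  change Reaches _ (Config.mk 0 [] ((inputTape (2 ^ d) xs).headD none) (inputTape (2 ^ d) xs).tail) _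
  rw [har, show ∀ l, Config.mk 0 l = Config.mk (num P [P] .init₁) l by rw [num_init]; simp]
  refine .head (machine_step hP ha rfl _ _) ?_
  refine .head (machine_step hP (a := none) (by simp) rfl _ _) ?_
  refine .head (machine_step hP (a := none) (by simp) rfl _ _) ?_
  have h4 : trans [P] .init₄ none = some (none, .right, [P], .go) := rfl
  exact .head (machine_step (d := d) hP (a := none) (by simp) h4 _ _) .refl

/-- Two moves bring the head across the separator to the output; behind it there are only blanks, so
exactly the output is read. The `2` in the size counts the two blanks that enclose the register
cells. -/
theorem finish_reaches {cs : List ℕ} {rest : List Symbol} {t : St} (hr : Rep d t cs rest)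
    (hin : t.inp = []) (hrest : rest ≠ []) :
    ∃ c, Reaches (machine P d).step (home P [] cs rest) c ∧ (machine P d).step c = none ∧
      c.output (2 ^ d) = Nat.ofDigits (2 ^ d) t.out ∧ c.size = cs.length + 2 + rest.length := by
  have hP : [] ∈ states P := by simp [states]
  obtain ⟨x, cs, rfl⟩ := List.exists_cons_of_ne_nil hr.ne
  obtain ⟨j, hj⟩ := hr.rest_out hin
  have hval : ∀ c ∈ rest.headD none, c < 2 ^ d := by
    rw [hj]
    have := hr.out
    cases ho : t.out with
    | nil => cases j <;> simp [List.replicate_succ]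
    | cons a l => rw [ho] at this; simpa using this a (by simp)
  have hgo : ∀ a, trans [] .go a = some (a, .right, [], .fin₁) := fun _ => rfl
  have hfin : ∀ a, trans [] .fin₁ a = some (a, .right, [], .fin₂) := fun _ => rfl
  refine ⟨_, ReflTransGen.head
      (machine_step hP (a := some x) (by simpa using hr.cells x (by simp)) (hgo _) _ _)
    (ReflTransGen.head (machine_step hP (a := none) (by simp) (hfin _) _ _) .refl),
    machine_halt _ hval _, ?_, ?_⟩
  · obtain ⟨a, r, rfl⟩ := List.exists_cons_of_ne_nil hrest
    simp only [moved, Config.output]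
    change Nat.ofDigits _ (((a :: r).takeWhile Option.isSome).reduceOption) = _
    rw [hj, List.takeWhile_append_of_pos (by simp)]
    cases j <;> simp [List.replicate_succ, List.reduceOption]
  · obtain ⟨a, r, rfl⟩ := List.exists_cons_of_ne_nil hrest
    simp [moved, Config.size]
    omega

/-- The machine simulates a halting run of the program. -/
theorem machine_final (hd : 0 < d) (hb : P.bound ≤ d) (he : P.EmitsBelow (2 ^ d)) {xs : List ℕ}
    (hx : xs ≠ []) {V : ℕ} {t : St} (h : Runs V P (start (2 ^ d) xs) t) (hin : t.inp = [])
    {W : ℕ} (hV : V < 2 ^ W) (hW : 0 < W) :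
    ∃ c ∈ (machine P d).final xs, c.output (2 ^ d) = Nat.ofDigits (2 ^ d) t.out ∧
      ∃ w ≤ W, (∀ r < d, t r < 2 ^ w) ∧
        c.size = w + 2 + max (inputTape (2 ^ d) xs).length t.out.length := by
  obtain ⟨n, h⟩ := h
  obtain ⟨-, cs', rest', h1, h2, h3, h4⟩ := path_reaches (d := d) (h.path []) hb he
    (by simp [states, self_mem_conts]) (rep_start hd hx) hV (by simp; omega)
  dsimp only at h1 h3 h4
  have hrest : rest' ≠ [] := by
    have := List.length_pos_of_ne_nil (inputTape_ne_nil (N := 2 ^ d) hx)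
    rintro rfl
    simp only [List.length_nil] at h3
    omega
  obtain ⟨c, g1, g2, g3, g4⟩ := finish_reaches (P := P) h1 hin hrest
  refine ⟨c, mem_eval.2 ⟨((start_reaches hd hx).trans h4).trans g1, g2⟩, g3, cs'.length, h2,
    fun r hr => ?_, by rw [g4, h3]⟩
  rw [← h1.regs r hr]
  exact val_lt r cs'

/-- A set of configurations from which one always comes back to the set is never left. -/
theorem not_dom_of_forall {σ : Type*} {f : σ → Option σ} (X : σ → Prop)
    (hX : ∀ c, X c → ∃ c', X c' ∧ Reaches₁ f c c') {c : σ} (hc : X c) : ¬ (eval f c).Dom := by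
  -- A step function on the subtype that is nowhere `none` cannot halt, and each of its steps is
  -- simulated by at least one step of `f`.
  let f₁ : {c // X c} → Option {c // X c} := fun c =>
    some ⟨(hX c.1 c.2).choose, (hX c.1 c.2).choose_spec.1⟩
  have hR : Respects f₁ f fun a b => a.1 = b := by
    rintro a _ rfl
    exact ⟨_, rfl, (hX a.1 a.2).choose_spec.2⟩
  rw [tr_eval_dom hR (a₁ := ⟨c, hc⟩) rfl]
  intro h
  have := (mem_eval.1 (Part.get_mem h)).2
  simp [f₁] at this

/-- The machine does not halt when a pure part of the program does not halt. -/
theorem machine_not_dom (hd : 0 < d) {p q r : Prog} (hP : P = .seq p (.seq q r))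
    (hb : P.bound ≤ d) (he : P.EmitsBelow (2 ^ d)) {xs : List ℕ} (hx : xs ≠ [])
    {V : ℕ} {t : St} (h : Runs V p (start (2 ^ d) xs) t) (hq : q.Pure)
    (hdiv : ∀ V' u, ¬ Runs V' q t u) : ¬ ((machine P d).final xs).Dom := by
  obtain ⟨n, h⟩ := h
  have hp : Path V (1 + n + 1) ([P], start (2 ^ d) xs) (q :: [r], t) := by
    subst hP
    refine Path.trans (Path.trans (d := (p :: [.seq q r], start (2 ^ d) xs)) ?_ (h.path _)) ?_
    · exact .single rfl (by intro h; exact h) (by simp)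
    · exact .single rfl (by intro h; exact h) (by simp)
  obtain ⟨h0, cs', rest', h1, h2, h3, h4⟩ := path_reaches (d := d) hp hb he
    (by simp [states, self_mem_conts]) (rep_start hd hx)
    (W := V + 1) (lt_of_lt_of_le Nat.lt_two_pow_self (Nat.pow_le_pow_right (by norm_num) (by omega)))
    (by simp)
  rw [Machine.final, reaches_eval ((start_reaches hd hx).trans h4)]
  -- The invariant: what is left of `q` is a pure list `L` in front of `r` whose execution does not
  -- terminate. A pure instruction never blocks, and by `RunList.of_step` one step preserves the
  -- invariant.
  refine not_dom_of_forall (fun c => ∃ L s cs rest, (∀ p ∈ L, p.Pure) ∧ ¬ RunList L s ∧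
    L ++ [r] ∈ states P ∧ Rep d s cs rest ∧ c = home P (L ++ [r]) cs rest) ?_
    ⟨[q], t, cs', rest', by simpa using hq, ?_, h0, h1, rfl⟩
  · rintro _ ⟨L, s, cs, rest, hL, hrun, hst, hr, rfl⟩
    rcases L with _ | ⟨p, K⟩
    · exact absurd (.nil s) hrun
    · obtain ⟨b, u, ha⟩ := act_isSome (hL p (by simp)) s
      have hm : p :: (K ++ [r]) ∈ conts P [] := by simpa [states] using hst
      obtain ⟨cs₁, rest₁, g1, -, -, g4⟩ := act_reaches (K := K ++ [r]) hst
        (conts_bound hm hb (by simp) p (by simp))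
        (conts_emitsBelow hm he (by simp) p (by simp)) ha hr
      have hc : cont (p :: (K ++ [r])) b = cont (p :: K) b ++ [r] := by
        cases p <;> cases b <;> rfl
      refine ⟨_, ⟨cont (p :: K) b, u, cs₁, rest₁, cont_pure hL b, ?_, ?_, g1, rfl⟩, ?_⟩
      · exact fun h => hrun (.of_step (hL p (by simp)) ha h)
      · rw [← hc]
        rcases cont_mem_conts hm b with h | h <;> simp [states, h]
      · rw [← hc]
        exact g4
  · rintro (_ | ⟨h, -⟩)
    exact hdiv _ _ ⟨_, h⟩

end

/-! ### Basic programs. Register `0` is a scratch register and holds `0` between them. -/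

theorem St.eq_of_regs {s t : St} (hi : s.inp = t.inp) (ho : s.out = t.out)
    (h : ∀ r, s r = t r) : s = t := St.ext_regs h hi ho

/-- `f k` is the state when the counter stands at `k`. Naming these states explicitly reduces a loop
to a single turn. -/
theorem Runs.loop_iter {V r p} (f : ℕ → St) (hr : ∀ k, f k r = k)
    (n : ℕ) (h : ∀ k < n, Runs V p ((f (k + 1)).set r k) (f k)) :
    Runs V (.loop r p) (f n) (f 0) := by
  induction n with
  | zero => exact .loop_zero (hr 0)
  | succ n ih =>
    refine .loop_pos (by simp [hr]) ?_ (ih fun k hk => h k (by omega))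
    have := h n (by omega)
    rwa [hr, Nat.add_sub_cancel]

/-- Set a register to `0`. -/
def clr (r : ℕ) : Prog := .loop r .skip

theorem runs_clr (V r : ℕ) (s : St) : Runs V (clr r) s (s.set r 0) := by
  have := Runs.loop_iter (V := V) (r := r) (p := .skip) (fun k => s.set r k) (by simp) (s r)
    (fun k _ => by simpa using Runs.skip V _)
  simpa [clr] using this

/-- Move the content of register `a` to register `b`, where it is added. -/
def move (a b : ℕ) : Prog := .loop a (.inc b)

theorem runs_move {V a b : ℕ} {s : St} (hab : a ≠ b) (hV : s b + s a ≤ V) :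
    Runs V (move a b) s ((s.set a 0).set b (s b + s a)) := by
  have := Runs.loop_iter (V := V) (r := a) (p := .inc b)
    (fun k => (s.set a k).set b (s b + (s a - k))) (by simp [St.set_apply, hab]) (s a)
    (fun k hk => by
      have h1 : (((s.set a (k + 1)).set b (s b + (s a - (k + 1)))).set a k) b + 1 =
          s b + (s a - k) := by simp only [St.set_apply]; grind
      have := Runs.inc (V := V) (s := ((s.set a (k + 1)).set b (s b + (s a - (k + 1)))).set a k)
        (r := b) (by omega)
      rw [h1] at this
      convert this using 1
      refine St.eq_of_regs rfl rfl fun i => ?_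
      simp only [St.set_apply]
      grind)
  unfold move
  convert this using 1
  · exact St.eq_of_regs rfl rfl fun i => by grind [St.set_apply]
  · rw [Nat.sub_zero]

/-- Add register `a` to register `b`. -/
def addTo (a b : ℕ) : Prog := .seq (.loop a (.seq (.inc b) (.inc 0))) (move 0 a)

theorem runs_addTo {V a b : ℕ} {s : St} (ha : a ≠ 0) (hb : b ≠ 0) (hab : a ≠ b) (h0 : s 0 = 0)
    (hV : s b + s a ≤ V) : Runs V (addTo a b) s (s.set b (s b + s a)) := by
  have h1 := Runs.loop_iter (V := V) (r := a) (p := .seq (.inc b) (.inc 0))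
    (fun k => ((s.set a k).set b (s b + (s a - k))).set 0 (s a - k))
    (by simp [St.set_apply, hab, ha]) (s a)
    (fun k hk => by
      refine .seq (Runs.inc ?_) ?_
      · simp only [St.set_apply]; grind
      · convert Runs.inc (V := V) (r := 0) ?_ using 1
        · exact St.eq_of_regs rfl rfl fun i => by simp only [St.set_apply]; grind
        · simp only [St.set_apply]; grind)
  refine .seq (t := ((s.set a 0).set b (s b + s a)).set 0 (s a)) ?_ ?_
  · simp only [Nat.sub_self, Nat.sub_zero] at h1
    convert h1 using 1
    exact St.eq_of_regs rfl rfl fun i => by simp only [St.set_apply]; grind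
  · convert runs_move (V := V) ha.symm ?_ using 1
    · exact St.eq_of_regs rfl rfl fun i => by simp only [St.set_apply]; grind
    · simp only [St.set_apply]; grind

/-- Copy register `a` to register `b`. -/
def copy (a b : ℕ) : Prog := .seq (clr b) (addTo a b)

theorem runs_copy {V a b : ℕ} {s : St} (ha : a ≠ 0) (hb : b ≠ 0) (hab : a ≠ b) (h0 : s 0 = 0)
    (hV : s a ≤ V) : Runs V (copy a b) s (s.set b (s a)) := by
  have h1 : (s.set b 0) a = s a := by simp [St.set_apply, hab]
  have := runs_addTo (V := V) (s := s.set b 0) ha hb hab (by simp [St.set_apply, hb.symm, h0])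
    (by simp [h1, hV])
  rw [h1] at this
  simp only [St.set_same, zero_add, St.set_set] at this
  exact .seq (runs_clr V b s) this

/-- Branch on a register without changing it. -/
def ifnz (r : ℕ) (p q : Prog) : Prog := .cond r (.seq (.inc r) p) q

theorem runs_ifnz_pos {V r p q} {s t : St} (h : s r ≠ 0) (hV : s r ≤ V) (hp : Runs V p s t) :
    Runs V (ifnz r p q) s t := by
  have h1 : (s.set r (s r - 1)) r + 1 = s r := by simp; omega
  have h2 := Runs.inc (V := V) (s := s.set r (s r - 1)) (r := r) (by omega)
  rw [h1] at h2
  simp only [St.set_set, St.set_self] at h2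
  exact .cond_pos h (.seq h2 hp)

theorem runs_ifnz_zero {V r p q} {s t : St} (h : s r = 0) (hq : Runs V q s t) :
    Runs V (ifnz r p q) s t := .cond_zero h hq

/-- Repeat `p` as long as register `r` is not zero. -/
def while_ (r : ℕ) (p : Prog) : Prog := .loop r (.seq (.inc r) p)

theorem runs_while_pos {V r p} {s t u : St} (h : s r ≠ 0) (hV : s r ≤ V) (hp : Runs V p s t)
    (hw : Runs V (while_ r p) t u) : Runs V (while_ r p) s u := by
  have h1 : (s.set r (s r - 1)) r + 1 = s r := by simp; omega
  have h2 := Runs.inc (V := V) (s := s.set r (s r - 1)) (r := r) (by omega)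
  rw [h1] at h2
  simp only [St.set_set, St.set_self] at h2
  exact .loop_pos h (.seq h2 hp) hw

/-- Add a constant to a register. -/
def addConst (r : ℕ) : ℕ → Prog
  | 0 => .skip
  | c + 1 => .seq (addConst r c) (.inc r)

theorem runs_addConst {V r : ℕ} {s : St} (c : ℕ) (hV : s r + c ≤ V) :
    Runs V (addConst r c) s (s.set r (s r + c)) := by
  induction c with
  | zero => simpa [addConst] using Runs.skip V s
  | succ c ih =>
    refine .seq (ih (by omega)) ?_
    have := Runs.inc (V := V) (s := s.set r (s r + c)) (r := r) (by simp; omega)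
    simpa [add_assoc] using this

/-- Replace the content `v` of register `l` by `v * B + h`, where `B` and `h` are the contents of
registers `b` and `h`, and `t` is a temporary register. -/
def push (l b h t : ℕ) : Prog := .seq (move l t) (.seq (addTo h l) (.loop t (addTo b l)))

theorem runs_push {V l b h t : ℕ} {s : St} (hl : l ≠ 0) (hb : b ≠ 0) (hh : h ≠ 0) (ht : t ≠ 0)
    (hlb : l ≠ b) (hlh : l ≠ h) (hlt : l ≠ t) (hbt : b ≠ t) (hht : h ≠ t)
    (h0 : s 0 = 0) (ht0 : s t = 0) (hbpos : s b ≠ 0) (hV : s l * s b + s h ≤ V) :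
    Runs V (push l b h t) s (s.set l (s l * s b + s h)) := by
  -- Moving the old content aside takes no more room than the result; this is where the multiplier
  -- must not be zero.
  have hle : s l ≤ s l * s b := Nat.le_mul_of_pos_right _ (by omega)
  refine .seq (t := (s.set l 0).set t (s l)) ?_ (.seq (t := (s.set l (s h)).set t (s l)) ?_ ?_)
  · have := runs_move (V := V) (s := s) hlt (by omega)
    rwa [ht0, zero_add] at this
  · convert runs_addTo (V := V) hh hl hlh.symm ?_ ?_ using 1
    · exact St.eq_of_regs rfl rfl fun i => by simp only [St.set_apply]; grind
    · simp only [St.set_apply]; grind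
    · simp only [St.set_apply]; grind
  · have h1 := Runs.loop_iter (V := V) (r := t) (p := addTo b l)
      (fun k => (s.set t k).set l ((s l - k) * s b + s h))
      (by simp [St.set_apply, hlt.symm]) (s l)
      (fun k hk => by
        have e : s l - k = (s l - (k + 1)) + 1 := by omega
        have hm : (s l - k) * s b ≤ s l * s b := Nat.mul_le_mul_right _ (by omega)
        have hm' : (s l - k) * s b = (s l - (k + 1)) * s b + s b := by rw [e]; ring
        convert runs_addTo (V := V) hb hl hlb.symm ?_ ?_ using 1
        · refine St.eq_of_regs rfl rfl fun i => ?_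
          simp only [St.set_apply]; grind
        · simp only [St.set_apply]; grind
        · simp only [St.set_apply, hlb.symm, hbt, if_true, if_false]
          grind)
    convert h1 using 1
    · exact St.eq_of_regs rfl rfl fun i => by simp only [St.set_apply]; grind
    · refine St.eq_of_regs rfl rfl fun i => ?_
      simp only [St.set_apply, Nat.sub_zero]; grind

/-- Divide the content of register `y` by the content of register `b`, with remainder in
register `h` and temporary registers `t` and `c`. -/
def divmod (y b h t c : ℕ) : Prog :=
  .seq (move y t) (.seq (clr h) (.seq (addTo b c) (.seq
    (.loop t (.seq (.inc h) (.cond c (ifnz c .skip (.seq (.inc y) (.seq (clr h) (addTo b c))))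
      .skip)))
    (clr c))))

/-- While `t` counts the dividend down, `h`, `c` and `y` follow `j % b`, `b - j % b` and `j / b` for
the part `j` counted so far. That `c` arrives at `0` is the signal for a carry into the quotient. -/
theorem runs_divmod {V y b h t c : ℕ} {s : St} (hd : [0, y, b, h, t, c].Nodup)
    (h0 : s 0 = 0) (ht0 : s t = 0) (hc0 : s c = 0) (hbpos : s b ≠ 0) (hV : s y ≤ V)
    (hV' : s b ≤ V) :
    Runs V (divmod y b h t c) s ((s.set h (s y % s b)).set y (s y / s b)) := by
  simp only [List.nodup_cons, List.mem_cons, List.not_mem_nil, or_false, not_or,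
    List.nodup_nil, and_true, not_false_eq_true] at hd
  have hmod : ∀ j, j % s b < s b := fun j => Nat.mod_lt _ (by omega)
  refine .seq (t := (s.set y 0).set t (s y)) ?_
    (.seq (t := ((s.set y 0).set t (s y)).set h 0) (runs_clr _ _ _)
    (.seq (t := (((s.set y 0).set t (s y)).set h 0).set c (s b)) ?_
    (.seq (t := ((s.set h (s y % s b)).set y (s y / s b)).set c (s b - s y % s b)) ?_ ?_)))
  · have := runs_move (V := V) (s := s) (a := y) (b := t) (by grind) (by omega)
    rwa [ht0, zero_add] at this
  · convert runs_addTo (V := V) (a := b) (b := c) ?_ ?_ ?_ ?_ ?_ using 1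
    · exact St.eq_of_regs rfl rfl fun i => by simp only [St.set_apply]; grind
    all_goals (try simp only [St.set_apply]); grind
  · have h1 := Runs.loop_iter (V := V) (r := t)
      (p := .seq (.inc h) (.cond c (ifnz c .skip (.seq (.inc y) (.seq (clr h) (addTo b c))))
        .skip))
      (fun k => (((s.set t k).set h ((s y - k) % s b)).set y ((s y - k) / s b)).set c
        (s b - (s y - k) % s b))
      (by simp [St.set_apply]; grind) (s y)
      (fun k hk => by
        obtain ⟨j, hj⟩ : ∃ j, s y - (k + 1) = j := ⟨_, rfl⟩
        have hj' : s y - k = j + 1 := by omega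
        rw [hj, hj']
        have hm := hmod j
        have hdj : j / s b ≤ j := Nat.div_le_self _ _
        refine .seq (t := (((s.set t k).set h (j % s b + 1)).set y (j / s b)).set c
          (s b - j % s b)) ?_ (.cond_pos (by simp; omega) ?_)
        · convert Runs.inc (V := V) (r := h) ?_ using 1
          · exact St.eq_of_regs rfl rfl fun i => by simp only [St.set_apply]; grind
          · simp only [St.set_apply]; grind
        · by_cases hlast : j % s b + 1 = s b
          · obtain ⟨e2, e1⟩ : (j + 1) / s b = j / s b + 1 ∧ (j + 1) % s b = 0 := by
              rw [Nat.div_mod_unique (by omega)]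
              have := Nat.div_add_mod j (s b)
              exact ⟨by rw [mul_add]; omega, by omega⟩
            refine runs_ifnz_zero (by simp; omega) ?_
            refine .seq (t := (((s.set t k).set h (j % s b + 1)).set y (j / s b + 1)).set c 0)
              ?_ (.seq (t := (((s.set t k).set h 0).set y (j / s b + 1)).set c 0) ?_ ?_)
            · convert Runs.inc (V := V) (r := y) ?_ using 1
              · exact St.eq_of_regs rfl rfl fun i => by simp only [St.set_apply]; grind
              · simp only [St.set_apply]; grind
            · convert runs_clr V h _ using 1
              exact St.eq_of_regs rfl rfl fun i => by simp only [St.set_apply]; grind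
            · rw [e1, e2]
              convert runs_addTo (V := V) (a := b) (b := c) ?_ ?_ ?_ ?_ ?_ using 1
              · exact St.eq_of_regs rfl rfl fun i => by simp only [St.set_apply]; grind
              all_goals (try simp only [St.set_apply]); grind
          · obtain ⟨e2, e1⟩ : (j + 1) / s b = j / s b ∧ (j + 1) % s b = j % s b + 1 := by
              rw [Nat.div_mod_unique (by omega)]
              have := Nat.div_add_mod j (s b)
              omega
            refine runs_ifnz_pos (by simp; omega) (by simp; omega) ?_
            rw [e1, e2]
            convert Runs.skip V _ using 1
            exact St.eq_of_regs rfl rfl fun i => by simp only [St.set_apply]; grind)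
    simp only [Nat.sub_self, Nat.zero_mod, Nat.zero_div, Nat.sub_zero] at h1
    convert h1 using 1
    · exact St.eq_of_regs rfl rfl fun i => by simp only [St.set_apply]; grind
    · exact St.eq_of_regs rfl rfl fun i => by simp only [St.set_apply]; grind
  · convert runs_clr V c _ using 1
    exact St.eq_of_regs rfl rfl fun i => by simp only [St.set_apply]; grind

/-! ### Every total computable function is computed by a pure program -/

/-- For every position `b ≥ 1` of its arguments, some pure program computes the function `f`: it
puts the value behind the arguments and preserves all registers before the value. -/
def Computes {n : ℕ} (f : List.Vector ℕ n →. ℕ) : Prop :=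
  ∀ b, 0 < b → ∃ p : Prog, p.Pure ∧ ∀ v, ∀ y ∈ f v, ∃ V₀, ∀ V, V₀ ≤ V → ∀ s : St,
    s 0 = 0 → (∀ r, s r ≤ V) → (∀ i : Fin n, s (b + i) = v.get i) →
    ∃ t, Runs V p s t ∧ t (b + n) = y ∧ ∀ r < b + n, t r = s r

@[simp] theorem pure_clr (r : ℕ) : (clr r).Pure := trivial
@[simp] theorem pure_move (a b : ℕ) : (move a b).Pure := trivial
@[simp] theorem pure_addTo (a b : ℕ) : (addTo a b).Pure := by simp [addTo, move, Prog.Pure]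
@[simp] theorem pure_copy (a b : ℕ) : (copy a b).Pure := by
  simp [copy, Prog.Pure]
@[simp] theorem pure_seq (p q : Prog) : (Prog.seq p q).Pure ↔ p.Pure ∧ q.Pure := Iff.rfl
@[simp] theorem pure_cond (r : ℕ) (p q : Prog) : (Prog.cond r p q).Pure ↔ p.Pure ∧ q.Pure := Iff.rfl
@[simp] theorem pure_ifnz (r : ℕ) (p q : Prog) : (ifnz r p q).Pure ↔ p.Pure ∧ q.Pure := by
  simp [ifnz, Prog.Pure]
@[simp] theorem pure_loop (r : ℕ) (p : Prog) : (Prog.loop r p).Pure ↔ p.Pure := Iff.rfl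
@[simp] theorem pure_while (r : ℕ) (p : Prog) : (while_ r p).Pure ↔ p.Pure := by
  simp [while_, Prog.Pure]
@[simp] theorem pure_inc (r : ℕ) : (Prog.inc r).Pure := trivial
@[simp] theorem pure_skip : Prog.skip.Pure := trivial
@[simp] theorem pure_addConst (r c : ℕ) : (addConst r c).Pure := by
  induction c <;> simp_all [addConst]

/-- Copy `n` consecutive registers. -/
def copyBlock (a b : ℕ) : ℕ → Prog
  | 0 => .skip
  | n + 1 => .seq (copyBlock a b n) (copy (a + n) (b + n))

@[simp] theorem pure_copyBlock (a b n : ℕ) : (copyBlock a b n).Pure := by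
  induction n <;> simp_all [copyBlock]

theorem runs_copyBlock {V a b n : ℕ} {s : St} (ha : 0 < a) (hab : a + n ≤ b) (h0 : s 0 = 0)
    (hV : ∀ r, s r ≤ V) :
    ∃ t, Runs V (copyBlock a b n) s t ∧ (∀ i < n, t (b + i) = s (a + i)) ∧
      (∀ r, (r < b ∨ b + n ≤ r) → t r = s r) := by
  induction n with
  | zero => exact ⟨s, .skip V s, by simp, by simp⟩
  | succ n ih =>
    obtain ⟨t, h1, h2, h3⟩ := ih (by omega)
    have e : t (a + n) = s (a + n) := h3 _ (by omega)
    refine ⟨t.set (b + n) (t (a + n)), .seq h1 (runs_copy (by omega) (by omega) (by omega)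
      (by rw [h3 _ (by omega), h0]) (by rw [e]; exact hV _)), fun i hi => ?_, fun r hr => ?_⟩
    · rw [St.set_apply]
      split_ifs with h
      · have : i = n := by omega
        rw [e, this]
      · exact h2 i (by omega)
    · rw [St.set_apply, if_neg (by omega)]
      exact h3 r (by omega)

theorem computes_zero : Computes (n := 0) fun _ => Part.some 0 := by
  intro b hb
  refine ⟨clr b, by simp, fun v y hy => ⟨0, fun V _ s _ _ _ => ⟨_, runs_clr V b s, ?_, ?_⟩⟩⟩
  · simpa using (Part.mem_some_iff.1 hy).symm
  · intro r hr
    rw [St.set_apply, if_neg (by simp at hr; omega)]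

theorem computes_get {n : ℕ} (i : Fin n) : Computes fun v => Part.some (v.get i) := by
  intro b hb
  refine ⟨copy (b + i) (b + n), by simp, fun v y hy => ⟨0, fun V _ s h0 hV hv =>
    ⟨_, runs_copy (by omega) (by omega) (by omega) h0 (hV _), ?_, ?_⟩⟩⟩
  · rw [St.set_same, hv, Part.mem_some_iff.1 hy]
  · intro r hr
    rw [St.set_apply, if_neg (by omega)]

theorem computes_succ : Computes (n := 1) fun v => Part.some v.head.succ := by
  intro b hb
  refine ⟨.seq (copy b (b + 1)) (.inc (b + 1)), by simp, fun v y hy =>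
    ⟨v.head + 1, fun V hVy s h0 hV hv => ⟨_, .seq (runs_copy (by omega) (by omega) (by omega) h0
      (hV _)) (.inc ?_), ?_, ?_⟩⟩⟩
  all_goals
    have hb : s b = v.head := by simpa using hv 0
  · simpa [hb] using hVy
  · simp [hb, Part.mem_some_iff.1 hy]
  · intro r hr
    simp only [St.set_apply]
    rw [if_neg (by omega), if_neg (by omega)]

/-- Evaluate several functions at the same arguments. -/
theorem computes_list {m : ℕ} {n : ℕ} (g : Fin n → List.Vector ℕ m →. ℕ)
    (hg : ∀ i, Computes (g i)) (a b k : ℕ) (ha : 0 < a) (hb : a + m ≤ b) (hk : k ≤ n) :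
    ∃ p : Prog, p.Pure ∧ ∀ v : List.Vector ℕ m, ∀ y : Fin n → ℕ, (∀ i, y i ∈ g i v) →
      ∃ V₀, ∀ V, V₀ ≤ V → ∀ s : St, s 0 = 0 → (∀ r, s r ≤ V) →
        (∀ i : Fin m, s (a + i) = v.get i) →
        ∃ t, Runs V p s t ∧ (∀ i : Fin n, i < k → t (b + i) = y i) ∧ ∀ r < b, t r = s r := by
  induction k with
  | zero => exact ⟨.skip, by simp, fun v y hy => ⟨0, fun V _ s _ _ _ => ⟨s, .skip V s, by simp, by simp⟩⟩⟩
  | succ k ih =>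
    obtain ⟨p, hp, hp'⟩ := ih (by omega)
    -- Each function works in the area behind the `n` registers reserved for the values, on its own
    -- copy of the arguments.
    obtain ⟨q, hq, hq'⟩ := hg ⟨k, hk⟩ (b + n) (by omega)
    refine ⟨.seq p (.seq (copyBlock a (b + n) m) (.seq q (copy (b + n + m) (b + k)))), by simp [hp, hq],
      fun v y hy => ?_⟩
    obtain ⟨V₁, h1⟩ := hp' v y hy
    obtain ⟨V₂, h2⟩ := hq' v _ (hy ⟨k, hk⟩)
    refine ⟨max V₁ V₂, fun V hVm s h0 hV hv => ?_⟩
    obtain ⟨t₁, r₁, f₁, g₁⟩ := h1 V (by omega) s h0 hV hv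
    have hV₁ := r₁.le hV
    obtain ⟨t₂, r₂, f₂, g₂⟩ := runs_copyBlock (V := V) (a := a) (b := b + n) (n := m) (s := t₁) ha
      (by omega) (by rw [g₁ 0 (by omega), h0]) hV₁
    have hV₂ := r₂.le hV₁
    obtain ⟨t₃, r₃, f₃, g₃⟩ := h2 V (by omega) t₂ (by rw [g₂ 0 (by omega), g₁ 0 (by omega), h0]) hV₂
      (fun i => by rw [f₂ i i.2, g₁ _ (by omega), hv])
    have hV₃ := r₃.le hV₂
    refine ⟨_, .seq r₁ (.seq r₂ (.seq r₃ (runs_copy (by omega) (by omega) (by omega) ?_ (hV₃ _)))),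
      fun i hi => ?_, fun r hr => ?_⟩
    · rw [g₃ 0 (by omega), g₂ 0 (by omega), g₁ 0 (by omega), h0]
    · rw [St.set_apply]
      split_ifs with h
      · have : i = ⟨k, hk⟩ := Fin.ext (by simp; omega)
        rw [f₃, this]
      · rw [g₃ _ (by omega), g₂ _ (by omega), f₁ i (by omega)]
    · rw [St.set_apply, if_neg (by omega), g₃ _ (by omega), g₂ _ (by omega), g₁ _ hr]

theorem computes_comp {m n : ℕ} {f : List.Vector ℕ n →. ℕ} (g : Fin n → List.Vector ℕ m →. ℕ)
    (hf : Computes f) (hg : ∀ i, Computes (g i)) {F : List.Vector ℕ m →. ℕ}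
    (hF : ∀ v, ∀ z ∈ F v, ∃ y : Fin n → ℕ, (∀ i, y i ∈ g i v) ∧ z ∈ f (List.Vector.ofFn y)) :
    Computes F := by
  intro b hb
  obtain ⟨p, hp, hp'⟩ := computes_list g hg b (b + m + 1) n hb (by omega) le_rfl
  obtain ⟨q, hq, hq'⟩ := hf (b + m + 1) (by omega)
  refine ⟨.seq p (.seq q (copy (b + m + 1 + n) (b + m))), by simp [hp, hq], fun v z hz => ?_⟩
  obtain ⟨y, hy, hz⟩ := hF v z hz
  obtain ⟨V₁, h1⟩ := hp' v y hy
  obtain ⟨V₂, h2⟩ := hq' _ z hz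
  refine ⟨max V₁ V₂, fun V hVm s h0 hV hv => ?_⟩
  obtain ⟨t₁, r₁, f₁, g₁⟩ := h1 V (by omega) s h0 hV hv
  have hV₁ := r₁.le hV
  obtain ⟨t₂, r₂, f₂, g₂⟩ := h2 V (by omega) t₁ (by rw [g₁ 0 (by omega), h0]) hV₁
    (fun i => by rw [f₁ i i.2, List.Vector.get_ofFn])
  refine ⟨_, .seq r₁ (.seq r₂ (runs_copy (by omega) (by omega) (by omega) ?_ (r₂.le hV₁ _))), ?_,
    fun r hr => ?_⟩
  · rw [g₂ 0 (by omega), g₁ 0 (by omega), h0]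
  · rw [St.set_same, f₂]
  · rw [St.set_apply, if_neg (by omega), g₂ _ (by omega), g₁ _ (by omega)]

/-- Layout: the value of the recursion so far is in `b + n + 1`, the number of turns left in `b + n
+ 2`, the recursion index in `b + n + 3`, and the area from `c` on is lent to `f` and `g`. -/
theorem computes_prec {n : ℕ} {f : List.Vector ℕ n → ℕ} {g : List.Vector ℕ (n + 2) → ℕ}
    (hf : Computes fun v => Part.some (f v)) (hg : Computes fun v => Part.some (g v)) :
    Computes fun v : List.Vector ℕ (n + 1) => Part.some
      (v.head.rec (f v.tail) fun y IH => g (y ::ᵥ IH ::ᵥ v.tail)) := by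
  intro b hb
  obtain ⟨c, hc⟩ : ∃ c, c = b + n + 4 := ⟨_, rfl⟩
  obtain ⟨p, hp, hp'⟩ := hf c (by omega)
  obtain ⟨q, hq, hq'⟩ := hg c (by omega)
  refine ⟨.seq (copy b (b + n + 2)) (.seq (clr (b + n + 3)) (.seq (copyBlock (b + 1) c n)
    (.seq p (.seq (copy (c + n) (b + n + 1)) (.loop (b + n + 2)
      (.seq (copy (b + n + 3) c) (.seq (copy (b + n + 1) (c + 1))
        (.seq (copyBlock (b + 1) (c + 2) n) (.seq q (.seq (copy (c + (n + 2)) (b + n + 1))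
          (.inc (b + n + 3)))))))))))), by simp [hp, hq], fun v z hz => ?_⟩
  rw [Part.mem_some_iff] at hz
  obtain ⟨V₁, h1⟩ := hp' v.tail _ (Part.mem_some _)
  set F : ℕ → ℕ := fun k => Nat.rec (f v.tail) (fun y IH => g (y ::ᵥ IH ::ᵥ v.tail)) k with hF
  have h2 := fun k => hq' (k ::ᵥ F k ::ᵥ v.tail) _ (Part.mem_some _)
  choose W hW using h2
  -- One bound for all turns: the sum dominates the bound of each call of `g`.
  refine ⟨max V₁ (max v.head (∑ k ∈ Finset.range v.head, W k)), fun V hVm s h0 hV hv => ?_⟩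
  simp only [max_le_iff] at hVm
  have hs0 : s b = v.head := by simpa using hv 0
  have hs1 : ∀ i, (hi : i < n) → s (b + 1 + i) = v.tail.get ⟨i, hi⟩ := by
    intro i hi
    have := hv (Fin.succ ⟨i, hi⟩)
    rw [List.Vector.get_tail_succ] 
    simpa [add_assoc, add_comm 1] using this
  have k1 := runs_copy (V := V) (a := b) (b := b + n + 2) (s := s) (by omega) (by omega) (by omega)
    h0 (hV _)
  set s₁ := s.set (b + n + 2) (s b) with hs₁
  have k2 := runs_clr V (b + n + 3) s₁
  set s₂ := s₁.set (b + n + 3) 0 with hs₂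
  have e2 : ∀ r, r < b + n + 2 → s₂ r = s r := by
    intro r hr; simp only [hs₂, hs₁, St.set_apply]; grind
  have hV₂ := k2.le (k1.le hV)
  obtain ⟨s₃, k3, f3, g3⟩ := runs_copyBlock (V := V) (a := b + 1) (b := c) (n := n) (s := s₂)
    (by omega) (by omega) (by rw [e2 0 (by omega), h0]) hV₂
  have hV₃ := k3.le hV₂
  obtain ⟨s₄, k4, f4, g4⟩ := h1 V (by omega) s₃ (by rw [g3 0 (by omega), e2 0 (by omega), h0]) hV₃
    (fun i => (f3 i i.2).trans ((e2 _ (by omega)).trans (hs1 i i.2)))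
  have hV₄ := k4.le hV₃
  have k5 := runs_copy (V := V) (a := c + n) (b := b + n + 1) (s := s₄) (by omega) (by omega)
    (by omega) (by rw [g4 0 (by omega), g3 0 (by omega), e2 0 (by omega), h0]) (hV₄ _)
  set s₅ := s₄.set (b + n + 1) (s₄ (c + n)) with hs₅
  have hV₅ := k5.le hV₄
  refine Exists.elim (Runs.loop_count (V := V) (r := b + n + 2)
    (p := (.seq (copy (b + n + 3) c) (.seq (copy (b + n + 1) (c + 1))
        (.seq (copyBlock (b + 1) (c + 2) n) (.seq q (.seq (copy (c + (n + 2)) (b + n + 1))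
          (.inc (b + n + 3))))))))
    (fun k s' => k ≤ v.head ∧ (∀ r, s' r ≤ V) ∧ (∀ r < b + n + 1, s' r = s r) ∧ s' (b + n + 2) = k ∧
      s' (b + n + 3) = v.head - k ∧ s' (b + n + 1) = F (v.head - k))
    (fun k s' h => h.2.2.2.1) ?_ v.head s₅ ?_) fun t ⟨k6, h6⟩ => ?_
  · rintro k s' ⟨i1, i2, i3, i4, i5, i6⟩
    obtain ⟨j, hj⟩ : ∃ j, v.head - (k + 1) = j := ⟨_, rfl⟩
    have hj' : v.head - k = j + 1 := by omega
    rw [hj] at i5 i6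
    have hWV : W j ≤ V := by
      refine le_trans ?_ hVm.2.2
      exact Finset.single_le_sum (f := W) (fun _ _ => Nat.zero_le _) (Finset.mem_range.2 (by omega))
    set u₀ := s'.set (b + n + 2) k with hu₀
    have b0 : ∀ r, u₀ r ≤ V := by
      intro r; simp only [hu₀, St.set_apply]
      have := i2 r; have := i2 (b + n + 2)
      split_ifs <;> omega
    have z0 : u₀ 0 = 0 := by rw [hu₀, St.set_apply, if_neg (by omega), i3 0 (by omega), h0]
    have l1 := runs_copy (V := V) (a := b + n + 3) (b := c) (s := u₀) (by omega) (by omega) (by omega)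
      z0 (b0 _)
    set u₁ := u₀.set c (u₀ (b + n + 3)) with hu₁
    have b1 := l1.le b0
    have z1 : u₁ 0 = 0 := by rw [hu₁, St.set_apply, if_neg (by omega), z0]
    have l2 := runs_copy (V := V) (a := b + n + 1) (b := c + 1) (s := u₁) (by omega) (by omega)
      (by omega) z1 (b1 _)
    set u₂ := u₁.set (c + 1) (u₁ (b + n + 1)) with hu₂
    have b2 := l2.le b1
    have z2 : u₂ 0 = 0 := by rw [hu₂, St.set_apply, if_neg (by omega), z1]
    obtain ⟨u₃, l3, f3', g3'⟩ := runs_copyBlock (V := V) (a := b + 1) (b := c + 2) (n := n) (s := u₂)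
      (by omega) (by omega) z2 b2
    have b3 := l3.le b2
    have e2' : ∀ r < c, u₂ r = if r = b + n + 2 then k else s' r := by
      intro r hr; simp only [hu₂, hu₁, hu₀, St.set_apply]; grind
    obtain ⟨u₄, l4, f4', g4'⟩ := hW j V hWV u₃ (by rw [g3' 0 (by omega), z2]) b3 (fun i => by
      refine Fin.cases ?_ (fun i => ?_) i
      · simp only [Fin.val_zero, add_zero, List.Vector.get_cons_zero]
        rw [g3' c (by omega)]
        simp only [hu₂, hu₁, hu₀, St.set_apply]
        grind
      · refine Fin.cases ?_ (fun i => ?_) i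
        · simp only [List.Vector.get_cons_succ, List.Vector.get_cons_zero, Fin.val_succ, Fin.val_zero]
          rw [g3' _ (by omega)]
          simp only [hu₂, hu₁, hu₀, St.set_apply]
          grind
        · simp only [List.Vector.get_cons_succ, Fin.val_succ]
          rw [show c + (i.val + 1 + 1) = c + 2 + i.val by omega, f3' i i.2, e2' _ (by omega),
            if_neg (by omega), i3 _ (by omega)]
          exact hs1 i i.2)
    have b4 := l4.le b3
    have z4 : u₄ 0 = 0 := by rw [g4' 0 (by omega), g3' 0 (by omega), z2]
    have l5 := runs_copy (V := V) (a := c + (n + 2)) (b := b + n + 1) (s := u₄) (by omega)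
      (by omega) (by omega) z4 (b4 _)
    set u₅ := u₄.set (b + n + 1) (u₄ (c + (n + 2))) with hu₅
    have b5 := l5.le b4
    have e5 : ∀ r < c, r ≠ b + n + 1 → u₅ r = if r = b + n + 2 then k else s' r := by
      intro r hr hr'
      rw [hu₅, St.set_apply, if_neg hr', g4' _ (by omega), g3' _ (by omega), e2' _ hr]
    have i5' : u₅ (b + n + 3) = j := by rw [e5 _ (by omega) (by omega), if_neg (by omega), i5]
    have l6 := Runs.inc (V := V) (s := u₅) (r := b + n + 3) (by omega)
    refine ⟨_, .seq l1 (.seq l2 (.seq l3 (.seq l4 (.seq l5 l6)))), by omega, l6.le b5,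
      fun r hr => ?_, ?_, ?_, ?_⟩
    · rw [St.set_apply, if_neg (by omega), e5 _ (by omega) (by omega), if_neg (by omega), i3 r hr]
    · rw [St.set_apply, if_neg (by omega), e5 _ (by omega) (by omega), if_pos rfl]
    · rw [St.set_same, i5', hj']
    · rw [St.set_apply, if_neg (by omega), hu₅, St.set_same, f4', hj']
  · refine ⟨le_rfl, hV₅, fun r hr => ?_, ?_, ?_, ?_⟩
    · rw [hs₅, St.set_apply, if_neg (by omega), g4 _ (by omega), g3 _ (by omega), e2 _ (by omega)]
    · rw [hs₅, St.set_apply, if_neg (by omega), g4 _ (by omega), g3 _ (by omega)]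
      simp only [hs₂, hs₁, St.set_apply]; grind
    · rw [hs₅, St.set_apply, if_neg (by omega), g4 _ (by omega), g3 _ (by omega)]
      simp only [hs₂, hs₁, St.set_apply]; grind
    · rw [hs₅, St.set_same, f4, Nat.sub_self]
      rfl
  · refine ⟨t, .seq k1 (.seq k2 (.seq k3 (.seq k4 (.seq k5 k6)))), ?_, fun r hr => ?_⟩
    · rw [← add_assoc, h6.2.2.2.2.2, hz, Nat.sub_zero]
    · exact h6.2.2.1 r (by omega)

/-- The candidate, which ends up as the value, is in `b + n`, and the loop flag in `b + n + 1`.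
Nothing has to be shown when there is no zero, since `Computes` speaks about existing values only.
-/
theorem computes_rfind {n : ℕ} {f : List.Vector ℕ (n + 1) → ℕ}
    (hf : Computes fun v => Part.some (f v)) :
    Computes fun v => Nat.rfind fun k => Part.some (decide (f (k ::ᵥ v) = 0)) := by
  intro b hb
  obtain ⟨c, hc⟩ : ∃ c, c = b + n + 2 := ⟨_, rfl⟩
  obtain ⟨p, hp, hp'⟩ := hf c (by omega)
  set body : Prog := .seq (copy (b + n) c) (.seq (copyBlock b (c + 1) n) (.seq p
      (ifnz (c + (n + 1)) (.seq (.inc (b + n)) (.inc (b + n + 1))) .skip))) with hbody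
  refine ⟨.seq (clr (b + n)) (.seq (clr (b + n + 1)) (.seq (.inc (b + n + 1))
    (.loop (b + n + 1) body))), by simp [hp, hbody], fun v y hy => ?_⟩
  have h2 := fun k => hp' (k ::ᵥ v) _ (Part.mem_some _)
  choose W hW using h2
  have hy0 : f (y ::ᵥ v) = 0 := by simpa using Nat.rfind_spec hy
  have hy1 : ∀ m < y, f (m ::ᵥ v) ≠ 0 := by
    intro m hm
    simpa using Nat.rfind_min hy hm
  refine ⟨y + 1 + ∑ k ∈ Finset.range (y + 1), W k, fun V hVm s h0 hV hv => ?_⟩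
  have key : ∀ j, j ≤ y → ∀ s' : St, (∀ r, s' r ≤ V) → (∀ r < b + n, s' r = s r) →
      s' (b + n) = y - j → s' (b + n + 1) = 1 →
      ∃ t, Runs V (.loop (b + n + 1) body) s' t ∧ t (b + n) = y ∧ ∀ r < b + n, t r = s r := by
    intro j
    induction j with
    -- `j` is the distance from the candidate to `y`. Both cases share the evaluation of `f`;
    -- whether the search stops is decided by the alternatives of `first` below.
    | zero | succ j ih =>
      intro hj s' i2 i3 i5 i6
      obtain ⟨m, hm⟩ : ∃ m, m = s' (b + n) := ⟨_, rfl⟩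
      have hWV : W m ≤ V := by
        refine le_trans ?_ hVm
        refine le_trans ?_ (Nat.le_add_left _ _)
        exact Finset.single_le_sum (f := W) (fun _ _ => Nat.zero_le _)
          (Finset.mem_range.2 (by omega))
      set u₀ := s'.set (b + n + 1) (s' (b + n + 1) - 1) with hu₀
      have b0 : ∀ r, u₀ r ≤ V := by
        intro r; simp only [hu₀, St.set_apply]
        have := i2 r; have := i2 (b + n + 1)
        split_ifs <;> omega
      have z0 : u₀ 0 = 0 := by rw [hu₀, St.set_apply, if_neg (by omega), i3 0 (by omega), h0]
      have l1 := runs_copy (V := V) (a := b + n) (b := c) (s := u₀) (by omega) (by omega)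
        (by omega) z0 (b0 _)
      set u₁ := u₀.set c (u₀ (b + n)) with hu₁
      have b1 := l1.le b0
      have z1 : u₁ 0 = 0 := by rw [hu₁, St.set_apply, if_neg (by omega), z0]
      obtain ⟨u₂, l2, f2, g2⟩ := runs_copyBlock (V := V) (a := b) (b := c + 1) (n := n) (s := u₁)
        (by omega) (by omega) z1 b1
      have b2 := l2.le b1
      have e1 : ∀ r < b + n + 1, u₁ r = s' r := by
        intro r hr; simp only [hu₁, hu₀, St.set_apply]; grind
      obtain ⟨u₃, l3, f3, g3⟩ := hW m V hWV u₂ (by rw [g2 0 (by omega), z1]) b2 (fun i => by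
        refine Fin.cases ?_ (fun i => ?_) i
        · simp only [Fin.val_zero, add_zero, List.Vector.get_cons_zero]
          rw [g2 c (by omega)]
          simp only [hu₁, hu₀, St.set_apply]
          grind
        · simp only [List.Vector.get_cons_succ, Fin.val_succ]
          rw [show c + (i.val + 1) = c + 1 + i.val by omega, f2 i i.2, e1 _ (by omega),
            i3 _ (by omega), hv])
      have b3 := l3.le b2
      have e3 : ∀ r < b + n + 1, u₃ r = s' r := by
        intro r hr; rw [g3 _ (by omega), g2 _ (by omega), e1 _ hr]
      have e3' : u₃ (b + n + 1) = 0 := by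
        rw [g3 _ (by omega), g2 _ (by omega)]
        simp only [hu₁, hu₀, St.set_apply]; grind
      first
      | have hm0 : m = y := by omega
        subst hm0
        refine ⟨u₃, .loop_pos (by omega) (.seq l1 (.seq l2 (.seq l3
          (runs_ifnz_zero (by rw [f3, hy0]) (.skip _ _))))) (.loop_zero e3'), ?_, fun r hr => ?_⟩
        · rw [e3 _ (by omega), hm]
        · rw [e3 _ (by omega), i3 r hr]
      | have hm0 : m < y := by omega
        have e3n : u₃ (b + n) = m := by rw [e3 _ (by omega), hm]
        have l4 := Runs.inc (V := V) (s := u₃) (r := b + n) (by omega)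
        have l5 := Runs.inc (V := V) (s := u₃.set (b + n) (u₃ (b + n) + 1)) (r := b + n + 1)
          (by rw [St.set_apply, if_neg (by omega)]; omega)
        obtain ⟨t, q1, q2⟩ := ih (by omega) _ (l5.le (l4.le b3)) (fun r hr => by
            rw [St.set_apply, if_neg (by omega), St.set_apply, if_neg (by omega), e3 _ (by omega),
              i3 r hr])
          (by rw [St.set_apply, if_neg (by omega), St.set_same]; omega)
          (by rw [St.set_same, St.set_apply, if_neg (by omega), e3'])
        exact ⟨t, .loop_pos (by omega) (.seq l1 (.seq l2 (.seq l3
          (runs_ifnz_pos (by rw [f3]; exact hy1 m hm0) (b3 _) (.seq l4 l5))))) q1, q2⟩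
  have k1 := runs_clr V (b + n) s
  have k2 := runs_clr V (b + n + 1) (s.set (b + n) 0)
  have k3 := Runs.inc (V := V) (s := (s.set (b + n) 0).set (b + n + 1) 0) (r := b + n + 1)
    (by simp; omega)
  obtain ⟨t, q1, q2, q3⟩ := key y le_rfl _ (k3.le (k2.le (k1.le hV))) (fun r hr => by
      simp only [St.set_apply]; grind) (by simp only [St.set_apply]; grind) (by simp)
  exact ⟨t, .seq k1 (.seq k2 (.seq k3 q1)), q2, q3⟩

theorem computes_of_primrec' {n : ℕ} {f : List.Vector ℕ n → ℕ} (hf : Nat.Primrec' f) :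
    Computes fun v => Part.some (f v) := by
  induction hf with
  | zero => exact computes_zero
  | succ => exact computes_succ
  | get i => exact computes_get i
  | comp g _ _ hf hg =>
    refine computes_comp _ hf hg fun v z hz => ⟨fun i => g i v, fun i => Part.mem_some _, ?_⟩
    exact hz
  | prec _ _ hf hg => exact computes_prec hf hg

theorem get_mem_of_mem_mOfFn {α : Type} {n : ℕ} {f : Fin n → Part α} {w : List.Vector α n}
    (hw : w ∈ (List.Vector.mOfFn f : Part (List.Vector α n))) (i : Fin n) : w.get i ∈ f i := by
  induction n with
  | zero => exact i.elim0
  | succ n ih =>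
    simp only [List.Vector.mOfFn, Part.bind_eq_bind, Part.mem_bind_iff, Part.pure_eq_some,
      Part.mem_some_iff] at hw
    obtain ⟨a, ha, u, hu, rfl⟩ := hw
    refine Fin.cases ?_ (fun i => ?_) i
    · simpa using ha
    · simpa using ih hu i

theorem computes_of_partrec' {n : ℕ} {f : List.Vector ℕ n →. ℕ} (hf : Nat.Partrec' f) :
    Computes f := by
  induction hf with
  | prim hf => exact computes_of_primrec' hf
  | @comp m n f g _ _ hf hg =>
    refine computes_comp _ hf hg fun v z hz => ?_
    obtain ⟨w, hw, hz⟩ := Part.mem_bind_iff.1 hz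
    refine ⟨w.get, get_mem_of_mem_mOfFn hw, ?_⟩
    rwa [List.Vector.ofFn_get]
  | rfind hf ih => exact computes_rfind ih

/-! ### Running a program with bounded fuel -/

/-- The program `p` executed as long as the fuel in register `D` lasts; every step takes one unit.
Register `D + 1` is a temporary register. -/
def clip (D : ℕ) : Prog → Prog
  | .skip => .cond D .skip .skip
  | .inc r => .cond D (.inc r) .skip
  | .seq p q => .cond D (.seq (clip D p) (clip D q)) .skip
  | .cond r p q => .cond D (.cond r (clip D p) (clip D q)) .skip
  | .loop r p => .seq (.inc (D + 1)) (.loop (D + 1)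
      (.cond D (.cond r (.seq (clip D p) (.inc (D + 1))) .skip) .skip))
  | .take _ _ => .skip
  | .last _ _ => .skip
  | .emit _ => .skip

theorem pure_clip (D : ℕ) (p : Prog) : (clip D p).Pure := by
  induction p <;> simp_all [clip, Prog.Pure]

/-- `t` results from executing `p` at `s` with bounded fuel. -/
structure Clipped (D V : ℕ) (p : Prog) (s t : St) : Prop where
  le : t D ≤ s D
  tmp : t (D + 1) = 0
  frame : ∀ r, D + 1 < r → t r = s r
  -- An increment costs one unit of fuel, so a register and the fuel together never grow.
  bnd : ∀ r < D, t r + t D ≤ V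
  run : 0 < t D → ∀ s' : St, (∀ r < D, s' r = s r) →
    ∃ W u, Run W p (s D - t D) s' u ∧ ∀ r < D, u r = t r
  -- Together with `run`: fuel is left exactly when `p` halts in fewer than `s D` steps. A run that
  -- uses up the last unit counts as a failure.
  fail : t D = 0 → ∀ s' : St, (∀ r < D, s' r = s r) → ∀ W n u, Run W p n s' u → s D ≤ n

theorem clipped_self {D V : ℕ} {p : Prog} {s : St} (hF : s D = 0) (hT : s (D + 1) = 0)
    (hV : ∀ r < D, s r + s D ≤ V) : Clipped D V p s s :=
  ⟨le_rfl, hT, fun _ _ => rfl, hV, by omega, fun _ _ _ _ _ _ _ => by omega⟩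

/-- Strong induction on the fuel, since each test of the loop costs a unit. The flag in register `D
+ 1` is `0` while the body is executed, so nested loops can share it. -/
theorem runs_clip_loop {D V r : ℕ} {p : Prog} (hr : r < D) (hV1 : 1 ≤ V)
    (hp : ∀ s : St, s (D + 1) = 0 → (∀ r < D, s r + s D ≤ V) →
      ∃ t, Runs V (clip D p) s t ∧ Clipped D V p s t) (f : ℕ) :
    ∀ s : St, s D = f → (∀ r < D, s r + s D ≤ V) →
      ∃ t, Runs V (.loop (D + 1)
        (.cond D (.cond r (.seq (clip D p) (.inc (D + 1))) .skip) .skip)) (s.set (D + 1) 1) t ∧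
        Clipped D V (.loop r p) s t := by
  induction f using Nat.strong_induction_on with
  | _ f ih =>
    intro s hf hs
    have e1 : (s.set (D + 1) 1).set (D + 1) ((s.set (D + 1) 1) (D + 1) - 1) = s.set (D + 1) 0 := by
      simp
    by_cases hF : s D = 0
    · refine ⟨s.set (D + 1) 0, .loop_pos (by simp) (by
        rw [e1]; exact .cond_zero (by simp [St.set_apply, hF]) (.skip _ _))
        (.loop_zero (by simp)), ?_⟩
      · refine ⟨by simp [St.set_apply], by simp, fun i hi => ?_, fun i hi => ?_, fun h => ?_,
          fun _ _ _ _ _ _ _ => by omega⟩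
        · rw [St.set_apply, if_neg (by omega)]
        · have := hs i hi
          simp only [St.set_apply]; grind
        · simp only [St.set_apply] at h; grind
    set s₁ := (s.set (D + 1) 0).set D (s D - 1) with hs₁
    have a1 : ∀ i < D, s₁ i = s i := by intro i hi; simp only [hs₁, St.set_apply]; grind
    have a2 : s₁ D = s D - 1 := by simp [hs₁]
    have a3 : s₁ (D + 1) = 0 := by simp [hs₁, St.set_apply]
    have a4 : ∀ i, D + 1 < i → s₁ i = s i := by intro i hi; simp only [hs₁, St.set_apply]; grind
    have hD0 : (s.set (D + 1) 0) D = s D := by simp [St.set_apply]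
    by_cases hr0 : s r = 0
    · refine ⟨s₁, .loop_pos (by simp) (by
        rw [e1]
        refine .cond_pos (by rwa [hD0]) ?_
        rw [hD0]
        exact .cond_zero (by rw [← hs₁, a1 r hr, hr0]) (.skip _ _)) (.loop_zero a3), ?_⟩
      · refine ⟨by omega, a3, a4, fun i hi => ?_, fun h s' hs' => ⟨0, s', ?_, fun i hi => ?_⟩,
          fun h s' hs' W n u hu => ?_⟩
        · have := hs i hi
          rw [a1 i hi]; omega
        · rw [show s D - s₁ D = 1 by omega]
          exact .loop_zero (by rw [hs' r hr, hr0])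
        · rw [hs' i hi, a1 i hi]
        · cases hu <;> omega
    set s₂ := s₁.set r (s r - 1) with hs₂
    have b1 : ∀ i < D, s₂ i = (s.set r (s r - 1)) i := by
      intro i hi; simp only [hs₂, St.set_apply, a1 i hi]
    have b2 : s₂ D = s D - 1 := by rw [hs₂, St.set_apply, if_neg (by omega), a2]
    have b3 : s₂ (D + 1) = 0 := by rw [hs₂, St.set_apply, if_neg (by omega), a3]
    have b4 : ∀ i, D + 1 < i → s₂ i = s i := by
      intro i hi; rw [hs₂, St.set_apply, if_neg (by omega), a4 i hi]
    have b5 : ∀ i < D, s₂ i + s₂ D ≤ V := by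
      intro i hi
      have := hs i hi
      rw [b1 i hi, St.set_apply]; split_ifs <;> subst_vars <;> omega
    obtain ⟨t₁, r1, c1⟩ := hp s₂ b3 b5
    obtain ⟨t, r2, c2⟩ := ih (t₁ D) (by have := c1.le; omega) t₁ rfl c1.bnd
    have hle := c1.le
    have hle2 := c2.le
    refine ⟨t, .loop_pos (by simp) (by
      rw [e1]
      refine .cond_pos (by rwa [hD0]) ?_
      rw [hD0]
      refine .cond_pos (by rwa [← hs₁, a1 r hr]) ?_
      rw [← hs₁, a1 r hr]
      refine .seq r1 ?_
      have := Runs.inc (V := V) (s := t₁) (r := D + 1) (by rw [c1.tmp]; omega)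
      rwa [c1.tmp, zero_add] at this) r2, ?_⟩
    · refine ⟨by omega, c2.tmp, fun i hi => by rw [c2.frame i hi, c1.frame i hi, b4 i hi],
        c2.bnd, fun h s' hs' => ?_, fun h s' hs' W n u hu => ?_⟩
      · have hs'' : ∀ i < D, (s'.set r (s' r - 1)) i = s₂ i := by
          intro i hi; rw [b1 i hi, St.set_apply, St.set_apply, hs' i hi, hs' r hr]
        obtain ⟨W₁, u₁, k1, l1⟩ := c1.run (by omega) _ hs''
        obtain ⟨W₂, u₂, k2, l2⟩ := c2.run h u₁ l1
        refine ⟨max W₁ W₂, u₂, ?_, l2⟩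
        have := Run.loop_pos (r := r) (s := s') (by rwa [hs' r hr]) (k1.mono (le_max_left W₁ W₂))
          (k2.mono (le_max_right W₁ W₂))
        convert this using 1
        omega
      · have hs'' : ∀ i < D, (s'.set r (s' r - 1)) i = s₂ i := by
          intro i hi; rw [b1 i hi, St.set_apply, St.set_apply, hs' i hi, hs' r hr]
        cases hu with
        | loop_zero h => rw [hs' r hr] at h; omega
        | loop_pos _ k1 k2 =>
          by_cases ht : t₁ D = 0
          · have := c1.fail ht _ hs'' _ _ _ k1
            omega
          · obtain ⟨W₁, u₁, k3, l1⟩ := c1.run (by omega) _ hs''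
            obtain ⟨e, rfl⟩ := k3.unique k1
            have := c2.fail h _ l1 _ _ _ k2
            omega

/-- The clipped program always terminates, and it stays within the sum of contents and fuel,
whatever `p` itself would need. This allows unknown programs to be tested in prescribed space. -/
theorem runs_clip {D V : ℕ} {p : Prog} (hp : p.Pure) (hb : p.bound ≤ D) (hV1 : 1 ≤ V) :
    ∀ s : St, s (D + 1) = 0 → (∀ r < D, s r + s D ≤ V) →
      ∃ t, Runs V (clip D p) s t ∧ Clipped D V p s t := by
  have key : ∀ (q c : Prog), (∀ s : St, s D ≠ 0 → s (D + 1) = 0 → (∀ r < D, s r + s D ≤ V) →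
      ∃ t, Runs V c (s.set D (s D - 1)) t ∧ Clipped D V q s t) →
      ∀ s : St, s (D + 1) = 0 → (∀ r < D, s r + s D ≤ V) →
        ∃ t, Runs V (.cond D c .skip) s t ∧ Clipped D V q s t := by
    intro q c h s h1 h2
    by_cases hF : s D = 0
    · exact ⟨s, .cond_zero hF (.skip _ _), clipped_self hF h1 h2⟩
    · obtain ⟨t, h3, h4⟩ := h s hF h1 h2
      exact ⟨t, .cond_pos hF h3, h4⟩
  have low : ∀ (s : St), (∀ r < D, (s.set D (s D - 1)) r = s r) := by
    intro s i hi; rw [St.set_apply, if_neg (by omega)]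
  have low' : ∀ (s : St), s D ≠ 0 → (∀ r < D, s r + s D ≤ V) →
      ∀ r < D, (s.set D (s D - 1)) r + (s.set D (s D - 1)) D ≤ V := by
    intro s hF h i hi
    have := h i hi
    rw [low s i hi, St.set_same]; omega
  have hi : ∀ (s : St) i, D < i → (s.set D (s D - 1)) i = s i := by
    intro s i hi; rw [St.set_apply, if_neg (by omega)]
  induction p with
  | skip =>
    refine key _ _ fun s hF h1 h2 => ⟨_, .skip _ _, ⟨by simp, by rw [hi _ _ (by omega), h1],
      fun i h => hi _ _ (by omega), low' s hF h2, fun h s' hs' => ⟨0, s', ?_, fun i hi => ?_⟩,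
      fun h s' hs' W n u hu => ?_⟩⟩
    · rw [St.set_same, show s D - (s D - 1) = 1 by omega]
      exact .skip _
    · rw [hs' i hi, low s i hi]
    · rw [St.set_same] at h
      cases hu; omega
  | inc r =>
    simp only [Prog.bound] at hb
    refine key _ _ fun s hF h1 h2 => ?_
    have hr := h2 r (by omega)
    have e := low s r (by omega)
    refine ⟨_, .inc (by rw [e]; omega), ⟨?_, ?_, fun i h => ?_, fun i h => ?_,
      fun h s' hs' => ⟨V, s'.set r (s' r + 1), ?_, fun i hi => ?_⟩, fun h s' hs' W n u hu => ?_⟩⟩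
    · rw [St.set_apply, if_neg (by omega), St.set_same]; omega
    · rw [St.set_apply, if_neg (by omega), hi _ _ (by omega), h1]
    · rw [St.set_apply, if_neg (by omega), hi _ _ (by omega)]
    · have := h2 i h
      simp only [St.set_apply]; grind
    · rw [St.set_apply, if_neg (by omega), St.set_same, show s D - (s D - 1) = 1 by omega]
      exact .inc _ _ (by rw [hs' r (by omega)]; omega)
    · simp only [St.set_apply, hs' i hi, hs' r (by omega)]; grind
    · rw [St.set_apply, if_neg (by omega), St.set_same] at h
      cases hu; omega
  | seq p q ihp ihq =>
    simp only [Prog.bound] at hb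
    refine key _ _ fun s hF h1 h2 => ?_
    obtain ⟨t₁, r1, c1⟩ := ihp hp.1 (by omega) (s.set D (s D - 1)) (by rw [hi _ _ (by omega), h1])
      (low' s hF h2)
    obtain ⟨t, r2, c2⟩ := ihq hp.2 (by omega) t₁ c1.tmp c1.bnd
    have hle := c1.le
    have hle2 := c2.le
    rw [St.set_same] at hle
    refine ⟨t, .seq r1 r2, ⟨by omega, c2.tmp, fun i h => ?_, c2.bnd, fun h s' hs' => ?_,
      fun h s' hs' W n u hu => ?_⟩⟩
    · rw [c2.frame i h, c1.frame i h, hi _ _ (by omega)]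
    · obtain ⟨W₁, u₁, k1, l1⟩ := c1.run (by omega) s' fun i hi => by rw [hs' i hi, low s i hi]
      obtain ⟨W₂, u₂, k2, l2⟩ := c2.run h u₁ l1
      refine ⟨max W₁ W₂, u₂, ?_, l2⟩
      have := Run.seq (k1.mono (le_max_left W₁ W₂)) (k2.mono (le_max_right W₁ W₂))
      convert this using 1
      rw [St.set_same]; omega
    · cases hu with
      | seq k1 k2 =>
        have hs'' : ∀ i < D, s' i = (s.set D (s D - 1)) i := fun i hi => by
          rw [hs' i hi, low s i hi]
        by_cases ht : t₁ D = 0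
        · have := c1.fail ht _ hs'' _ _ _ k1
          rw [St.set_same] at this
          omega
        · obtain ⟨W₁, u₁, k3, l1⟩ := c1.run (by omega) _ hs''
          obtain ⟨e, rfl⟩ := k3.unique k1
          have := c2.fail h _ l1 _ _ _ k2
          rw [St.set_same] at e
          omega
  | cond r p q ihp ihq =>
    simp only [Prog.bound] at hb
    refine key _ _ fun s hF h1 h2 => ?_
    by_cases hr : s r = 0
    · obtain ⟨t, r1, c1⟩ := ihq hp.2 (by omega) (s.set D (s D - 1))
        (by rw [hi _ _ (by omega), h1]) (low' s hF h2)
      have hle := c1.le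
      have hset := St.set_same s D (s D - 1)
      refine ⟨t, .cond_zero (by rw [low s r (by omega), hr]) r1, ⟨by omega, c1.tmp, fun i h => ?_,
        c1.bnd, fun h s' hs' => ?_, fun h s' hs' W n u hu => ?_⟩⟩
      · rw [c1.frame i h, hi _ _ (by omega)]
      · obtain ⟨W₁, u₁, k1, l1⟩ := c1.run h s' fun i hi => by rw [hs' i hi, low s i hi]
        refine ⟨W₁, u₁, ?_, l1⟩
        convert Run.cond_zero (r := r) (p := p) (by rw [hs' r (by omega), hr]) k1 using 1
        omega
      · cases hu with
        | cond_pos h' _ => rw [hs' r (by omega)] at h'; omega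
        | cond_zero _ k1 =>
          have := c1.fail h s' (fun i hi => by rw [hs' i hi, low s i hi]) _ _ _ k1
          omega
    · have hr' : (s.set D (s D - 1)) r = s r := low s r (by omega)
      have hset : ((s.set D (s D - 1)).set r (s r - 1)) D = s D - 1 := by
        rw [St.set_apply, if_neg (by omega), St.set_same]
      obtain ⟨t, r1, c1⟩ := ihp hp.1 (by omega) ((s.set D (s D - 1)).set r (s r - 1))
        (by rw [St.set_apply, if_neg (by omega), hi _ _ (by omega), h1]) (fun i hi => by
          have := low' s hF h2 i hi
          have := low' s hF h2 r (by omega)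
          rw [hset]
          rw [St.set_same] at *
          rw [St.set_apply]; split_ifs <;> omega)
      have hle := c1.le
      have hs'' : ∀ s' : St, (∀ i < D, s' i = s i) → ∀ i < D, (s'.set r (s' r - 1)) i =
          ((s.set D (s D - 1)).set r (s r - 1)) i := fun s' hs' i hi => by
        rw [St.set_apply, St.set_apply, hs' r (by omega), low s i hi, hs' i hi]
      refine ⟨t, .cond_pos (by rwa [hr']) (by rwa [hr']), ⟨by omega, c1.tmp, fun i h => ?_,
        c1.bnd, fun h s' hs' => ?_, fun h s' hs' W n u hu => ?_⟩⟩
      · rw [c1.frame i h, St.set_apply, if_neg (by omega), hi _ _ (by omega)]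
      · obtain ⟨W₁, u₁, k1, l1⟩ := c1.run h _ (hs'' s' hs')
        refine ⟨W₁, u₁, ?_, l1⟩
        convert Run.cond_pos (r := r) (q := q) (by rwa [hs' r (by omega)]) k1 using 1
        omega
      · cases hu with
        | cond_zero h' _ => rw [hs' r (by omega)] at h'; omega
        | cond_pos _ k1 =>
          have := c1.fail h _ (hs'' s' hs') _ _ _ k1
          omega
  | loop r p ih =>
    simp only [Prog.bound] at hb
    intro s h1 h2
    obtain ⟨t, h3, h4⟩ := runs_clip_loop (r := r) (by omega) hV1 (ih hp (by omega)) (s D) s rfl h2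
    refine ⟨t, .seq ?_ h3, h4⟩
    have := Runs.inc (V := V) (s := s) (r := D + 1) (by omega)
    rwa [h1, zero_add] at this
  | take => exact hp.elim
  | last => exact hp.elim
  | emit => exact hp.elim

/-! ### Machines compute partial recursive functions -/

/-- Configurations are coded as the tuples of their fields. -/
def Config.equivProd : Config ≃ ℕ × List Symbol × Symbol × List Symbol where
  toFun c := (c.state, c.left, c.head, c.right)
  invFun t := ⟨t.1, t.2.1, t.2.2.1, t.2.2.2⟩
  left_inv _ := rfl
  right_inv _ := rfl

instance : Primcodable Config := Primcodable.ofEquiv _ Config.equivProd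

/-- The instruction that applies in state `q` when reading `a`. -/
def look (m : Machine) (q : ℕ) (a : Symbol) : Option Instr :=
  m.program.find? fun i => i.state == q && i.read == a

theorem step_eq_look (m : Machine) (c : Config) :
    m.step c = (look m c.state c.head).map fun i => i.exec c := rfl

theorem primrec_instr : Primrec Instr.equivProd := Primrec.of_equiv

theorem primrec_instr_state : Primrec Instr.state := Primrec.fst.comp primrec_instr
theorem primrec_instr_read : Primrec Instr.read :=
  Primrec.fst.comp (Primrec.snd.comp primrec_instr)
theorem primrec_instr_write : Primrec Instr.write :=
  Primrec.fst.comp (Primrec.snd.comp (Primrec.snd.comp primrec_instr))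
theorem primrec_instr_move : Primrec Instr.move :=
  Primrec.fst.comp (Primrec.snd.comp (Primrec.snd.comp (Primrec.snd.comp primrec_instr)))
theorem primrec_instr_next : Primrec Instr.next :=
  Primrec.snd.comp (Primrec.snd.comp (Primrec.snd.comp (Primrec.snd.comp primrec_instr)))

theorem primrec_machine_base : Primrec Machine.base :=
  Primrec.fst.comp (Primrec.of_equiv (e := Machine.equivProd))
theorem primrec_machine_program : Primrec Machine.program :=
  Primrec.snd.comp (Primrec.of_equiv (e := Machine.equivProd))

theorem primrec_move : Primrec Move.equivFin := Primrec.of_equiv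

/-- The code of a move. -/
def Move.code (m : Move) : ℕ := (Move.equivFin m).val

theorem primrec_move_code : Primrec Move.code := Primrec.fin_val.comp primrec_move

theorem primrec_config : Primrec Config.equivProd := Primrec.of_equiv

theorem primrec_config_state : Primrec Config.state := Primrec.fst.comp primrec_config
theorem primrec_config_left : Primrec Config.left :=
  Primrec.fst.comp (Primrec.snd.comp primrec_config)
theorem primrec_config_head : Primrec Config.head :=
  Primrec.fst.comp (Primrec.snd.comp (Primrec.snd.comp primrec_config))
theorem primrec_config_right : Primrec Config.right :=
  Primrec.snd.comp (Primrec.snd.comp (Primrec.snd.comp primrec_config))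

theorem primrec_config_mk : Primrec fun t : ℕ × List Symbol × Symbol × List Symbol =>
    (⟨t.1, t.2.1, t.2.2.1, t.2.2.2⟩ : Config) :=
  Primrec.of_equiv_symm (e := Config.equivProd)

theorem primrec_look : Primrec fun t : Machine × ℕ × Symbol => look t.1 t.2.1 t.2.2 := by
  have h : Primrec₂ fun (t : Machine × ℕ × Symbol) (i : Instr) =>
      (i.state == t.2.1 && i.read == t.2.2) := by
    have hr : Primrec₂ fun (t : Machine × ℕ × Symbol) (i : Instr) => decide (i.read = t.2.2) :=
      Primrec.eq.decide.comp (primrec_instr_read.comp Primrec.snd)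
        (Primrec.snd.comp (Primrec.snd.comp Primrec.fst))
    refine Primrec.and.comp (Primrec.beq.comp (primrec_instr_state.comp Primrec.snd) ?_)
      (Primrec.of_eq hr fun t => ?_)
    · exact Primrec.fst.comp (Primrec.snd.comp Primrec.fst)
    · exact (beq_eq_decide _ _).symm
  have hp := primrec_machine_program.comp (Primrec.fst (α := Machine) (β := ℕ × Symbol))
  refine (Primrec.list_getElem?.comp hp (Primrec.list_findIdx hp h)).of_eq fun t => ?_
  rw [look, List.find?_eq_getElem?_findIdx]

/-- Without pattern matching on the move and the tape, the formula serves both for primitive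
recursiveness and for estimates of sizes and symbols. -/
theorem exec_eq (i : Instr) (c : Config) : i.exec c =
    if i.move.code = 1 then ⟨i.next, c.left, i.write, c.right⟩
    else if i.move.code = 0 then ⟨i.next, c.left.tail, c.left.head?.getD none, i.write :: c.right⟩
    else ⟨i.next, i.write :: c.left, c.right.head?.getD none, c.right.tail⟩ := by
  rcases i with ⟨a, b, w, (_ | _ | _), n⟩ <;> rcases c with ⟨q, (_ | ⟨l, ls⟩), h, (_ | ⟨r, rs⟩)⟩ <;> rfl

theorem primrec_exec : Primrec₂ Instr.exec := by
  have i := Primrec.fst (α := Instr) (β := Config)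
  have c := Primrec.snd (α := Instr) (β := Config)
  have hn := primrec_instr_next.comp i
  have hw := primrec_instr_write.comp i
  have hm := primrec_move_code.comp (primrec_instr_move.comp i)
  have hl := primrec_config_left.comp c
  have hr := primrec_config_right.comp c
  have hmk {f : Instr × Config → ℕ × List Symbol × Symbol × List Symbol} (hf : Primrec f) :=
    primrec_config_mk.comp hf
  have hd {f : Instr × Config → List Symbol} (hf : Primrec f) :
      Primrec fun a => (f a).head?.getD none :=
    Primrec.option_getD.comp (Primrec.list_head?.comp hf) (Primrec.const none)
  have h := Primrec.ite (Primrec.eq.comp hm (Primrec.const 1))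
    (hmk (hn.pair (hl.pair (hw.pair hr))))
    (Primrec.ite (Primrec.eq.comp hm (Primrec.const 0))
      (hmk (hn.pair ((Primrec.list_tail.comp hl).pair ((hd hl).pair (Primrec.list_cons.comp hw hr)))))
      (hmk (hn.pair ((Primrec.list_cons.comp hw hl).pair ((hd hr).pair (Primrec.list_tail.comp hr))))))
  exact h.of_eq fun t => (exec_eq t.1 t.2).symm

theorem primrec_step (m : Machine) : Primrec m.step := by
  refine (Primrec.option_map (f := fun c : Config => look m c.state c.head) (g := fun c i => i.exec c)
    ?_ ?_).of_eq fun c => rfl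
  · exact primrec_look.comp ((Primrec.const m).pair (primrec_config_state.pair primrec_config_head))
  · exact primrec_exec.comp Primrec.snd Primrec.fst

theorem partrec_eval {α : Type*} [Primcodable α] {f : α → Option α} (hf : Computable f) :
    Partrec (StateTransition.eval f) := by
  unfold StateTransition.eval
  refine Partrec.fix ?_
  have : Computable fun s => ((f s).casesOn (.inl s) .inr : α ⊕ α) :=
    Computable.option_casesOn hf Computable.sumInl (Computable.sumInr.comp Computable.snd)
  exact this.partrec.of_eq fun s => by
    rw [PFun.coe_val]; cases f s <;> rfl

/-! ### Words and outputs as primitive recursive functions -/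

/-- The value of a word on the tape up to the first blank. -/
def tapeVal (b : ℕ) (l : List Symbol) : ℕ :=
  l.foldr (fun a v => a.elim 0 fun d => d + b * v) 0

theorem output_eq (b : ℕ) (c : Config) : c.output b = tapeVal b (c.head :: c.right) := by
  rw [Config.output]
  generalize c.head :: c.right = l
  induction l with
  | nil => rfl
  | cons a l ih =>
    cases a with
    | none => rfl
    | some d =>
      simp only [tapeVal, List.foldr_cons, Option.elim_some] at ih ⊢
      rw [← ih]
      simp [List.reduceOption_cons_of_some, Nat.ofDigits_cons]

theorem primrec_tapeVal (b : ℕ) : Primrec (tapeVal b) := by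
  refine Primrec.list_foldr (f := fun l : List Symbol => l) (g := fun _ => 0)
    (h := fun _ t => t.1.elim 0 fun d => d + b * t.2) Primrec.id (Primrec.const 0) ?_
  have : Primrec fun u : (List Symbol × Symbol × ℕ) => (u.2.1.casesOn 0 fun d => d + b * u.2.2 : ℕ) := by
    refine Primrec.option_casesOn (Primrec.fst.comp Primrec.snd) (Primrec.const 0) ?_
    exact Primrec.nat_add.comp Primrec.snd (Primrec.nat_mul.comp (Primrec.const b)
      (Primrec.snd.comp (Primrec.snd.comp Primrec.fst)))
  exact this.of_eq fun u => by cases h : u.2.1 <;> simp [h]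

theorem primrec_pow (b : ℕ) : Primrec fun j => b ^ j := by
  refine (Primrec.nat_rec₁ 1 (f := fun _ v => v * b) ?_).of_eq fun j => ?_
  · exact Primrec.nat_mul.comp Primrec.snd (Primrec.const b)
  · induction j with
    | zero => rfl
    | succ j ih => rw [pow_succ, ← ih]

theorem log_eq_findGreatest {b : ℕ} (hb : 1 < b) (x : ℕ) :
    Nat.log b x = Nat.findGreatest (fun j => b ^ j ≤ x) x := by
  symm
  rw [Nat.findGreatest_eq_iff]
  refine ⟨Nat.log_le_self b x, fun h => ?_, fun j h1 _ => ?_⟩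
  · exact Nat.pow_log_le_self b (by rintro rfl; simp at h)
  · exact (Nat.lt_pow_of_log_lt hb h1).not_ge

theorem primrec_log {b : ℕ} (hb : 1 < b) : Primrec (Nat.log b) := by
  have h : PrimrecRel fun (x j : ℕ) => b ^ j ≤ x :=
    Primrec.nat_le.comp ((primrec_pow b).comp Primrec.snd) Primrec.fst
  exact (Primrec.nat_findGreatest Primrec.id h).of_eq fun x => (log_eq_findGreatest hb x).symm

theorem word_eq {b : ℕ} (hb : 1 < b) (x : ℕ) :
    word b x = (List.range (Nat.log b x + 1)).map fun j => x / b ^ j % b := by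
  rw [word]
  split_ifs with h
  · simp [h]
  · refine List.ext_getElem ?_ fun j h1 h2 => ?_
    · simp [Nat.length_digits b x hb h]
    · have := Nat.getD_digits x j (b := b) (by omega)
      rw [List.getD_eq_getElem _ _ h1] at this
      simp [this]

theorem length_word {b : ℕ} (hb : 1 < b) (x : ℕ) : (word b x).length = Nat.log b x + 1 := by
  simp [word_eq hb]

theorem len_eq (x : ℕ) : len x = Nat.log 2 x + 1 := length_word one_lt_two x

theorem primrec_word {b : ℕ} (hb : 1 < b) : Primrec (word b) := by
  have h : Primrec₂ fun (x j : ℕ) => x / b ^ j % b :=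
    Primrec.nat_mod.comp (Primrec.nat_div.comp Primrec.fst ((primrec_pow b).comp Primrec.snd))
      (Primrec.const b)
  exact (Primrec.list_map (Primrec.list_range.comp (Primrec.succ.comp (primrec_log hb))) h).of_eq
    fun x => (word_eq hb x).symm

theorem primrec_len : Primrec len :=
  (Primrec.succ.comp (primrec_log one_lt_two)).of_eq fun x => (len_eq x).symm

/-- This serves the partial recursiveness of `g`, which is recovered from the output of a machine by
subtracting `len k`. -/
theorem partrec_result {m : Machine} (hm : 1 < m.base) : Partrec₂ fun k x => m.result [k, x] := by
  have hw : Primrec fun x : ℕ => (word m.base x).map some ++ [none] := by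
    refine Primrec.list_append.comp (Primrec.list_map (primrec_word hm) ?_) (Primrec.const [none])
    exact Primrec.option_some.comp Primrec.snd
  have ht : Primrec fun t : ℕ × ℕ => inputTape m.base [t.1, t.2] :=
    (Primrec.list_append.comp (hw.comp Primrec.fst) (hw.comp Primrec.snd)).of_eq fun t => by
      simp [inputTape]
  have hi : Primrec fun t : ℕ × ℕ => m.init [t.1, t.2] := by
    refine (primrec_config_mk.comp ((Primrec.const 0).pair ((Primrec.const []).pair
      ((Primrec.option_getD.comp (Primrec.list_head?.comp ht) (Primrec.const none)).pair
        (Primrec.list_tail.comp ht))))).of_eq fun t => ?_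
    simp [Machine.init, List.headD_eq_head?_getD]
  have ho : Primrec (Config.output m.base) := by
    refine ((primrec_tapeVal m.base).comp (Primrec.list_cons.comp primrec_config_head
      primrec_config_right)).of_eq fun c => (output_eq _ _).symm
  exact ((partrec_eval (primrec_step m).to_comp).comp hi.to_comp).map (ho.to_comp.comp Computable.snd).to₂

/-! ### Programs on lists of register contents -/

/-- The program `p` changes the contents of the registers below `K` from `xs` to `ys`. -/
def Trans (K V : ℕ) (p : Prog) (xs ys : List ℕ) : Prop :=
  ∀ s : St, (∀ r, s r ≤ V) → (∀ r < K, s r = xs.getD r 0) →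
    ∃ t, Runs V p s t ∧ ∀ r < K, t r = ys.getD r 0

section

variable {K V : ℕ} {p q : Prog} {xs ys zs : List ℕ}

theorem Trans.seq (hp : Trans K V p xs ys) (hq : Trans K V q ys zs) :
    Trans K V (.seq p q) xs zs := by
  intro s hV hs
  obtain ⟨t, h1, h2⟩ := hp s hV hs
  obtain ⟨u, h3, h4⟩ := hq t (h1.le hV) h2
  exact ⟨u, .seq h1 h3, h4⟩

theorem Trans.skip : Trans K V .skip xs xs := fun s _ hs => ⟨s, .skip V s, hs⟩

theorem getD_set (xs : List ℕ) {l : ℕ} (hl : l < xs.length) (v r : ℕ) :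
    (xs.set l v).getD r 0 = if r = l then v else xs.getD r 0 := by
  by_cases h : r = l
  · subst h; simp [hl]
  · simp [List.getD_eq_getElem?_getD, h, Ne.symm h]

theorem agree_set {s : St} (hs : ∀ r < K, s r = xs.getD r 0) {l : ℕ} (hl : l < xs.length) (v : ℕ) :
    ∀ r < K, (s.set l v) r = (xs.set l v).getD r 0 := by
  intro r hr
  rw [St.set_apply, getD_set xs hl, hs r hr]

theorem trans_clr {l : ℕ} (hl : l < xs.length) : Trans K V (clr l) xs (xs.set l 0) :=
  fun s _ hs => ⟨_, runs_clr V l s, agree_set hs hl 0⟩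

theorem trans_inc {l : ℕ} (hl : l < xs.length) (hK : l < K) (hV : xs.getD l 0 + 1 ≤ V) :
    Trans K V (.inc l) xs (xs.set l (xs.getD l 0 + 1)) := fun s _ hs =>
  ⟨_, hs l hK ▸ .inc (by rwa [hs l hK]), agree_set hs hl _⟩

theorem trans_addConst {l c : ℕ} (hl : l < xs.length) (hK : l < K) (hV : xs.getD l 0 + c ≤ V) :
    Trans K V (addConst l c) xs (xs.set l (xs.getD l 0 + c)) := fun s _ hs =>
  ⟨_, hs l hK ▸ runs_addConst c (by rwa [hs l hK]), agree_set hs hl _⟩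

theorem trans_copy {a b : ℕ} (ha : a < K) (hb : b < xs.length) (ha0 : a ≠ 0) (hb0 : b ≠ 0)
    (hab : a ≠ b) (h0 : xs.getD 0 0 = 0) :
    Trans K V (copy a b) xs (xs.set b (xs.getD a 0)) := fun s hV hs =>
  ⟨_, hs a ha ▸ runs_copy ha0 hb0 hab (by rw [hs 0 (by omega), h0]) (hV a), agree_set hs hb _⟩

theorem trans_push {l b h t : ℕ} (hd : [0, l, b, h, t].Nodup) (hb : b < K) (hh : h < K) (ht : t < K)
    (hl : l < K) (hl' : l < xs.length) (h0 : xs.getD 0 0 = 0) (ht0 : xs.getD t 0 = 0)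
    (hb0 : xs.getD b 0 ≠ 0) (hV : xs.getD l 0 * xs.getD b 0 + xs.getD h 0 ≤ V) :
    Trans K V (push l b h t) xs (xs.set l (xs.getD l 0 * xs.getD b 0 + xs.getD h 0)) := by
  intro s _ hs
  simp only [List.nodup_cons, List.mem_cons, List.not_mem_nil, or_false, not_or,
    List.nodup_nil, and_true, not_false_eq_true] at hd
  refine ⟨_, runs_push (by grind) (by grind) (by grind) (by grind) (by grind) (by grind)
    (by grind) (by grind) (by grind) (by rw [hs 0 (by omega), h0]) (by rw [hs t ht, ht0])
    (by rwa [hs b hb]) (by rwa [hs l hl, hs b hb, hs h hh]), ?_⟩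
  rw [hs l hl, hs b hb, hs h hh]
  exact agree_set hs hl' _

theorem trans_divmod {y b h t c : ℕ} (hd : [0, y, b, h, t, c].Nodup) (hy : y < K) (hb : b < K)
    (ht : t < K) (hc : c < K) (hy' : y < xs.length) (hh : h < xs.length) (h0 : xs.getD 0 0 = 0)
    (ht0 : xs.getD t 0 = 0) (hc0 : xs.getD c 0 = 0) (hb0 : xs.getD b 0 ≠ 0) :
    Trans K V (divmod y b h t c) xs
      ((xs.set h (xs.getD y 0 % xs.getD b 0)).set y (xs.getD y 0 / xs.getD b 0)) := by
  intro s hV hs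
  refine ⟨_, runs_divmod hd (by rw [hs 0 (by omega), h0]) (by rw [hs t ht, ht0])
    (by rw [hs c hc, hc0]) (by rwa [hs b hb]) (hV y) (hV b), ?_⟩
  rw [hs y hy, hs b hb]
  exact agree_set (agree_set hs hh _) (by simpa using hy') _

theorem trans_cond_pos {r : ℕ} (hr : r < K) (hr' : r < xs.length) (h : xs.getD r 0 ≠ 0)
    (hp : Trans K V p (xs.set r (xs.getD r 0 - 1)) ys) : Trans K V (.cond r p q) xs ys := by
  intro s hV hs
  obtain ⟨t, h1, h2⟩ := hp (s.set r (s r - 1)) (fun i => by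
    have := hV i; have := hV r
    rw [St.set_apply]; split_ifs <;> omega) (by rw [hs r hr]; exact agree_set hs hr' _)
  exact ⟨t, .cond_pos (by rwa [hs r hr]) h1, h2⟩

theorem trans_cond_zero {r : ℕ} (hr : r < K) (h : xs.getD r 0 = 0) (hq : Trans K V q xs ys) :
    Trans K V (.cond r p q) xs ys := by
  intro s hV hs
  obtain ⟨t, h1, h2⟩ := hq s hV hs
  exact ⟨t, .cond_zero (by rwa [hs r hr]) h1, h2⟩

theorem trans_ifnz_pos {r : ℕ} (hr : r < K) (h : xs.getD r 0 ≠ 0) (hp : Trans K V p xs ys) :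
    Trans K V (ifnz r p q) xs ys := by
  intro s hV hs
  obtain ⟨t, h1, h2⟩ := hp s hV hs
  exact ⟨t, runs_ifnz_pos (by rwa [hs r hr]) (hV r) h1, h2⟩

theorem trans_ifnz_zero {r : ℕ} (hr : r < K) (h : xs.getD r 0 = 0) (hq : Trans K V q xs ys) :
    Trans K V (ifnz r p q) xs ys := trans_cond_zero hr h hq

theorem trans_loop_zero {r : ℕ} (hr : r < K) (h : xs.getD r 0 = 0) :
    Trans K V (.loop r p) xs xs := fun s _ hs =>
  ⟨s, .loop_zero (by rwa [hs r hr]), hs⟩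

theorem trans_loop_pos {r : ℕ} (hr : r < K) (hr' : r < xs.length) (h : xs.getD r 0 ≠ 0)
    (hp : Trans K V p (xs.set r (xs.getD r 0 - 1)) ys) (hq : Trans K V (.loop r p) ys zs) :
    Trans K V (.loop r p) xs zs := by
  intro s hV hs
  have hV' : ∀ i, (s.set r (s r - 1)) i ≤ V := fun i => by
    have := hV i; have := hV r
    rw [St.set_apply]; split_ifs <;> omega
  obtain ⟨t, h1, h2⟩ := hp (s.set r (s r - 1)) hV' (by rw [hs r hr]; exact agree_set hs hr' _)
  obtain ⟨u, h3, h4⟩ := hq t (h1.le hV') h2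
  exact ⟨u, .loop_pos (by rwa [hs r hr]) h1 h3, h4⟩

theorem trans_while_pos {r : ℕ} (hr : r < K) (h : xs.getD r 0 ≠ 0)
    (hp : Trans K V p xs ys) (hq : Trans K V (while_ r p) ys zs) :
    Trans K V (while_ r p) xs zs := by
  intro s hV hs
  obtain ⟨t, h1, h2⟩ := hp s hV hs
  obtain ⟨u, h3, h4⟩ := hq t (h1.le hV) h2
  exact ⟨u, runs_while_pos (by rwa [hs r hr]) (hV r) h1 h3, h4⟩

theorem trans_while_zero {r : ℕ} (hr : r < K) (h : xs.getD r 0 = 0) :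
    Trans K V (while_ r p) xs xs := trans_loop_zero hr h

end

/-- A loop that always reaches another turn does not end. -/
theorem not_runs_loop {r : ℕ} {p : Prog} (I : St → Prop)
    (hI : ∀ s, I s → s r ≠ 0 ∧ ∃ V t, Runs V p (s.set r (s r - 1)) t ∧ I t) {s t : St} (hs : I s)
    {V : ℕ} : ¬ Runs V (.loop r p) s t := by
  rintro ⟨n, h⟩
  induction n using Nat.strong_induction_on generalizing s with
  | _ n ih =>
    obtain ⟨h0, W, u, ⟨_, h1⟩, h2⟩ := hI s hs
    cases h with
    | loop_zero h => exact h0 h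
    | loop_pos _ k1 k2 =>
      obtain ⟨-, rfl⟩ := h1.unique k1
      exact ih _ (by omega) h2 k2

/-- Every total computable function of three arguments is computed by a pure program in the
registers 11, 12, 13, with the value in register 14. -/
theorem exists_box {f : ℕ → ℕ → ℕ → ℕ} (hf : Computable fun t : ℕ × ℕ × ℕ => f t.1 t.2.1 t.2.2) :
    ∃ p : Prog, p.Pure ∧ ∀ i q h, ∃ V₀, ∀ V, V₀ ≤ V → ∀ xs : List ℕ, 14 < xs.length →
      xs.getD 0 0 = 0 → xs.getD 11 0 = i → xs.getD 12 0 = q → xs.getD 13 0 = h →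
      Trans 15 V p xs (xs.set 14 (f i q h)) := by
  have hv (i : Fin 3) : Computable fun v : List.Vector ℕ 3 => v.get i :=
    (Primrec.vector_get.comp Primrec.id (Primrec.const i)).to_comp
  have h1 : Computable fun v : List.Vector ℕ 3 => f (v.get 0) (v.get 1) (v.get 2) :=
    hf.comp ((hv 0).pair ((hv 1).pair (hv 2)))
  have h2 : Nat.Partrec' (fun v : List.Vector ℕ 3 => Part.some (f (v.get 0) (v.get 1) (v.get 2))) :=
    Nat.Partrec'.part_iff.2 h1
  obtain ⟨p, hp, hp'⟩ := computes_of_partrec' h2 11 (by norm_num)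
  refine ⟨p, hp, fun i q h => ?_⟩
  obtain ⟨V₀, hV₀⟩ := hp' (i ::ᵥ q ::ᵥ h ::ᵥ .nil) _ (Part.mem_some _)
  refine ⟨V₀, fun V hV xs hl h0 h11 h12 h13 s hsV hs => ?_⟩
  obtain ⟨t, k1, k2, k3⟩ := hV₀ V hV s (by rw [hs 0 (by norm_num), h0]) hsV (by
    intro j
    rw [hs _ (by omega)]
    fin_cases j <;> assumption)
  refine ⟨t, k1, fun r hr => ?_⟩
  rw [getD_set xs hl]
  split_ifs with h
  · subst h; exact k2
  · rw [k3 r (by omega), hs r hr]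

/-! ### A universal program -/

/-- The code of a tape symbol. -/
def sym : Symbol → ℕ
  | none => 1
  | some d => d + 2

/-- The symbol with a given code. -/
def unsym (h : ℕ) : Symbol := if h ≤ 1 then none else some (h - 2)

@[simp] theorem unsym_sym (a : Symbol) : unsym (sym a) = a := by cases a <;> simp [sym, unsym]

theorem sym_pos (a : Symbol) : 0 < sym a := by cases a <;> simp [sym]

/-- The code of a part of the tape. -/
def enc (B : ℕ) (l : List Symbol) : ℕ := l.foldr (fun a v => v * B + sym a) 0

@[simp] theorem enc_nil (B : ℕ) : enc B [] = 0 := rfl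
@[simp] theorem enc_cons (B : ℕ) (a : Symbol) (l : List Symbol) :
    enc B (a :: l) = enc B l * B + sym a := rfl

theorem enc_lt {B : ℕ} {l : List Symbol} (h : ∀ a ∈ l, sym a < B) :
    enc B l < B ^ l.length := by
  induction l with
  | nil => simp
  | cons a l ih =>
    simp only [List.mem_cons, forall_eq_or_imp] at h
    have h1 := ih h.2
    have h2 : (enc B l + 1) * B ≤ B ^ l.length * B := Nat.mul_le_mul_right _ h1
    rw [enc_cons, List.length_cons, pow_succ]
    nlinarith [h.1]

/-- Codes of symbols are positive, so no symbol vanishes as a leading zero. Hence the length of a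
part of the tape is bounded by the logarithm of the register that codes it. -/
theorem two_pow_le_enc {B : ℕ} (hB : 2 ≤ B) (l : List Symbol) :
    2 ^ l.length ≤ 2 * enc B l + 1 := by
  induction l with
  | nil => simp
  | cons a l ih =>
    have := sym_pos a
    have : enc B l * 2 ≤ enc B l * B := Nat.mul_le_mul_left _ hB
    rw [enc_cons, List.length_cons, pow_succ]
    omega

/-- Take the first symbol off the tape coded in register `l`. -/
def pop (l : ℕ) : Prog := .seq (divmod l 5 13 6 7) (ifnz 13 .skip (.inc 13))

/-- Set up the initial configuration. -/
def simInit (pb : Prog) : Prog :=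
  -- The copy of `x` is never used as data; it makes every run longer than `x`, see `lt_of_run_sim`.
  -- Afterwards the digits of `x` are stacked in register `3` and moved over to register `4`, which
  -- restores their order.
  .seq (copy 1 2) (.seq pb (.seq (copy 14 8) (.seq (copy 14 5) (.seq (addConst 5 2) (.seq (.inc 9)
    (.seq (.loop 9 (.seq (divmod 1 8 13 6 7) (.seq (addConst 13 2) (.seq (push 3 5 13 6)
      (ifnz 1 (.inc 9) .skip)))))
    (.seq (clr 13) (.seq (.inc 13) (.seq (push 4 5 13 6)
    (.seq (while_ 3 (.seq (divmod 3 5 13 6 7) (push 4 5 13 6)))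
    (.seq (divmod 4 5 13 6 7) (.seq (clr 8) (.inc 8)))))))))))))

/-- Execute one step of the simulated machine. -/
def simStep (pa pw pn : Prog) : Prog :=
  -- Register `8` holds `0` if no instruction applies, and otherwise the code of the move plus one.
  -- The outer test removes the one, the inner tests tell the moves apart, and finally the register
  -- is the flag of the main loop again.
  .seq pa (.seq (copy 14 8) (.cond 8 (.seq pw (.seq (copy 14 9) (.seq pn (.seq (copy 14 10)
    (.seq (.cond 8 (.cond 8 (.seq (push 3 5 9 6) (pop 4)) (copy 9 13)) (.seq (push 4 5 9 6) (pop 3)))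
      (.seq (copy 10 12) (.inc 8))))))) .skip))

/-- The simulation of a machine. -/
def sim (pb pa pw pn : Prog) : Prog := .seq (simInit pb) (.loop 8 (simStep pa pw pn))

theorem pure_sim {pb pa pw pn : Prog} (hb : pb.Pure) (ha : pa.Pure) (hw : pw.Pure) (hn : pn.Pure) :
    (sim pb pa pw pn).Pure := by
  have h1 (a b c d : ℕ) : (push a b c d).Pure := by simp [push]
  have h2 (a b c d e : ℕ) : (divmod a b c d e).Pure := by simp [divmod]
  simp [sim, simInit, simStep, pop, hb, ha, hw, hn, h1, h2]

/-- The registers that represent a configuration. -/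
def simState (B i x : ℕ) (c : Config) (f w n o : ℕ) : List ℕ :=
  -- `0`, `6` and `7` are temporary registers, `1` held the input, `8` is the loop flag, `9` and
  -- `10` receive the symbol to be written and the next state, and `14` the values of the component
  -- programs, whose arguments are in `11`, `12` and `13`.
  [0, 0, x, enc B c.left, enc B c.right, B, 0, 0, f, w, n, i, c.state, sym c.head, o]

/-- The symbols of a configuration have codes below `B`. -/
def Config.Below (B : ℕ) (c : Config) : Prop :=
  (∀ a ∈ c.left, sym a < B) ∧ sym c.head < B ∧ ∀ a ∈ c.right, sym a < B

/-- The move of the instruction to be executed; `0` if there is none. -/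
def actCode (m : Machine) (q h : ℕ) : ℕ := (look m q (unsym h)).elim 0 fun i => i.move.code + 1
/-- The symbol to be written. -/
def writeCode (m : Machine) (q h : ℕ) : ℕ := (look m q (unsym h)).elim 0 fun i => sym i.write
/-- The next state. -/
def nextCode (m : Machine) (q h : ℕ) : ℕ := (look m q (unsym h)).elim 0 fun i => i.next

/-- Above the bound `V`, the program `p` computes `f` at the given arguments. -/
def BoxAt (V : ℕ) (p : Prog) (f : ℕ → ℕ → ℕ → ℕ) (i q h : ℕ) : Prop :=
  ∀ xs : List ℕ, 14 < xs.length → xs.getD 0 0 = 0 → xs.getD 11 0 = i → xs.getD 12 0 = q →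
    xs.getD 13 0 = h → Trans 15 V p xs (xs.set 14 (f i q h))

section

variable {E : ℕ → Machine} {pb pa pw pn : Prog} {V B i x : ℕ}

/-- A remainder `0` is not the code of a symbol and means that the stack is empty; it is raised to
`1`, the code of the blank found beyond the used tape. -/
theorem trans_pop_left {a2 a4 a8 a9 a10 a12 a13 a14 : ℕ} (l : List Symbol)
    (hB : 1 < B) (hl : ∀ a ∈ l, sym a < B) (hV : 1 ≤ V) :
    Trans 15 V (pop 3) [0, 0, a2, enc B l, a4, B, 0, 0, a8, a9, a10, i, a12, a13, a14]
      [0, 0, a2, enc B l.tail, a4, B, 0, 0, a8, a9, a10, i, a12, sym (l.head?.getD none), a14] := by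
  refine .seq (trans_divmod (by decide) (by decide) (by decide) (by decide) (by decide) (by simp)
    (by simp) rfl rfl rfl (by simp; omega)) ?_
  simp only [List.set, List.getD_cons_succ, List.getD_cons_zero]
  cases l with
  | nil =>
    refine trans_ifnz_zero (by decide) (by simp) ?_
    have := trans_inc (K := 15) (V := V) (l := 13)
      (xs := [0, 0, a2, 0, a4, B, 0, 0, a8, a9, a10, i, a12, 0, a14]) (by simp) (by decide) hV
    simpa [sym] using this
  | cons a l =>
    have h1 : (enc B l * B + sym a) % B = sym a := by
      rw [mul_comm, Nat.mul_add_mod, Nat.mod_eq_of_lt (hl a (by simp))]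
    have h2 : (enc B l * B + sym a) / B = enc B l := by
      rw [mul_comm, Nat.mul_add_div (by omega), Nat.div_eq_of_lt (hl a (by simp)), add_zero]
    rw [enc_cons, h1, h2]
    exact trans_ifnz_pos (by decide) (by simpa using (sym_pos a).ne') .skip

theorem trans_pop_right {a2 a3 a8 a9 a10 a12 a13 a14 : ℕ} (l : List Symbol)
    (hB : 1 < B) (hl : ∀ a ∈ l, sym a < B) (hV : 1 ≤ V) :
    Trans 15 V (pop 4) [0, 0, a2, a3, enc B l, B, 0, 0, a8, a9, a10, i, a12, a13, a14]
      [0, 0, a2, a3, enc B l.tail, B, 0, 0, a8, a9, a10, i, a12, sym (l.head?.getD none), a14] := by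
  refine .seq (trans_divmod (by decide) (by decide) (by decide) (by decide) (by decide) (by simp)
    (by simp) rfl rfl rfl (by simp; omega)) ?_
  simp only [List.set, List.getD_cons_succ, List.getD_cons_zero]
  cases l with
  | nil =>
    refine trans_ifnz_zero (by decide) (by simp) ?_
    have := trans_inc (K := 15) (V := V) (l := 13)
      (xs := [0, 0, a2, a3, 0, B, 0, 0, a8, a9, a10, i, a12, 0, a14]) (by simp) (by decide) hV
    simpa [sym] using this
  | cons a l =>
    have h1 : (enc B l * B + sym a) % B = sym a := by
      rw [mul_comm, Nat.mul_add_mod, Nat.mod_eq_of_lt (hl a (by simp))]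
    have h2 : (enc B l * B + sym a) / B = enc B l := by
      rw [mul_comm, Nat.mul_add_div (by omega), Nat.div_eq_of_lt (hl a (by simp)), add_zero]
    rw [enc_cons, h1, h2]
    exact trans_ifnz_pos (by decide) (by simpa using (sym_pos a).ne') .skip

theorem trans_step_halt {c : Config} {w n o : ℕ} (hc : (E i).step c = none)
    (ha : BoxAt V pa (fun i q h => actCode (E i) q h) i c.state (sym c.head)) :
    Trans 15 V (simStep pa pw pn) (simState B i x c 0 w n o) (simState B i x c 0 w n 0) := by
  have h0 : actCode (E i) c.state (sym c.head) = 0 := by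
    rw [step_eq_look, Option.map_eq_none_iff] at hc
    simp [actCode, hc]
  refine .seq (ha _ (by simp [simState]) rfl rfl rfl rfl) ?_
  simp only [simState, List.set, h0]
  refine .seq (trans_copy (by decide) (by simp) (by decide) (by decide) (by decide) rfl) ?_
  simp only [List.set, List.getD_cons_succ, List.getD_cons_zero]
  exact trans_cond_zero (by decide) rfl .skip

/-- The bound `B ^ (c.size + 1)` leaves room for one further symbol on either stack, and a move
pushes just one. -/
theorem trans_step {c c' : Config} {w n o : ℕ} (hc : (E i).step c = some c') (hB : 1 < B)
    (hcB : c.Below B) (hc' : c'.Below B) (hV : B ^ (c.size + 1) ≤ V)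
    (ha : BoxAt V pa (fun i q h => actCode (E i) q h) i c.state (sym c.head))
    (hw : BoxAt V pw (fun i q h => writeCode (E i) q h) i c.state (sym c.head))
    (hn : BoxAt V pn (fun i q h => nextCode (E i) q h) i c.state (sym c.head)) :
    ∃ w' n' o', Trans 15 V (simStep pa pw pn) (simState B i x c 0 w n o)
      (simState B i x c' 1 w' n' o') := by
  have hBV : B ≤ V := (Nat.le_self_pow (by omega) B).trans hV
  rw [step_eq_look, Option.map_eq_some_iff] at hc
  obtain ⟨ins, hi, rfl⟩ := hc
  have e1 : actCode (E i) c.state (sym c.head) = ins.move.code + 1 := by simp [actCode, hi]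
  have e2 : writeCode (E i) c.state (sym c.head) = sym ins.write := by simp [writeCode, hi]
  have e3 : nextCode (E i) c.state (sym c.head) = ins.next := by simp [nextCode, hi]
  -- The symbol written is still on the tape in the next configuration, wherever the head went.
  have hwB : sym ins.write < B := by
    rw [exec_eq] at hc'
    split_ifs at hc'
    · exact hc'.2.1
    · exact hc'.2.2 _ (by simp)
    · exact hc'.1 _ (by simp)
  have hpush (l : List Symbol) (hl : ∀ a ∈ l, sym a < B) (hs : l.length ≤ c.size) :
      enc B l * B + sym ins.write ≤ V := by
    have h1 := enc_lt (B := B) hl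
    have h2 : (enc B l + 1) * B ≤ B ^ l.length * B := Nat.mul_le_mul_right _ h1
    rw [← pow_succ] at h2
    have h3 : B ^ (l.length + 1) ≤ B ^ (c.size + 1) :=
      Nat.pow_le_pow_right (by omega) (Nat.succ_le_succ hs)
    have h4 : (enc B l + 1) * B = enc B l * B + B := by ring
    omega
  have hL := hpush c.left hcB.1 (by simp [Config.size]; omega)
  have hR := hpush c.right hcB.2.2 (by simp [Config.size])
  refine ⟨sym ins.write, ins.next, ins.next, ?_⟩
  refine .seq (ha _ (by simp [simState]) rfl rfl rfl rfl) ?_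
  simp only [simState, List.set, e1]
  refine .seq (trans_copy (by decide) (by simp) (by decide) (by decide) (by decide) rfl) ?_
  simp only [List.set, List.getD_cons_succ, List.getD_cons_zero]
  refine trans_cond_pos (by decide) (by simp) (by simp) ?_
  simp only [List.set, List.getD_cons_succ, List.getD_cons_zero, Nat.add_sub_cancel]
  refine .seq (hw _ (by simp) rfl rfl rfl rfl) ?_
  simp only [List.set, e2]
  refine .seq (trans_copy (by decide) (by simp) (by decide) (by decide) (by decide) rfl) ?_
  simp only [List.set, List.getD_cons_succ, List.getD_cons_zero]
  refine .seq (hn _ (by simp) rfl rfl rfl rfl) ?_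
  simp only [List.set, e3]
  refine .seq (trans_copy (by decide) (by simp) (by decide) (by decide) (by decide) rfl) ?_
  simp only [List.set, List.getD_cons_succ, List.getD_cons_zero]
  have hmid : Trans 15 V (.cond 8 (.cond 8 (.seq (push 3 5 9 6) (pop 4)) (copy 9 13))
      (.seq (push 4 5 9 6) (pop 3)))
      [0, 0, x, enc B c.left, enc B c.right, B, 0, 0, ins.move.code, sym ins.write, ins.next, i,
        c.state, sym c.head, ins.next]
      [0, 0, x, enc B (ins.exec c).left, enc B (ins.exec c).right, B, 0, 0, 0, sym ins.write,
        ins.next, i, c.state, sym (ins.exec c).head, ins.next] := by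
    have hcode : ins.move.code < 3 := (Move.equivFin ins.move).2
    rw [exec_eq]
    split_ifs with h1 h2
    · rw [h1]
      refine trans_cond_pos (by decide) (by simp) (by simp) ?_
      simp only [List.set, List.getD_cons_succ, List.getD_cons_zero, Nat.sub_self]
      refine trans_cond_zero (by decide) rfl ?_
      exact trans_copy (by decide) (by simp) (by decide) (by decide) (by decide) rfl
    · rw [h2]
      refine trans_cond_zero (by decide) rfl ?_
      refine .seq (trans_push (by decide) (by decide) (by decide) (by decide) (by decide) (by simp)
        rfl rfl (by simp; omega) (by simpa using hR)) ?_
      simp only [List.set, List.getD_cons_succ, List.getD_cons_zero]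
      exact trans_pop_left _ hB hcB.1 (by omega)
    · have h3 : ins.move.code = 2 := by omega
      rw [h3]
      refine trans_cond_pos (by decide) (by simp) (by simp) ?_
      simp only [List.set, List.getD_cons_succ, List.getD_cons_zero, Nat.reduceSub]
      refine trans_cond_pos (by decide) (by simp) (by simp) ?_
      simp only [List.set, List.getD_cons_succ, List.getD_cons_zero, Nat.reduceSub]
      refine .seq (trans_push (by decide) (by decide) (by decide) (by decide) (by decide) (by simp)
        rfl rfl (by simp; omega) (by simpa using hL)) ?_
      simp only [List.set, List.getD_cons_succ, List.getD_cons_zero]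
      exact trans_pop_right _ hB hcB.2.2 (by omega)
  refine .seq hmid ?_
  refine .seq (trans_copy (by decide) (by simp) (by decide) (by decide) (by decide) rfl) ?_
  simp only [List.set, List.getD_cons_succ, List.getD_cons_zero]
  have := trans_inc (K := 15) (V := V) (l := 8) (xs := [0, 0, x, enc B (ins.exec c).left,
    enc B (ins.exec c).right, B, 0, 0, 0, sym ins.write, ins.next, i, ins.next,
    sym (ins.exec c).head, ins.next]) (by simp) (by decide) (by simp; omega)
  have hst : (ins.exec c).state = ins.next := by rw [exec_eq]; split_ifs <;> rfl
  rw [hst]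
  simpa using this

end

theorem word_of_lt {b y : ℕ} (h : y < b) : word b y = [y] := by
  rw [word]
  split_ifs with h0
  · rw [h0]
  · exact Nat.digits_of_lt b y h0 h

theorem word_of_le {b y : ℕ} (hb : 1 < b) (h : b ≤ y) : word b y = y % b :: word b (y / b) := by
  have h1 : y / b ≠ 0 := (Nat.div_pos h (by omega)).ne'
  rw [word, word, if_neg (by omega), if_neg h1, Nat.digits_def' hb (by omega)]

section

variable {E : ℕ → Machine} {pb pa pw pn : Prog} {V B i x : ℕ}

theorem enc_mul_add_le {l : List Symbol} {a : ℕ} (hl : ∀ a ∈ l, sym a < B) (ha : a < B)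
    (hV : B ^ (l.length + 1) ≤ V) : enc B l * B + a ≤ V := by
  have h1 := enc_lt hl
  have h2 : (enc B l + 1) * B ≤ B ^ l.length * B := Nat.mul_le_mul_right _ h1
  rw [← pow_succ] at h2
  have h3 : (enc B l + 1) * B = enc B l * B + B := by ring
  omega

/-- Division yields the digits in the order of the tape, and stacking reverses them. The flag in
register `9` is set before the first division, so the number `0` contributes its single digit, as in
`word`. -/
theorem trans_digits {b a10 a14 : ℕ} (hb : 1 < b) (hBb : B = b + 2) (y : ℕ) :
    ∀ (l : List Symbol) (h : ℕ), (∀ a ∈ l, sym a < B) → B ^ (l.length + (word b y).length + 1) ≤ V →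
    ∃ h', Trans 15 V (.loop 9 (.seq (divmod 1 8 13 6 7) (.seq (addConst 13 2) (.seq (push 3 5 13 6)
      (ifnz 1 (.inc 9) .skip)))))
      [0, y, x, enc B l, 0, B, 0, 0, b, 1, a10, i, 0, h, a14]
      [0, 0, x, enc B (((word b y).map some).reverse ++ l), 0, B, 0, 0, b, 0, a10, i, 0, h', a14] := by
  induction y using Nat.strong_induction_on with
  | _ y ih =>
    intro l h hl hV
    have hBV : B ≤ V := (Nat.le_self_pow (by omega) B).trans hV
    have hm : y % b < b := Nat.mod_lt _ (by omega)
    have hVl : B ^ (l.length + 1) ≤ V :=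
      (Nat.pow_le_pow_right (by omega) (by omega)).trans hV
    have hp := enc_mul_add_le (a := y % b + 2) hl (by omega) hVl
    have hbody {z : ℕ} (hz : Trans 15 V (ifnz 1 (.inc 9) .skip)
        [0, y / b, x, enc B (some (y % b) :: l), 0, B, 0, 0, b, 0, a10, i, 0, y % b + 2, a14]
        [0, y / b, x, enc B (some (y % b) :: l), 0, B, 0, 0, b, z, a10, i, 0, y % b + 2, a14]) :
        Trans 15 V (.seq (divmod 1 8 13 6 7) (.seq (addConst 13 2) (.seq (push 3 5 13 6)
          (ifnz 1 (.inc 9) .skip))))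
          [0, y, x, enc B l, 0, B, 0, 0, b, 0, a10, i, 0, h, a14]
          [0, y / b, x, enc B (some (y % b) :: l), 0, B, 0, 0, b, z, a10, i, 0, y % b + 2, a14] := by
      refine .seq (trans_divmod (by decide) (by decide) (by decide) (by decide) (by decide)
        (by simp) (by simp) rfl rfl rfl (by simp; omega)) ?_
      simp only [List.set, List.getD_cons_succ, List.getD_cons_zero]
      refine .seq (trans_addConst (by simp) (by decide) (by simp; omega)) ?_
      simp only [List.set, List.getD_cons_succ, List.getD_cons_zero]
      refine .seq (trans_push (by decide) (by decide) (by decide) (by decide) (by decide) (by simp)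
        rfl rfl (by simp; omega) (by simpa using hp)) ?_
      simp only [List.set, List.getD_cons_succ, List.getD_cons_zero]
      exact hz
    by_cases hy : y < b
    · refine ⟨y % b + 2, trans_loop_pos (by decide) (by simp) (by simp) ?_
        (trans_loop_zero (by decide) rfl)⟩
      simp only [List.set, List.getD_cons_succ, List.getD_cons_zero, Nat.sub_self]
      have := hbody (trans_ifnz_zero (by decide) (Nat.div_eq_of_lt hy) .skip)
      rw [Nat.div_eq_of_lt hy] at this
      rw [word_of_lt hy]
      rw [Nat.mod_eq_of_lt hy] at this ⊢
      exact this
    · have hy' : y / b ≠ 0 := (Nat.div_pos (by omega) (by omega)).ne'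
      have hw := word_of_le hb (not_lt.1 hy)
      rw [hw] at hV ⊢
      obtain ⟨h', k⟩ := ih (y / b) (Nat.div_lt_self (by omega) hb) (some (y % b) :: l) (y % b + 2)
        (by
          simp only [List.mem_cons, forall_eq_or_imp]
          exact ⟨by simp only [sym]; omega, hl⟩) (by
          convert hV using 2
          simp only [List.length_cons]; omega)
      refine ⟨h', trans_loop_pos (by decide) (by simp) (by simp) (hbody (z := 1)
        (trans_ifnz_pos (by decide) (by simpa using hy') ?_)) ?_⟩
      · have := trans_inc (K := 15) (V := V) (l := 9) (xs :=
          [0, y / b, x, enc B (some (y % b) :: l), 0, B, 0, 0, b, 0, a10, i, 0, y % b + 2, a14])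
          (by simp) (by decide) (by simp; omega)
        simpa using this
      · convert k using 4
        simp

/-- The loop can test the stack itself, because the code of a nonempty stack is not zero. -/
theorem trans_reverse {a8 a9 a10 a12 a14 : ℕ} (hB : 1 < B) (l : List Symbol) :
    ∀ (r : List Symbol) (h : ℕ), (∀ a ∈ l, sym a < B) → (∀ a ∈ r, sym a < B) →
      B ^ (l.length + r.length) ≤ V →
      ∃ h', Trans 15 V (while_ 3 (.seq (divmod 3 5 13 6 7) (push 4 5 13 6)))
        [0, 0, x, enc B l, enc B r, B, 0, 0, a8, a9, a10, i, a12, h, a14]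
        [0, 0, x, 0, enc B (l.reverse ++ r), B, 0, 0, a8, a9, a10, i, a12, h', a14] := by
  induction l with
  | nil => exact fun r h _ _ _ => ⟨h, trans_while_zero (by decide) rfl⟩
  | cons a l ih =>
    intro r h hl hr hV
    simp only [List.mem_cons, forall_eq_or_imp] at hl
    obtain ⟨h', k⟩ := ih (a :: r) (sym a) hl.2 (by simpa using ⟨hl.1, hr⟩) (by
      convert hV using 2
      simp only [List.length_cons]; omega)
    refine ⟨h', ?_⟩
    refine trans_while_pos (by decide) (by have := sym_pos a; simp; omega) ?_ (by simpa using k)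
    have h1 : (enc B l * B + sym a) % B = sym a := by
      rw [mul_comm, Nat.mul_add_mod, Nat.mod_eq_of_lt hl.1]
    have h2 : (enc B l * B + sym a) / B = enc B l := by
      rw [mul_comm, Nat.mul_add_div (by omega), Nat.div_eq_of_lt hl.1, add_zero]
    refine .seq (trans_divmod (by decide) (by decide) (by decide) (by decide) (by decide)
        (by simp) (by simp) rfl rfl rfl (by simp; omega)) ?_
    simp only [List.set, List.getD_cons_succ, List.getD_cons_zero, enc_cons, h1, h2]
    have hp := enc_mul_add_le (a := sym a) (V := V) hr hl.1
      ((Nat.pow_le_pow_right (by omega) (by rw [List.length_cons]; omega)).trans hV)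
    exact trans_push (by decide) (by decide) (by decide) (by decide) (by decide) (by simp)
        rfl rfl (by simp; omega) (by simpa using hp)

/-- The `1` at the bottom of the right stack is the blank that terminates the input word; the
topmost symbol is taken off as the scanned one. -/
theorem trans_init (hb : 1 < (E i).base) (hBb : B = (E i).base + 2)
    (hbox : BoxAt V pb (fun i _ _ => (E i).base) i 0 0)
    (hV : B ^ ((E i).init [x]).size ≤ V) :
    ∃ o, Trans 15 V (simInit pb) [0, x, 0, 0, 0, 0, 0, 0, 0, 0, 0, i, 0, 0, 0]
      (simState B i x ((E i).init [x]) 1 0 0 o) := by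
  obtain ⟨b, hbE⟩ : ∃ b, b = (E i).base := ⟨_, rfl⟩
  rw [← hbE] at hb hBb
  obtain ⟨d, w, hw⟩ : ∃ d w, word b x = d :: w := List.exists_cons_of_ne_nil (word_ne_nil x)
  have hlt : ∀ a ∈ (word b x).map some, sym a < B := by
    simp only [List.mem_map, forall_exists_index, and_imp, forall_apply_eq_imp_iff₂, sym]
    intro a ha
    have := word_lt (by omega) x a ha
    omega
  have hsize : ((E i).init [x]).size = (word b x).length + 1 := by
    simp [Config.size, Machine.init, inputTape, ← hbE, hw]
    omega
  rw [hsize] at hV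
  have hBV : B ≤ V := (Nat.le_self_pow (by omega) B).trans hV
  obtain ⟨h₁, k₁⟩ := trans_digits (V := V) (x := x) (i := i) (a10 := 0) (a14 := b) hb hBb x [] 0 (by simp) (by simpa using hV)
  obtain ⟨h₂, k₂⟩ := trans_reverse (V := V) (x := x) (i := i) (a8 := b) (a9 := 0) (a10 := 0) (a12 := 0) (a14 := b)
    (by omega : 1 < B) ((word b x).map some).reverse [none] 1 (by simpa using hlt) (by simp [sym]; omega)
    (by simpa using hV)
  have hn : enc B [none] = 1 := by simp [sym]
  rw [hn] at k₂
  refine ⟨b, ?_⟩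
  refine .seq (trans_copy (by decide) (by simp) (by decide) (by decide) (by decide) rfl) ?_
  simp only [List.set, List.getD_cons_succ, List.getD_cons_zero]
  refine .seq (hbox _ (by simp) rfl rfl rfl rfl) ?_
  simp only [List.set, ← hbE]
  refine .seq (trans_copy (by decide) (by simp) (by decide) (by decide) (by decide) rfl) ?_
  simp only [List.set, List.getD_cons_succ, List.getD_cons_zero]
  refine .seq (trans_copy (by decide) (by simp) (by decide) (by decide) (by decide) rfl) ?_
  simp only [List.set, List.getD_cons_succ, List.getD_cons_zero]
  refine .seq (trans_addConst (by simp) (by decide) (by simp; omega)) ?_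
  simp only [List.set, List.getD_cons_succ, List.getD_cons_zero, ← hBb]
  refine .seq (trans_inc (by simp) (by decide) (by simp; omega)) ?_
  simp only [List.set, List.getD_cons_succ, List.getD_cons_zero, zero_add]
  refine .seq k₁ ?_
  refine .seq (trans_clr (by simp)) ?_
  simp only [List.set]
  refine .seq (trans_inc (by simp) (by decide) (by simp; omega)) ?_
  simp only [List.set, List.getD_cons_succ, List.getD_cons_zero, zero_add]
  refine .seq (trans_push (by decide) (by decide) (by decide) (by decide) (by decide) (by simp)
        rfl rfl (by simp; omega) (by simp; omega)) ?_
  simp only [List.set, List.getD_cons_succ, List.getD_cons_zero, zero_add, zero_mul]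
  rw [List.append_nil]
  refine .seq k₂ ?_
  refine .seq (trans_divmod (by decide) (by decide) (by decide) (by decide) (by decide)
        (by simp) (by simp) rfl rfl rfl (by simp; omega)) ?_
  simp only [List.set, List.getD_cons_succ, List.getD_cons_zero]
  refine .seq (trans_clr (by simp)) ?_
  simp only [List.set]
  have hd : sym (some d) < B := hlt _ (by simp [hw])
  have h1 (e : ℕ) : (e * B + sym (some d)) % B = sym (some d) := by
    rw [mul_comm, Nat.mul_add_mod, Nat.mod_eq_of_lt hd]
  have h2 (e : ℕ) : (e * B + sym (some d)) / B = e := by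
    rw [mul_comm, Nat.mul_add_div (by omega), Nat.div_eq_of_lt hd, add_zero]
  have e1 : ((E i).init [x]).right = w.map some ++ [none] := by simp [Machine.init, inputTape, ← hbE, hw]
  have e2 : ((E i).init [x]).head = some d := by simp [Machine.init, inputTape, ← hbE, hw]
  rw [hw, List.reverse_reverse, List.map_cons, List.cons_append, enc_cons, h1, h2]
  simp only [simState, e1, e2]
  have := trans_inc (K := 15) (V := V) (l := 8) (xs :=
    [0, 0, x, 0, enc B (w.map some ++ [none]), B, 0, 0, 0, 0, 0, i, 0, sym (some d), b])
    (by simp) (by decide) (by simp; omega)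
  simpa [Machine.init] using this

end

/-! ### Correctness of the universal program -/

/-- The registers with the arguments `i` and `x` of a simulation. -/
def input (i x : ℕ) : St := ⟨fun r => if r = 11 then i else if r = 1 then x else 0, [], []⟩

theorem input_eq (i x r : ℕ) :
    (input i x) r = [0, x, 0, 0, 0, 0, 0, 0, 0, 0, 0, i, 0, 0, 0].getD r 0 := by
  simp only [input]
  by_cases h : r < 15
  · interval_cases r <;> rfl
  · rw [if_neg (by omega), if_neg (by omega), List.getD_eq_default _ _ (by simp; omega)]

theorem size_le_of_step {m : Machine} {c c' : Config} (h : m.step c = some c') :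
    c.size ≤ c'.size := by
  rw [step_eq_look, Option.map_eq_some_iff] at h
  obtain ⟨ins, -, rfl⟩ := h
  rw [exec_eq]
  split_ifs <;> simp only [Config.size, List.length_tail, List.length_cons] <;> omega

theorem size_le_of_reaches {m : Machine} {c c' : Config} (h : Reaches m.step c c') :
    c.size ≤ c'.size := by
  induction h with
  | refl => rfl
  | tail _ h ih => exact ih.trans (size_le_of_step h)

theorem below_of_step {m : Machine} (hm : m.Valid) {c c' : Config} (h : m.step c = some c')
    (hc : c.Below (m.base + 2)) : c'.Below (m.base + 2) := by
  rw [step_eq_look, Option.map_eq_some_iff] at h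
  obtain ⟨ins, hi, rfl⟩ := h
  have hw : sym ins.write < m.base + 2 := by
    have := hm.2 ins (List.mem_of_find?_eq_some hi)
    cases hw : ins.write with
    | none => simp [sym]
    | some d =>
      have := this d hw
      simp only [sym]; omega
  have hd (l : List Symbol) (hl : ∀ a ∈ l, sym a < m.base + 2) :
      sym (l.head?.getD none) < m.base + 2 := by
    cases l with
    | nil => simp [sym]
    | cons a l => simpa using hl a (by simp)
  have hcons (l : List Symbol) (hl : ∀ a ∈ l, sym a < m.base + 2) :
      ∀ a ∈ ins.write :: l, sym a < m.base + 2 := by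
    simpa using ⟨hw, hl⟩
  have htail (l : List Symbol) (hl : ∀ a ∈ l, sym a < m.base + 2) :
      ∀ a ∈ l.tail, sym a < m.base + 2 := fun a ha => hl a (List.mem_of_mem_tail ha)
  rw [exec_eq]
  split_ifs
  · exact ⟨hc.1, hw, hc.2.2⟩
  · exact ⟨htail _ hc.1, hd _ hc.1, hcons _ hc.2.2⟩
  · exact ⟨hcons _ hc.1, hd _ hc.2.2, htail _ hc.2.2⟩

theorem below_init {m : Machine} (hm : m.Valid) (x : ℕ) : (m.init [x]).Below (m.base + 2) := by
  have h : ∀ a ∈ inputTape m.base [x], sym a < m.base + 2 := by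
    simp only [inputTape, List.flatMap_cons, List.flatMap_nil, List.append_nil, List.mem_append,
      List.mem_map, List.mem_singleton]
    rintro a (⟨d, hd, rfl⟩ | rfl)
    · have := word_lt hm.1 x d hd
      simp only [sym]; omega
    · simp [sym]
  refine ⟨by simp [Machine.init], ?_, fun a ha => h a (List.mem_of_mem_tail ha)⟩
  rw [Machine.init]
  cases hl : inputTape m.base [x] with
  | nil => simp [sym]
  | cons a l => simpa using h a (by simp [hl])

/-- A bound for the states of a machine. -/
def Machine.stateBound (m : Machine) : ℕ := (m.program.map Instr.next).sum

/-- Only finitely many states are ever entered; therefore the room needed by the component programs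
does not depend on the input. -/
theorem state_le_of_step {m : Machine} {c c' : Config} (h : m.step c = some c') :
    c'.state ≤ m.stateBound := by
  rw [step_eq_look, Option.map_eq_some_iff] at h
  obtain ⟨ins, hi, rfl⟩ := h
  have : (ins.exec c).state = ins.next := by rw [exec_eq]; split_ifs <;> rfl
  rw [this]
  exact List.single_le_sum (by simp) _ (List.mem_map_of_mem (List.mem_of_find?_eq_some hi))

/-- `m` reaches `c` from the input `x`. -/
theorem inv_of_reaches {m : Machine} (hm : m.Valid) {x : ℕ} {c : Config}
    (h : Reaches m.step (m.init [x]) c) : c.Below (m.base + 2) ∧ c.state ≤ m.stateBound := by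
  induction h with
  | refl => exact ⟨below_init hm x, Nat.zero_le _⟩
  | tail _ h ih => exact ⟨below_of_step hm h ih.1, state_le_of_step h⟩

theorem primrec_unsym : Primrec unsym :=
  (Primrec.ite (Primrec.nat_le.comp Primrec.id (Primrec.const 1)) (Primrec.const none)
    (Primrec.option_some.comp (Primrec.nat_sub.comp Primrec.id (Primrec.const 2)))).of_eq
    fun _ => rfl

theorem primrec_sym : Primrec sym := by
  have := Primrec.option_casesOn (o := fun a : Symbol => a) (f := fun _ => 1)
    (g := fun _ d => d + 2) Primrec.id (Primrec.const 1)
    (Primrec.nat_add.comp Primrec.snd (Primrec.const 2))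
  exact this.of_eq fun a => by cases a <;> rfl

theorem computable_look_elim {E : ℕ → Machine} (hE : Computable E) {g : Instr → ℕ}
    (hg : Primrec g) :
    Computable fun t : ℕ × ℕ × ℕ => (look (E t.1) t.2.1 (unsym t.2.2)).elim 0 g := by
  have hlook : Computable fun t : ℕ × ℕ × ℕ => look (E t.1) t.2.1 (unsym t.2.2) :=
    Computable.comp (g := fun t : ℕ × ℕ × ℕ => (E t.1, t.2.1, unsym t.2.2)) primrec_look.to_comp
      ((hE.comp Computable.fst).pair ((Computable.fst.comp Computable.snd).pair
        (primrec_unsym.to_comp.comp (Computable.snd.comp Computable.snd))))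
  exact (Computable.option_casesOn hlook (Computable.const 0)
    (hg.to_comp.comp Computable.snd).to₂).of_eq fun t => by
      cases look (E t.1) t.2.1 (unsym t.2.2) <;> rfl

/-- The programs from which the universal program is composed. -/
theorem exists_boxes {E : ℕ → Machine} (hE : Computable E) : ∃ pb pa pw pn : Prog,
    pb.Pure ∧ pa.Pure ∧ pw.Pure ∧ pn.Pure ∧ ∃ W : ℕ → ℕ → ℕ → ℕ, ∀ i q h V, W i q h ≤ V →
      BoxAt V pb (fun i _ _ => (E i).base) i q h ∧
      BoxAt V pa (fun i q h => actCode (E i) q h) i q h ∧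
      BoxAt V pw (fun i q h => writeCode (E i) q h) i q h ∧
      BoxAt V pn (fun i q h => nextCode (E i) q h) i q h := by
  obtain ⟨pb, pb1, pb2⟩ := exists_box (f := fun i _ _ => (E i).base)
    (primrec_machine_base.to_comp.comp (hE.comp Computable.fst))
  obtain ⟨pa, pa1, pa2⟩ := exists_box (f := fun i q h => actCode (E i) q h)
    (computable_look_elim hE (Primrec.succ.comp (primrec_move_code.comp primrec_instr_move)))
  obtain ⟨pw, pw1, pw2⟩ := exists_box (f := fun i q h => writeCode (E i) q h)
    (computable_look_elim hE (primrec_sym.comp primrec_instr_write))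
  obtain ⟨pn, pn1, pn2⟩ := exists_box (f := fun i q h => nextCode (E i) q h)
    (computable_look_elim hE primrec_instr_next)
  choose Vb hVb using pb2
  choose Va hVa using pa2
  choose Vw hVw using pw2
  choose Vn hVn using pn2
  exact ⟨pb, pa, pw, pn, pb1, pa1, pw1, pn1, fun i q h => Vb i q h + Va i q h + Vw i q h + Vn i q h,
    fun i q h V hV => by
      dsimp only at hV
      exact ⟨hVb _ _ _ V (by omega), hVa _ _ _ V (by omega), hVw _ _ _ V (by omega),
        hVn _ _ _ V (by omega)⟩⟩

/-- The initial copy fills a register that starts with `0`, which takes at least `x` steps. So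
halting within `2 ^ s` steps forces `len x ≤ s`, and bounds linear in `len x` become harmless. -/
theorem lt_of_run_sim {pb pa pw pn : Prog} {i x V n : ℕ} {t : St}
    (h : Run V (sim pb pa pw pn) n (input i x) t) : x < n := by
  have h0 : Runs x (copy 1 2) (input i x) ((input i x).set 2 x) :=
    runs_copy (s := input i x) (by decide) (by decide) (by decide) rfl le_rfl
  obtain ⟨k, h0⟩ := h0
  rw [sim, simInit] at h
  cases h with
  | seq h _ =>
    cases h with
    | seq h _ =>
      obtain ⟨rfl, -⟩ := h0.unique h
      have := h0.le_add 2
      rw [St.set_same] at this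
      have e : (input i x) 2 = 0 := rfl
      omega

theorem lt_pow_length_word {b : ℕ} (hb : 1 < b) (x : ℕ) : x < b ^ (word b x).length := by
  rw [length_word hb]
  exact Nat.lt_pow_succ_log_self hb x

/-- The component programs are called at finitely many states and symbols, so one constant `V₀`
covers them for all inputs; beyond it only the tape codes need room. -/
theorem runs_sim {E : ℕ → Machine} {pb pa pw pn : Prog} {W : ℕ → ℕ → ℕ → ℕ} {i : ℕ} (hi : (E i).Valid)
    (hW : ∀ i q h V, W i q h ≤ V → BoxAt V pb (fun i _ _ => (E i).base) i q h ∧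
      BoxAt V pa (fun i q h => actCode (E i) q h) i q h ∧
      BoxAt V pw (fun i q h => writeCode (E i) q h) i q h ∧
      BoxAt V pn (fun i q h => nextCode (E i) q h) i q h) :
    (∃ V₀, ∀ x, ∀ c ∈ (E i).final [x], ∀ V, V₀ ≤ V → ((E i).base + 2) ^ (c.size + 1) ≤ V →
        ∃ t w n o, Runs V (sim pb pa pw pn) (input i x) t ∧
          ∀ r < 15, t r = (simState ((E i).base + 2) i x c 0 w n o).getD r 0) ∧
      ∀ x, ¬ ((E i).final [x]).Dom → ∀ V t, ¬ Runs V (sim pb pa pw pn) (input i x) t := by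
  obtain ⟨B, hB⟩ : ∃ B, B = (E i).base + 2 := ⟨_, rfl⟩
  have hb := hi.1
  rw [← hB]
  obtain ⟨V₀, hiV, hV00, hsup⟩ : ∃ V₀, i ≤ V₀ ∧ W i 0 0 ≤ V₀ ∧
      ∀ q h, q ≤ (E i).stateBound → h < B → W i q h ≤ V₀ := by
    refine ⟨i + W i 0 0 + ((Finset.range ((E i).stateBound + 1)) ×ˢ Finset.range B).sup
      (fun t => W i t.1 t.2), by omega, by omega, fun q h hq hh => ?_⟩
    have := Finset.le_sup (f := fun t : ℕ × ℕ => W i t.1 t.2)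
      (s := (Finset.range ((E i).stateBound + 1)) ×ˢ Finset.range B) (b := (q, h)) (by simp; omega)
    simp only at this
    omega
  have hinit (x V : ℕ) (h1 : V₀ ≤ V) (h2 : B ^ ((E i).init [x]).size ≤ V) :
      ∃ o, Trans 15 V (simInit pb) [0, x, 0, 0, 0, 0, 0, 0, 0, 0, 0, i, 0, 0, 0]
        (simState B i x ((E i).init [x]) 1 0 0 o) :=
    trans_init (by omega) hB (hW i 0 0 V (by omega)).1 h2
  have hstep {x V w n o : ℕ} {c c' : Config} (h1 : V₀ ≤ V) (h2 : B ^ (c.size + 1) ≤ V)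
      (hr : Reaches (E i).step ((E i).init [x]) c) (hc : (E i).step c = some c') :
      ∃ w' n' o', Trans 15 V (simStep pa pw pn) (simState B i x c 0 w n o)
        (simState B i x c' 1 w' n' o') := by
    obtain ⟨g1, g2⟩ := inv_of_reaches hi hr
    obtain ⟨g3, -⟩ := inv_of_reaches hi (hr.tail hc)
    rw [← hB] at g1 g3
    obtain ⟨-, b1, b2, b3⟩ := hW i _ _ V ((hsup _ _ g2 g1.2.1).trans h1)
    exact trans_step hc (by omega) g1 g3 h2 b1 b2 b3
  refine ⟨⟨V₀, fun x c hc V h1 h2 => ?_⟩, fun x hx V t h => ?_⟩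
  · obtain ⟨hr, hc⟩ := mem_eval.1 hc
    have hmono {c' : Config} (h : Reaches (E i).step c' c) : B ^ (c'.size + 1) ≤ V :=
      (Nat.pow_le_pow_right (by omega) (Nat.succ_le_succ (size_le_of_reaches h))).trans h2
    have hloop (c' : Config) (h : Reaches (E i).step c' c) :
        Reaches (E i).step ((E i).init [x]) c' → ∀ w n o, ∃ w' n' o',
        Trans 15 V (.loop 8 (simStep pa pw pn)) (simState B i x c' 1 w n o)
          (simState B i x c 0 w' n' o') := by
      induction h using Relation.ReflTransGen.head_induction_on with
      | refl =>
        intro hr' w n o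
        obtain ⟨g1, g2⟩ := inv_of_reaches hi hr
        rw [← hB] at g1
        refine ⟨w, n, 0, trans_loop_pos (by decide) (by simp [simState]) (by simp [simState]) ?_
          (trans_loop_zero (by decide) rfl)⟩
        exact trans_step_halt hc (hW i _ _ V ((hsup _ _ g2 g1.2.1).trans h1)).2.1
      | @head c₁ c₂ k1 k2 ih =>
        intro hr' w n o
        obtain ⟨w', n', o', g⟩ := hstep (w := w) (n := n) (o := o) h1
          (hmono (.head k1 k2)) hr' k1
        obtain ⟨w'', n'', o'', g'⟩ := ih (hr'.tail k1) w' n' o'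
        exact ⟨w'', n'', o'', trans_loop_pos (by decide) (by simp [simState]) (by simp [simState])
          g g'⟩
    obtain ⟨o, k1⟩ := hinit x V h1 ((Nat.pow_le_pow_right (by omega) (by omega)).trans (hmono hr))
    obtain ⟨w', n', o', k2⟩ := hloop _ hr .refl 0 0 o
    have hx : x ≤ V := by
      have h3 := (lt_pow_length_word hb x).le
      have h4 : (word (E i).base x).length ≤ c.size + 1 := by
        refine le_trans ?_ ((size_le_of_reaches hr).trans (Nat.le_succ _))
        obtain ⟨d, w, hw⟩ : ∃ d w, word (E i).base x = d :: w :=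
          List.exists_cons_of_ne_nil (word_ne_nil x)
        simp [Config.size, Machine.init, inputTape, hw]
      exact h3.trans ((Nat.pow_le_pow_left (by omega) _).trans
        ((Nat.pow_le_pow_right (by omega) h4).trans h2))
    have hBV : ∀ r, (input i x) r ≤ V := by
      intro r
      simp only [input]
      split_ifs <;> omega
    obtain ⟨t, k3, k4⟩ := k1.seq k2 (input i x) hBV (fun r _ => input_eq i x r)
    exact ⟨t, w', n', o', k3, k4⟩
  · cases h with
    | intro n h =>
    cases h with
    | seq k1 k2 =>
      -- A diverging machine may need unbounded space, so every turn gets a bound of its own; runs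
      -- with different bounds are identified by uniqueness.
      obtain ⟨U, hU⟩ : ∃ U, U = V₀ + B ^ ((E i).init [x]).size + i + x := ⟨_, rfl⟩
      obtain ⟨o, k3⟩ := hinit x U (by omega) (by omega)
      have hV : ∀ r, (input i x) r ≤ U := by
        intro r
        simp only [input]
        split_ifs <;> omega
      obtain ⟨u, k4, k5⟩ := k3 (input i x) hV (fun r _ => input_eq i x r)
      obtain rfl := k4.unique ⟨_, k1⟩
      refine not_runs_loop (fun s => ∃ c V w n o, Reaches (E i).step ((E i).init [x]) c ∧
        (∀ r, s r ≤ V) ∧ ∀ r < 15, s r = (simState B i x c 1 w n o).getD r 0) ?_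
        ⟨_, U, 0, 0, o, .refl, k4.le hV, k5⟩ ⟨_, k2⟩
      rintro s ⟨c, V', w, n, o, g1, g2, g3⟩
      have h8 : s 8 = 1 := g3 8 (by decide)
      refine ⟨by omega, ?_⟩
      obtain ⟨c', hc'⟩ : ∃ c', (E i).step c = some c' := by
        cases hc : (E i).step c with
        | none => exact absurd (Part.dom_iff_mem.2 ⟨c, mem_eval.2 ⟨g1, hc⟩⟩) hx
        | some c' => exact ⟨c', rfl⟩
      obtain ⟨w', n', o', g⟩ := hstep (V := V₀ + B ^ (c.size + 1) + V') (w := w) (n := n) (o := o)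
        (by omega) (by omega) g1 hc'
      have hV' : ∀ r, (s.set 8 (s 8 - 1)) r ≤ V₀ + B ^ (c.size + 1) + V' := by
        intro r
        have := g2 r
        rw [St.set_apply]; split_ifs <;> omega
      obtain ⟨t', k6, k7⟩ := g _ hV' (by
        have := agree_set g3 (l := 8) (by simp [simState]) 0
        rw [h8]; exact this)
      exact ⟨_, t', k6, c', _, w', n', o', g1.tail hc', k6.le hV', k7⟩

/-- There is a universal program for a computable sequence of machines. Its values are bounded
exponentially in the space of the simulated machine. -/
theorem exists_sim {E : ℕ → Machine} (hE : Computable E) : ∃ P : Prog, P.Pure ∧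
    (∀ i x V n t, Run V P n (input i x) t → x < n) ∧
    ∀ i, (E i).Valid →
      (∃ V₀, ∀ x, ∀ c ∈ (E i).final [x], ∀ V, V₀ ≤ V → ((E i).base + 2) ^ (c.size + 1) ≤ V →
        ∃ t w n o, Runs V P (input i x) t ∧
          ∀ r < 15, t r = (simState ((E i).base + 2) i x c 0 w n o).getD r 0) ∧
      ∀ x, ¬ ((E i).final [x]).Dom → ∀ V t, ¬ Runs V P (input i x) t := by
  obtain ⟨pb, pa, pw, pn, h1, h2, h3, h4, W, hW⟩ := exists_boxes hE
  exact ⟨sim pb pa pw pn, pure_sim h1 h2 h3 h4, fun i x V n t h => lt_of_run_sim h,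
    fun i hi => runs_sim hi hW⟩

/-! ### States with a window of registers -/

/-- The state with the registers `f`, except that the registers from `o` on contain `xs`. -/
def win (o : ℕ) (f : ℕ → ℕ) (xs : List ℕ) (inp : List (List ℕ)) (out : List ℕ) : St :=
  ⟨fun r => if o ≤ r ∧ r < o + xs.length then xs.getD (r - o) 0 else f r, inp, out⟩

section

variable {V N o : ℕ} {f : ℕ → ℕ} {xs : List ℕ} {inp : List (List ℕ)} {out : List ℕ}

theorem win_get {i : ℕ} (hi : i < xs.length) : (win o f xs inp out) (o + i) = xs.getD i 0 := by
  simp only [win]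
  rw [if_pos (by omega), Nat.add_sub_cancel_left]

theorem win_other {r : ℕ} (hr : r < o ∨ o + xs.length ≤ r) : (win o f xs inp out) r = f r := by
  simp only [win]
  rw [if_neg (by omega)]

theorem win_set {i : ℕ} (hi : i < xs.length) (v : ℕ) :
    (win o f xs inp out).set (o + i) v = win o f (xs.set i v) inp out := by
  refine St.ext_regs (fun r => ?_) rfl rfl
  rw [St.set_apply]
  simp only [win, List.length_set]
  by_cases h : o ≤ r ∧ r < o + xs.length
  · rw [if_pos h, if_pos h, getD_set _ hi]
    by_cases h' : r = o + i
    · rw [if_pos h', if_pos (by omega)]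
    · rw [if_neg h', if_neg (by omega)]
  · rw [if_neg h, if_neg h, if_neg (by omega)]

theorem win_zero (ho : 0 < o) (h0 : f 0 = 0) : (win o f xs inp out) 0 = 0 := by
  rw [win_other (by omega), h0]

theorem win_le (hf : ∀ r, f r ≤ V) (hx : ∀ v ∈ xs, v ≤ V) (r : ℕ) :
    (win o f xs inp out) r ≤ V := by
  simp only [win]
  split_ifs with h
  · rw [List.getD_eq_getElem _ _ (by omega)]
    exact hx _ (List.getElem_mem _)
  · exact hf r

/-- Brings a state left behind by another program into the form to which the lemmas on windows
apply. -/
theorem win_self (s : St) (o k : ℕ) :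
    s = win o s ((List.range k).map fun i => s (o + i)) s.inp s.out := by
  refine St.ext_regs (fun r => ?_) rfl rfl
  simp only [win, List.length_map, List.length_range]
  split_ifs with h
  · rw [List.getD_eq_getElem _ _ (by simp; omega)]
    simp only [List.getElem_map, List.getElem_range]
    rw [Nat.add_sub_cancel' h.1]
  · rfl

theorem win_clr {i : ℕ} (hi : i < xs.length) :
    Runs V (clr (o + i)) (win o f xs inp out) (win o f (xs.set i 0) inp out) :=
  win_set hi 0 ▸ runs_clr V (o + i) _

theorem win_inc {i : ℕ} (hi : i < xs.length) (hV : xs.getD i 0 + 1 ≤ V) :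
    Runs V (.inc (o + i)) (win o f xs inp out) (win o f (xs.set i (xs.getD i 0 + 1)) inp out) := by
  have := Runs.inc (V := V) (s := win o f xs inp out) (r := o + i) (by rwa [win_get hi])
  rwa [win_get hi, win_set hi] at this

theorem win_addConst {i : ℕ} (c : ℕ) (hi : i < xs.length) (hV : xs.getD i 0 + c ≤ V) :
    Runs V (addConst (o + i) c) (win o f xs inp out)
      (win o f (xs.set i (xs.getD i 0 + c)) inp out) := by
  have := runs_addConst (V := V) (s := win o f xs inp out) (r := o + i) c (by rwa [win_get hi])
  rwa [win_get hi, win_set hi] at this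

theorem win_addTo {a b : ℕ} (ho : 0 < o) (h0 : f 0 = 0) (ha : a < xs.length) (hb : b < xs.length)
    (hab : a ≠ b) (hV : xs.getD b 0 + xs.getD a 0 ≤ V) :
    Runs V (addTo (o + a) (o + b)) (win o f xs inp out)
      (win o f (xs.set b (xs.getD b 0 + xs.getD a 0)) inp out) := by
  have := runs_addTo (V := V) (s := win o f xs inp out) (a := o + a) (b := o + b) (by omega)
    (by omega) (by omega) (win_zero ho h0) (by rwa [win_get ha, win_get hb])
  rwa [win_get ha, win_get hb, win_set hb] at this

theorem win_copy {a b : ℕ} (ho : 0 < o) (h0 : f 0 = 0) (ha : a < xs.length) (hb : b < xs.length)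
    (hab : a ≠ b) (hV : xs.getD a 0 ≤ V) :
    Runs V (copy (o + a) (o + b)) (win o f xs inp out)
      (win o f (xs.set b (xs.getD a 0)) inp out) := by
  have := runs_copy (V := V) (s := win o f xs inp out) (a := o + a) (b := o + b) (by omega)
    (by omega) (by omega) (win_zero ho h0) (by rwa [win_get ha])
  rwa [win_get ha, win_set hb] at this

theorem win_divmod {y b h t c : ℕ} (ho : 0 < o) (h0 : f 0 = 0) (hd : [y, b, h, t, c].Nodup)
    (hy : y < xs.length) (hb : b < xs.length) (hh : h < xs.length) (ht : t < xs.length)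
    (hc : c < xs.length) (ht0 : xs.getD t 0 = 0) (hc0 : xs.getD c 0 = 0) (hb0 : xs.getD b 0 ≠ 0)
    (hV : xs.getD y 0 ≤ V) (hV' : xs.getD b 0 ≤ V) :
    Runs V (divmod (o + y) (o + b) (o + h) (o + t) (o + c)) (win o f xs inp out)
      (win o f ((xs.set h (xs.getD y 0 % xs.getD b 0)).set y (xs.getD y 0 / xs.getD b 0))
        inp out) := by
  have := runs_divmod (V := V) (s := win o f xs inp out) (y := o + y) (b := o + b) (h := o + h)
    (t := o + t) (c := o + c) (by
      simp only [List.nodup_cons, List.mem_cons, List.not_mem_nil, or_false, not_or,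
        List.nodup_nil, and_true, not_false_eq_true] at hd ⊢
      omega) (win_zero ho h0) (by rwa [win_get ht]) (by rwa [win_get hc]) (by rwa [win_get hb])
    (by rwa [win_get hy]) (by rwa [win_get hb])
  rwa [win_get hy, win_get hb, win_set hh, win_set (by simpa using hy)] at this

theorem win_cond_pos {i : ℕ} {p q : Prog} {t : St} (hi : i < xs.length) (h : xs.getD i 0 ≠ 0)
    (hp : Runs V p (win o f (xs.set i (xs.getD i 0 - 1)) inp out) t) :
    Runs V (.cond (o + i) p q) (win o f xs inp out) t :=
  .cond_pos (by rwa [win_get hi]) (by rwa [win_get hi, win_set hi])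

theorem win_cond_zero {i : ℕ} {p q : Prog} {t : St} (hi : i < xs.length) (h : xs.getD i 0 = 0)
    (hp : Runs V q (win o f xs inp out) t) :
    Runs V (.cond (o + i) p q) (win o f xs inp out) t :=
  .cond_zero (by rwa [win_get hi]) hp

theorem win_loop_pos {i : ℕ} {p : Prog} {t u : St} (hi : i < xs.length) (h : xs.getD i 0 ≠ 0)
    (hp : Runs V p (win o f (xs.set i (xs.getD i 0 - 1)) inp out) t)
    (hq : Runs V (.loop (o + i) p) t u) : Runs V (.loop (o + i) p) (win o f xs inp out) u :=
  .loop_pos (by rwa [win_get hi]) (by rwa [win_get hi, win_set hi]) hq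

theorem win_loop_zero {i : ℕ} {p : Prog} (hi : i < xs.length) (h : xs.getD i 0 = 0) :
    Runs V (.loop (o + i) p) (win o f xs inp out) (win o f xs inp out) :=
  .loop_zero (by rwa [win_get hi])

end

/-! ### Case distinction, reading and writing -/

/-- Execute `g (k + v)`, where `v < n` is the content of register `h`, and clear register `h`. -/
def switch (h : ℕ) (g : ℕ → Prog) : ℕ → ℕ → Prog
  | _, 0 => .skip
  | k, n + 1 => .cond h (switch h g (k + 1) n) (g k)

/-- Emitted digits and added constants are fixed in the text of a program, so a digit held in a
register must select one of `n` programs. -/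
theorem runs_switch {V h : ℕ} {g : ℕ → Prog} (n : ℕ) : ∀ (k : ℕ) {s t : St}, s h < n →
    Runs V (g (k + s h)) (s.set h 0) t → Runs V (switch h g k n) s t := by
  induction n with
  | zero => intro k s t h1; omega
  | succ n ih =>
    intro k s t h1 h2
    by_cases h0 : s h = 0
    · rw [h0, add_zero] at h2
      refine .cond_zero h0 ?_
      rw [← h0] at h2
      rwa [St.set_self] at h2
    · refine .cond_pos h0 (ih (k + 1) ?_ ?_)
      · rw [St.set_same]; omega
      · rw [St.set_same, St.set_set]
        rwa [show k + 1 + (s h - 1) = k + s h by omega]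

theorem win_switch {V o h n : ℕ} {f : ℕ → ℕ} {xs : List ℕ} {inp : List (List ℕ)} {out : List ℕ}
    {g : ℕ → Prog} {t : St} (hh : h < xs.length) (hn : xs.getD h 0 < n)
    (hg : Runs V (g (xs.getD h 0)) (win o f (xs.set h 0) inp out) t) :
    Runs V (switch (o + h) g 0 n) (win o f xs inp out) t := by
  refine runs_switch n 0 (by rwa [win_get hh]) ?_
  rwa [win_get hh, win_set hh, zero_add]

theorem bound_switch {h b : ℕ} {g : ℕ → Prog} (hh : h < b) (hg : ∀ k, (g k).bound ≤ b) (n : ℕ) :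
    ∀ k, (switch h g k n).bound ≤ b := by
  induction n with
  | zero => intro k; simp [switch, Prog.bound]
  | succ n ih =>
    intro k
    have := ih (k + 1)
    have := hg k
    simp only [switch, Prog.bound]
    omega

theorem emitsBelow_switch {h N : ℕ} {g : ℕ → Prog} (n : ℕ) :
    ∀ k, (∀ j, k ≤ j → j < k + n → (g j).EmitsBelow N) → (switch h g k n).EmitsBelow N := by
  induction n with
  | zero => intro k _; trivial
  | succ n ih =>
    intro k hk
    exact ⟨ih (k + 1) fun j h1 h2 => hk j (by omega) (by omega), hk k le_rfl (by omega)⟩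

/-- The last `t` digits of `v`, least significant first. -/
def padDigits (N : ℕ) : ℕ → ℕ → List ℕ
  | 0, _ => []
  | t + 1, v => v % N :: padDigits N t (v / N)

@[simp] theorem length_padDigits (N t v : ℕ) : (padDigits N t v).length = t := by
  induction t generalizing v with
  | zero => rfl
  | succ t ih => simp [padDigits, ih]

/-- Leading zeros do not matter, so the number of output cells is free and can be adjusted to the
space that is to be reported. -/
theorem ofDigits_padDigits {N : ℕ} (t v : ℕ) (h : v < N ^ t) :
    Nat.ofDigits N (padDigits N t v) = v := by
  induction t generalizing v with
  | zero => simp at h; simp [padDigits, h]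
  | succ t ih =>
    rw [padDigits, Nat.ofDigits_cons, ih _ (Nat.div_lt_of_lt_mul (by rwa [pow_succ'] at h))]
    simp [Nat.mod_add_div]

/-- Emit as many digits of register `o + 4` as register `o + 5` says, where register `o` contains
the base. -/
def emitLoop (o N : ℕ) : Prog :=
  .loop (o + 5) (.seq (divmod (o + 4) (o + 0) (o + 6) (o + 7) (o + 8)) (switch (o + 6) .emit 0 N))

theorem win_emitLoop {V N o : ℕ} {f : ℕ → ℕ} {z a b : ℕ} {l : List ℕ} (ho : 0 < o) (h0 : f 0 = 0)
    (hN : 0 < N) (hNV : N ≤ V) (t : ℕ) : ∀ (v h : ℕ) (out : List ℕ), v ≤ V →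
      ∃ v' h', Runs V (emitLoop o N) (win o f (N :: z :: a :: b :: v :: t :: h :: 0 :: 0 :: l) [] out)
        (win o f (N :: z :: a :: b :: v' :: 0 :: h' :: 0 :: 0 :: l) [] (out ++ padDigits N t v)) := by
  induction t with
  | zero =>
    intro v h out hv
    refine ⟨v, h, ?_⟩
    rw [padDigits, List.append_nil]
    exact win_loop_zero (i := 5) (by simp) rfl
  | succ t ih =>
    intro v h out hv
    obtain ⟨v', h', k⟩ := ih (v / N) 0 (out ++ [v % N]) ((Nat.div_le_self _ _).trans hv)
    rw [List.append_assoc] at k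
    refine ⟨v', h', win_loop_pos (by simp) (by simp) (.seq (win_divmod ho h0 (by simp) (by simp)
      (by simp) (by simp) (by simp) (by simp) rfl rfl (by simp; omega) (by simpa using hv)
      (by simpa using hNV)) ?_) k⟩
    simp only [List.set, List.getD_cons_succ, List.getD_cons_zero, Nat.add_sub_cancel]
    refine win_switch (by simp) (by simpa using Nat.mod_lt v hN) ?_
    simp only [List.set, List.getD_cons_succ, List.getD_cons_zero]
    exact ⟨_, .emit _ _ rfl⟩

/-- Execute `p` as often as the scanned digit of the input says, counting the digit down to zero.
Register `e` is a flag. -/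
def readDigit (e : ℕ) (p : Prog) : Prog := .seq (.inc e) (.loop e (.take (.seq p (.inc e)) .skip))

/-- Read a word into register `o`, adding `d` to register `o + 1` for each digit. The base is `N`,
and register `o + 4` contains the place value. -/
def readWord (o N d : ℕ) : Prog :=
  .loop (o + 5) (.seq (readDigit (o + 6) (addTo (o + 4) (o + 0))) (.seq (addConst (o + 1) d)
    (.last .skip (.seq (copy (o + 4) (o + 7)) (.seq (clr (o + 4)) (.seq
      (.loop (o + 7) (addConst (o + 4) N)) (.inc (o + 5))))))))

/-- Read a word, adding its length to register `o + 3` and the length of its binary form to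
register `o + 9`. -/
def readLength (o N d : ℕ) : Prog :=
  .loop (o + 5) (.seq (readDigit (o + 6) (.inc (o + 4))) (.seq (.inc (o + 3))
    (.last (switch (o + 4) (fun j => addConst (o + 9) (len j)) 0 N)
      (.seq (clr (o + 4)) (.seq (addConst (o + 9) d) (.inc (o + 5)))))))

/-- The length of the binary form of the number with the digits `w` in base `2 ^ d`. -/
def binLength (d : ℕ) : List ℕ → ℕ
  | [] => 0
  | [a] => len a
  | _ :: a :: w => d + binLength d (a :: w)

theorem len_pos (x : ℕ) : 0 < len x := by rw [len_eq]; omega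

theorem len_le_of_lt {d x : ℕ} (h : x < 2 ^ d) (hd : 0 < d) : len x ≤ d := by
  rw [len_eq]
  by_cases hx : x = 0
  · simp [hx]; omega
  · exact Nat.log_lt_of_lt_pow hx h

/-- The base is a power of two: each digit except the leading one stands for exactly `d` binary
digits, so the binary length can be added up while reading. -/
theorem len_div {d k : ℕ} (h : 2 ^ d ≤ k) : len k = d + len (k / 2 ^ d) := by
  have h1 : d ≤ Nat.log 2 k := Nat.le_log_of_pow_le (by norm_num) h
  rw [len_eq, len_eq, Nat.log_div_base_pow]
  omega

theorem binLength_word {d : ℕ} (hd : 0 < d) (k : ℕ) : binLength d (word (2 ^ d) k) = len k := by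
  have hN : 1 < 2 ^ d := Nat.one_lt_two_pow hd.ne'
  induction k using Nat.strong_induction_on with
  | _ k ih =>
    by_cases h : k < 2 ^ d
    · rw [word_of_lt h, binLength]
    · rw [word_of_le hN (not_lt.1 h), len_div (not_lt.1 h),
        ← ih (k / 2 ^ d) (Nat.div_lt_self (by omega) hN)]
      obtain ⟨a, w, hw⟩ : ∃ a w, word (2 ^ d) (k / 2 ^ d) = a :: w :=
        List.exists_cons_of_ne_nil (word_ne_nil _)
      rw [hw, binLength]

theorem binLength_le {d : ℕ} (hd : 0 < d) {w : List ℕ} (hw : ∀ a ∈ w, a < 2 ^ d) :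
    binLength d w ≤ d * w.length := by
  induction w with
  | nil => simp [binLength]
  | cons a w ih =>
    cases w with
    | nil =>
      have := len_le_of_lt (hw a (by simp)) hd
      simpa [binLength] using this
    | cons b w =>
      have := ih fun a ha => hw a (List.mem_cons_of_mem _ ha)
      rw [binLength, List.length_cons, mul_add]
      omega

/-- Each digit but the leading one accounts for `d ≥ 2` bits. Hence `len k` pays for the cells of
the word of `k` and for equally many register cells. -/
theorem le_binLength {d : ℕ} (hd : 1 < d) {w : List ℕ} (hw : w ≠ []) :
    2 * w.length ≤ binLength d w + 1 := by
  induction w with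
  | nil => exact absurd rfl hw
  | cons a w ih =>
    cases w with
    | nil => have := len_pos a; simp [binLength]; omega
    | cons b w =>
      have := ih (by simp)
      rw [binLength, List.length_cons]
      omega

section

variable {V N o d : ℕ} {f : ℕ → ℕ} {out : List ℕ}

/-- `g j` describes the registers after `j` units of the digit; the flag `e` is raised after every
unit, so that the loop tries the digit once more. -/
theorem win_readDigit {e δ : ℕ} {p : Prog} {w : List ℕ} {ws : List (List ℕ)} (g : ℕ → List ℕ)
    (hV : 1 ≤ V) (he : ∀ j, e < (g j).length) (he0 : ∀ j, (g j).getD e 0 = 0)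
    (hp : ∀ j < δ, ∀ inp, Runs V p (win o f (g j) inp out) (win o f (g (j + 1)) inp out)) :
    Runs V (readDigit (o + e) p) (win o f (g 0) ((δ :: w) :: ws) out)
      (win o f (g δ) ((0 :: w) :: ws) out) := by
  have e0 (j : ℕ) : ((g j).set e 1).set e (((g j).set e 1).getD e 0 - 1) = g j := by
    have h0 := he0 j
    rw [getD_set _ (he j), if_pos rfl, List.set_set, Nat.sub_self]
    rw [List.getD_eq_getElem _ _ (he j)] at h0
    rw [← h0, List.set_getElem_self]
  have hinc (j : ℕ) (inp : List (List ℕ)) :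
      Runs V (.inc (o + e)) (win o f (g j) inp out) (win o f ((g j).set e 1) inp out) := by
    have := win_inc (V := V) (o := o) (f := f) (inp := inp) (out := out) (he j)
      (by rw [he0]; exact hV)
    rwa [he0, zero_add] at this
  refine .seq (hinc 0 _) ?_
  have key : ∀ k j, j + k = δ → Runs V (.loop (o + e) (.take (.seq p (.inc (o + e))) .skip))
      (win o f ((g j).set e 1) ((k :: w) :: ws) out) (win o f (g δ) ((0 :: w) :: ws) out) := by
    intro k
    induction k with
    | zero =>
      intro j hj
      refine win_loop_pos (by simpa using he j) (by rw [getD_set _ (he j), if_pos rfl]; simp) ?_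
        (win_loop_zero (he δ) (he0 δ))
      rw [e0, ← hj]
      obtain ⟨n, h⟩ := Runs.skip V (win o f (g j) ((0 :: w) :: ws) out)
      exact ⟨_, .take_zero rfl h⟩
    | succ k ih =>
      intro j hj
      refine win_loop_pos (by simpa using he j) (by rw [getD_set _ (he j), if_pos rfl]; simp) ?_
        (ih (j + 1) (by omega))
      rw [e0]
      obtain ⟨n, h⟩ := (hp j (by omega) ((k :: w) :: ws)).seq (hinc (j + 1) ((k :: w) :: ws))
      exact ⟨_, .take_pos rfl h⟩
  exact key δ 0 (zero_add _)

theorem win_readWord {z n c κ n' : ℕ} {ws : List (List ℕ)} (ho : 0 < o) (h0 : f 0 = 0) (hN : 0 < N)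
    (w : List ℕ) : w ≠ [] → (∀ a ∈ w, a < N) → ∀ x u p : ℕ, 0 < p →
      x + p * Nat.ofDigits N w ≤ V → p * N ^ w.length ≤ V → u + d * w.length ≤ V →
      ∃ p', Runs V (readWord o N d) (win o f [x, u, z, n, p, 1, 0, 0, c, κ, n'] (w :: ws) out)
        (win o f [x + p * Nat.ofDigits N w, u + d * w.length, z, n, p', 0, 0, 0, c, κ, n'] ws out) ∧
        p' ≤ V := by
  induction w with
  | nil => intro h; exact absurd rfl h
  | cons δ w ih =>
    intro _ hw x u p hp hx hpw hu
    simp only [List.mem_cons, forall_eq_or_imp] at hw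
    rw [List.length_cons, pow_succ] at hpw
    have e1 : x + p * Nat.ofDigits N (δ :: w) = x + p * δ + p * N * Nat.ofDigits N w := by
      rw [Nat.ofDigits_cons]; ring
    rw [e1] at hx ⊢
    rw [List.length_cons, mul_add, mul_one] at hu
    have hN1 : 1 ≤ N ^ w.length := Nat.one_le_pow _ _ hN
    have hpN : p * N ≤ p * (N ^ w.length * N) :=
      Nat.mul_le_mul_left _ (Nat.le_mul_of_pos_left _ (by omega))
    have hpp : p ≤ p * N := Nat.le_mul_of_pos_right _ hN
    have h1 := win_readDigit (V := V) (o := o) (f := f) (out := out) (e := 6) (δ := δ) (w := w)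
      (ws := ws) (p := addTo (o + 4) (o + 0))
      (fun j => [x + p * j, u, z, n, p, 0, 0, 0, c, κ, n']) (by omega) (by simp) (by simp)
      (fun j hj inp => by
        have hj' : p * j + p ≤ p * δ := by
          have : p * (j + 1) ≤ p * δ := Nat.mul_le_mul_left _ (by omega)
          rwa [mul_add, mul_one] at this
        have := win_addTo (V := V) (o := o) (f := f) (inp := inp) (out := out) (a := 4) (b := 0)
          (xs := [x + p * j, u, z, n, p, 0, 0, 0, c, κ, n']) ho h0 (by simp) (by simp) (by simp)
          (by simp; omega)
        simpa [mul_add, add_assoc] using this)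
    rw [mul_zero, add_zero] at h1
    have h2 := win_addConst (V := V) (o := o) (f := f) (out := out) (inp := (0 :: w) :: ws) (i := 1)
      (xs := [x + p * δ, u, z, n, p, 0, 0, 0, c, κ, n']) d (by simp) (by simp; omega)
    simp only [List.set, List.getD_cons_succ, List.getD_cons_zero] at h2
    cases w with
    | nil =>
      refine ⟨p, win_loop_pos (by simp) (by simp) (.seq h1 (.seq h2 ?_))
        (win_loop_zero (i := 5) (by simp) rfl), by omega⟩
      obtain ⟨k, h⟩ := Runs.skip V (win o f [x + p * δ, u + d, z, n, p, 0, 0, 0, c, κ, n'] ws out)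
      have := Run.last_pos (s := win o f [x + p * δ, u + d, z, n, p, 0, 0, 0, c, κ, n'] ([0] :: ws) out)
        (q := .seq (copy (o + 4) (o + 7)) (.seq (clr (o + 4)) (.seq
          (.loop (o + 7) (addConst (o + 4) N)) (.inc (o + 5))))) rfl h
      simpa using ⟨_, this⟩
    | cons a w =>
      obtain ⟨p', k1, k2⟩ := ih (by simp) hw.2 (x + p * δ) (u + d) (p * N)
        (Nat.mul_pos hp hN) hx (by
          rwa [show p * N * N ^ (a :: w).length = p * (N ^ (a :: w).length * N) by ring]) (by omega)
      refine ⟨p', win_loop_pos (by simp) (by simp) (.seq h1 (.seq h2 ?_)) (by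
        rwa [show u + d * (δ :: a :: w).length = u + d + d * (a :: w).length by
          simp only [List.length_cons]; ring]), k2⟩
      have h3 : Runs V (.seq (copy (o + 4) (o + 7)) (.seq (clr (o + 4)) (.seq
          (.loop (o + 7) (addConst (o + 4) N)) (.inc (o + 5)))))
          (win o f [x + p * δ, u + d, z, n, p, 0, 0, 0, c, κ, n'] ((a :: w) :: ws) out)
          (win o f [x + p * δ, u + d, z, n, p * N, 1, 0, 0, c, κ, n'] ((a :: w) :: ws) out) := by
        refine .seq (win_copy ho h0 (by simp) (by simp) (by simp) (by simp; omega)) ?_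
        simp only [List.set, List.getD_cons_succ, List.getD_cons_zero]
        refine .seq (win_clr (by simp)) ?_
        simp only [List.set]
        have hloop : ∀ k y, y + k * N ≤ V → Runs V (.loop (o + 7) (addConst (o + 4) N))
            (win o f [x + p * δ, u + d, z, n, y, 0, 0, k, c, κ, n'] ((a :: w) :: ws) out)
            (win o f [x + p * δ, u + d, z, n, y + k * N, 0, 0, 0, c, κ, n'] ((a :: w) :: ws) out) := by
          intro k
          induction k with
          | zero =>
            intro y _
            rw [zero_mul, add_zero]
            exact win_loop_zero (i := 7) (by simp) rfl
          | succ k ih =>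
            intro y hy
            rw [add_mul, one_mul] at hy
            refine win_loop_pos (by simp) (by simp) (win_addConst N (by simp) (by simp; omega)) ?_
            simp only [List.set, List.getD_cons_succ, List.getD_cons_zero, Nat.add_sub_cancel]
            have := ih (y + N) (by omega)
            rwa [show y + N + k * N = y + (k + 1) * N by ring] at this
        have h4 := hloop p 0 (by omega)
        rw [zero_add] at h4
        refine .seq h4 ?_
        have := win_inc (V := V) (o := o) (f := f) (out := out) (inp := (a :: w) :: ws) (i := 5)
          (xs := [x + p * δ, u + d, z, n, p * N, 0, 0, 0, c, κ, n']) (by simp) (by simp; omega)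
        simpa using this
      obtain ⟨k, h⟩ := h3
      exact ⟨_, .last_neg rfl h⟩

/-- Only lengths are counted here: a register holding `k` itself would take `len k` cells in
addition to the word of `k`, more than the summand `len k` of the output pays for. -/
theorem win_readLength {x u z c n' : ℕ} {ws : List (List ℕ)} (hNd : N = 2 ^ d) (hd : 0 < d)
    (w : List ℕ) : w ≠ [] → (∀ a ∈ w, a < N) → ∀ n κ : ℕ,
      N ≤ V → n + w.length ≤ V → κ + d * w.length ≤ V →
      Runs V (readLength o N d) (win o f [x, u, z, n, 0, 1, 0, 0, c, κ, n'] (w :: ws) out)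
        (win o f [x, u, z, n + w.length, 0, 0, 0, 0, c, κ + binLength d w, n'] ws out) := by
  induction w with
  | nil => intro h; exact absurd rfl h
  | cons δ w ih =>
    intro _ hw n κ hNV hn hκ
    simp only [List.mem_cons, forall_eq_or_imp] at hw
    rw [List.length_cons] at hn
    rw [List.length_cons, mul_add, mul_one] at hκ
    have h1 := win_readDigit (V := V) (o := o) (f := f) (out := out) (e := 6) (δ := δ) (w := w)
      (ws := ws) (p := .inc (o + 4))
      (fun j => [x, u, z, n, j, 0, 0, 0, c, κ, n']) (by omega) (by simp) (by simp)
      (fun j hj inp => by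
        have := win_inc (V := V) (o := o) (f := f) (inp := inp) (out := out) (i := 4)
          (xs := [x, u, z, n, j, 0, 0, 0, c, κ, n']) (by simp) (by simp; omega)
        simpa using this)
    have h2 := win_inc (V := V) (o := o) (f := f) (out := out) (inp := (0 :: w) :: ws) (i := 3)
      (xs := [x, u, z, n, δ, 0, 0, 0, c, κ, n']) (by simp) (by simp; omega)
    simp only [List.set, List.getD_cons_succ, List.getD_cons_zero] at h2
    cases w with
    | nil =>
      refine win_loop_pos (by simp) (by simp) (.seq h1 (.seq h2 ?_))
        (win_loop_zero (i := 5) (by simp) rfl)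
      have hl : len δ ≤ d := len_le_of_lt (hNd ▸ hw.1) hd
      obtain ⟨k, h⟩ := win_switch (V := V) (o := o) (f := f) (out := out) (inp := ws) (h := 4) (n := N)
        (xs := [x, u, z, n + 1, δ, 0, 0, 0, c, κ, n']) (g := fun j => addConst (o + 9) (len j))
        (by simp) (by simpa using hw.1) (win_addConst (len δ) (by simp) (by simp; omega))
      exact ⟨_, .last_pos rfl h⟩
    | cons a w =>
      have k1 := ih (by simp) hw.2 (n + 1) (κ + d) hNV (by omega) (by omega)
      refine win_loop_pos (by simp) (by simp) (.seq h1 (.seq h2 ?_)) (by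
        rwa [show n + 1 + (a :: w).length = n + (δ :: a :: w).length by
          simp only [List.length_cons]; ring, show κ + d + binLength d (a :: w) =
            κ + binLength d (δ :: a :: w) by rw [binLength, add_assoc]] at k1)
      have h3 : Runs V (.seq (clr (o + 4)) (.seq (addConst (o + 9) d) (.inc (o + 5))))
          (win o f [x, u, z, n + 1, δ, 0, 0, 0, c, κ, n'] ((a :: w) :: ws) out)
          (win o f [x, u, z, n + 1, 0, 1, 0, 0, c, κ + d, n'] ((a :: w) :: ws) out) := by
        refine .seq (win_clr (by simp)) ?_
        simp only [List.set]
        refine .seq (win_addConst d (by simp) (by simp; omega)) ?_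
        simp only [List.set, List.getD_cons_succ, List.getD_cons_zero]
        have := win_inc (V := V) (o := o) (f := f) (out := out) (inp := (a :: w) :: ws) (i := 5)
          (xs := [x, u, z, n + 1, 0, 0, 0, 0, c, κ + d, n']) (by simp) (by simp; omega)
        simpa using this
      obtain ⟨k, h⟩ := h3
      exact ⟨_, .last_neg rfl h⟩

end

/-! ### Simple machines -/

/-- The pure program `q` computes the partial function `u`: its arguments `x`, `u₀`, `n` are in the
registers `o`, `o + 1` and `o + 3`, its value `v ≥ u₀` is put into register `o + 1`, and `2 ^ v` into
register `o + 2`, with values up to about `2 ^ v`. -/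
structure IsCore (o : ℕ) (q : Prog) (u : ℕ → ℕ → ℕ → Part ℕ) (c₀ : ℕ) : Prop where
  pure : q.Pure
  bound : q.bound ≤ o + 4
  pos : 0 < o
  le : ∀ n x u₀, ∀ v ∈ u n x u₀, u₀ ≤ v
  -- The number `2 ^ v` is left behind to force at least `v + 1` register cells; together with the
  -- upper bound this fixes the space.
  runs : ∀ n x u₀, ∀ v ∈ u n x u₀, ∀ V, 2 ^ v + x + n + c₀ ≤ V → ∀ s : St,
    (∀ r < o, s r = 0) → s o = x → s (o + 1) = u₀ → s (o + 2) = 0 → s (o + 3) = n →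
    (∀ r, s r ≤ V) → ∃ t, Runs V q s t ∧ t 0 = 0 ∧ t (o + 1) = v ∧ t (o + 2) = 2 ^ v
  div : ∀ n x u₀, ¬ (u n x u₀).Dom → ∀ s : St,
    (∀ r < o, s r = 0) → s o = x → s (o + 1) = u₀ → s (o + 2) = 0 → s (o + 3) = n →
    ∀ V t, ¬ Runs V q s t

/-- Read the only argument. -/
def prologue₁ (o N d c n : ℕ) : Prog :=
  -- Register `o + 1` receives `c` plus `d` per digit of `x`. This is the bound `u₀`, with `x < 2 ^
  -- u₀`, so that reading `x` fits into the space `v ≥ u₀`.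
  .seq (addConst (o + 3) n) (.seq (addConst (o + 1) c) (.seq (.inc (o + 4)) (.seq (.inc (o + 5))
    (readWord o N d))))

/-- Write `2 * v + 2`, where `v` is in register `o + 1`, with `v` digits. -/
def epilogue₁ (o N : ℕ) : Prog :=
  .seq (clr (o + 0)) (.seq (addConst (o + 0) N) (.seq (copy (o + 1) (o + 4))
    (.seq (addTo (o + 1) (o + 4)) (.seq (addConst (o + 4) 2) (.seq (copy (o + 1) (o + 5))
      (emitLoop o N))))))

/-- Read two arguments. -/
def prologue₂ (o N d c : ℕ) : Prog :=
  .seq (.inc (o + 5)) (.seq (readLength o N d) (.seq (copy (o + 3) (o + 10))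
    (.seq (addConst (o + 1) c) (.seq (.inc (o + 4)) (.seq (.inc (o + 5)) (readWord o N d))))))

/-- Write `4 * v + l`, where `v` and `l` are in the registers `o + 1` and `o + 9`. -/
def epilogue₂ (o N : ℕ) : Prog :=
  .seq (clr (o + 0)) (.seq (addConst (o + 0) N) (.seq (copy (o + 1) (o + 4))
    (.seq (addTo (o + 1) (o + 4)) (.seq (addTo (o + 1) (o + 4)) (.seq (addTo (o + 1) (o + 4))
      (.seq (addTo (o + 9) (o + 4)) (.seq (copy (o + 1) (o + 5)) (.seq (addTo (o + 10) (o + 5))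
        (emitLoop o N)))))))))

theorem bound_addConst (r c : ℕ) : (addConst r c).bound ≤ r + 1 := by
  induction c with
  | zero => simp [addConst, Prog.bound]
  | succ c ih => simp only [addConst, Prog.bound]; omega

theorem bound_addTo {a b k : ℕ} (ha : a < k) (hb : b < k) : (addTo a b).bound ≤ k := by
  simp only [addTo, move, Prog.bound]
  omega

theorem bound_copy {a b k : ℕ} (ha : a < k) (hb : b < k) : (copy a b).bound ≤ k := by
  simp only [copy, addTo, clr, move, Prog.bound]
  omega

theorem emitsBelow_addConst (r c N : ℕ) : (addConst r c).EmitsBelow N :=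
  (pure_addConst r c).emitsBelow N

section

variable {o N d : ℕ}

theorem bound_readWord : (readWord o N d).bound ≤ o + 11 := by
  have h1 := bound_addConst (o + 1) d
  have h2 := bound_addConst (o + 4) N
  simp only [readWord, readDigit, addTo, copy, clr, move, Prog.bound]
  omega

theorem bound_readLength : (readLength o N d).bound ≤ o + 11 := by
  have h1 := bound_addConst (o + 9) d
  have h2 := bound_switch (h := o + 4) (b := o + 11) (g := fun j => addConst (o + 9) (len j))
    (by omega) (fun k => (bound_addConst _ _).trans (by omega)) N 0
  simp only [readLength, readDigit, clr, Prog.bound]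
  omega

theorem bound_emitLoop : (emitLoop o N).bound ≤ o + 11 := by
  have h2 := bound_switch (h := o + 6) (b := o + 11) (g := .emit)
    (by omega) (fun k => by simp [Prog.bound]) N 0
  simp only [emitLoop, divmod, ifnz, addTo, clr, move, Prog.bound]
  omega

theorem bound_prologue₁ (c n : ℕ) : (prologue₁ o N d c n).bound ≤ o + 11 := by
  have h1 := bound_addConst (o + 3) n
  have h2 := bound_addConst (o + 1) c
  have h3 := bound_readWord (o := o) (N := N) (d := d)
  simp only [prologue₁, Prog.bound]
  omega

theorem bound_epilogue₁ : (epilogue₁ o N).bound ≤ o + 11 := by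
  have h1 := bound_addConst (o + 0) N
  have h2 := bound_addConst (o + 4) 2
  have h3 := bound_emitLoop (o := o) (N := N)
  simp only [epilogue₁, copy, addTo, move, clr, Prog.bound]
  omega

theorem bound_prologue₂ (c : ℕ) : (prologue₂ o N d c).bound ≤ o + 11 := by
  have h2 := bound_addConst (o + 1) c
  have h3 := bound_readWord (o := o) (N := N) (d := d)
  have h4 := bound_readLength (o := o) (N := N) (d := d)
  simp only [prologue₂, copy, addTo, move, clr, Prog.bound]
  omega

theorem bound_epilogue₂ : (epilogue₂ o N).bound ≤ o + 11 := by
  have h1 := bound_addConst (o + 0) N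
  have h3 := bound_emitLoop (o := o) (N := N)
  simp only [epilogue₂, clr, Prog.bound, max_le_iff]
  have h4 := bound_addTo (a := o + 1) (b := o + 4) (k := o + 11) (by omega) (by omega)
  have h5 := bound_addTo (a := o + 9) (b := o + 4) (k := o + 11) (by omega) (by omega)
  have h6 := bound_addTo (a := o + 10) (b := o + 5) (k := o + 11) (by omega) (by omega)
  have h7 := bound_copy (a := o + 1) (b := o + 4) (k := o + 11) (by omega) (by omega)
  have h8 := bound_copy (a := o + 1) (b := o + 5) (k := o + 11) (by omega) (by omega)
  exact ⟨⟨by omega, by omega⟩, by omega, h7, h4, h4, h4, h5, h8, h6, h3⟩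

theorem emitsBelow_readWord : (readWord o N d).EmitsBelow N := by
  simp [readWord, readDigit, addTo, copy, clr, move, Prog.EmitsBelow, emitsBelow_addConst]

theorem emitsBelow_readLength : (readLength o N d).EmitsBelow N := by
  have := emitsBelow_switch (h := o + 4) (g := fun j => addConst (o + 9) (len j)) (N := N) N 0
    fun j _ _ => emitsBelow_addConst _ _ _
  simp [readLength, readDigit, clr, Prog.EmitsBelow, emitsBelow_addConst, this]

theorem emitsBelow_emitLoop : (emitLoop o N).EmitsBelow N := by
  have := emitsBelow_switch (h := o + 6) (g := .emit) (N := N) N 0 fun j _ h => by simpa [Prog.EmitsBelow] using h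
  simp [emitLoop, divmod, ifnz, addTo, clr, move, Prog.EmitsBelow, this]

theorem start_eq (N : ℕ) (xs : List ℕ) :
    start N xs = win o (fun _ => 0) [0, 0, 0, 0, 0, 0, 0, 0, 0, 0, 0] (xs.map (word N)) [] := by
  refine St.ext_regs (fun r => ?_) rfl rfl
  simp only [win, start]
  split_ifs with h
  · obtain ⟨k, rfl⟩ := Nat.exists_eq_add_of_le h.1
    have hk : k < 11 := by simpa using h.2
    rw [Nat.add_sub_cancel_left]
    interval_cases k <;> rfl
  · rfl

theorem runs_prologue₁ {V c n x : ℕ} (ho : 0 < o) (hN : 1 < N) (h1 : N ^ (word N x).length ≤ V)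
    (h2 : c + d * (word N x).length ≤ V) (h3 : n ≤ V) :
    ∃ p, p ≤ V ∧ Runs V (prologue₁ o N d c n) (start N [x]) (win o (fun _ => 0)
      [x, c + d * (word N x).length, 0, n, p, 0, 0, 0, 0, 0, 0] [] []) := by
  have hV : 1 ≤ V := (Nat.one_le_pow _ _ (by omega)).trans h1
  have hx := lt_pow_length_word hN x
  obtain ⟨p, k1, k2⟩ := win_readWord (V := V) (o := o) (f := fun _ => 0) (out := []) (N := N) (d := d)
    (z := 0) (n := n) (c := 0) (κ := 0) (n' := 0) (ws := []) ho rfl (by omega) (word N x)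
    (word_ne_nil x) (word_lt (by omega) x) 0 c 1 one_pos (by rw [ofDigits_word]; omega)
    (by omega) h2
  rw [ofDigits_word, one_mul, zero_add] at k1
  refine ⟨p, k2, ?_⟩
  rw [start_eq (o := o)]
  refine .seq (win_addConst n (by simp) (by simpa using h3)) ?_
  simp only [List.set, List.getD_cons_succ, List.getD_cons_zero, zero_add]
  refine .seq (win_addConst c (by simp) (by simp; omega)) ?_
  simp only [List.set, List.getD_cons_succ, List.getD_cons_zero, zero_add]
  refine .seq (win_inc (by simp) (by simpa using hV)) ?_
  simp only [List.set, List.getD_cons_succ, List.getD_cons_zero, zero_add]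
  refine .seq (win_inc (by simp) (by simpa using hV)) ?_
  simp only [List.set, List.getD_cons_succ, List.getD_cons_zero, zero_add]
  exact k1

theorem runs_prologue₂ {V c k x : ℕ} (ho : 0 < o) (hNd : N = 2 ^ d) (hd : 0 < d) (hNV : N ≤ V)
    (h1 : N ^ (word N x).length ≤ V)
    (h2 : c + d * (word N x).length ≤ V) (h3 : d * (word N k).length ≤ V) :
    ∃ p, p ≤ V ∧ Runs V (prologue₂ o N d c) (start N [k, x]) (win o (fun _ => 0)
      [x, c + d * (word N x).length, 0, (word N k).length, p, 0, 0, 0, 0, len k,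
        (word N k).length] [] []) := by
  have hN : 1 < N := hNd ▸ Nat.one_lt_two_pow hd.ne'
  have hV : 1 ≤ V := (Nat.one_le_pow _ _ (by omega)).trans h1
  have hx := lt_pow_length_word hN x
  have hnV : (word N k).length ≤ V := (Nat.le_mul_of_pos_left _ hd).trans h3
  have hr := win_readLength (V := V) (o := o) (f := fun _ => 0) (out := []) (x := 0) (u := 0) (z := 0)
    (c := 0) (n' := 0) (ws := [word N x]) hNd hd (word N k) (word_ne_nil k) (word_lt (by omega) k)
    0 0 hNV (by omega) (by omega)
  rw [zero_add, zero_add, hNd, binLength_word hd, ← hNd] at hr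
  obtain ⟨p, k1, k2⟩ := win_readWord (V := V) (o := o) (f := fun _ => 0) (out := []) (N := N) (d := d)
    (z := 0) (n := (word N k).length) (c := 0) (κ := len k) (n' := (word N k).length) (ws := []) ho
    rfl (by omega) (word N x) (word_ne_nil x) (word_lt (by omega) x) 0 c 1 one_pos
    (by rw [ofDigits_word]; omega) (by omega) h2
  rw [ofDigits_word, one_mul, zero_add] at k1
  refine ⟨p, k2, ?_⟩
  rw [start_eq (o := o)]
  refine .seq (win_inc (by simp) (by simpa using hV)) ?_
  simp only [List.set, List.getD_cons_succ, List.getD_cons_zero, zero_add]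
  refine .seq hr ?_
  refine .seq (win_copy ho rfl (by simp) (by simp) (by simp) (by simpa using hnV)) ?_
  simp only [List.set, List.getD_cons_succ, List.getD_cons_zero]
  refine .seq (win_addConst c (by simp) (by simp; omega)) ?_
  simp only [List.set, List.getD_cons_succ, List.getD_cons_zero, zero_add]
  refine .seq (win_inc (by simp) (by simpa using hV)) ?_
  simp only [List.set, List.getD_cons_succ, List.getD_cons_zero, zero_add]
  refine .seq (win_inc (by simp) (by simpa using hV)) ?_
  simp only [List.set, List.getD_cons_succ, List.getD_cons_zero, zero_add]
  exact k1

theorem runs_epilogue₁ {V a v z b p κ n' : ℕ} {f : ℕ → ℕ} (ho : 0 < o) (h0 : f 0 = 0)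
    (hN : 0 < N) (hNV : N ≤ V) (hv : 2 * v + 2 ≤ V) :
    ∃ v' h', Runs V (epilogue₁ o N) (win o f [a, v, z, b, p, 0, 0, 0, 0, κ, n'] [] [])
      (win o f [N, v, z, b, v', 0, h', 0, 0, κ, n'] [] (padDigits N v (2 * v + 2))) := by
  obtain ⟨v', h', k⟩ := win_emitLoop (V := V) (N := N) (o := o) (f := f) (z := v) (a := z) (b := b)
    (l := [κ, n']) ho h0 hN hNV v (2 * v + 2) 0 [] hv
  rw [List.nil_append] at k
  refine ⟨v', h', ?_⟩
  refine .seq (win_clr (by simp)) ?_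
  simp only [List.set]
  refine .seq (win_addConst N (by simp) (by simpa using hNV)) ?_
  simp only [List.set, List.getD_cons_zero, zero_add]
  refine .seq (win_copy ho h0 (by simp) (by simp) (by simp) (by simp; omega)) ?_
  simp only [List.set, List.getD_cons_succ, List.getD_cons_zero]
  refine .seq (win_addTo ho h0 (by simp) (by simp) (by simp) (by simp; omega)) ?_
  simp only [List.set, List.getD_cons_succ, List.getD_cons_zero]
  refine .seq (win_addConst 2 (by simp) (by simp; omega)) ?_
  simp only [List.set, List.getD_cons_succ, List.getD_cons_zero]
  refine .seq (win_copy ho h0 (by simp) (by simp) (by simp) (by simp; omega)) ?_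
  simp only [List.set, List.getD_cons_succ, List.getD_cons_zero]
  rwa [← two_mul]

theorem runs_epilogue₂ {V a v z b p κ n' : ℕ} {f : ℕ → ℕ} (ho : 0 < o) (h0 : f 0 = 0)
    (hN : 0 < N) (hNV : N ≤ V) (hv : 4 * v + κ ≤ V) (hn : v + n' ≤ V) :
    ∃ v' h', Runs V (epilogue₂ o N) (win o f [a, v, z, b, p, 0, 0, 0, 0, κ, n'] [] [])
      (win o f [N, v, z, b, v', 0, h', 0, 0, κ, n'] [] (padDigits N (v + n') (4 * v + κ))) := by
  obtain ⟨v', h', k⟩ := win_emitLoop (V := V) (N := N) (o := o) (f := f) (z := v) (a := z) (b := b)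
    (l := [κ, n']) ho h0 hN hNV (v + n') (4 * v + κ) 0 [] hv
  rw [List.nil_append] at k
  refine ⟨v', h', ?_⟩
  refine .seq (win_clr (by simp)) ?_
  simp only [List.set]
  refine .seq (win_addConst N (by simp) (by simpa using hNV)) ?_
  simp only [List.set, List.getD_cons_zero, zero_add]
  refine .seq (win_copy ho h0 (by simp) (by simp) (by simp) (by simp; omega)) ?_
  simp only [List.set, List.getD_cons_succ, List.getD_cons_zero]
  refine .seq (win_addTo ho h0 (by simp) (by simp) (by simp) (by simp; omega)) ?_
  simp only [List.set, List.getD_cons_succ, List.getD_cons_zero]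
  refine .seq (win_addTo ho h0 (by simp) (by simp) (by simp) (by simp; omega)) ?_
  simp only [List.set, List.getD_cons_succ, List.getD_cons_zero]
  refine .seq (win_addTo ho h0 (by simp) (by simp) (by simp) (by simp; omega)) ?_
  simp only [List.set, List.getD_cons_succ, List.getD_cons_zero]
  refine .seq (win_addTo ho h0 (by simp) (by simp) (by simp) (by simp; omega)) ?_
  simp only [List.set, List.getD_cons_succ, List.getD_cons_zero]
  refine .seq (win_copy ho h0 (by simp) (by simp) (by simp) (by simp; omega)) ?_
  simp only [List.set, List.getD_cons_succ, List.getD_cons_zero]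
  refine .seq (win_addTo ho h0 (by simp) (by simp) (by simp) (by simp; omega)) ?_
  simp only [List.set, List.getD_cons_succ, List.getD_cons_zero]
  rwa [show v + v + v + v + κ = 4 * v + κ by ring]

end

/-! ### From cores to machines -/

/-- A core yields a machine that outputs its own space. -/
theorem IsCore.exists_machine₁ {o c₀ : ℕ} {q : Prog} {u : ℕ → ℕ → ℕ → Part ℕ} (hq : IsCore o q u c₀)
    (n : ℕ) : ∃ d c, 0 < d ∧ ∃ m : Machine, m.Valid ∧ ∀ x,
      m.result [x] = (u n x (c + d * (word (2 ^ d) x).length)).map (fun v => 2 * v + 2) ∧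
      m.result [x] = m.space [x] := by
  -- A cell needs one bit for each register; reading and writing use eleven registers from `o` on,
  -- and the core none beyond them.
  obtain ⟨d, hd⟩ : ∃ d, d = o + 11 := ⟨_, rfl⟩
  -- Since `v ≥ c`, this absorbs `n`, `c₀`, the base `2 ^ d` and the additive constants below.
  obtain ⟨c, hc⟩ : ∃ c, c = n + c₀ + d + 3 := ⟨_, rfl⟩
  have hd0 : 0 < d := by omega
  have hN : 1 < 2 ^ d := Nat.one_lt_two_pow hd0.ne'
  obtain ⟨P, hP⟩ : ∃ P : Prog, P = .seq (prologue₁ o (2 ^ d) d c n) (.seq q (epilogue₁ o (2 ^ d))) :=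
    ⟨_, rfl⟩
  have hb : P.bound ≤ d := by
    have h1 := bound_prologue₁ (o := o) (N := 2 ^ d) (d := d) c n
    have h2 := bound_epilogue₁ (o := o) (N := 2 ^ d)
    have h3 := hq.bound
    rw [hP]
    simp only [Prog.bound]
    omega
  have he : P.EmitsBelow (2 ^ d) := by
    rw [hP]
    refine ⟨?_, hq.pure.emitsBelow _, ?_⟩
    · simp [prologue₁, Prog.EmitsBelow, emitsBelow_addConst, emitsBelow_readWord]
    · simp [epilogue₁, Prog.EmitsBelow, emitsBelow_addConst, emitsBelow_emitLoop, copy, addTo, move,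
        clr]
  refine ⟨d, c, hd0, machine P d, machine_valid hd0 hb he, fun x => ?_⟩
  obtain ⟨m, hm⟩ : ∃ m, m = (word (2 ^ d) x).length := ⟨_, rfl⟩
  have hx := lt_pow_length_word hN x
  rw [← hm] at hx ⊢
  have hpro (V : ℕ) (hV : 2 ^ (c + d * m) ≤ V) := runs_prologue₁ (o := o) (d := d) (V := V) (c := c)
    (n := n) (x := x) hq.pos hN (by
      rw [← hm, ← pow_mul]
      exact (Nat.pow_le_pow_right (by norm_num) (by omega)).trans hV) (by
      rw [← hm]; exact Nat.lt_two_pow_self.le.trans hV) (by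
      have : c + d * m < 2 ^ (c + d * m) := Nat.lt_two_pow_self
      omega)
  rw [← hm] at hpro
  obtain ⟨s, hs⟩ : ∃ s : ℕ → St, s = fun p => win o (fun _ => 0)
    [x, c + d * m, 0, n, p, 0, 0, 0, 0, 0, 0] [] [] := ⟨_, rfl⟩
  have hs0 (p : ℕ) : ∀ r < o, s p r = 0 := fun r hr => by rw [hs, win_other (.inl hr)]
  have hs1 (p : ℕ) : s p o = x := by rw [hs]; exact win_get (i := 0) (by simp)
  have hs2 (p : ℕ) : s p (o + 1) = c + d * m := by rw [hs]; exact win_get (i := 1) (by simp)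
  have hs3 (p : ℕ) : s p (o + 2) = 0 := by rw [hs]; exact win_get (i := 2) (by simp)
  have hs4 (p : ℕ) : s p (o + 3) = n := by rw [hs]; exact win_get (i := 3) (by simp)
  by_cases hdom : (u n x (c + d * m)).Dom
  · obtain ⟨v, hv⟩ := Part.dom_iff_mem.1 hdom
    have hle := hq.le _ _ _ _ hv
    have hpow : 2 ^ (c + d * m) ≤ 2 ^ v := Nat.pow_le_pow_right (by norm_num) hle
    have hV2 : 2 ^ (v + 1) = 2 ^ v + 2 ^ v := by ring
    -- From `x < 2 ^ (d * m)` and `c < 2 ^ c`: the product of the two powers is at most `2 ^ v` and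
    -- exceeds the sum `x + c`.
    have hbig : x + n + c₀ < 2 ^ v := by
      have h1 : c < 2 ^ c := Nat.lt_two_pow_self
      have h2 : 2 ^ (d * m) * (c + 1) ≤ 2 ^ (d * m) * 2 ^ c := Nat.mul_le_mul_left _ h1
      rw [← pow_add, add_comm (d * m)] at h2
      rw [← pow_mul] at hx
      have h3 : 1 * c ≤ 2 ^ (d * m) * c := Nat.mul_le_mul_right _ Nat.one_le_two_pow
      rw [mul_add] at h2
      omega
    have hNv : 2 ^ d ≤ 2 ^ v := Nat.pow_le_pow_right (by norm_num) (by omega)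
    have hvv : v + 2 ≤ 2 ^ v := by
      obtain ⟨w, rfl⟩ : ∃ w, v = w + 2 := ⟨v - 2, by omega⟩
      have : w < 2 ^ w := Nat.lt_two_pow_self
      rw [pow_add]; omega
    -- The largest number of `v + 1` binary digits.
    obtain ⟨V, hV⟩ : ∃ V, V = 2 ^ (v + 1) - 1 := ⟨_, rfl⟩
    obtain ⟨p, hpV, k1⟩ := hpro V (by omega)
    have hsV : ∀ r, s p r ≤ V := by
      rw [hs]
      refine win_le (fun _ => Nat.zero_le _) ?_
      have : c + d * m < 2 ^ (c + d * m) := Nat.lt_two_pow_self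
      simp only [List.mem_cons, List.not_mem_nil, or_false, forall_eq_or_imp, forall_eq]
      omega
    obtain ⟨t, k2, t0, t1, t2⟩ := hq.runs n x _ v hv V (by omega) (s p) (hs0 p) (hs1 p) (hs2 p)
      (hs3 p) (hs4 p) hsV
    have htf (j : ℕ) (hj : 4 ≤ j) (hj' : j < 11) : t (o + j) =
        [x, c + d * m, 0, n, p, 0, 0, 0, 0, 0, 0].getD j 0 := by
      rw [k2.frame (by have := hq.bound; omega), hs]
      exact win_get (by simpa using hj')
    have ht : t = win o t [t o, v, 2 ^ v, t (o + 3), p, 0, 0, 0, 0, 0, 0] [] [] := by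
      have hi : t.inp = [] := by rw [k2.inp hq.pure, hs]; rfl
      have ho : t.out = [] := by rw [k2.out hq.pure, hs]; rfl
      conv_lhs => rw [win_self t o 11, hi, ho]
      congr 1
      simp only [List.range_succ, List.range_zero, List.nil_append, List.map_cons,
        List.map_nil, List.cons_append, add_zero, t1, t2]
      rw [htf 4 (by decide) (by decide), htf 5 (by decide) (by decide),
        htf 6 (by decide) (by decide), htf 7 (by decide) (by decide), htf 8 (by decide) (by decide),
        htf 9 (by decide) (by decide), htf 10 (by decide) (by decide)]
      rfl
    obtain ⟨v', h', k3⟩ := runs_epilogue₁ (V := V) (a := t o) (v := v) (z := 2 ^ v) (b := t (o + 3))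
      (p := p) (κ := 0) (n' := 0) (f := t) (N := 2 ^ d) hq.pos t0 (by omega) (by omega) (by omega)
    rw [← ht] at k3
    have hs' : s p = win o (fun _ => 0) [x, c + d * m, 0, n, p, 0, 0, 0, 0, 0, 0] [] [] := by
      rw [hs]
    rw [← hs'] at k1
    have hrun : Runs V P (start (2 ^ d) [x]) _ := hP ▸ k1.seq (k2.seq k3)
    obtain ⟨cf, c1, c2, w, hw, c3, c4⟩ := machine_final hd0 hb he (by simp) hrun rfl
      (W := v + 1) (by omega) (by omega)
    -- At most `v + 1` cells because no register exceeds `V`, and no fewer because one register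
    -- holds `2 ^ v`.
    have hw' : w = v + 1 := by
      have h1 := c3 (o + 2) (by omega)
      have h2 : (2 : ℕ) ^ v < 2 ^ w := by
        rw [win_get (i := 2) (by rw [List.length_cons, List.length_cons, List.length_cons]; omega)] at h1
        exact h1
      have := (Nat.pow_lt_pow_iff_right (by norm_num)).1 h2
      omega
    have hdm : m ≤ d * m := Nat.le_mul_of_pos_left _ hd0
    have hlen : (inputTape (2 ^ d) [x]).length = m + 1 := by simp [inputTape, hm]
    have hout : Nat.ofDigits (2 ^ d) (padDigits (2 ^ d) v (2 * v + 2)) = 2 * v + 2 := by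
      refine ofDigits_padDigits _ _ ?_
      rw [← pow_mul]
      refine lt_of_lt_of_le (by omega : 2 * v + 2 < 2 ^ (v + 1)) (Nat.pow_le_pow_right (by norm_num) ?_)
      have : 2 * v ≤ d * v := Nat.mul_le_mul_right _ (by omega)
      omega
    have hbase : (machine P d).base = 2 ^ d := rfl
    have hfin : (machine P d).final [x] = Part.some cf := Part.eq_some_iff.2 c1
    have e1 : (machine P d).result [x] = Part.some (2 * v + 2) := by
      rw [Machine.result, hfin, Part.map_some, hbase, c2]
      exact congrArg Part.some hout
    have e2 : (machine P d).space [x] = Part.some (2 * v + 2) := by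
      rw [Machine.space, hfin, Part.map_some, c4, hlen, hw']
      congr 1
      -- Register cells, two blanks, and `v` output cells, which cover the input since `m + 1 ≤ v`.
      -- Less one, this is the number written.
      change v + 1 + 2 + max (m + 1) (padDigits (2 ^ d) v (2 * v + 2)).length - 1 = 2 * v + 2
      rw [length_padDigits]
      omega
    rw [e1, e2, Part.eq_some_iff.2 hv, Part.map_some]
    simp
  · obtain ⟨p, -, k1⟩ := hpro _ le_rfl
    have hs' : s p = win o (fun _ => 0) [x, c + d * m, 0, n, p, 0, 0, 0, 0, 0, 0] [] [] := by
      rw [hs]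
    have hfin : ¬ ((machine P d).final [x]).Dom := by
      refine machine_not_dom hd0 hP hb he (by simp) k1 hq.pure (hs' ▸ ?_)
      exact fun V t => hq.div n x _ hdom (s p) (hs0 p) (hs1 p) (hs2 p) (hs3 p) (hs4 p) V t
    rw [Machine.result, Machine.space, Part.eq_none_iff'.2 hfin, Part.eq_none_iff'.2 hdom]
    simp

/-- A core yields a machine with two arguments whose space is bounded by its output. -/
theorem IsCore.exists_machine₂ {o c₀ : ℕ} {q : Prog} {u : ℕ → ℕ → ℕ → Part ℕ}
    (hq : IsCore o q u c₀) : ∃ d c, 0 < d ∧ ∃ m : Machine, m.Valid ∧ ∀ k x,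
      m.result [k, x] = (u (word (2 ^ d) k).length x (c + d * (word (2 ^ d) x).length)).map
        (fun v => 4 * v + len k) ∧
      ext (m.space [k, x]) ≤ ext (m.result [k, x]) := by
  obtain ⟨d, hd⟩ : ∃ d, d = o + 11 := ⟨_, rfl⟩
  obtain ⟨c, hc⟩ : ∃ c, c = c₀ + d + 5 := ⟨_, rfl⟩
  have hd0 : 0 < d := by omega
  have hN : 1 < 2 ^ d := Nat.one_lt_two_pow hd0.ne'
  obtain ⟨P, hP⟩ : ∃ P : Prog, P = .seq (prologue₂ o (2 ^ d) d c) (.seq q (epilogue₂ o (2 ^ d))) :=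
    ⟨_, rfl⟩
  have hb : P.bound ≤ d := by
    have h1 := bound_prologue₂ (o := o) (N := 2 ^ d) (d := d) c
    have h2 := bound_epilogue₂ (o := o) (N := 2 ^ d)
    have h3 := hq.bound
    rw [hP]
    simp only [Prog.bound]
    omega
  have he : P.EmitsBelow (2 ^ d) := by
    rw [hP]
    refine ⟨?_, hq.pure.emitsBelow _, ?_⟩
    · simp [prologue₂, Prog.EmitsBelow, emitsBelow_addConst, emitsBelow_readWord,
        emitsBelow_readLength, copy, addTo, move, clr]
    · simp [epilogue₂, Prog.EmitsBelow, emitsBelow_addConst, emitsBelow_emitLoop, copy, addTo, move,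
        clr]
  refine ⟨d, c, hd0, machine P d, machine_valid hd0 hb he, fun k x => ?_⟩
  obtain ⟨m, hm⟩ : ∃ m, m = (word (2 ^ d) x).length := ⟨_, rfl⟩
  obtain ⟨n, hn⟩ : ∃ n, n = (word (2 ^ d) k).length := ⟨_, rfl⟩
  have hn0 : 0 < n := hn ▸ List.length_pos_of_ne_nil (word_ne_nil k)
  have hκ1 : len k ≤ d * n := by
    rw [← binLength_word hd0, hn]
    exact binLength_le hd0 (word_lt (by omega) k)
  have hκ2 : 2 * n ≤ len k + 1 := by
    rw [← binLength_word hd0, hn]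
    exact le_binLength (by omega) (word_ne_nil k)
  have hx := lt_pow_length_word hN x
  rw [← hm] at hx ⊢
  rw [← hn]
  have hpro (V : ℕ) (hV : 2 ^ (c + d * m) ≤ V) (hV' : d * n ≤ V) :=
    runs_prologue₂ (o := o) (V := V) (c := c) (k := k) (x := x) hq.pos rfl hd0
      ((Nat.pow_le_pow_right (by norm_num) (by omega)).trans hV) (by
      rw [← hm, ← pow_mul]
      exact (Nat.pow_le_pow_right (by norm_num) (by omega)).trans hV) (by
      rw [← hm]; exact Nat.lt_two_pow_self.le.trans hV) (hn ▸ hV')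
  rw [← hm, ← hn] at hpro
  obtain ⟨s, hs⟩ : ∃ s : ℕ → St, s = fun p => win o (fun _ => 0)
    [x, c + d * m, 0, n, p, 0, 0, 0, 0, len k, n] [] [] := ⟨_, rfl⟩
  have hs0 (p : ℕ) : ∀ r < o, s p r = 0 := fun r hr => by rw [hs, win_other (.inl hr)]
  have hs1 (p : ℕ) : s p o = x := by rw [hs]; exact win_get (i := 0) (by simp)
  have hs2 (p : ℕ) : s p (o + 1) = c + d * m := by rw [hs]; exact win_get (i := 1) (by simp)
  have hs3 (p : ℕ) : s p (o + 2) = 0 := by rw [hs]; exact win_get (i := 2) (by simp)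
  have hs4 (p : ℕ) : s p (o + 3) = n := by rw [hs]; exact win_get (i := 3) (by simp)
  by_cases hdom : (u n x (c + d * m)).Dom
  · obtain ⟨v, hv⟩ := Part.dom_iff_mem.1 hdom
    have hle := hq.le _ _ _ _ hv
    have hpow : 2 ^ (c + d * m) ≤ 2 ^ v := Nat.pow_le_pow_right (by norm_num) hle
    have hbig : x + c₀ + d < 2 ^ v := by
      have h1 : c < 2 ^ c := Nat.lt_two_pow_self
      have h2 : 2 ^ (d * m) * (c + 1) ≤ 2 ^ (d * m) * 2 ^ c := Nat.mul_le_mul_left _ h1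
      rw [← pow_add, add_comm (d * m)] at h2
      rw [← pow_mul] at hx
      have h3 : 1 * c ≤ 2 ^ (d * m) * c := Nat.mul_le_mul_right _ Nat.one_le_two_pow
      rw [mul_add] at h2
      omega
    have hNv : 2 ^ d ≤ 2 ^ v := Nat.pow_le_pow_right (by norm_num) (by omega)
    have hvv : 2 * v ≤ 2 ^ v := by
      obtain ⟨w, rfl⟩ : ∃ w, v = w + 2 := ⟨v - 2, by omega⟩
      have : w < 2 ^ w := Nat.lt_two_pow_self
      rw [pow_add]; omega
    have hV2 : 2 * 2 ^ v + 2 * (2 ^ v * n) ≤ 2 ^ (v + n + 1) := by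
      have h1 : n < 2 ^ n := Nat.lt_two_pow_self
      have h2 : 2 ^ v * (n + 1) ≤ 2 ^ v * 2 ^ n := Nat.mul_le_mul_left _ h1
      rw [← pow_add, mul_add] at h2
      rw [pow_succ]
      omega
    have hdn : d * n + n ≤ 2 ^ v * n := by
      have : (d + 1) * n ≤ 2 ^ v * n := Nat.mul_le_mul_right _ (by omega)
      rwa [add_mul, one_mul] at this
    -- The extra `n` cells make room for `n` and for `len k ≤ d * n`, which may be large compared
    -- with `2 ^ v`.
    obtain ⟨V, hV⟩ : ∃ V, V = 2 ^ (v + n + 1) - 1 := ⟨_, rfl⟩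
    obtain ⟨p, hpV, k1⟩ := hpro V (by omega) (by omega)
    have hsV : ∀ r, s p r ≤ V := by
      rw [hs]
      refine win_le (fun _ => Nat.zero_le _) ?_
      have : c + d * m < 2 ^ (c + d * m) := Nat.lt_two_pow_self
      simp only [List.mem_cons, List.not_mem_nil, or_false, forall_eq_or_imp, forall_eq]
      omega
    obtain ⟨t, k2, t0, t1, t2⟩ := hq.runs n x _ v hv V (by omega) (s p) (hs0 p) (hs1 p) (hs2 p)
      (hs3 p) (hs4 p) hsV
    have htf (j : ℕ) (hj : 4 ≤ j) (hj' : j < 11) : t (o + j) =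
        [x, c + d * m, 0, n, p, 0, 0, 0, 0, len k, n].getD j 0 := by
      rw [k2.frame (by have := hq.bound; omega), hs]
      exact win_get (by simpa using hj')
    have ht : t = win o t [t o, v, 2 ^ v, t (o + 3), p, 0, 0, 0, 0, len k, n] [] [] := by
      have hi : t.inp = [] := by rw [k2.inp hq.pure, hs]; rfl
      have ho : t.out = [] := by rw [k2.out hq.pure, hs]; rfl
      conv_lhs => rw [win_self t o 11, hi, ho]
      congr 1
      simp only [List.range_succ, List.range_zero, List.nil_append, List.map_cons,
        List.map_nil, List.cons_append, add_zero, t1, t2]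
      rw [htf 4 (by decide) (by decide), htf 5 (by decide) (by decide),
        htf 6 (by decide) (by decide), htf 7 (by decide) (by decide), htf 8 (by decide) (by decide),
        htf 9 (by decide) (by decide), htf 10 (by decide) (by decide)]
      rfl
    obtain ⟨v', h', k3⟩ := runs_epilogue₂ (V := V) (a := t o) (v := v) (z := 2 ^ v) (b := t (o + 3))
      (p := p) (κ := len k) (n' := n) (f := t) (N := 2 ^ d) hq.pos t0 (by omega) (by omega) (by omega)
      (by omega)
    rw [← ht] at k3
    have hs' : s p = win o (fun _ => 0) [x, c + d * m, 0, n, p, 0, 0, 0, 0, len k, n] [] [] := by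
      rw [hs]
    rw [← hs'] at k1
    have hrun : Runs V P (start (2 ^ d) [k, x]) _ := hP ▸ k1.seq (k2.seq k3)
    obtain ⟨cf, c1, c2, w, hw, c3, c4⟩ := machine_final hd0 hb he (by simp) hrun rfl
      (W := v + n + 1) (by omega) (by omega)
    have hdm : m ≤ d * m := Nat.le_mul_of_pos_left _ hd0
    have hlen : (inputTape (2 ^ d) [k, x]).length = n + m + 2 := by
      simp [inputTape, hm, hn]; omega
    have hout : Nat.ofDigits (2 ^ d) (padDigits (2 ^ d) (v + n) (4 * v + len k)) = 4 * v + len k := by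
      refine ofDigits_padDigits _ _ ?_
      rw [← pow_mul]
      refine lt_of_lt_of_le (by omega : 4 * v + len k < 2 ^ (v + n + 1))
        (Nat.pow_le_pow_right (by norm_num) ?_)
      have : 2 * (v + n) ≤ d * (v + n) := Nat.mul_le_mul_right _ (by omega)
      omega
    have hbase : (machine P d).base = 2 ^ d := rfl
    have hfin : (machine P d).final [k, x] = Part.some cf := Part.eq_some_iff.2 c1
    have e1 : (machine P d).result [k, x] = Part.some (4 * v + len k) := by
      rw [Machine.result, hfin, Part.map_some, hbase, c2]
      exact congrArg Part.some hout
    have e2 : ∃ z ≤ 4 * v + len k, (machine P d).space [k, x] = Part.some z := by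
      refine ⟨cf.size - 1, ?_, by rw [Machine.space, hfin, Part.map_some]⟩
      rw [c4, hlen]
      -- About `2 * v + 2 * n` cells are used. By `2 * n ≤ len k + 1` and `v ≥ m + 2` the factor `4`
      -- leaves enough to spare.
      change w + 2 + max (n + m + 2) (padDigits (2 ^ d) (v + n) (4 * v + len k)).length - 1 ≤ _
      rw [length_padDigits]
      omega
    obtain ⟨z, hz, e2⟩ := e2
    rw [e1, e2, Part.eq_some_iff.2 hv, Part.map_some]
    simp only [ext, Part.some_dom, dif_pos, Part.get_some, true_and]
    exact Nat.cast_le.2 hz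
  · obtain ⟨p, -, k1⟩ := hpro (2 ^ (c + d * m) + d * n) (Nat.le_add_right _ _)
      (Nat.le_add_left _ _)
    have hs' : s p = win o (fun _ => 0) [x, c + d * m, 0, n, p, 0, 0, 0, 0, len k, n] [] [] := by
      rw [hs]
    have hfin : ¬ ((machine P d).final [k, x]).Dom := by
      refine machine_not_dom hd0 hP hb he (by simp) k1 hq.pure (hs' ▸ ?_)
      exact fun V t => hq.div n x _ hdom (s p) (hs0 p) (hs1 p) (hs2 p) (hs3 p) (hs4 p) V t
    rw [Machine.result, Machine.space, Part.eq_none_iff'.2 hfin, Part.eq_none_iff'.2 hdom]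
    simp

/-! ### Dovetailing -/

/-- The pure program `p` halts on the arguments `i` and `x` in less than `w` steps. -/
def HaltsIn (p : Prog) (i x w : ℕ) : Prop := ∃ n < w, ∃ V t, Run V p n (input i x) t

theorem HaltsIn.mono {p : Prog} {i x w w' : ℕ} (h : HaltsIn p i x w) (hw : w ≤ w') :
    HaltsIn p i x w' := by
  obtain ⟨n, h1, h2⟩ := h
  exact ⟨n, by omega, h2⟩

/-- Clear the first registers. -/
def clrBelow : ℕ → Prog
  | 0 => .skip
  | k + 1 => .seq (clrBelow k) (clr k)

theorem pure_clrBelow (k : ℕ) : (clrBelow k).Pure := by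
  induction k with
  | zero => trivial
  | succ k ih => simp [clrBelow, ih]

theorem bound_clrBelow (k : ℕ) : (clrBelow k).bound ≤ k := by
  induction k with
  | zero => simp [clrBelow, Prog.bound]
  | succ k ih => simp only [clrBelow, clr, Prog.bound]; omega

theorem runs_clrBelow (V k : ℕ) (s : St) : ∃ t, Runs V (clrBelow k) s t ∧ t.inp = s.inp ∧
    t.out = s.out ∧ ∀ r, t r = if r < k then 0 else s r := by
  induction k with
  | zero => exact ⟨s, .skip _ _, rfl, rfl, fun r => by simp⟩
  | succ k ih =>
    obtain ⟨t, h1, h2, h3, h4⟩ := ih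
    refine ⟨t.set k 0, h1.seq (runs_clr _ _ _), h2, h3, fun r => ?_⟩
    rw [St.set_apply, h4]
    split_ifs <;> omega

/-- Run `p` on the contents of the registers `D + 3` and `a`, with the fuel in register `w`. -/
def attempt (D : ℕ) (p : Prog) (a w : ℕ) : Prog :=
  .seq (addTo (D + 3) 11) (.seq (addTo a 1) (.seq (addTo w (D + 0)) (.seq (clip D p) (clrBelow D))))

section

variable {V D : ℕ} {p q : Prog} {f : ℕ → ℕ} {inp : List (List ℕ)} {out : List ℕ}

theorem pure_attempt (a w : ℕ) : (attempt D p a w).Pure := by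
  simp [attempt, Prog.Pure, addTo, move, pure_clip, pure_clrBelow]

theorem bound_clip (hp : p.bound ≤ D) : (clip D p).bound ≤ D + 2 := by
  induction p with
  | skip => simp only [clip, Prog.bound] at *; omega
  | inc r => simp only [clip, Prog.bound] at *; omega
  | seq p q ihp ihq =>
    simp only [clip, Prog.bound, max_le_iff] at *
    have := ihp hp.1
    have := ihq hp.2
    omega
  | cond r p q ihp ihq =>
    simp only [clip, Prog.bound, max_le_iff] at *
    have := ihp (by omega)
    have := ihq (by omega)
    omega
  | loop r p ih =>
    simp only [clip, Prog.bound, max_le_iff] at *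
    have := ih (by omega)
    omega
  | take p q => simp only [clip, Prog.bound] at *; omega
  | last p q => simp only [clip, Prog.bound] at *; omega
  | emit => simp only [clip, Prog.bound] at *; omega

theorem bound_attempt (hD : 15 ≤ D) (hp : p.bound ≤ D) {a w : ℕ} (ha : a < 10) (hw : w < 10) :
    (attempt D p (D + a) (D + w)).bound ≤ D + 10 := by
  have h1 := bound_clip hp
  have h2 := bound_clrBelow D
  simp only [attempt, addTo, move, Prog.bound, max_le_iff]
  omega

/-- The registers below `D` are the workspace of `p` and are cleared afterwards, so only the
remaining fuel survives; it tells whether `p` halted in time. The two bounds are those of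
`runs_clip` for the two arguments. -/
theorem win_attempt (hD : 15 ≤ D) (hp : p.Pure) (hb : p.bound ≤ D) (hf : ∀ r < D, f r = 0)
    {a w : ℕ} (ha0 : 1 ≤ a) (ha : a < 10) (hw0 : 1 ≤ w) (hw : w < 10) {xs : List ℕ}
    (hl : xs.length = 10) (h0 : xs.getD 0 0 = 0) (h1 : xs.getD 1 0 = 0) (hV1 : 1 ≤ V)
    (hV : xs.getD 3 0 + xs.getD w 0 ≤ V) (hV' : xs.getD a 0 + xs.getD w 0 ≤ V) :
    ∃ F, Runs V (attempt D p (D + a) (D + w)) (win D f xs inp out)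
      (win D f (xs.set 0 F) inp out) ∧
      (F ≠ 0 ↔ HaltsIn p (xs.getD 3 0) (xs.getD a 0) (xs.getD w 0)) := by
  obtain ⟨s, hs⟩ : ∃ s, s = win D f xs inp out := ⟨_, rfl⟩
  have hlow (r : ℕ) (hr : r < D) : s r = 0 := by rw [hs, win_other (.inl hr), hf r hr]
  have hwin (j : ℕ) (hj : j < 10) : s (D + j) = xs.getD j 0 := by rw [hs, win_get (by omega)]
  obtain ⟨s₁, hs₁⟩ : ∃ s₁, s₁ = ((s.set 11 (xs.getD 3 0)).set 1 (xs.getD a 0)).set (D + 0)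
    (xs.getD w 0) := ⟨_, rfl⟩
  have hin : ∀ r < D, (input (xs.getD 3 0) (xs.getD a 0)) r = s₁ r := by
    intro r hr
    simp only [hs₁, St.set_apply, input]
    have := hlow r hr
    grind
  have hD0 : s₁ D = xs.getD w 0 := by rw [hs₁]; simp
  have hD1 : s₁ (D + 1) = 0 := by
    rw [hs₁]
    have := hwin 1 (by omega)
    simp only [St.set_apply]
    grind
  have r1 : Runs V (addTo (D + 3) 11) s (s.set 11 (xs.getD 3 0)) := by
    have := runs_addTo (V := V) (s := s) (a := D + 3) (b := 11) (by omega) (by omega) (by omega)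
      (hlow 0 (by omega)) (by rw [hwin 3 (by omega), hlow 11 (by omega)]; omega)
    rwa [hwin 3 (by omega), hlow 11 (by omega), zero_add] at this
  have r2 : Runs V (addTo (D + a) 1) (s.set 11 (xs.getD 3 0))
      ((s.set 11 (xs.getD 3 0)).set 1 (xs.getD a 0)) := by
    have e1 : (s.set 11 (xs.getD 3 0)) (D + a) = xs.getD a 0 := by
      rw [St.set_apply, if_neg (by omega), hwin a ha]
    have e2 : (s.set 11 (xs.getD 3 0)) 1 = 0 := by
      rw [St.set_apply, if_neg (by omega), hlow 1 (by omega)]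
    have := runs_addTo (V := V) (s := s.set 11 (xs.getD 3 0)) (a := D + a) (b := 1) (by omega)
      (by omega) (by omega)
      (by rw [St.set_apply, if_neg (by omega), hlow 0 (by omega)]) (by rw [e1, e2]; omega)
    rwa [e1, e2, zero_add] at this
  have r3 : Runs V (addTo (D + w) (D + 0)) ((s.set 11 (xs.getD 3 0)).set 1 (xs.getD a 0)) s₁ := by
    have e1 : ((s.set 11 (xs.getD 3 0)).set 1 (xs.getD a 0)) (D + w) = xs.getD w 0 := by
      rw [St.set_apply, if_neg (by omega), St.set_apply, if_neg (by omega), hwin w hw]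
    have e2 : ((s.set 11 (xs.getD 3 0)).set 1 (xs.getD a 0)) (D + 0) = 0 := by
      rw [St.set_apply, if_neg (by omega), St.set_apply, if_neg (by omega), hwin 0 (by omega), h0]
    have := runs_addTo (V := V) (s := (s.set 11 (xs.getD 3 0)).set 1 (xs.getD a 0)) (a := D + w)
      (b := D + 0) (by omega) (by omega) (by omega)
      (by rw [St.set_apply, if_neg (by omega), St.set_apply, if_neg (by omega), hlow 0 (by omega)])
      (by rw [e1, e2]; omega)
    rwa [e1, e2, zero_add, ← hs₁] at this
  obtain ⟨t, r4, hc⟩ := runs_clip (V := V) hp hb hV1 s₁ hD1 (by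
    intro r hr
    rw [← hin r hr, hD0]
    simp only [input]
    split_ifs <;> omega)
  obtain ⟨u, r5, u1, u2, u3⟩ := runs_clrBelow V D t
  refine ⟨t D, ?_, ?_⟩
  · rw [← hs]
    suffices e : win D f (xs.set 0 (t D)) inp out = u from
      e ▸ r1.seq (r2.seq (r3.seq (r4.seq r5)))
    refine St.eq_of_regs ?_ ?_ fun r => ?_
    · rw [u1, r4.inp (pure_clip _ _), hs₁, hs]; rfl
    · rw [u2, r4.out (pure_clip _ _), hs₁, hs]; rfl
    · rw [u3]
      split_ifs with hr
      · rw [win_other (.inl hr), hf r hr]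
      · obtain ⟨j, rfl⟩ : ∃ j, r = D + j := ⟨r - D, by omega⟩
        match j with
        | 0 =>
          rw [win_get (by simp; omega), getD_set _ (by omega), if_pos rfl]
          rfl
        | 1 =>
          rw [win_get (by simp; omega), getD_set _ (by omega), if_neg (by omega), h1]
          exact hc.tmp.symm
        | j + 2 =>
          have e : t (D + (j + 2)) = s (D + (j + 2)) := by
            rw [hc.frame (D + (j + 2)) (by omega), hs₁]
            simp only [St.set_apply]
            rw [if_neg (by omega), if_neg (by omega), if_neg (by omega)]
          rw [e]
          by_cases hj : j + 2 < 10
          · rw [win_get (by simp; omega), getD_set _ (by omega), if_neg (by omega), hwin _ hj]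
          · rw [hs, win_other (.inr (by simp; omega)), win_other (.inr (by omega))]
  · constructor
    · intro h
      obtain ⟨W, u', h2, -⟩ := hc.run (by omega) _ hin
      have := hc.le
      rw [hD0] at h2 this
      exact ⟨_, by omega, W, u', h2⟩
    · rintro ⟨n, hn, W, u', h2⟩ h
      have := hc.fail h _ hin W n u' h2
      rw [hD0] at this
      omega

end

/-- Within time `2 ^ s` the program `p` halts on `i` and `x`, and `x` steps do not suffice to find
the defect of `i` by the program `q`. -/
def Accepts (p q : Prog) (i x s : ℕ) : Prop := HaltsIn p i x (2 ^ s) ∧ ¬ HaltsIn q i 0 x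

theorem Accepts.mono {p q : Prog} {i x s s' : ℕ} (h : Accepts p q i x s) (hs : s ≤ s') :
    Accepts p q i x s' :=
  ⟨h.1.mono (Nat.pow_le_pow_right (by norm_num) hs), h.2⟩

open Classical in
/-- The least `s ≥ u₀` such that one of the first `n` programs accepts. -/
noncomputable def minSpace (p q : Prog) (n x u₀ : ℕ) : Part ℕ :=
  ⟨∃ s, u₀ ≤ s ∧ ∃ i < n, Accepts p q i x s, fun h => Nat.find h⟩

open Classical in
theorem mem_minSpace {p q : Prog} {n x u₀ v : ℕ} : v ∈ minSpace p q n x u₀ ↔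
    (u₀ ≤ v ∧ ∃ i < n, Accepts p q i x v) ∧
      ∀ s, u₀ ≤ s → s < v → ¬ ∃ i < n, Accepts p q i x s := by
  constructor
  · rintro ⟨h, rfl⟩
    exact ⟨Nat.find_spec h, fun s h1 h2 h3 => Nat.find_min h h2 ⟨h1, h3⟩⟩
  · rintro ⟨h1, h2⟩
    refine ⟨⟨v, h1⟩, ?_⟩
    exact (Nat.find_eq_iff _).2 ⟨h1, fun s h3 h4 => h2 s h4.1 h3 h4.2⟩

/-- Test the program numbered by register `D + 3`, and set the flag in register `D + 4` if it
accepts. -/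
def test (D : ℕ) (p q : Prog) : Prog :=
  -- The registers from `D` on: fuel, flag of `clip`, counter, program number, success, loop flag,
  -- `x`, `s`, `2 ^ s`, `n`. The search for a defect is run on `0` with fuel `x`, the simulation on
  -- `x` with fuel `2 ^ s`.
  .seq (ifnz (D + 4) .skip (.seq (attempt D q (D + 1) (D + 6)) (.cond (D + 0) (clr (D + 0))
    (.seq (attempt D p (D + 6) (D + 8)) (.cond (D + 0) (.seq (clr (D + 0)) (.inc (D + 4))) .skip)))))
    (.inc (D + 3))

/-- Test the first programs, and increase the bound if none of them accepts. -/
def trial (D : ℕ) (p q : Prog) : Prog :=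
  .seq (copy (D + 9) (D + 2)) (.seq (clr (D + 3)) (.seq (.loop (D + 2) (test D p q))
    (.cond (D + 4) .skip (.seq (.inc (D + 7)) (.seq (copy (D + 8) (D + 2))
      (.seq (addTo (D + 2) (D + 8)) (.inc (D + 5))))))))

/-- Compute `2 ^ u₀`. -/
def setup (D : ℕ) : Prog :=
  .seq (.inc (D + 8)) (.seq (copy (D + 7) (D + 2)) (.seq (.loop (D + 2)
    (.seq (copy (D + 8) (D + 3)) (addTo (D + 3) (D + 8)))) (.inc (D + 5))))

/-- The program for `minSpace`. -/
def dovetail (D : ℕ) (p q : Prog) : Prog := .seq (setup D) (.loop (D + 5) (trial D p q))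

section

variable {V D : ℕ} {p q : Prog} {f : ℕ → ℕ} {inp : List (List ℕ)} {out : List ℕ}

theorem pure_dovetail : (dovetail D p q).Pure := by
  simp [dovetail, setup, trial, test, Prog.Pure, addTo, move, copy, clr, ifnz, pure_attempt]

theorem bound_dovetail (hD : 15 ≤ D) (hp : p.bound ≤ D) (hq : q.bound ≤ D) :
    (dovetail D p q).bound ≤ D + 10 := by
  have h1 := bound_attempt hD hp (a := 6) (w := 8) (by omega) (by omega)
  have h2 := bound_attempt hD hq (a := 1) (w := 6) (by omega) (by omega)
  have h3 := bound_copy (a := D + 9) (b := D + 2) (k := D + 10) (by omega) (by omega)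
  have h4 := bound_copy (a := D + 8) (b := D + 2) (k := D + 10) (by omega) (by omega)
  have h5 := bound_copy (a := D + 7) (b := D + 2) (k := D + 10) (by omega) (by omega)
  have h6 := bound_copy (a := D + 8) (b := D + 3) (k := D + 10) (by omega) (by omega)
  have h7 := bound_addTo (a := D + 2) (b := D + 8) (k := D + 10) (by omega) (by omega)
  have h8 := bound_addTo (a := D + 3) (b := D + 8) (k := D + 10) (by omega) (by omega)
  simp only [dovetail, setup, trial, test, ifnz, clr, Prog.bound, max_le_iff]
  omega

theorem win_ifnz_pos {o i : ℕ} {xs : List ℕ} {a b : Prog} {t : St} (hi : i < xs.length)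
    (h : xs.getD i 0 ≠ 0) (hV : xs.getD i 0 ≤ V) (hp : Runs V a (win o f xs inp out) t) :
    Runs V (ifnz (o + i) a b) (win o f xs inp out) t :=
  runs_ifnz_pos (by rwa [win_get hi]) (by rwa [win_get hi]) hp

theorem win_ifnz_zero {o i : ℕ} {xs : List ℕ} {a b : Prog} {t : St} (hi : i < xs.length)
    (h : xs.getD i 0 = 0) (hp : Runs V b (win o f xs inp out) t) :
    Runs V (ifnz (o + i) a b) (win o f xs inp out) t :=
  win_cond_zero hi h hp

open Classical in
-- Both attempts are cut off by their fuel, so `2 ^ s + x + i` suffices as a bound even if the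
-- programs do not halt.
theorem win_test (hD : 15 ≤ D) (hp : p.Pure) (hpb : p.bound ≤ D) (hq : q.Pure) (hqb : q.bound ≤ D)
    (hf : ∀ r < D, f r = 0) {j i S x s n : ℕ} (hS : S ≤ 1) (hV : 2 ^ s + x + i ≤ V) :
    Runs V (test D p q) (win D f [0, 0, j, i, S, 0, x, s, 2 ^ s, n] inp out)
      (win D f [0, 0, j, i + 1, if S = 1 ∨ Accepts p q i x s then 1 else 0, 0, x, s, 2 ^ s, n]
        inp out) := by
  have hpos : 0 < 2 ^ s := Nat.two_pow_pos s
  have hinc (S' : ℕ) : Runs V (.inc (D + 3)) (win D f [0, 0, j, i, S', 0, x, s, 2 ^ s, n] inp out)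
      (win D f [0, 0, j, i + 1, S', 0, x, s, 2 ^ s, n] inp out) :=
    win_inc (i := 3) (by simp) (by simp only [List.getD_cons_succ, List.getD_cons_zero]; omega)
  refine .seq ?_ (hinc _)
  obtain rfl | rfl : S = 1 ∨ S = 0 := by omega
  · rw [if_pos (.inl rfl)]
    exact win_ifnz_pos (i := 4) (by simp) (by simp) (by simp; omega) (.skip _ _)
  · refine win_ifnz_zero (i := 4) (by simp) (by simp) ?_
    obtain ⟨F, k1, k2⟩ := win_attempt (V := V) (inp := inp) (out := out) hD hq hqb hf (a := 1)
      (w := 6) (xs := [0, 0, j, i, 0, 0, x, s, 2 ^ s, n]) (by omega) (by omega) (by omega) (by omega)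
      rfl rfl rfl (by omega) (by simp only [List.getD_cons_succ, List.getD_cons_zero]; omega)
      (by simp only [List.getD_cons_succ, List.getD_cons_zero]; omega)
    simp only [List.set, List.getD_cons_succ, List.getD_cons_zero] at k1 k2
    refine k1.seq ?_
    by_cases hF : F = 0
    · rw [hF] at k2 ⊢
      refine win_cond_zero (i := 0) (by simp) (by simp) ?_
      obtain ⟨F', k3, k4⟩ := win_attempt (V := V) (inp := inp) (out := out) hD hp hpb hf (a := 6)
        (w := 8) (xs := [0, 0, j, i, 0, 0, x, s, 2 ^ s, n]) (by omega) (by omega) (by omega)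
        (by omega) rfl rfl rfl (by omega)
        (by simp only [List.getD_cons_succ, List.getD_cons_zero]; omega)
        (by simp only [List.getD_cons_succ, List.getD_cons_zero]; omega)
      simp only [List.set, List.getD_cons_succ, List.getD_cons_zero] at k3 k4
      refine k3.seq ?_
      by_cases hF' : F' = 0
      · rw [hF'] at k4 ⊢
        rw [if_neg (by simp only [Accepts, ← k4]; simp)]
        exact win_cond_zero (i := 0) (by simp) (by simp) (.skip _ _)
      · rw [if_pos (.inr ⟨k4.1 hF', by simp [← k2]⟩)]
        exact win_cond_pos (i := 0) (by simp) (by simpa using hF')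
          (.seq (win_clr (i := 0) (by simp)) (win_inc (i := 4) (by simp) (by simp; omega)))
    · rw [if_neg (by simp only [Accepts, ← k2]; simp [hF])]
      exact win_cond_pos (i := 0) (by simp) (by simpa using hF) (win_clr (i := 0) (by simp))

open Classical in
theorem win_tests (hD : 15 ≤ D) (hp : p.Pure) (hpb : p.bound ≤ D) (hq : q.Pure) (hqb : q.bound ≤ D)
    (hf : ∀ r < D, f r = 0) {x s n : ℕ} (hV : 2 ^ s + x + n ≤ V) (j : ℕ) : ∀ i S, S ≤ 1 →
    i + j = n → Runs V (.loop (D + 2) (test D p q))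
      (win D f [0, 0, j, i, S, 0, x, s, 2 ^ s, n] inp out)
      (win D f [0, 0, 0, n, if S = 1 ∨ ∃ k < n, i ≤ k ∧ Accepts p q k x s then 1 else 0, 0, x, s,
        2 ^ s, n] inp out) := by
  induction j with
  | zero =>
    intro i S hS hi
    obtain rfl : i = n := hi
    have e : (if S = 1 ∨ ∃ k < i, i ≤ k ∧ Accepts p q k x s then 1 else 0) = S := by
      have : ¬ ∃ k < i, i ≤ k ∧ Accepts p q k x s := fun ⟨k, h1, h2, _⟩ => by omega
      split_ifs with h <;> simp only [this, or_false] at h <;> omega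
    rw [e]
    exact win_loop_zero (i := 2) (by simp) (by simp)
  | succ j ih =>
    intro i S hS hi
    have h1 := win_test (V := V) (inp := inp) (out := out) (n := n) (j := j) hD hp hpb hq hqb hf
      (i := i) (x := x) (s := s) hS (by omega)
    have h2 := ih (i + 1) (if S = 1 ∨ Accepts p q i x s then 1 else 0) (by split_ifs <;> omega)
      (by omega)
    refine win_loop_pos (i := 2) (by simp) (by simp) h1 ?_
    convert h2 using 8
    simp only [ite_eq_left_iff, zero_ne_one, imp_false, not_not]
    constructor
    · rintro (h | ⟨k, h3, h4, h5⟩)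
      · exact .inl (.inl h)
      · rcases h4.eq_or_lt with rfl | h4
        · exact .inl (.inr h5)
        · exact .inr ⟨k, h3, h4, h5⟩
    · rintro ((h | h) | ⟨k, h3, h4, h5⟩)
      · exact .inl h
      · exact .inr ⟨i, by omega, le_rfl, h⟩
      · exact .inr ⟨k, h3, by omega, h5⟩

theorem win_trial_pos (hD : 15 ≤ D) (hp : p.Pure) (hpb : p.bound ≤ D) (hq : q.Pure)
    (hqb : q.bound ≤ D) (hf : ∀ r < D, f r = 0) {j i x s n : ℕ} (hV : 2 ^ s + x + n ≤ V)
    (h : ∃ k < n, Accepts p q k x s) :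
    Runs V (trial D p q) (win D f [0, 0, j, i, 0, 0, x, s, 2 ^ s, n] inp out)
      (win D f [0, 0, 0, n, 0, 0, x, s, 2 ^ s, n] inp out) := by
  have hpos := Nat.two_pow_pos s
  have h1 := win_tests (V := V) (inp := inp) (out := out) hD hp hpb hq hqb hf hV n 0 0 (by omega)
    (by omega)
  rw [if_pos (.inr (by obtain ⟨k, h1, h2⟩ := h; exact ⟨k, h1, by omega, h2⟩))] at h1
  refine .seq (win_copy (a := 9) (b := 2) (by omega) (hf 0 (by omega)) (by simp) (by simp) (by simp)
    (by simp only [List.getD_cons_succ, List.getD_cons_zero]; omega))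
    (.seq (win_clr (i := 3) (by simp)) (.seq h1 ?_))
  exact win_cond_pos (i := 4) (by simp) (by simp) (.skip _ _)

theorem win_trial_neg (hD : 15 ≤ D) (hp : p.Pure) (hpb : p.bound ≤ D) (hq : q.Pure)
    (hqb : q.bound ≤ D) (hf : ∀ r < D, f r = 0) {j i x s n : ℕ} (hV : 2 ^ (s + 1) + x + n ≤ V)
    (h : ¬ ∃ k < n, Accepts p q k x s) :
    Runs V (trial D p q) (win D f [0, 0, j, i, 0, 0, x, s, 2 ^ s, n] inp out)
      (win D f [0, 0, 2 ^ s, n, 0, 1, x, s + 1, 2 ^ (s + 1), n] inp out) := by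
  have h2 : s < 2 ^ s := Nat.lt_two_pow_self
  rw [pow_succ] at hV ⊢
  have h1 := win_tests (V := V) (inp := inp) (out := out) hD hp hpb hq hqb hf (s := s)
    (x := x) (n := n) (by omega) n 0 0 (by omega) (by omega)
  rw [if_neg (by rintro (h1 | ⟨k, h1, -, h2⟩); exacts [zero_ne_one h1, h ⟨k, h1, h2⟩])] at h1
  have h0 := hf 0 (by omega)
  refine .seq (win_copy (a := 9) (b := 2) (by omega) h0 (by simp) (by simp) (by simp)
    (by simp only [List.getD_cons_succ, List.getD_cons_zero]; omega))
    (.seq (win_clr (i := 3) (by simp)) (.seq h1 ?_))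
  refine win_cond_zero (i := 4) (by simp) (by simp) (.seq (win_inc (i := 7) (by simp) ?_)
    (.seq (win_copy (a := 8) (b := 2) (by omega) h0 (by simp) (by simp) (by simp) ?_)
    (.seq (win_addTo (a := 2) (b := 8) (by omega) h0 (by simp) (by simp) (by simp) ?_) ?_)))
  · simp only [List.getD_cons_succ, List.getD_cons_zero]; omega
  · simp only [List.set, List.getD_cons_succ, List.getD_cons_zero]; omega
  · simp only [List.set, List.getD_cons_succ, List.getD_cons_zero]; omega
  · have := win_inc (V := V) (o := D) (f := f) (inp := inp) (out := out) (i := 5)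
      (xs := [0, 0, 2 ^ s, n, 0, 0, x, s + 1, 2 ^ s * 2, n]) (by simp) (by simp; omega)
    simpa only [List.set, List.getD_cons_succ, List.getD_cons_zero, mul_two, zero_add] using this

/-- A failing trial at `s < v` doubles the power of two to at most `2 ^ v`. So the search for the
least value stays within the space that this value allows. -/
theorem win_trials (hD : 15 ≤ D) (hp : p.Pure) (hpb : p.bound ≤ D) (hq : q.Pure)
    (hqb : q.bound ≤ D) (hf : ∀ r < D, f r = 0) {x u₀ v n : ℕ} (hv : v ∈ minSpace p q n x u₀)
    (hV : 2 ^ v + x + n ≤ V) (k : ℕ) : ∀ j i s, u₀ ≤ s → s + k = v →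
    ∃ i' j', Runs V (.loop (D + 5) (trial D p q)) (win D f [0, 0, j, i, 0, 1, x, s, 2 ^ s, n] inp out)
      (win D f [0, 0, j', i', 0, 0, x, v, 2 ^ v, n] inp out) := by
  rw [mem_minSpace] at hv
  induction k with
  | zero =>
    intro j i s h1 h2
    obtain rfl : s = v := h2
    exact ⟨_, _, win_loop_pos (i := 5) (by simp) (by simp)
      (win_trial_pos hD hp hpb hq hqb hf hV hv.1.2) (win_loop_zero (i := 5) (by simp) (by simp))⟩
  | succ k ih =>
    intro j i s h1 h2
    obtain ⟨i', j', h3⟩ := ih (2 ^ s) n (s + 1) (by omega) (by omega)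
    have h4 : 2 ^ (s + 1) ≤ 2 ^ v := Nat.pow_le_pow_right (by norm_num) (by omega)
    exact ⟨i', j', win_loop_pos (i := 5) (by simp) (by simp)
      (win_trial_neg hD hp hpb hq hqb hf (by omega) (hv.2 s h1 (by omega))) h3⟩

theorem not_runs_trials (hD : 15 ≤ D) (hp : p.Pure) (hpb : p.bound ≤ D) (hq : q.Pure)
    (hqb : q.bound ≤ D) (hf : ∀ r < D, f r = 0) {x u₀ n j i : ℕ} (hv : ¬ (minSpace p q n x u₀).Dom)
    (t : St) : ¬ Runs V (.loop (D + 5) (trial D p q))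
      (win D f [0, 0, j, i, 0, 1, x, u₀, 2 ^ u₀, n] inp out) t := by
  refine not_runs_loop (fun s => ∃ j i u, u₀ ≤ u ∧
    s = win D f [0, 0, j, i, 0, 1, x, u, 2 ^ u, n] inp out) ?_ ⟨j, i, u₀, le_rfl, rfl⟩
  rintro s ⟨j, i, u, h1, rfl⟩
  rw [win_get (i := 5) (by simp), win_set (i := 5) (by simp)]
  exact ⟨by simp, 2 ^ (u + 1) + x + n, _, win_trial_neg hD hp hpb hq hqb hf le_rfl
    fun h => hv ⟨u, h1, h⟩, _, _, u + 1, by omega, rfl⟩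

theorem win_setup (hf : f 0 = 0) (hD : 15 ≤ D) {x u₀ n : ℕ} (hV : 2 ^ u₀ ≤ V) :
    ∃ i, Runs V (setup D) (win D f [0, 0, 0, 0, 0, 0, x, u₀, 0, n] inp out)
      (win D f [0, 0, 0, i, 0, 1, x, u₀, 2 ^ u₀, n] inp out) := by
  have hu : u₀ < 2 ^ u₀ := Nat.lt_two_pow_self
  have hloop (k : ℕ) : ∀ i s, s + k = u₀ → ∃ i', Runs V (.loop (D + 2)
      (.seq (copy (D + 8) (D + 3)) (addTo (D + 3) (D + 8))))
      (win D f [0, 0, k, i, 0, 0, x, u₀, 2 ^ s, n] inp out)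
      (win D f [0, 0, 0, i', 0, 0, x, u₀, 2 ^ u₀, n] inp out) := by
    induction k with
    | zero =>
      intro i s h
      obtain rfl : s = u₀ := h
      exact ⟨i, win_loop_zero (i := 2) (by simp) (by simp)⟩
    | succ k ih =>
      intro i s h
      obtain ⟨i', h1⟩ := ih (2 ^ s) (s + 1) (by omega)
      have h4 : 2 ^ (s + 1) ≤ 2 ^ u₀ := Nat.pow_le_pow_right (by norm_num) (by omega)
      rw [pow_succ, mul_two] at h1 h4
      refine ⟨i', win_loop_pos (i := 2) (by simp) (by simp) (.seq (win_copy (a := 8) (b := 3)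
        (by omega) hf (by simp) (by simp) (by simp) ?_) (win_addTo (a := 3) (b := 8)
        (by omega) hf (by simp) (by simp) (by simp) ?_)) h1⟩
      · simp only [List.set, List.getD_cons_succ, List.getD_cons_zero]; omega
      · simp only [List.set, List.getD_cons_succ, List.getD_cons_zero]; omega
  obtain ⟨i, h⟩ := hloop u₀ 0 0 (zero_add _)
  exact ⟨i, .seq (win_inc (i := 8) (by simp)
    (by simp only [List.getD_cons_succ, List.getD_cons_zero]; omega))
    (.seq (win_copy (a := 7) (b := 2) (by omega) hf (by simp) (by simp) (by simp)
      (by simp only [List.set, List.getD_cons_succ, List.getD_cons_zero]; omega))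
    (.seq h (win_inc (i := 5) (by simp)
      (by simp only [List.getD_cons_succ, List.getD_cons_zero]; omega))))⟩

end

/-- The last four registers of the window, with `x`, `s`, `2 ^ s` and `n`, are the interface of a
core, hence the offset `D + 6`. The required `2 ^ v` is the last fuel. -/
theorem isCore_dovetail {D : ℕ} {p q : Prog} (hD : 15 ≤ D) (hp : p.Pure) (hpb : p.bound ≤ D)
    (hq : q.Pure) (hqb : q.bound ≤ D) : IsCore (D + 6) (dovetail D p q) (minSpace p q) 1 := by
  have hs' (s : St) (x u₀ n : ℕ) (h0 : ∀ r < D + 6, s r = 0) (h1 : s (D + 6) = x)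
      (h2 : s (D + 6 + 1) = u₀) (h3 : s (D + 6 + 2) = 0) (h4 : s (D + 6 + 3) = n) :
      s = win D s [0, 0, 0, 0, 0, 0, x, u₀, 0, n] s.inp s.out := by
    conv_lhs => rw [win_self s D 10]
    congr 1
    simp only [List.range_succ, List.range_zero, List.nil_append, List.map_cons,
      List.map_nil, List.cons_append]
    rw [h0 (D + 0) (by omega), h0 (D + 1) (by omega), h0 (D + 2) (by omega), h0 (D + 3) (by omega),
      h0 (D + 4) (by omega), h0 (D + 5) (by omega), h1, h2, h3, h4]
  refine ⟨pure_dovetail, bound_dovetail hD hpb hqb, by omega,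
    fun n x u₀ v hv => (mem_minSpace.1 hv).1.1, ?_, ?_⟩
  · intro n x u₀ v hv V hV s h0 h1 h2 h3 h4 h5
    have hf : ∀ r < D, s r = 0 := fun r hr => h0 r (by omega)
    have h6 : 2 ^ u₀ ≤ 2 ^ v :=
      Nat.pow_le_pow_right (by norm_num) (mem_minSpace.1 hv).1.1
    obtain ⟨i, k1⟩ := win_setup (V := V) (f := s) (inp := s.inp) (out := s.out) (x := x) (n := n)
      (hf 0 (by omega)) hD (show 2 ^ u₀ ≤ V by omega)
    obtain ⟨i', j', k2⟩ := win_trials (V := V) (inp := s.inp) (out := s.out) hD hp hpb hq hqb hf hv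
      (by omega) (v - u₀) 0 i u₀ le_rfl (by have := (mem_minSpace.1 hv).1.1; omega)
    rw [← hs' s x u₀ n h0 h1 h2 h3 h4] at k1
    refine ⟨_, k1.seq k2, ?_, ?_, ?_⟩
    · rw [win_other (by omega), hf 0 (by omega)]
    · exact win_get (i := 7) (by simp)
    · exact win_get (i := 8) (by simp)
  · rintro n x u₀ hv s h0 h1 h2 h3 h4 V t ⟨_, h⟩
    have hf : ∀ r < D, s r = 0 := fun r hr => h0 r (by omega)
    obtain ⟨i, k1⟩ := win_setup (V := 2 ^ u₀) (f := s) (inp := s.inp) (out := s.out) (x := x)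
      (n := n) (hf 0 (by omega)) hD le_rfl
    rw [← hs' s x u₀ n h0 h1 h2 h3 h4] at k1
    cases h with
    | seq h1 h2 =>
      obtain rfl := k1.unique ⟨_, h1⟩
      exact not_runs_trials hD hp hpb hq hqb hf hv t ⟨_, h2⟩

/-! ### Unbounded search -/

/-- Search for a `b` where the program `p` yields a nonzero value. -/
def search (p : Prog) : Prog :=
  .seq (.inc 8) (.loop 8 (.seq p (.cond 14 .skip (.seq (.inc 12) (.inc 8)))))

/-- Only termination matters here; no bound on the space is needed, because the search is always run
with limited fuel. -/
theorem exists_search {ρ : ℕ → ℕ → ℕ} (hρ : Computable₂ ρ) : ∃ q : Prog, q.Pure ∧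
    ∀ i, (∃ w, HaltsIn q i 0 w) ↔ ∃ b, ρ i b ≠ 0 := by
  obtain ⟨p, hp, hW⟩ := exists_box (f := fun i b _ => ρ i b)
    (Computable₂.comp hρ Computable.fst (Computable.fst.comp Computable.snd))
  choose W hW using hW
  refine ⟨search p, by simp [search, Prog.Pure, hp], fun i => ?_⟩
  obtain ⟨st, hst⟩ : ∃ st : ℕ → ℕ → ℕ → List ℕ,
    st = fun c b o => [0, 0, 0, 0, 0, 0, 0, 0, c, 0, 0, i, b, 0, o] := ⟨_, rfl⟩
  have hbox (V b o : ℕ) (hV : W i b 0 ≤ V) : Trans 15 V p (st 0 b o) (st 0 b (ρ i b)) := by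
    have := hW i b 0 V hV (st 0 b o) (by simp [hst]) (by simp [hst]) (by simp [hst]) (by simp [hst])
      (by simp [hst])
    simpa [hst] using this
  have hinc (V : ℕ) (hV : 1 ≤ V) : Trans 15 V (.inc 8) (st 0 0 0) (st 1 0 0) := by
    have := trans_inc (K := 15) (V := V) (l := 8) (xs := st 0 0 0) (by simp [hst]) (by decide)
      (by simpa [hst] using hV)
    simpa [hst] using this
  have hstep (V b o : ℕ) (hV : W i b 0 + b + 1 ≤ V) (h : ρ i b = 0) :
      Trans 15 V (.seq p (.cond 14 .skip (.seq (.inc 12) (.inc 8)))) (st 0 b o) (st 1 (b + 1) 0) := by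
    refine (hbox V b o (by omega)).seq (trans_cond_zero (by decide) (by simp [hst, h]) ?_)
    have h1 := trans_inc (K := 15) (V := V) (l := 12) (xs := st 0 b 0) (by simp [hst]) (by decide)
      (by simp [hst]; omega)
    have h2 := trans_inc (K := 15) (V := V) (l := 8) (xs := st 0 (b + 1) 0) (by simp [hst])
      (by decide) (by simp [hst]; omega)
    rw [h]
    refine .seq h1 ?_
    simpa [hst] using h2
  have hin (V r : ℕ) (hr : r < 15) : (input i 0) r = (st 0 0 0).getD r 0 := by
    rw [hst]; exact input_eq i 0 r
  have hiV (r : ℕ) : (input i 0) r ≤ i := by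
    simp only [input]
    split_ifs <;> omega
  constructor
  · rintro ⟨w, n, -, V, t, h⟩
    by_contra hno
    push Not at hno
    cases h with
    | seq h1 h2 =>
      obtain ⟨s, k1, k2⟩ := hinc (i + 1) (by omega) (input i 0)
        (fun r => (hiV r).trans (Nat.le_succ _)) (hin 0)
      obtain rfl := k1.unique ⟨_, h1⟩
      refine not_runs_loop (fun s => ∃ b V o, (∀ r, s r ≤ V) ∧
        ∀ r < 15, s r = (st 1 b o).getD r 0) ?_
        ⟨0, i + 1, 0, k1.le fun r => (hiV r).trans (Nat.le_succ _), k2⟩ ⟨_, h2⟩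
      rintro s ⟨b, V', o, g1, g2⟩
      have h8 : s 8 = 1 := by rw [g2 8 (by decide)]; simp [hst]
      refine ⟨by omega, ?_⟩
      have hV' : ∀ r, (s.set 8 (s 8 - 1)) r ≤ W i b 0 + b + 1 + V' := by
        intro r
        have := g1 r
        rw [St.set_apply]; split_ifs <;> omega
      obtain ⟨t', k3, k4⟩ := hstep (W i b 0 + b + 1 + V') b o (by omega) (hno b) _ hV' (by
        have := agree_set g2 (l := 8) (by simp [hst]) 0
        rw [h8]
        simpa [hst] using this)
      exact ⟨_, t', k3, b + 1, _, 0, k3.le hV', k4⟩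
  · rintro ⟨b, hb⟩
    classical
    have hex : ∃ b, ρ i b ≠ 0 := ⟨b, hb⟩
    obtain ⟨b, hb, hmin⟩ : ∃ b, ρ i b ≠ 0 ∧ ∀ a < b, ρ i a = 0 :=
      ⟨Nat.find hex, Nat.find_spec hex, fun a ha => not_not.1 (Nat.find_min hex ha)⟩
    obtain ⟨V, hVi, hV⟩ : ∃ V, i + 1 ≤ V ∧ ∀ a ≤ b, W i a 0 + a + 1 ≤ V := by
      refine ⟨i + 1 + (Finset.range (b + 1)).sup fun a => W i a 0 + a + 1, by omega,
        fun a ha => ?_⟩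
      have := Finset.le_sup (f := fun a => W i a 0 + a + 1) (s := Finset.range (b + 1)) (b := a)
        (by simp; omega)
      omega
    have hloop (k : ℕ) : ∀ a o, a + k = b → ∃ o', Trans 15 V
        (.loop 8 (.seq p (.cond 14 .skip (.seq (.inc 12) (.inc 8))))) (st 1 a o) (st 0 b o') := by
      induction k with
      | zero =>
        intro a o ha
        obtain rfl : a = b := ha
        refine ⟨ρ i a - 1, trans_loop_pos (by decide) (by simp [hst]) (by simp [hst]) (ys := st 0 a (ρ i a - 1)) ?_
          (trans_loop_zero (by decide) (by simp [hst]))⟩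
        have h1 := trans_cond_pos (K := 15) (V := V) (r := 14) (xs := st 0 a (ρ i a)) (p := .skip)
          (q := .seq (.inc 12) (.inc 8)) (by decide) (by simp [hst]) (by simpa [hst] using hb) .skip
        have h2 := (hbox V a o (by have := hV a le_rfl; omega)).seq h1
        simpa [hst] using h2
      | succ k ih =>
        intro a o ha
        obtain ⟨o', h1⟩ := ih (a + 1) 0 (by omega)
        refine ⟨o', trans_loop_pos (by decide) (by simp [hst]) (by simp [hst]) ?_ h1⟩
        have := hstep V a o (hV a (by omega)) (hmin a (by omega))
        simpa [hst] using this
    obtain ⟨o', h1⟩ := hloop b 0 0 (zero_add b)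
    obtain ⟨t, ⟨n, h⟩, -⟩ := (hinc V (by omega)).seq h1 (input i 0)
      (fun r => (hiV r).trans (by omega)) (hin 0)
    exact ⟨n + 1, n, by omega, V, t, h⟩

/-! ### Simple algorithms for simple functions -/

/-- Read the output of a simulated machine of base `b`. -/
def readOut (b : ℕ) : Prog :=
  .seq (clr 9) (.seq (.inc 9) (.seq (clr 10) (.seq (clr 12) (.seq (addConst 12 b) (.seq (.inc 8)
    (.loop 8 (.cond 13 (.cond 13 (.seq (push 13 9 10 6) (.seq (copy 13 10) (.seq (push 9 12 7 6)
      (.seq (pop 4) (.inc 8))))) .skip) .skip)))))))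

/-- Add `C` times the content of register `a` to register `b`. -/
def addMul (a b : ℕ) : ℕ → Prog
  | 0 => .skip
  | C + 1 => .seq (addMul a b C) (addTo a b)

/-- Put `2 ^ (u + C * a)` into register `o + 2`, where `u` and `a` are the contents of the registers
`o + 1` and `10`. -/
def affine (o C : ℕ) : Prog :=
  .seq (copy 10 (o + 3)) (.seq (addMul (o + 3) (o + 1) C)
    (.seq (.inc (o + 2)) (.seq (copy (o + 1) (o + 3)) (.loop (o + 3)
      (.seq (copy (o + 2) (o + 0)) (addTo (o + 0) (o + 2)))))))

section

variable {V : ℕ}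

/-- Register `9` is the place value and `10` the sum so far. A digit `d` has the code `d + 2`, so
two decrementing tests both detect a blank, of code `1`, and leave `d` behind; the multiplications
are done by `push`. -/
theorem trans_readOut_loop {a2 a3 i b B : ℕ} (hb : 1 ≤ b) (hB : b + 2 ≤ B) (hV1 : 1 ≤ V)
    (k : List Symbol) : ∀ pow acc o, (∀ a ∈ k, sym a < b + 2) → acc < pow → pow * b ^ k.length ≤ V →
    ∃ p' r' h' o', Trans 15 V (.loop 8 (.cond 13 (.cond 13 (.seq (push 13 9 10 6) (.seq (copy 13 10)
      (.seq (push 9 12 7 6) (.seq (pop 4) (.inc 8))))) .skip) .skip))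
      [0, 0, a2, a3, enc B k.tail, B, 0, 0, 1, pow, acc, i, b, sym (k.head?.getD none), o]
      [0, 0, a2, a3, r', B, 0, 0, 0, p', acc + pow * tapeVal b k, i, b, h', o'] := by
  have hnone (r pow acc o : ℕ) : Trans 15 V (.loop 8 (.cond 13 (.cond 13 (.seq (push 13 9 10 6)
      (.seq (copy 13 10) (.seq (push 9 12 7 6) (.seq (pop 4) (.inc 8))))) .skip) .skip))
      [0, 0, a2, a3, r, B, 0, 0, 1, pow, acc, i, b, 1, o]
      [0, 0, a2, a3, r, B, 0, 0, 0, pow, acc, i, b, 0, o] :=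
    trans_loop_pos (by decide) (by simp) (by simp) (trans_cond_pos (by decide) (by simp) (by simp)
      (trans_cond_zero (by decide) (by simp) .skip)) (trans_loop_zero (by decide) (by simp))
  induction k with
  | nil =>
    intro pow acc o _ _ _
    exact ⟨pow, _, 0, o, by simpa [tapeVal, sym] using hnone 0 pow acc o⟩
  | cons a k ih =>
    intro pow acc o hk hacc hpow
    cases a with
    | none => exact ⟨pow, _, 0, o, by simpa [tapeVal, sym] using hnone (enc B k) pow acc o⟩
    | some d =>
      have hd : d < b := by
        have := hk (some d) (by simp)
        simp only [sym] at this
        omega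
      have hp1 : pow * b ≤ V := by
        refine le_trans (Nat.mul_le_mul_left _ ?_) hpow
        rw [List.length_cons, pow_succ]
        exact Nat.le_mul_of_pos_left _ (Nat.pow_pos hb)
      have hdp : d * pow + pow ≤ pow * b := by
        have : (d + 1) * pow ≤ b * pow := Nat.mul_le_mul_right _ hd
        rw [mul_comm pow b]
        rwa [add_mul, one_mul] at this
      obtain ⟨p', r', h', o', h1⟩ := ih (pow * b) (d * pow + acc) o
        (fun a ha => hk a (List.mem_cons_of_mem _ ha)) (by omega) (by
          rw [List.length_cons, pow_succ'] at hpow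
          rwa [mul_assoc])
      have e : acc + pow * tapeVal b (some d :: k) = d * pow + acc + pow * b * tapeVal b k := by
        simp only [tapeVal, List.foldr_cons, Option.elim_some]
        ring
      rw [e]
      refine ⟨p', r', h', o', trans_loop_pos (by decide) (by simp) (by simp) (trans_cond_pos
        (by decide) (by simp) (by simp [sym]) (trans_cond_pos (by decide) (by simp) (by simp [sym])
          (.seq (trans_push (by decide) (by decide) (by decide) (by decide) (by decide) (by simp)
            rfl rfl (by simp; omega) ?_) (.seq (trans_copy (by decide) (by simp) (by decide)
              (by decide) (by decide) rfl) (.seq (trans_push (by decide) (by decide) (by decide)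
              (by decide) (by decide) (by simp) rfl rfl (by simp; omega) ?_)
              (.seq (ys := [0, 0, a2, a3, enc B k.tail, B, 0, 0, 0, pow * b, d * pow + acc, i, b,
                sym (k.head?.getD none), o]) ?_ ?_)))))) h1⟩
      · simp only [sym, List.head?_cons, Option.getD_some, List.set, List.getD_cons_succ,
          List.getD_cons_zero, Nat.add_one_sub_one]
        omega
      · simp only [List.set, List.getD_cons_succ, List.getD_cons_zero]
        omega
      · have := trans_pop_right (V := V) (B := B) (i := i) (a2 := a2) (a3 := a3) (a8 := 0)
          (a9 := pow * b) (a10 := d * pow + acc) (a12 := b) (a13 := d * pow + acc) (a14 := o) k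
          (by omega) (fun a ha => (hk a (List.mem_cons_of_mem _ ha)).trans_le hB) hV1
        simpa [sym] using this
      · have := trans_inc (K := 15) (V := V) (l := 8) (xs := [0, 0, a2, a3, enc B k.tail, B, 0, 0, 0,
          pow * b, d * pow + acc, i, b, sym (k.head?.getD none), o]) (by simp) (by decide)
          (by simpa using hV1)
        simpa using this

theorem trans_readOut {i x b w n o : ℕ} {c : Config} (hb : 1 ≤ b) (hc : c.Below (b + 2))
    (hV : (b + 2) ^ (c.size + 1) ≤ V) : ∃ r' h' p' o', Trans 15 V (readOut b)
      (simState (b + 2) i x c 0 w n o)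
      [0, 0, x, enc (b + 2) c.left, r', b + 2, 0, 0, 0, p', c.output b, i, b, h', o'] := by
  have hbV : b ≤ V := by
    refine le_trans ?_ hV
    exact (Nat.le_add_right b 2).trans (Nat.le_self_pow (by omega) _)
  have hpow : 1 * b ^ (c.head :: c.right).length ≤ V := by
    rw [one_mul]
    refine le_trans ?_ hV
    exact (Nat.pow_le_pow_left (by omega) _).trans (Nat.pow_le_pow_right (by omega)
      (by simp only [Config.size, List.length_cons]; omega))
  obtain ⟨p', r', h', o', h1⟩ := trans_readOut_loop (V := V) (a2 := x)
    (a3 := enc (b + 2) c.left) (i := i) hb le_rfl (by omega) (c.head :: c.right) 1 0 o (by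
      simp only [List.mem_cons, forall_eq_or_imp]
      exact hc.2) (by omega) hpow
  rw [zero_add, one_mul, ← output_eq] at h1
  refine ⟨r', h', p', o', .seq (trans_clr (by simp [simState])) (.seq (trans_inc (by simp [simState])
    (by decide) (by simp [simState]; omega)) (.seq (trans_clr (by simp [simState]))
    (.seq (trans_clr (by simp [simState])) (.seq (trans_addConst (by simp [simState]) (by decide)
      (by simpa [simState] using hbV)) (.seq (trans_inc (by simp [simState]) (by decide)
        (by simp [simState]; omega)) ?_)))))⟩
  simpa [simState] using h1

theorem win_affine {o a u x C : ℕ} {t : St} (ho : 15 ≤ o) (h0 : t 0 = 0) (h10 : t 10 = a)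
    (hx : t (o + 0) = x) (hu : t (o + 1) = u) (hz : t (o + 2) = 0) (hV : 2 ^ (u + C * a) ≤ V)
    (hC : 1 ≤ C) :
    ∃ t', Runs V (affine o C) t t' ∧ t' 0 = 0 ∧ t' (o + 1) = u + C * a ∧
      t' (o + 2) = 2 ^ (u + C * a) := by
  have hlt : u + C * a < 2 ^ (u + C * a) := Nat.lt_two_pow_self
  have hx' : t o = x := hx
  have haC : 1 * a ≤ C * a := Nat.mul_le_mul_right _ hC
  have k0 : Runs V (copy 10 (o + 3)) t (win o t [x, u, 0, a] t.inp t.out) := by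
    have := runs_copy (V := V) (s := t) (a := 10) (b := o + 3) (by omega) (by omega) (by omega) h0
      (by omega)
    convert this using 1
    refine St.eq_of_regs rfl rfl fun r => ?_
    rw [St.set_apply]
    by_cases hr : o ≤ r ∧ r < o + 4
    · obtain ⟨j, rfl⟩ : ∃ j, r = o + j := ⟨r - o, by omega⟩
      rw [win_get (by simp; omega)]
      have : j < 4 := by omega
      interval_cases j <;> simp [*]
    · rw [win_other (by simp; omega), if_neg (by omega)]
  have k1 (k : ℕ) : k ≤ C → Runs V (addMul (o + 3) (o + 1) k)
      (win o t [x, u, 0, a] t.inp t.out) (win o t [x, u + k * a, 0, a] t.inp t.out) := by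
    induction k with
    | zero => intro _; simpa [addMul] using Runs.skip V _
    | succ k ih =>
      intro hk
      have hka : (k + 1) * a ≤ C * a := Nat.mul_le_mul_right _ hk
      rw [add_mul, one_mul] at hka ⊢
      have := win_addTo (V := V) (o := o) (f := t) (inp := t.inp) (out := t.out) (a := 3) (b := 1)
        (xs := [x, u + k * a, 0, a]) (by omega) h0 (by simp) (by simp) (by simp) (by simp; omega)
      exact (ih (by omega)).seq (by simpa [add_assoc] using this)
  have k2 (k : ℕ) : ∀ y s, s + k = u + C * a → ∃ y', Runs V (.loop (o + 3)
      (.seq (copy (o + 2) (o + 0)) (addTo (o + 0) (o + 2))))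
      (win o t [y, u + C * a, 2 ^ s, k] t.inp t.out)
      (win o t [y', u + C * a, 2 ^ (u + C * a), 0] t.inp t.out) := by
    induction k with
    | zero =>
      intro y s h
      obtain rfl : s = u + C * a := h
      exact ⟨y, win_loop_zero (i := 3) (by simp) (by simp)⟩
    | succ k ih =>
      intro y s h
      obtain ⟨y', h1⟩ := ih (2 ^ s) (s + 1) (by omega)
      have h4 : 2 ^ (s + 1) ≤ 2 ^ (u + C * a) := Nat.pow_le_pow_right (by norm_num) (by omega)
      rw [pow_succ, mul_two] at h1 h4
      refine ⟨y', win_loop_pos (i := 3) (by simp) (by simp) (.seq (win_copy (a := 2) (b := 0)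
        (by omega) h0 (by simp) (by simp) (by simp) ?_) (win_addTo (a := 0) (b := 2)
        (by omega) h0 (by simp) (by simp) (by simp) ?_)) h1⟩
      · simp only [List.set, List.getD_cons_succ, List.getD_cons_zero]; omega
      · simp only [List.set, List.getD_cons_succ, List.getD_cons_zero]; omega
  obtain ⟨y', k3⟩ := k2 (u + C * a) x 0 (zero_add _)
  refine ⟨_, k0.seq ((k1 C le_rfl).seq (.seq (win_inc (i := 2) (by simp) (by simp; omega))
    (.seq (win_copy (a := 1) (b := 3) (by omega) h0 (by simp) (by simp) (by simp)
      (by simp only [List.set, List.getD_cons_succ, List.getD_cons_zero]; omega)) k3))), ?_, ?_, ?_⟩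
  · rw [win_other (by omega), h0]
  · exact win_get (i := 1) (by simp)
  · exact win_get (i := 2) (by simp)

theorem pure_affine (o C : ℕ) : (affine o C).Pure := by
  have : (addMul (o + 3) (o + 1) C).Pure := by
    induction C with
    | zero => trivial
    | succ C ih => exact ⟨ih, by simp⟩
  simp [affine, Prog.Pure, this]

theorem bound_affine {o : ℕ} (ho : 15 ≤ o) (C : ℕ) : (affine o C).bound ≤ o + 4 := by
  have h0 := bound_addTo (a := o + 3) (b := o + 1) (k := o + 4) (by omega) (by omega)
  have : (addMul (o + 3) (o + 1) C).bound ≤ o + 4 := by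
    induction C with
    | zero => simp [addMul, Prog.bound]
    | succ C ih => simp only [addMul, Prog.bound, max_le_iff]; exact ⟨ih, h0⟩
  have h1 := bound_addTo (a := o + 0) (b := o + 2) (k := o + 4) (by omega) (by omega)
  have h2 := bound_copy (a := 10) (b := o + 3) (k := o + 4) (by omega) (by omega)
  have h3 := bound_copy (a := o + 1) (b := o + 3) (k := o + 4) (by omega) (by omega)
  have h4 := bound_copy (a := o + 2) (b := o + 0) (k := o + 4) (by omega) (by omega)
  simp only [affine, Prog.bound, max_le_iff]
  omega

theorem pure_readOut (b : ℕ) : (readOut b).Pure := by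
  have h1 (a b c d : ℕ) : (push a b c d).Pure := by simp [push]
  have h2 (a b c d e : ℕ) : (divmod a b c d e).Pure := by simp [divmod]
  simp [readOut, pop, h1, h2]

theorem bound_push {l b h t k : ℕ} (hl : l < k) (hb : b < k) (hh : h < k) (ht : t < k) :
    (push l b h t).bound ≤ k := by
  have h1 := bound_addTo hh hl
  have h2 := bound_addTo hb hl
  simp only [push, move, Prog.bound, max_le_iff]
  omega

theorem bound_readOut (b : ℕ) : (readOut b).bound ≤ 15 := by
  have h1 := bound_addConst 12 b
  have h2 := bound_push (l := 13) (b := 9) (h := 10) (t := 6) (k := 15) (by decide) (by decide)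
    (by decide) (by decide)
  have h3 := bound_push (l := 9) (b := 12) (h := 7) (t := 6) (k := 15) (by decide) (by decide)
    (by decide) (by decide)
  have h4 := bound_copy (a := 13) (b := 10) (k := 15) (by decide) (by decide)
  have h5 : (pop 4).bound ≤ 15 := by decide
  simp only [readOut, clr, Prog.bound, max_le_iff]
  omega

end

theorem size_of_final {m : Machine} {x : ℕ} {c : Config} (h : c ∈ m.final [x]) :
    (word m.base x).length + 1 ≤ c.size := by
  refine le_trans ?_ (size_le_of_reaches (mem_eval.1 h).1)
  obtain ⟨d, w, hw⟩ : ∃ d w, word m.base x = d :: w := List.exists_cons_of_ne_nil (word_ne_nil x)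
  simp [Config.size, Machine.init, inputTape, hw]

theorem size_le_of_mem {m : Machine} {xs : List ℕ} (h : ext (m.space xs) ≤ ext (m.result xs))
    {c : Config} (hc : c ∈ m.final xs) : c.size ≤ c.output m.base + 1 := by
  rw [Machine.space, Machine.result, Part.eq_some_iff.2 hc, Part.map_some, Part.map_some] at h
  simp only [ext, Part.some_dom, dif_pos, Part.get_some, Nat.cast_le] at h
  omega

/-- A machine working within its own output `a` is simulated with tape codes up to `B ^ (a + 2) ≤ 2
^ (3 * B * a)`. So `u + 3 * B * a` is linear in `a` and still large enough as space for the
simulation. -/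
theorem exists_isCore {m : Machine} (hm : m.Valid)
    (hs : ∀ x, ext (m.space [x]) ≤ ext (m.result [x])) : ∃ o q C c₀, 1 ≤ C ∧
      IsCore o q (fun _ x u => (m.result [x]).map fun a => u + C * a) c₀ := by
  obtain ⟨P, hP, -, hsim⟩ := exists_sim (E := fun _ => m) (Computable.const m)
  obtain ⟨⟨V₀, hV₀⟩, hdiv⟩ := hsim 0 hm
  obtain ⟨o, ho⟩ : ∃ o, o = P.bound + 15 := ⟨_, rfl⟩
  obtain ⟨B, hB⟩ : ∃ B, B = m.base + 2 := ⟨_, rfl⟩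
  have hb := hm.1
  have hset (V x : ℕ) (s : St) (h0 : ∀ r < o, s r = 0) (h1 : s o = x) (hV : x ≤ V) :
      Runs V (addTo (o + 0) 1) s (s.set 1 x) := by
    have := runs_addTo (V := V) (s := s) (a := o + 0) (b := 1) (by omega) (by omega) (by omega)
      (h0 0 (by omega)) (by rw [h0 1 (by omega), add_zero, h1]; omega)
    rwa [h0 1 (by omega), add_zero, h1, zero_add] at this
  have hin (x : ℕ) (s : St) (h0 : ∀ r < o, s r = 0) : ∀ r < o, (s.set 1 x) r = (input 0 x) r := by
    intro r hr
    have := h0 r hr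
    simp only [St.set_apply, input]
    grind
  refine ⟨o, .seq (addTo (o + 0) 1) (.seq P (.seq (readOut m.base) (affine o (3 * B)))), 3 * B,
    V₀, by omega, ?_, ?_, by omega, ?_, ?_, ?_⟩
  · simp [Prog.Pure, hP, pure_readOut, pure_affine]
  · have h1 := bound_affine (o := o) (by omega) (3 * B)
    have h2 := bound_readOut m.base
    have h3 := bound_addTo (a := o + 0) (b := 1) (k := o + 4) (by omega) (by omega)
    simp only [Prog.bound, max_le_iff]
    omega
  · intro n x u v hv
    obtain ⟨a, -, rfl⟩ := (Part.mem_map_iff _).1 hv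
    omega
  · intro n x u v hv V hV s h0 h1 h2 h3 h4 hsV
    obtain ⟨a, ha, rfl⟩ := (Part.mem_map_iff _).1 hv
    obtain ⟨c, hc, rfl⟩ := (Part.mem_map_iff _).1 ha
    have hsize := size_le_of_mem (hs x) hc
    have hsize' := size_of_final hc
    have hw : 0 < (word m.base x).length := List.length_pos_of_ne_nil (word_ne_nil x)
    have hpow : B ^ (c.size + 1) ≤ V := by
      refine le_trans ?_ ((Nat.le_add_right _ _).trans ((Nat.le_add_right _ _).trans
        ((Nat.le_add_right _ _).trans hV)))
      -- The input word and its blank occupy at least two cells, so the output `a` is at least `1`,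
      -- and `c.size + 1 ≤ a + 2 ≤ 3 * a`.
      calc B ^ (c.size + 1) ≤ B ^ (3 * c.output m.base) :=
            Nat.pow_le_pow_right (by omega) (by omega)
        _ ≤ (2 ^ B) ^ (3 * c.output m.base) := Nat.pow_le_pow_left Nat.lt_two_pow_self.le _
        _ = 2 ^ (3 * B * c.output m.base) := by rw [← pow_mul]; ring_nf
        _ ≤ _ := Nat.pow_le_pow_right (by norm_num) (by omega)
    obtain ⟨t, w, n', o', ⟨k, k1⟩, k2⟩ := hV₀ x c hc V ((Nat.le_add_left _ _).trans hV) (by rw [← hB]; exact hpow)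
    obtain ⟨t', k3, k4⟩ := k1.congr hP (D := o) (by omega) (hin x s h0)
    have hxV : x ≤ V := h1 ▸ hsV o
    have hs1 : ∀ r, (s.set 1 x) r ≤ V := by
      intro r
      have := hsV r
      rw [St.set_apply]; split_ifs <;> omega
    obtain ⟨r', h', p', o'', k5⟩ := trans_readOut (V := V) (i := 0) (x := x) (w := w) (n := n')
      (o := o') (by omega) (inv_of_reaches hm (mem_eval.1 hc).1).1 (by rw [← hB]; exact hpow)
    obtain ⟨t'', k6, k7⟩ := k5 t' (k3.le hs1) fun r hr => by rw [k4 r (by omega), k2 r hr]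
    have hfr (j : ℕ) : t'' (o + j) = s (o + j) := by
      rw [k6.frame (by have := bound_readOut m.base; omega), k3.frame (by omega), St.set_apply,
        if_neg (by omega)]
    obtain ⟨t₃, k8, k9, k10, k11⟩ := win_affine (V := V) (o := o) (t := t'') (u := u)
      (a := c.output m.base) (C := 3 * B) (by omega) (by rw [k7 0 (by norm_num)]; rfl)
      (by rw [k7 10 (by norm_num)]; rfl) rfl (by rw [hfr, h2]) (by rw [hfr, h3])
      (by omega) (by omega)
    exact ⟨t₃, (hset V x s h0 h1 hxV).seq (.seq ⟨k, k3⟩ (k6.seq k8)), k9, k10, k11⟩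
  · rintro n x u hd s h0 h1 h2 h3 h4 V t ⟨_, h⟩
    cases h with
    | seq h5 h6 =>
      obtain rfl := (hset x x s h0 h1 le_rfl).unique ⟨_, h5⟩
      cases h6 with
      | seq h7 h8 =>
        obtain ⟨t', k3, -⟩ := h7.congr hP (D := o) (by omega) fun r hr => (hin x s h0 r hr).symm
        exact hdiv x hd V t' ⟨_, k3⟩

/-! ### Extended values and constant factors -/

/-- The factor must not vanish because of undefined values, as `0 * ⊤ = 0`. -/
theorem ext_map_le {a : Part ℕ} {f : ℕ → ℕ} {C : ℕ} (hC : C ≠ 0) (h : ∀ v ∈ a, f v ≤ C * v) :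
    ext (a.map f) ≤ C * ext a := by
  by_cases ha : a.Dom
  · obtain ⟨v, hv⟩ := Part.dom_iff_mem.1 ha
    have := h v hv
    rw [Part.eq_some_iff.2 hv, Part.map_some]
    simp only [ext, Part.some_dom, dif_pos, Part.get_some]
    exact_mod_cast this
  · rw [Part.eq_none_iff'.2 ha]
    simp [ext, ENat.mul_top, hC]

theorem ext_le_map {a : Part ℕ} {f : ℕ → ℕ} (h : ∀ v ∈ a, v ≤ f v) : ext a ≤ ext (a.map f) := by
  by_cases ha : a.Dom
  · obtain ⟨v, hv⟩ := Part.dom_iff_mem.1 ha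
    have := h v hv
    rw [Part.eq_some_iff.2 hv, Part.map_some]
    simp only [ext, Part.some_dom, dif_pos, Part.get_some]
    exact_mod_cast this
  · rw [Part.eq_none_iff'.2 ha]
    simp [ext]

/-- Lengths in different bases are proportional; `b < 2 ^ b` gives a crude factor. -/
theorem length_word_le_mul {N b : ℕ} (hN : 1 < N) (hb : 1 < b) (x : ℕ) :
    (word N x).length ≤ b * (word b x).length := by
  have h1 : x < 2 ^ (b * (word b x).length) := by
    refine (lt_pow_length_word hb x).trans_le ?_
    rw [pow_mul]
    exact Nat.pow_le_pow_left Nat.lt_two_pow_self.le _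
  rw [length_word hN]
  rcases Nat.eq_zero_or_pos x with rfl | hx
  · have : 0 < (word b 0).length := List.length_pos_of_ne_nil (word_ne_nil 0)
    simp only [Nat.log_zero_right, zero_add]
    exact Nat.mul_pos (by omega) this
  · refine Nat.log_lt_of_lt_pow hx.ne' (h1.trans_le (Nat.pow_le_pow_left hN _))

/-- Every simple function is computed, up to a constant factor, by a simple algorithm. -/
theorem exists_isSimple {p : ℕ →. ℕ} (hp : IsSimple p) : ∃ e : Machine, e.IsSimple ∧
    (∀ x, ext (p x) ≤ ext (e.result [x])) ∧
    ∃ C : ℕ, ∀ x, ext (e.result [x]) ≤ C * ext (p x) := by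
  obtain ⟨m, hm, hmp⟩ := hp
  have hs (x : ℕ) : ext (m.space [x]) ≤ ext (m.result [x]) := (hmp x).1 ▸ (hmp x).2
  obtain ⟨o, q, C, c₀, hC, hq⟩ := exists_isCore hm hs
  obtain ⟨d, c, hd, e, he, h⟩ := hq.exists_machine₁ 0
  have hr (x : ℕ) : e.result [x] =
      (p x).map fun a => 2 * (c + d * (word (2 ^ d) x).length + C * a) + 2 := by
    rw [(h x).1, (hmp x).1, Part.map_map]
    rfl
  -- The summand linear in the length of `x` is absorbed as well: the space of a machine, and so the
  -- value `p x`, is at least the length of its input.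
  refine ⟨e, ⟨he, fun x => (h x).2⟩, fun x => ?_, 2 * (c + d * m.base + C) + 2, fun x => ?_⟩
  · rw [hr]
    refine ext_le_map fun v _ => ?_
    have : 1 * v ≤ C * v := Nat.mul_le_mul_right _ hC
    omega
  · rw [hr]
    refine ext_map_le (by omega) fun v hv => ?_
    rw [← (hmp x).1] at hv
    obtain ⟨cf, hc, rfl⟩ := (Part.mem_map_iff _).1 hv
    have h1 := size_le_of_mem (hs x) hc
    have h2 := size_of_final hc
    have h3 : 0 < (word m.base x).length := List.length_pos_of_ne_nil (word_ne_nil x)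
    have h4 := length_word_le_mul (N := 2 ^ d) (Nat.one_lt_two_pow hd.ne') hm.1 x
    have h5 : d * (word (2 ^ d) x).length ≤ d * (m.base * cf.output m.base) :=
      Nat.mul_le_mul_left _ (h4.trans (Nat.mul_le_mul_left _ (by omega)))
    have h6 : c * 1 ≤ c * cf.output m.base := Nat.mul_le_mul_left _ (by omega)
    rw [← mul_assoc] at h5
    have e1 : (2 * (c + d * m.base + C) + 2) * cf.output m.base = 2 * (c * cf.output m.base +
      d * m.base * cf.output m.base + C * cf.output m.base) + 2 * cf.output m.base := by ring
    rw [e1]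
    omega

theorem ext_some (v : ℕ) : ext (Part.some v) = v := by simp [ext]

theorem ext_none : ext Part.none = ⊤ := by simp [ext]

theorem ext_of_mem {a : Part ℕ} {v : ℕ} (h : v ∈ a) : ext a = v := by
  rw [Part.eq_some_iff.2 h, ext_some]

theorem ext_le_coe {a : Part ℕ} {s : ℕ} : ext a ≤ s ↔ ∃ v ∈ a, v ≤ s := by
  constructor
  · intro h
    by_cases ha : a.Dom
    · obtain ⟨v, hv⟩ := Part.dom_iff_mem.1 ha
      rw [ext_of_mem hv] at h
      exact ⟨v, hv, by exact_mod_cast h⟩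
    · rw [Part.eq_none_iff'.2 ha, ext_none] at h
      simp at h
  · rintro ⟨v, hv, h⟩
    rw [ext_of_mem hv]
    exact_mod_cast h

/-- An inequality within a constant factor may be tested on finite values. -/
theorem le_mul_of_forall_coe {a b : ℕ∞} {C : ℕ} (hC : C ≠ 0)
    (h : ∀ s : ℕ, b = s → a ≤ (C * s : ℕ)) : a ≤ C * b := by
  induction b using ENat.recTopCoe with
  | top => simp [ENat.mul_top, hC]
  | coe s => simpa using h s rfl

theorem Below.of_le {A : Set ℕ} {f g : ℕ → ℕ∞} (h : ∀ x ∈ A, f x ≤ g x) : Below A f g :=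
  ⟨1, fun x hx => by simpa using h x hx⟩

theorem Below.trans {A : Set ℕ} {f g h : ℕ → ℕ∞} (hfg : Below A f g) (hgh : Below A g h) :
    Below A f h := by
  obtain ⟨C, hC⟩ := hfg
  obtain ⟨C', hC'⟩ := hgh
  refine ⟨C * C', fun x hx => (hC x hx).trans ?_⟩
  rw [Nat.cast_mul, mul_assoc]
  exact mul_le_mul_right (hC' x hx) _

theorem Machine.IsSimple.isSimple {m : Machine} (h : m.IsSimple) :
    SpaceComplexity.IsSimple fun x => m.result [x] :=
  ⟨m, h.1, fun x => ⟨rfl, (congrArg ext (h.2 x)).ge⟩⟩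

theorem IsCanonical.mem_of_below {A : Set ℕ} {M : Set (ℕ →. ℕ)} (hM : IsCanonical A M)
    {f h : ℕ →. ℕ} (hf : f ∈ M) (hh : IsSimple h)
    (hfh : Below A (fun x => ext (f x)) fun x => ext (h x)) : h ∈ M :=
  hM.closed f f h hf hf hh (by simpa using hfh)

/-! ### The sequence of algorithms of a canonical class -/

/-- The algorithms of a canonical class are the elements without a defect in a computable sequence
of machines. -/
theorem IsCanonical.exists_sequence {A : Set ℕ} {M : Set (ℕ →. ℕ)} (hM : IsCanonical A M) :
    ∃ (E : ℕ → Machine) (ρ : ℕ → ℕ → ℕ), Computable E ∧ Computable₂ ρ ∧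
      (∀ i, (∀ b, ρ i b = 0) → E i ∈ algorithms M) ∧
      (∀ e ∈ algorithms M, ∃ i, (∀ b, ρ i b = 0) ∧ E i = e) ∧ (∀ b, ρ 0 b = 0) ∧
      ∀ x, ((E 0).result [x]).Dom ↔ x ∈ A := by
  obtain ⟨f, hf, hfA⟩ := hM.exists_dom
  obtain ⟨e₀, h1, h2, C, h3⟩ := exists_isSimple (hM.simple f hf)
  -- The algorithm lies above `f`, so upward closure puts it into the class; the opposite estimate
  -- `h3` serves only to retain the domain.
  have he₀ : e₀ ∈ algorithms M := ⟨h1, hM.mem_of_below hf h1.isSimple (.of_le fun x _ => h2 x)⟩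
  obtain ⟨R, ⟨hdec, hR⟩, hRM⟩ := hM.sigma
  obtain ⟨δ, hδ, hδR⟩ : ∃ δ : ℕ × ℕ × Machine → Bool, Computable δ ∧
      ∀ a b m, δ (a, b, m) = true ↔ R a b m :=
    ⟨_, hR, fun a b m => decide_eq_true_iff⟩
  -- Index `0` is reserved for `e₀`. Index `j + 1` codes a machine together with a witness for the
  -- outer quantifier, so each machine is listed once for every possible witness.
  obtain ⟨E, hE⟩ : ∃ E : ℕ → Machine, E = fun i => i.casesOn e₀ fun j =>
    (Encodable.decode (α := Machine) j.unpair.2).getD e₀ := ⟨_, rfl⟩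
  have hEc : Computable E := by
    have h : Computable₂ fun (_ j : ℕ) => (Encodable.decode (α := Machine) j.unpair.2).getD e₀ :=
      Computable.option_getD (f := fun t : ℕ × ℕ => Encodable.decode (α := Machine) t.2.unpair.2)
        (g := fun _ => e₀) (Computable.decode.comp (Computable.snd.comp
          (Computable.unpair.comp Computable.snd))) (Computable.const e₀)
    rw [hE]
    exact Computable.nat_casesOn Computable.id (Computable.const e₀) h
  -- A defect is a `b` that refutes the witness; index `0` has none by definition.
  obtain ⟨ρ, hρ⟩ : ∃ ρ : ℕ → ℕ → ℕ, ρ = fun i b => i.casesOn 0 fun j =>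
    bif δ (j.unpair.1, b, E (j + 1)) then 0 else 1 := ⟨_, rfl⟩
  refine ⟨E, ρ, hEc, ?_, ?_, ?_, fun b => by simp [hρ], fun x => ?_⟩
  · have h : Computable₂ fun (t : ℕ × ℕ) (j : ℕ) =>
        bif δ (j.unpair.1, t.2, E (j + 1)) then 0 else 1 := by
      refine Computable.cond (c := fun u : (ℕ × ℕ) × ℕ =>
        δ (u.2.unpair.1, u.1.2, E (u.2 + 1))) (f := fun _ => 0) (g := fun _ => 1) ?_
        (Computable.const 0) (Computable.const 1)
      exact Computable.comp (g := fun u : (ℕ × ℕ) × ℕ => (u.2.unpair.1, u.1.2, E (u.2 + 1))) hδ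
        ((Computable.fst.comp (Computable.unpair.comp Computable.snd)).pair
          ((Computable.snd.comp Computable.fst).pair
            (hEc.comp (Computable.succ.comp Computable.snd))))
    rw [hρ]
    exact Computable.nat_casesOn (f := fun t : ℕ × ℕ => t.1) Computable.fst (Computable.const 0) h
  · intro i hi
    cases i with
    | zero => rw [hE]; exact he₀
    | succ j =>
      refine (hRM _).2 ⟨j.unpair.1, fun b => ?_⟩
      have := hi b
      rw [← hδR]
      by_contra hn
      rw [Bool.not_eq_true] at hn
      simp only [hρ, hn, cond_false] at this
      exact one_ne_zero this
  · intro e he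
    obtain ⟨a, ha⟩ := (hRM e).1 he
    have hEe : E (Nat.pair a (Encodable.encode e) + 1) = e := by simp [hE]
    refine ⟨Nat.pair a (Encodable.encode e) + 1, fun b => ?_, hEe⟩
    simp [hρ, hEe, (hδR _ _ _).2 (ha b)]
  · have h4 : (f x).Dom ↔ x ∈ A := by rw [← hfA]; rfl
    rw [← h4, show E 0 = e₀ by simp [hE]]
    constructor
    · intro h
      obtain ⟨v, hv⟩ := Part.dom_iff_mem.1 h
      have := h2 x
      rw [ext_of_mem hv, ext_le_coe] at this
      exact Part.dom_iff_mem.2 ⟨_, this.choose_spec.1⟩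
    · intro h
      obtain ⟨v, hv⟩ := Part.dom_iff_mem.1 h
      have := h3 x
      rw [ext_of_mem hv, ← Nat.cast_mul, ext_le_coe] at this
      exact Part.dom_iff_mem.2 ⟨_, this.choose_spec.1⟩

/-! ### `minSpace` up to constant factors -/

/-- Acceptance is monotone in `s`; with this, minimality need not be mentioned any more. -/
theorem ext_minSpace_le {p q : Prog} {n x u₀ s : ℕ} :
    ext (minSpace p q n x u₀) ≤ s ↔ u₀ ≤ s ∧ ∃ i < n, Accepts p q i x s := by
  classical
  rw [ext_le_coe]
  constructor
  · rintro ⟨v, hv, hs⟩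
    obtain ⟨h1, i, h2, h3⟩ := (mem_minSpace.1 hv).1
    exact ⟨h1.trans hs, i, h2, h3.mono hs⟩
  · intro h
    have hex : ∃ s, u₀ ≤ s ∧ ∃ i < n, Accepts p q i x s := ⟨s, h⟩
    exact ⟨Nat.find hex, mem_minSpace.2 ⟨Nat.find_spec hex, fun s h1 h2 h3 =>
      Nat.find_min hex h2 ⟨h1, h3⟩⟩, Nat.find_min' hex h⟩

theorem ext_minSpace_anti {p q : Prog} {n n' x u₀ : ℕ} (h : n ≤ n') :
    ext (minSpace p q n' x u₀) ≤ ext (minSpace p q n x u₀) := by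
  cases e : ext (minSpace p q n x u₀) using ENat.recTopCoe with
  | top => exact le_top
  | coe s =>
    obtain ⟨h1, i, h2, h3⟩ := ext_minSpace_le.1 e.le
    exact ext_minSpace_le.2 ⟨h1, i, by omega, h3⟩

theorem ext_minSpace_mono {p q : Prog} {n x u₀ : ℕ} :
    ext (minSpace p q n x 0) ≤ ext (minSpace p q n x u₀) := by
  cases e : ext (minSpace p q n x u₀) using ENat.recTopCoe with
  | top => exact le_top
  | coe s => exact ext_minSpace_le.2 ⟨Nat.zero_le _, (ext_minSpace_le.1 e.le).2⟩

theorem Accepts.len_le {p q : Prog} (hp : ∀ i x V n t, Run V p n (input i x) t → x < n)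
    {i x s : ℕ} (h : Accepts p q i x s) : len x ≤ s ∧ 1 ≤ s := by
  obtain ⟨⟨n, hn, V, t, hr⟩, -⟩ := h
  have hx := hp i x V n t hr
  have hs : s ≠ 0 := by rintro rfl; simp at hn; omega
  exact ⟨len_le_of_lt (hx.trans hn) (by omega), by omega⟩

/-- The lower bound on `minSpace` needed by machines costs only a constant factor. -/
theorem ext_minSpace_le_mul {p q : Prog} (hp : ∀ i x V n t, Run V p n (input i x) t → x < n)
    {d c n x : ℕ} (hd : 0 < d) :
    ext (minSpace p q n x (c + d * (word (2 ^ d) x).length)) ≤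
      ((1 + c + 2 * d : ℕ) : ℕ∞) * ext (minSpace p q n x 0) := by
  refine le_mul_of_forall_coe (by omega) fun s hs => ?_
  obtain ⟨-, i, hi, ha⟩ := ext_minSpace_le.1 hs.le
  obtain ⟨h1, h2⟩ := ha.len_le hp
  have h3 : (word (2 ^ d) x).length ≤ 2 * s :=
    (length_word_le_mul (b := 2) (Nat.one_lt_two_pow hd.ne') (by norm_num) x).trans
      (Nat.mul_le_mul_left 2 h1)
  have h4 : d * (word (2 ^ d) x).length ≤ d * (2 * s) := Nat.mul_le_mul_left d h3
  have h5 : c * 1 ≤ c * s := Nat.mul_le_mul_left c h2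
  have e : (1 + c + 2 * d) * s = s + c * s + d * (2 * s) := by ring
  refine ext_minSpace_le.2 ⟨by omega, i, hi, ha.mono (by omega)⟩

/-! ### Time of the simulation against space of the machine -/

/-- `P` simulates the machines `E i` with values exponential in the space. -/
structure Simulates (P : Prog) (E : ℕ → Machine) : Prop where
  pure : P.Pure
  lt : ∀ i x V n t, Run V P n (input i x) t → x < n
  runs : ∀ i, (E i).Valid → ∃ V₀, ∀ x, ∀ c ∈ (E i).final [x], ∀ V, V₀ ≤ V →
    ((E i).base + 2) ^ (c.size + 1) ≤ V → ∃ t w n o, Runs V P (input i x) t ∧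
      ∀ r < 15, t r = (simState ((E i).base + 2) i x c 0 w n o).getD r 0
  div : ∀ i, (E i).Valid → ∀ x, ¬ ((E i).final [x]).Dom → ∀ V t, ¬ Runs V P (input i x) t

section

variable {P Q : Prog} {E : ℕ → Machine} {i : ℕ}

/-- In fewer than `2 ^ s` steps the registers coding the two halves of the tape, initially `0`, stay
below `2 ^ s`, so each half has at most `s` symbols. The factor `2` stands for the two halves. -/
theorem Simulates.result_le (hP : Simulates P E) (hi : (E i).IsSimple) {x s : ℕ}
    (h : Accepts P Q i x s) : ext ((E i).result [x]) ≤ (2 * s : ℕ) := by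
  obtain ⟨⟨n, hn, V, t, hr⟩, -⟩ := h
  have hd : ((E i).final [x]).Dom := by
    by_contra hd
    exact hP.div i hi.1 x hd V t ⟨_, hr⟩
  obtain ⟨c, hc⟩ := Part.dom_iff_mem.1 hd
  obtain ⟨V₀, hV₀⟩ := hP.runs i hi.1
  obtain ⟨t', w, n', o, ⟨k, k1⟩, k2⟩ := hV₀ x c hc
    (V₀ + ((E i).base + 2) ^ (c.size + 1)) (by omega) (by omega)
  obtain ⟨-, rfl⟩ := hr.unique k1
  have hlen {l : List Symbol} {r : ℕ} (h0 : (input i x) r = 0)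
      (h : t r = enc ((E i).base + 2) l) : l.length ≤ s := by
    have h1 := hr.le_add r
    have h2 := two_pow_le_enc (B := (E i).base + 2) (by omega) l
    have h3 : 2 ^ l.length < 2 ^ (s + 1) := by rw [pow_succ]; omega
    exact Nat.lt_succ_iff.1 ((Nat.pow_lt_pow_iff_right (by norm_num)).1 h3)
  have h3 : c.left.length ≤ s := hlen (r := 3) rfl (k2 3 (by norm_num))
  have h4 : c.right.length ≤ s := hlen (r := 4) rfl (k2 4 (by norm_num))
  rw [hi.2, Machine.space, Part.eq_some_iff.2 hc, Part.map_some, ext_some]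
  simp only [Config.size, Nat.cast_le]
  omega

/-- Space `s` means registers bounded by `2 ^ O(s)`, and a halting program runs no longer than it
has configurations. The constant depends on `i`, which is harmless, as each `i` is used by itself.
-/
theorem Simulates.exists_accepts (hP : Simulates P E) (hi : (E i).IsSimple)
    (hQ : ∀ w, ¬ HaltsIn Q i 0 w) :
    ∃ C, 1 ≤ C ∧ ∀ x s : ℕ, ext ((E i).result [x]) ≤ s → Accepts P Q i x (C * s) := by
  obtain ⟨V₀, hV₀⟩ := hP.runs i hi.1
  obtain ⟨B, hB⟩ : ∃ B, B = (E i).base + 2 := ⟨_, rfl⟩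
  obtain ⟨D, hD⟩ : ∃ D, D = P.bound := ⟨_, rfl⟩
  obtain ⟨K, hK⟩ : ∃ K, K = (conts P []).length + 1 := ⟨_, rfl⟩
  -- `K` accounts for the control, `V₀ + i + 3` for the constant part of the register bound, `3 * B`
  -- for the tape codes, and `D` is the number of registers.
  refine ⟨K + (V₀ + i + 3 + 3 * B) * D, by omega, fun x s hs => ⟨?_, hQ x⟩⟩
  obtain ⟨v, hv, hvs⟩ := ext_le_coe.1 hs
  obtain ⟨c, hc, rfl⟩ := (Part.mem_map_iff _).1 hv
  have h1 := size_le_of_mem ((congrArg ext (hi.2 x)).ge) hc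
  have h2 := size_of_final hc
  have h3 : 0 < (word (E i).base x).length := List.length_pos_of_ne_nil (word_ne_nil x)
  have hb := hi.1.1
  have hx : x ≤ B ^ (c.size + 1) := by
    refine (lt_pow_length_word (b := (E i).base) (by omega) x).le.trans ?_
    exact (Nat.pow_le_pow_left (by omega) _).trans (Nat.pow_le_pow_right (by omega) (by omega))
  have hpos : 1 ≤ B ^ (c.size + 1) := Nat.one_le_pow _ _ (by omega)
  obtain ⟨V, hV⟩ : ∃ V, V = V₀ + i + x + B ^ (c.size + 1) := ⟨_, rfl⟩
  obtain ⟨t, w, n', o, ⟨n, hr⟩, -⟩ := hV₀ x c hc V (by omega) (by rw [← hB]; omega)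
  have hn := hr.steps_le hP.pure (D := D) hD.ge fun r _ => by
    simp only [input]
    split_ifs <;> omega
  rw [← hK] at hn
  have hBs : B ^ (c.size + 1) ≤ 2 ^ (3 * B * s) := by
    calc B ^ (c.size + 1) ≤ B ^ (3 * s) := Nat.pow_le_pow_right (by omega) (by omega)
      _ ≤ (2 ^ B) ^ (3 * s) := Nat.pow_le_pow_left Nat.lt_two_pow_self.le _
      _ = 2 ^ (3 * B * s) := by rw [← pow_mul]; ring_nf
  have hVs : V + 1 ≤ 2 ^ ((V₀ + i + 3 + 3 * B) * s) := by
    have h5 : V + 1 ≤ (V₀ + i + 3) * B ^ (c.size + 1) := by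
      have : (V₀ + i) * 1 ≤ (V₀ + i) * B ^ (c.size + 1) := Nat.mul_le_mul_left _ hpos
      rw [add_mul]
      omega
    have h6 : V₀ + i + 3 ≤ 2 ^ ((V₀ + i + 3) * s) :=
      Nat.lt_two_pow_self.le.trans (Nat.pow_le_pow_right (by norm_num)
        (Nat.le_mul_of_pos_right _ (by omega)))
    rw [add_mul (V₀ + i + 3), pow_add]
    exact h5.trans (Nat.mul_le_mul h6 hBs)
  refine ⟨n, ?_, V, t, hr⟩
  calc n ≤ K * (V + 1) ^ D := hn
    _ ≤ K * (2 ^ ((V₀ + i + 3 + 3 * B) * s)) ^ D :=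
        Nat.mul_le_mul_left _ (Nat.pow_le_pow_left hVs _)
    _ < 2 ^ (K * s) * (2 ^ ((V₀ + i + 3 + 3 * B) * s)) ^ D := by
        refine Nat.mul_lt_mul_of_pos_right ?_ (by positivity)
        exact Nat.lt_two_pow_self.trans_le (Nat.pow_le_pow_right (by norm_num)
          (Nat.le_mul_of_pos_right _ (by omega)))
    _ = 2 ^ ((K + (V₀ + i + 3 + 3 * B) * D) * s) := by
        rw [← pow_mul, ← pow_add]; ring_nf

end

/-- The functions above `minSpace` belong to the class. -/
theorem IsCanonical.mem_of_minSpace_below {A : Set ℕ} {M : Set (ℕ →. ℕ)} (hM : IsCanonical A M)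
    {P Q : Prog} {E : ℕ → Machine} {ρ : ℕ → ℕ → ℕ} (hP : Simulates P E) (hQp : Q.Pure)
    (hQ : ∀ i, (∃ w, HaltsIn Q i 0 w) ↔ ∃ b, ρ i b ≠ 0)
    (hE : ∀ i, (∀ b, ρ i b = 0) → E i ∈ algorithms M) (h0 : ∀ b, ρ 0 b = 0)
    (hA : ∀ x, ((E 0).result [x]).Dom ↔ x ∈ A) (n : ℕ) : ∀ h : ℕ →. ℕ, IsSimple h →
      Below A (fun x => ext (minSpace P Q (n + 1) x 0)) (fun x => ext (h x)) → h ∈ M := by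
  have hgood (i : ℕ) (hi : ∀ b, ρ i b = 0) (w : ℕ) : ¬ HaltsIn Q i 0 w := fun h => by
    obtain ⟨b, hb⟩ := (hQ i).1 ⟨w, h⟩
    exact hb (hi b)
  -- One more program either adds a member of the class to the minimum or changes the minimum at
  -- finitely many arguments only.
  induction n with
  | zero =>
    intro h hh hb
    refine hM.mem_of_below (hE 0 h0).2 hh (.trans ⟨2, fun x _ => ?_⟩ hb)
    refine le_mul_of_forall_coe (by norm_num) fun s hs => ?_
    obtain ⟨-, i, hi, ha⟩ := ext_minSpace_le.1 hs.le
    obtain rfl : i = 0 := by omega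
    exact hP.result_le (hE 0 h0).1 ha
  | succ n ih =>
    intro h hh hb
    by_cases hn : ∀ b, ρ (n + 1) b = 0
    -- Closure under minima needs the minimum over the previous programs as a member of the class;
    -- it is realised, up to a constant factor, by a simple algorithm, to which the induction
    -- hypothesis applies.
    · have hcore := isCore_dovetail (D := P.bound + Q.bound + 15) (by omega) hP.pure (by omega) hQp
        (by omega)
      obtain ⟨d, c, hd, m, hm, hmr⟩ := hcore.exists_machine₁ (n + 1)
      have hms : m.IsSimple := ⟨hm, fun x => (hmr x).2⟩
      obtain ⟨K, hK⟩ : ∃ K, K = 2 * (1 + c + 2 * d) + 2 := ⟨_, rfl⟩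
      have hlow (x : ℕ) : ext (minSpace P Q (n + 1) x 0) ≤ ext (m.result [x]) := by
        rw [(hmr x).1]
        exact ext_minSpace_mono.trans (ext_le_map fun v _ => by omega)
      have hup (x s : ℕ) (hs : ext (minSpace P Q (n + 1) x 0) ≤ s) :
          ext (m.result [x]) ≤ (K * s : ℕ) := by
        obtain ⟨-, i, -, ha⟩ := ext_minSpace_le.1 hs
        have hs1 := (ha.len_le hP.lt).2
        have h1 := (ext_minSpace_le_mul (n := n + 1) (x := x) (c := c) hP.lt hd).trans
          (mul_le_mul_right hs _)
        rw [← Nat.cast_mul, ext_le_coe] at h1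
        obtain ⟨v, hv, hvs⟩ := h1
        rw [(hmr x).1, Part.eq_some_iff.2 hv, Part.map_some, ext_some, hK, Nat.cast_le, add_mul,
          mul_assoc]
        omega
      refine hM.closed _ _ h (ih _ hms.isSimple (.of_le fun x _ => hlow x)) (hE _ hn).2 hh
        (.trans ⟨K + 2, fun x _ => ?_⟩ hb)
      refine le_mul_of_forall_coe (by omega) fun s hs => ?_
      obtain ⟨-, i, hi, ha⟩ := ext_minSpace_le.1 hs.le
      rw [add_mul, min_le_iff]
      by_cases hin : i = n + 1
      · subst hin
        exact .inr ((hP.result_le (hE _ hn).1 ha).trans (by exact_mod_cast Nat.le_add_left _ _))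
      · exact .inl ((hup x s (ext_minSpace_le.2 ⟨Nat.zero_le _, i, by omega, ha⟩)).trans
          (by exact_mod_cast Nat.le_add_right _ _))
    · push Not at hn
      obtain ⟨w, hw⟩ := (hQ _).2 hn
      -- The defect is found in fewer than `w` steps, so the new program accepts no `x ≥ w`. For the
      -- finitely many `x < w` in `A` the old minimum is finite and the new one at least `1`, so a
      -- constant factor suffices.
      refine ih h hh (.trans ⟨1 + ∑ x ∈ Finset.range w, (ext (minSpace P Q (n + 1) x 0)).toNat,
        fun x hx => ?_⟩ hb)
      refine le_mul_of_forall_coe (by omega) fun s hs => ?_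
      obtain ⟨-, i, hi, ha⟩ := ext_minSpace_le.1 hs.le
      have hs1 := (ha.len_le hP.lt).2
      by_cases hxw : x < w
      -- Program `0` is always among the old ones, has no defect and halts on all of `A`.
      · have hfin : ext (minSpace P Q (n + 1) x 0) ≠ ⊤ := by
          obtain ⟨v, hv⟩ := Part.dom_iff_mem.1 ((hA x).2 hx)
          obtain ⟨C, -, hC⟩ := hP.exists_accepts (hE 0 h0).1 (hgood 0 h0)
          have h1 := ext_minSpace_le.2 ⟨Nat.zero_le _, 0, Nat.succ_pos n, hC x v (ext_of_mem hv).le⟩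
          exact ne_top_of_le_ne_top (ENat.natCast_ne_top _) h1
        change ext (minSpace P Q (n + 1) x 0) ≤ _
        rw [← ENat.natCast_toNat hfin, Nat.cast_le]
        have h1 := Finset.single_le_sum
          (f := fun x => (ext (minSpace P Q (n + 1) x 0)).toNat) (fun _ _ => Nat.zero_le _)
          (Finset.mem_range.2 hxw)
        exact (h1.trans (Nat.le_add_left _ 1)).trans (Nat.le_mul_of_pos_right _ hs1)
      · have hin : i ≠ n + 1 := by
          rintro rfl
          exact ha.2 (hw.mono (by omega))
        exact ext_minSpace_le.2 ⟨Nat.zero_le _, i, by omega,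
          ha.mono (Nat.le_mul_of_pos_left _ (by omega))⟩

end SpaceComplexity

/-! ### The function `g` -/

theorem lemma1 (A : Set ℕ) (hA : REPred fun x => x ∈ A) (M : Set (ℕ →. ℕ))
    (hM : SpaceComplexity.IsCanonical A M) :
    ∃ g : ℕ → ℕ →. ℕ,
      Partrec₂ g ∧
      (∀ x k k', k ≤ k' → SpaceComplexity.ext (g k' x) ≤ SpaceComplexity.ext (g k x)) ∧
      SpaceComplexity.IsSimple₂ (fun k x => (g k x).map fun v => v + SpaceComplexity.len k) ∧
      (g 0).Dom = A ∧
      ∀ p : ℕ →. ℕ, SpaceComplexity.IsSimple p →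
        (p ∈ M ↔ ∃ k, SpaceComplexity.Below A (fun x => SpaceComplexity.ext (g k x))
          (fun x => SpaceComplexity.ext (p x))) := by
  open SpaceComplexity in
  obtain ⟨E, ρ, hE, hρ, hgood, hall, h0, hdom⟩ := hM.exists_sequence
  obtain ⟨P, hPp, hPl, hPE⟩ := exists_sim hE
  have hP : Simulates P E := ⟨hPp, hPl, fun i hi => (hPE i hi).1, fun i hi => (hPE i hi).2⟩
  obtain ⟨Q, hQp, hQ⟩ := exists_search hρ
  have hhalt (i : ℕ) (hi : ∀ b, ρ i b = 0) (w : ℕ) : ¬ HaltsIn Q i 0 w := fun h => by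
    obtain ⟨b, hb⟩ := (hQ i).1 ⟨w, h⟩
    exact hb (hi b)
  have hcore := isCore_dovetail (D := P.bound + Q.bound + 15) (by omega) hP.pure (by omega) hQp
    (by omega)
  obtain ⟨d, c, hd, m, hm, hmr⟩ := hcore.exists_machine₂
  have hN : 1 < 2 ^ d := Nat.one_lt_two_pow hd.ne'
  -- The number of programs tried for `k` only has to be positive, monotone and unbounded, with
  -- value `1` at `0`; the length has these properties and is cheap to compute.
  obtain ⟨n, hn⟩ : ∃ n : ℕ → ℕ, n = fun k => (word (2 ^ d) k).length := ⟨_, rfl⟩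
  obtain ⟨u, hu⟩ : ∃ u : ℕ → ℕ →. ℕ,
    u = fun n x => minSpace P Q n x (c + d * (word (2 ^ d) x).length) := ⟨_, rfl⟩
  obtain ⟨C, hC⟩ : ∃ C, C = 1 + c + 2 * d := ⟨_, rfl⟩
  have hule (n x : ℕ) : ext (u n x) ≤ C * ext (minSpace P Q n x 0) := by
    rw [hu, hC]
    exact ext_minSpace_le_mul hP.lt hd
  have hleu (n x : ℕ) : ext (minSpace P Q n x 0) ≤ ext (u n x) := by
    rw [hu]
    exact ext_minSpace_mono
  have hres (k x : ℕ) : m.result [k, x] = ((u (n k) x).map (4 * ·)).map (· + len k) := by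
    rw [(hmr k x).1, Part.map_map, hu, hn]
    rfl
  have hmono {k k' : ℕ} (hk : k ≤ k') (x : ℕ) :
      ext ((u (n k') x).map (4 * ·)) ≤ ext ((u (n k) x).map (4 * ·)) := by
    have h1 : n k ≤ n k' := by
      simp only [hn, length_word hN]
      exact Nat.succ_le_succ (Nat.log_mono_right hk)
    have h2 : ext (u (n k') x) ≤ ext (u (n k) x) := by
      rw [hu]
      exact ext_minSpace_anti h1
    cases e : ext ((u (n k) x).map (4 * ·)) using ENat.recTopCoe with
    | top => exact le_top
    | coe s =>
      obtain ⟨v, hv, hvs⟩ := ext_le_coe.1 e.le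
      obtain ⟨w, hw, rfl⟩ := (Part.mem_map_iff _).1 hv
      rw [ext_of_mem hw, ext_le_coe] at h2
      obtain ⟨w', hw', hww⟩ := h2
      exact ext_le_coe.2 ⟨_, Part.mem_map _ hw', by omega⟩
  refine ⟨fun k x => (u (n k) x).map (4 * ·), ?_, fun x k k' hk => hmono hk x,
    ⟨m, hm, fun k x => ⟨hres k x, (hmr k x).2.trans (congrArg ext (hres k x)).le⟩⟩, ?_, fun p hp => ⟨fun hpM => ?_, ?_⟩⟩
  · have h1 : Computable₂ fun (t : ℕ × ℕ) (v : ℕ) => v - len t.1 :=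
      (Primrec.nat_sub.comp Primrec.snd (primrec_len.comp
        (Primrec.fst.comp Primrec.fst))).to_comp.to₂
    refine (Partrec.map (partrec_result hm.1) h1).of_eq fun t => ?_
    change (m.result [t.1, t.2]).map (fun v => v - len t.1) = _
    rw [hres, Part.map_map]
    exact (congrArg (fun f => Part.map f _) (funext fun v => Nat.add_sub_cancel _ _)).trans
      (Part.map_id' (fun _ => rfl) _)
  · ext x
    -- The word of `0` has length one, so only `E 0` is tried, and its domain is `A`.
    have hn0 : n 0 = 1 := by simp [hn, word]
    change (u (n 0) x).Dom ↔ _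
    rw [hn0, ← hdom x]
    constructor
    · intro h
      obtain ⟨v, hv⟩ := Part.dom_iff_mem.1 h
      have h1 := hleu 1 x
      rw [ext_of_mem hv] at h1
      obtain ⟨-, i, hi, ha⟩ := ext_minSpace_le.1 h1
      obtain rfl : i = 0 := by omega
      have h2 := ext_le_coe.1 (hP.result_le (hgood 0 h0).1 ha)
      exact Part.dom_iff_mem.2 ⟨_, h2.choose_spec.1⟩
    · intro h
      obtain ⟨v, hv⟩ := Part.dom_iff_mem.1 h
      obtain ⟨K, -, hK⟩ := hP.exists_accepts (hgood 0 h0).1 (hhalt 0 h0)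
      have h1 := (hule 1 x).trans (mul_le_mul_right (ext_minSpace_le.2
        ⟨Nat.zero_le _, 0, one_pos, hK x v (ext_of_mem hv).le⟩) _)
      rw [← Nat.cast_mul, ext_le_coe] at h1
      exact Part.dom_iff_mem.2 ⟨_, h1.choose_spec.1⟩
  -- The sequence lists algorithms that output their own space, so `p` is replaced by one between
  -- `p` and a multiple of `p`; upward closure keeps it in the class.
  · obtain ⟨e, he, hpe, K, hep⟩ := exists_isSimple hp
    obtain ⟨i, hi, rfl⟩ := hall e
      ⟨he, hM.mem_of_below hpM he.isSimple (.of_le fun x _ => hpe x)⟩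
    obtain ⟨L, hL, hacc⟩ := hP.exists_accepts he (hhalt i hi)
    -- The word of `(2 ^ d) ^ i` has `i + 1` digits.
    have hni : i < n ((2 ^ d) ^ i) := by
      simp only [hn, length_word hN, Nat.log_pow hN]
      omega
    refine ⟨(2 ^ d) ^ i, .trans (g := fun x => ext (u (n ((2 ^ d) ^ i)) x))
      ⟨4, fun x _ => ext_map_le (by norm_num) fun v _ => le_rfl⟩
      (.trans ⟨C, fun x _ => hule _ x⟩ (.trans ⟨L, fun x _ => ?_⟩ ⟨K, fun x _ => hep x⟩))⟩
    refine le_mul_of_forall_coe (by omega) fun s hs => ?_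
    exact ext_minSpace_le.2 ⟨Nat.zero_le _, i, hni, hacc x s hs.le⟩
  · rintro ⟨k, hk⟩
    -- `mem_of_minSpace_below` speaks about `n + 1` programs, and a word is never empty.
    have hnk : n k - 1 + 1 = n k := by
      have : 0 < n k := by rw [hn]; exact List.length_pos_of_ne_nil (word_ne_nil k)
      omega
    refine hM.mem_of_minSpace_below hP hQp hQ hgood h0 hdom (n k - 1) p hp (.trans (.of_le ?_) hk)
    intro x _
    rw [hnk]
    exact (hleu _ x).trans (ext_le_map fun v _ => by omega)
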